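/- **Setting.** Let $T$ be a text of length $n\ge 1$ over its effective alphabet $\Sigma=\{0,\dots,\sigma-1\}$ (every character of $\Sigma$ occurs in $T$) whose last character occurs nowhere else in $T$. For $1\le j\le n$ let $S_j(T)$ be the set of substrings of $T$ that start strictly before position $j$ (they may extend beyond it). The *LZ77 factorization* is $T=f_1\cdots f_z$ where, with $j=|f_1\cdots f_{x-1}|+1$ (the *factor position* of $f_x$), $f_x$ is the longest prefix of $T[j..n]$ that lies in $S_j(T)\cup\Sigma$. The factor $f_x$ is *referencing* if $f_x\in S_j(T)$ and *fresh* otherwise (then it is a single character). A *coding* of the factorization lists, for $x=1,\dots,z$, the character of $f_x$ if $f_x$ is fresh, and a pair $(p,|f_x|)$ with $1\le p<j$ and $T[p..p+|f_x|-1]=f_x$ ($p$ is a *referred position*) if $f_x$ is referencing. Let $H(n,z)\,n=z\lg\frac nz+(n-z)\lg\frac{n}{n-z}$ (the second term is $0$ if $z=n$). The *suffix tree* is the compacted trie of all suffixes; its leaves, in lexicographic order, are labeled by the starting positions of their suffixes. Assume that the compressed suffix tree is loaded, i.e. that the following are available in constant time, nodes being addressed by pre-order numbers: the $\psi$-array,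 the balanced parenthesis sequence of the topology, the leaf with label $1$, and the navigation operations parent, depth, level ancestor, leftmost and rightmost leaf of a subtree, rank and select for leaves and for internal nodes, leaf test, child rank, and $i$-th child. The text itself is not accessible. **Two passes.** A pass visits the leaves in text order, with labels $1,\dots,n$; from each leaf it climbs through its proper ancestors and marks them as visited, until it meets an already visited node $v$ other than the root, or reaches the root. *Pass 1* keeps the next factor position, and whenever the climb from the leaf at this position stops at a visited node $v\neq$ root, it marks $v$ in a bit vector $B_W$ and advances the factor position by the string depth of $v$; if the root is reached, it advances by $1$. *Pass 2* repeats the traversal with all visited-marks cleared. It keeps an array $W$ indexed by witness ids (the rank of a node among the nodes marked in $B_W$, in pre-order), sets $W[\mathrm{id}(u)]$ to the current leaf label when a node $u$ marked in $B_W$ is visited for the first time, and streams the output: for a leaf at a factor position, the pair consisting of $W[\mathrm{id}(v)]$ and the string depth of $v$ if the climb stops at $v\ne$ root, and the first character of the suffix of the leaf if it reaches the root. **Theorem.** There are a word RAM program, constants $\kappa,C$, and a function $r(n)=o(n)$, all independent of $T$, $\sigma$ and the word size, such that the following holds for every such text $T$, with $z$ the number of factors of its LZ77 factorization. 1. Pass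 1 marks in $B_W$ exactly the witnesses of the referencing factors, where the witness of a factor with factor position $j$ is the lowest node in the set of the lowest common ancestors of the leaf labeled $j$ with the leaves labeled $i$, $1\le i<j$. 2. After pass 2, for every witness $u$, $W[\mathrm{id}(u)]$ is the smallest label of a leaf in the subtree of $u$. 3. The output of the two passes is a coding of the LZ77 factorization of $T$. 4. On every word RAM with word size $w\ge\kappa(\lfloor\lg n\rfloor+1)$ into which the compressed suffix tree of $T$ is loaded, the program streams exactly this output and halts after at most $C\,n$ steps, and besides the loaded data structure, the write-only output and a constant number of registers it uses at most $(1+H(n,z))\,n+z\lg n+r(n)$ bits of working memory. -/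

import Mathlib

open Asymptotics Filter

namespace LZ

section Text

variable {σ : ℕ}

/-- A text over its effective alphabet `{0, …, σ-1}`: it is non-empty, its last character
(the end marker) occurs nowhere else, and every character of the alphabet occurs in it. -/
def IsText (T : List (Fin σ)) : Prop :=
  (∃ (body : List (Fin σ)) (c : Fin σ), T = body ++ [c] ∧ c ∉ body) ∧ ∀ a : Fin σ, a ∈ T

/-- The `j`-th suffix of `T`; text positions are `1, …, n`. -/
def suffix (T : List (Fin σ)) (j : ℕ) : List (Fin σ) := T.drop (j - 1)

/-- The substrings of `T` that start strictly before position `j` (they may extend beyond it). -/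
def substringsBefore (T : List (Fin σ)) (j : ℕ) : Set (List (Fin σ)) :=
  {S | ∃ i, 1 ≤ i ∧ i < j ∧ S <+: suffix T i}

/-- The strings that consist of one character. -/
def singletons (σ : ℕ) : Set (List (Fin σ)) := {S | ∃ a : Fin σ, S = [a]}

/-- The text position at which the factor of index `x` (counted from `0`) starts. -/
def factorPos (F : List (List (Fin σ))) (x : ℕ) : ℕ := (F.take x).flatten.length + 1

/-- `F` is the LZ77 factorization of `T`: the factors concatenate to `T`, and the factor starting
at `j` is the longest string in `S_j(T) ∪ Σ` that is a prefix of the `j`-th suffix. -/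
def IsLZ77 (T : List (Fin σ)) (F : List (List (Fin σ))) : Prop :=
  F.flatten = T ∧
  ∀ (x : ℕ) (hx : x < F.length),
    F[x] ∈ substringsBefore T (factorPos F x) ∪ singletons σ ∧
    ∀ S ∈ substringsBefore T (factorPos F x) ∪ singletons σ,
      S <+: suffix T (factorPos F x) → S.length ≤ F[x].length

end Text

/-- The code of a factor: a character for a fresh factor, or the referred position together with
the number of characters to copy for a referencing factor. -/
inductive Code where
  | fresh (c : ℕ)
  | ref (pos len : ℕ)

/-- `out` is a coding of the factorization `F` of `T`. -/
def IsCoding {σ : ℕ} (T : List (Fin σ)) (F : List (List (Fin σ))) (out : List Code) : Prop :=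
  out.length = F.length ∧
  ∀ (x : ℕ) (hx : x < F.length) (hx' : x < out.length),
    match out[x] with
    | Code.fresh c =>
        (∃ a : Fin σ, F[x] = [a] ∧ a.val = c) ∧ F[x] ∉ substringsBefore T (factorPos F x)
    | Code.ref p l =>
        l = F[x].length ∧ 1 ≤ p ∧ p < factorPos F x ∧ F[x] <+: suffix T p

/-- The zero-order entropy (per bit) of a bit vector of length `n` with `z` ones. -/
noncomputable def entropy (n z : ℕ) : ℝ :=
  ((z : ℝ) * Real.logb 2 ((n : ℝ) / z) +
    ((n : ℝ) - z) * Real.logb 2 ((n : ℝ) / ((n : ℝ) - z))) / n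

section Lists

variable {α : Type*} [DecidableEq α]

/-- The `i`-th entry of a list, counted from `1`. -/
def nth (l : List α) (i : ℕ) : Option α := if i = 0 then none else l[i - 1]?

/-- The position of `a` in `l`, counted from `1`; `0` if `a` does not occur. -/
def posOf (l : List α) (a : α) : ℕ := if a ∈ l then l.idxOf a + 1 else 0

end Lists

/-! ### The suffix tree

A node is identified with the string read on the path from the root to it. -/

section SuffixTree

variable {σ : ℕ}

/-- The leaves of the suffix tree are the non-empty suffixes. -/
def IsLeaf (T u : List (Fin σ)) : Prop := u ≠ [] ∧ u <:+ T

instance (T u : List (Fin σ)) : Decidable (IsLeaf T u) := by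
  unfold IsLeaf; infer_instance

/-- The nodes that survive the compaction of the suffix trie: the root, the leaves, and the
branching nodes. -/
def IsNode (T u : List (Fin σ)) : Prop :=
  u = [] ∨ IsLeaf T u ∨ ∃ a b : Fin σ, a ≠ b ∧ (u ++ [a]) <:+: T ∧ (u ++ [b]) <:+: T

instance (T u : List (Fin σ)) : Decidable (IsNode T u) := by
  unfold IsNode; infer_instance

/-- The set of nodes; all of them are substrings of the text. -/
def nodeSet (T : List (Fin σ)) : Finset (List (Fin σ)) :=
  (T.tails.flatMap List.inits).toFinset.filter (IsNode T)

/-- The nodes in pre-order, which is the lexicographic order of their strings. -/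
def nodes (T : List (Fin σ)) : List (List (Fin σ)) := (nodeSet T).sort

/-- The leaves in depth first order. -/
def leaves (T : List (Fin σ)) : List (List (Fin σ)) := (nodes T).filter (IsLeaf T ·)

/-- The internal nodes in pre-order. -/
def internals (T : List (Fin σ)) : List (List (Fin σ)) := (nodes T).filter (¬ IsLeaf T ·)

/-- The proper ancestors of a node, from the root downwards. -/
def ancestors (T u : List (Fin σ)) : List (List (Fin σ)) :=
  (nodes T).filter (fun a => a <+: u ∧ a ≠ u)

/-- The depth of a node; the root has depth `0`. -/
def depth (T u : List (Fin σ)) : ℕ := (ancestors T u).length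

/-- The parent of a node other than the root. -/
def parent (T u : List (Fin σ)) : Option (List (Fin σ)) := (ancestors T u).getLast?

/-- The ancestor of `u` (possibly `u` itself) at depth `d`. -/
def levelAnc (T u : List (Fin σ)) (d : ℕ) : Option (List (Fin σ)) := (ancestors T u ++ [u])[d]?

/-- The children of a node in their order. -/
def children (T u : List (Fin σ)) : List (List (Fin σ)) :=
  (nodes T).filter (fun v => parent T v = some u)

/-- The leaves in the subtree of a node in their order. -/
def leavesBelow (T u : List (Fin σ)) : List (List (Fin σ)) := (leaves T).filter (u <+: ·)

/-- The lowest common ancestor. -/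
def lca (T u v : List (Fin σ)) : List (Fin σ) :=
  ((nodes T).filter (fun a => a <+: u ∧ a <+: v)).getLastD []

/-- The inverse suffix array. -/
def isa (T : List (Fin σ)) (j : ℕ) : ℕ := posOf (leaves T) (suffix T j)

/-- The suffix array: the label of the `i`-th leaf (`0` if there is none). -/
def sa (T : List (Fin σ)) (i : ℕ) : ℕ :=
  match nth (leaves T) i with
  | none => 0
  | some u => T.length + 1 - u.length

/-- The `ψ`-array. -/
def psi (T : List (Fin σ)) (i : ℕ) : ℕ :=
  if sa T i = 0 then 0 else if sa T i = T.length then isa T 1 else isa T (sa T i + 1)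

/-- The balanced parenthesis sequence (`true` opens) of a tree whose nodes have the given depths
in pre-order: after the opening parenthesis of a node, as many nodes are closed as the depth
decreases on the way to the next node. -/
def bpOfDepths : List ℕ → List Bool
  | [] => []
  | [d] => true :: List.replicate (d + 1) false
  | d :: e :: l => true :: (List.replicate (d + 1 - e) false ++ bpOfDepths (e :: l))

/-- The balanced parenthesis sequence of the topology of the suffix tree. -/
def bp (T : List (Fin σ)) : List Bool := bpOfDepths ((nodes T).map (depth T))

end SuffixTree

/-! ### The loaded data structure

The compressed suffix tree is accessible only through the following queries. Nodes are addressed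
by their pre-order numbers `1, 2, …`; invalid queries are answered by `0`. -/

inductive Query where
  | psi | bp | smallestLeaf
  | parent | depth | levelAnc | leftmostLeaf | rightmostLeaf
  | leafSelect | leafRank | internalSelect | internalRank | isLeaf
  | childRank | child

section Queries

variable {σ : ℕ}

/-- The pre-order number of a node. -/
def preorder (T u : List (Fin σ)) : ℕ := posOf (nodes T) u

/-- The pre-order number of an optional node, `0` if there is none. -/
def preorderOpt (T : List (Fin σ)) (u : Option (List (Fin σ))) : ℕ :=
  match u with
  | none => 0
  | some u => preorder T u

/-- Apply a function to the node with pre-order number `v`; `0` if there is no such node. -/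
def onNode (T : List (Fin σ)) (v : ℕ) (f : List (Fin σ) → ℕ) : ℕ :=
  match nth (nodes T) v with
  | none => 0
  | some u => f u

/-- The answers to the queries. The child rank is the number of preceding siblings; all other
ranks, and all select arguments, are counted from `1`. -/
def answer (T : List (Fin σ)) (q : Query) (a b : ℕ) : ℕ :=
  match q with
  | .psi => psi T a
  | .bp => if nth (bp T) a = some true then 1 else 0
  | .smallestLeaf => preorder T (suffix T 1)
  | .parent => onNode T a fun u => preorderOpt T (parent T u)
  | .depth => onNode T a fun u => depth T u
  | .levelAnc => onNode T a fun u => preorderOpt T (levelAnc T u b)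
  | .leftmostLeaf => onNode T a fun u => preorderOpt T (leavesBelow T u).head?
  | .rightmostLeaf => onNode T a fun u => preorderOpt T (leavesBelow T u).getLast?
  | .leafSelect => preorderOpt T (nth (leaves T) a)
  | .leafRank => onNode T a fun u => posOf (leaves T) u
  | .internalSelect => preorderOpt T (nth (internals T) a)
  | .internalRank => onNode T a fun u => posOf (internals T) u
  | .isLeaf => onNode T a fun u => if IsLeaf T u then 1 else 0
  | .childRank => onNode T a fun u =>
      match parent T u with
      | none => 0
      | some p => (children T p).idxOf u
  | .child => onNode T a fun u => preorderOpt T (nth (children T u) b)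

end Queries

/-! ### The two passes

A pass visits the leaves in text order. From each leaf it climbs towards the root until it meets
a node that is already visited, and it marks the nodes on the way as visited. -/

section Passes

variable {σ : ℕ}

/-- The internal nodes other than the root on the way from a leaf to the root. -/
def climbPath (T l : List (Fin σ)) : List (List (Fin σ)) :=
  (ancestors T l).reverse.filter (· ≠ [])

/-- The unvisited nodes that are met before the climb stops. -/
def newlyVisited (T : List (Fin σ)) (V : Finset (List (Fin σ))) (l : List (Fin σ)) :
    List (List (Fin σ)) :=
  (climbPath T l).takeWhile (· ∉ V)

/-- The visited node at which the climb stops; `none` if the climb reaches the root. -/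
def stopNode (T : List (Fin σ)) (V : Finset (List (Fin σ))) (l : List (Fin σ)) :
    Option (List (Fin σ)) :=
  ((climbPath T l).dropWhile (· ∉ V)).head?

/-- The state of the first pass: the visited nodes, the nodes marked as witnesses, and the next
factor position. -/
structure StateOne (σ : ℕ) where
  visited : Finset (List (Fin σ))
  marked : Finset (List (Fin σ))
  next : ℕ

/-- The first pass processes the leaf with label `j`. -/
def stepOne (T : List (Fin σ)) (s : StateOne σ) (j : ℕ) : StateOne σ :=
  let l := suffix T j
  let V := s.visited ∪ (newlyVisited T s.visited l).toFinset
  match stopNode T s.visited l with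
  | some v =>
      if j = s.next then ⟨V, insert v s.marked, s.next + v.length⟩ else ⟨V, s.marked, s.next⟩
  | none => ⟨V, s.marked, s.next + 1⟩

/-- The first pass. -/
def passOne (T : List (Fin σ)) : StateOne σ :=
  (List.range' 1 T.length).foldl (stepOne T) ⟨∅, ∅, 1⟩

/-- The witness id of a marked node: its rank among the marked nodes. -/
def witnessId (T : List (Fin σ)) (M : Finset (List (Fin σ))) (v : List (Fin σ)) : ℕ :=
  posOf ((nodes T).filter (· ∈ M)) v

/-- The state of the second pass: the visited nodes, the array that maps witness ids to text
positions, the next factor position, and the streamed output. -/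
structure StateTwo (σ : ℕ) where
  visited : Finset (List (Fin σ))
  array : ℕ → ℕ
  next : ℕ
  out : List Code

/-- The first character of a string. -/
def headChar (u : List (Fin σ)) : ℕ :=
  match u with
  | [] => 0
  | a :: _ => a.val

/-- The second pass, run with the marked nodes `M`, processes the leaf with label `j`. -/
def stepTwo (T : List (Fin σ)) (M : Finset (List (Fin σ))) (s : StateTwo σ) (j : ℕ) :
    StateTwo σ :=
  let l := suffix T j
  let N := newlyVisited T s.visited l
  let V := s.visited ∪ N.toFinset
  let A := (N.filter (· ∈ M)).foldl (fun A v => Function.update A (witnessId T M v) j) s.array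
  match stopNode T s.visited l with
  | some v =>
      if j = s.next then
        ⟨V, A, s.next + v.length, s.out ++ [Code.ref (A (witnessId T M v)) v.length]⟩
      else ⟨V, A, s.next, s.out⟩
  | none =>
      if j = s.next then ⟨V, A, s.next + 1, s.out ++ [Code.fresh (headChar l)]⟩
      else ⟨V, A, s.next, s.out⟩

/-- The second pass. -/
def passTwo (T : List (Fin σ)) (M : Finset (List (Fin σ))) : StateTwo σ :=
  (List.range' 1 T.length).foldl (stepTwo T M) ⟨∅, fun _ => 0, 1, []⟩

/-- The output of the two passes. -/
def twoPass (T : List (Fin σ)) : List Code := (passTwo T (passOne T).marked).out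

/-- `u` is the lowest node in the set of the lowest common ancestors of the leaf labeled `j` with
the leaves labeled `i < j`. -/
def IsWitness (T : List (Fin σ)) (j : ℕ) (u : List (Fin σ)) : Prop :=
  (∃ i, 1 ≤ i ∧ i < j ∧ u = lca T (suffix T j) (suffix T i)) ∧
  ∀ i, 1 ≤ i → i < j → lca T (suffix T j) (suffix T i) <+: u

end Passes

/-! ### The word RAM

Words have `w` bits. There are finitely many registers used by a program; the working memory is a
sequence of bits, initially zero, of which any field of at most `w` consecutive bits can be read
or written in one step. The output is write-only. -/

inductive BinOp where
  | add | sub | mul | div | mod | and | or | xor | shl | shr | lt | eq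

/-- Arithmetic on `w`-bit words. -/
def BinOp.eval (w : ℕ) (o : BinOp) (a b : ℕ) : ℕ :=
  (match o with
    | .add => a + b
    | .sub => a + 2 ^ w - b
    | .mul => a * b
    | .div => a / b
    | .mod => a % b
    | .and => a &&& b
    | .or => a ||| b
    | .xor => a ^^^ b
    | .shl => a * 2 ^ b
    | .shr => a / 2 ^ b
    | .lt => if a < b then 1 else 0
    | .eq => if a = b then 1 else 0) % 2 ^ w

/-- Instructions; `d a b l s` are names of registers. -/
inductive Instr where
  | const (d k : ℕ)
  | op (o : BinOp) (d a b : ℕ)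
  | popcount (d a : ℕ)
  | load (d a l : ℕ)
  | store (a l s : ℕ)
  | jmp (target : ℕ)
  | jz (a target : ℕ)
  | query (q : Query) (d a b : ℕ)
  | outFresh (a : ℕ)
  | outRef (a b : ℕ)

/-- A configuration; `space` is the number of bits of the shortest initial segment of the working
memory that contains all bits accessed so far. -/
structure Config where
  pc : ℕ
  reg : ℕ → ℕ
  mem : ℕ → Bool
  space : ℕ
  out : List Code

/-- The number stored in the `l` bits from bit address `a` on. -/
def readField (mem : ℕ → Bool) (a l : ℕ) : ℕ :=
  ∑ i ∈ Finset.range l, if mem (a + i) then 2 ^ i else 0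

/-- Write the low `l` bits of `x` to the `l` bits from bit address `a` on. -/
def writeField (mem : ℕ → Bool) (a l x : ℕ) : ℕ → Bool :=
  fun k => if a ≤ k ∧ k < a + l then x.testBit (k - a) else mem k

/-- Execute one instruction on a machine with word size `w` into which the compressed suffix tree
of `T` is loaded. -/
def exec {σ : ℕ} (T : List (Fin σ)) (w : ℕ) (i : Instr) (c : Config) : Config :=
  match i with
  | .const d k => { c with pc := c.pc + 1, reg := Function.update c.reg d (k % 2 ^ w) }
  | .op o d a b =>
      { c with pc := c.pc + 1, reg := Function.update c.reg d (o.eval w (c.reg a) (c.reg b)) }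
  | .popcount d a =>
      { c with
        pc := c.pc + 1
        reg := Function.update c.reg d ((Nat.digits 2 (c.reg a)).sum % 2 ^ w) }
  | .load d a l =>
      let len := min (c.reg l) w
      { c with
        pc := c.pc + 1
        reg := Function.update c.reg d (readField c.mem (c.reg a) len)
        space := max c.space (c.reg a + len) }
  | .store a l s =>
      let len := min (c.reg l) w
      { c with
        pc := c.pc + 1
        mem := writeField c.mem (c.reg a) len (c.reg s)
        space := max c.space (c.reg a + len) }
  | .jmp t => { c with pc := t }
  | .jz a t => { c with pc := if c.reg a = 0 then t else c.pc + 1 }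
  | .query q d a b =>
      { c with
        pc := c.pc + 1
        reg := Function.update c.reg d (answer T q (c.reg a) (c.reg b) % 2 ^ w) }
  | .outFresh a => { c with pc := c.pc + 1, out := c.out ++ [Code.fresh (c.reg a)] }
  | .outRef a b => { c with pc := c.pc + 1, out := c.out ++ [Code.ref (c.reg a) (c.reg b)] }

/-- One step; the machine halts when the program counter leaves the program. -/
def step {σ : ℕ} (P : List Instr) (T : List (Fin σ)) (w : ℕ) (c : Config) : Config :=
  match P[c.pc]? with
  | none => c
  | some i => exec T w i c

/-- The configuration after `t` steps. -/
def run {σ : ℕ} (P : List Instr) (T : List (Fin σ)) (w t : ℕ) : Config :=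
  (step P T w)^[t] ⟨0, fun _ => 0, fun _ => false, 0, []⟩

end LZ

/-! Correctness. The last character of the text is unique, so no suffix is a prefix of another one,
and the longest common prefix of two suffixes is an inner node: their lowest common ancestor
(`isNode_lcp`, `lca_eq_lcp`). Just before leaf `j` is treated, the visited nodes are the inner nodes
other than the root that are prefixes of an earlier suffix (`vis`). This set is closed under
non-root ancestors. Hence the climb stops at the longest prefix of suffix `j` that also starts at an
earlier position, which is both the factor and its witness (`stop_eq_some`); it reaches the root
only if no non-empty prefix is repeated (`stop_eq_none`). Dropping the first character of a repeat
leaves a repeat at the next position, so strictly inside a referencing factor no climb reaches the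
root (`nxt_spec`). A node is visited for the first time from the leaf with the smallest label below
it, which is the value that pass 2 stores (`firstLabel_eq_of_new`).

The machine. Programs are written in a small structured language, compiled to the word RAM
(`Ev.reach`) and verified with a total-correctness calculus `wp` whose states carry a step counter.
The text is replaced by three facts. Two leaves lie below the same child of the root iff their
suffixes start with the same character; the rank of that child is this character; and the string
depth of a node is the number of times that its leftmost and rightmost leaves can be advanced
together by ψ before their first characters differ. Time is linear because every inner node is newly
visited at most once, there are at most `n` inner nodes (`length_internals_le`), and the string
depths computed at factor positions are factor lengths, which sum to at most `n`.

Space. A single plain bit vector of about `n` bits serves three times: for the marks of pass 1, for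
B_W, and for the marks of pass 2. To make this possible, pass 1 only lists the ranks of the stop
nodes. Afterwards the vector is cleared, B_W is written into it from the list and compressed over
the list's memory, and the vector is cleared again; the array of labels follows the compressed B_W.
The compression cuts B_W into blocks of about `lg n / 8` bits and stores for each block its number
of ones and its index among the patterns with that many ones, which gives the entropy bound
(`bptr_le_logb`). Rounding `lg n` up for each label could cost `z` bits, so groups of about `lg lg
n` entries share one number for their high parts (`Packed`, `pB_le_logb`). All other data take `O(n
/ lg lg n)` bits. There may be fewer witnesses than factors; what the label array then saves pays
for a possible growth of the entropy term (`bptr_add_le`). -/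

namespace LZ

/-! ### A structured language for the word RAM -/

/-- Expressions over program variables. -/
inductive Ex where
  | var (r : ℕ)
  | num (k : ℕ)
  | bin (o : BinOp) (a b : Ex)
  | pop (a : Ex)
  | ld (a l : Ex)
  | qry (q : Query) (a b : Ex)

instance : Add Ex := ⟨.bin .add⟩
instance : Sub Ex := ⟨.bin .sub⟩
instance : Mul Ex := ⟨.bin .mul⟩
instance : Div Ex := ⟨.bin .div⟩
instance : Mod Ex := ⟨.bin .mod⟩
instance (k : ℕ) : OfNat Ex k := ⟨.num k⟩

/-- The result of an operation when no overflow occurs. -/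
def opVal : BinOp → ℕ → ℕ → ℕ
  | .add, a, b => a + b
  | .sub, a, b => a - b
  | .mul, a, b => a * b
  | .div, a, b => a / b
  | .mod, a, b => a % b
  | .and, a, b => a &&& b
  | .or, a, b => a ||| b
  | .xor, a, b => a ^^^ b
  | .shl, a, b => a * 2 ^ b
  | .shr, a, b => a / 2 ^ b
  | .lt, a, b => if a < b then 1 else 0
  | .eq, a, b => if a = b then 1 else 0

/-- No overflow occurs. -/
def opOk (w : ℕ) : BinOp → ℕ → ℕ → Prop
  | .add, a, b => a + b < 2 ^ w
  | .sub, a, b => b ≤ a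
  | .mul, a, b => a * b < 2 ^ w
  | .shl, a, b => a * 2 ^ b < 2 ^ w
  | _, _, _ => True

theorem eval_eq_opVal {w : ℕ} (hw : 0 < w) (o : BinOp) {a b : ℕ} (ha : a < 2 ^ w) (hb : b < 2 ^ w)
    (h : opOk w o a b) : o.eval w a b = opVal o a b := by
  have h2 : 1 < 2 ^ w := Nat.one_lt_two_pow hw.ne'
  cases o <;> simp only [BinOp.eval, opVal, opOk] at *
  case add => exact Nat.mod_eq_of_lt h
  case sub =>
    rw [show a + 2 ^ w - b = (a - b) + 2 ^ w by omega, Nat.add_mod_right]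
    exact Nat.mod_eq_of_lt (by omega)
  case mul => exact Nat.mod_eq_of_lt h
  case div => exact Nat.mod_eq_of_lt ((Nat.div_le_self _ _).trans_lt ha)
  case mod => exact Nat.mod_eq_of_lt ((Nat.mod_le _ _).trans_lt ha)
  case and => exact Nat.mod_eq_of_lt (Nat.and_lt_two_pow _ hb)
  case or => exact Nat.mod_eq_of_lt (Nat.or_lt_two_pow ha hb)
  case xor => exact Nat.mod_eq_of_lt (Nat.xor_lt_two_pow ha hb)
  case shl => exact Nat.mod_eq_of_lt h
  case shr => exact Nat.mod_eq_of_lt ((Nat.div_le_self _ _).trans_lt ha)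
  case lt => split_ifs <;> exact Nat.mod_eq_of_lt (by omega)
  case eq => split_ifs <;> exact Nat.mod_eq_of_lt (by omega)

theorem readField_lt (mem : ℕ → Bool) (a l : ℕ) : readField mem a l < 2 ^ l := by
  induction l with
  | zero => simp [readField]
  | succ l ih =>
    unfold readField at *
    rw [Finset.sum_range_succ, pow_succ]
    split_ifs <;> omega

section Semantics

variable {σ : ℕ} (T : List (Fin σ)) (w M : ℕ)

/-- The ideal value of an expression. -/
def Ex.val (mem : ℕ → Bool) (v : ℕ → ℕ) : Ex → ℕ
  | var r => v r
  | num k => k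
  | bin o a b => opVal o (a.val mem v) (b.val mem v)
  | pop a => (Nat.digits 2 (a.val mem v)).sum
  | ld a l => readField mem (a.val mem v) (l.val mem v)
  | qry q a b => answer T q (a.val mem v) (b.val mem v)

/-- The expression is evaluated without overflow and within the first `M` bits of memory. -/
def Ex.ok (mem : ℕ → Bool) (v : ℕ → ℕ) : Ex → Prop
  | var _ => True
  | num k => k < 2 ^ w
  | bin o a b => a.ok mem v ∧ b.ok mem v ∧ opOk w o (a.val T mem v) (b.val T mem v)
  | pop a => a.ok mem v
  | ld a l => a.ok mem v ∧ l.ok mem v ∧ l.val T mem v ≤ w ∧ a.val T mem v + l.val T mem v ≤ M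
  | qry q a b => a.ok mem v ∧ b.ok mem v ∧ answer T q (a.val T mem v) (b.val T mem v) < 2 ^ w

/-- Code that evaluates an expression into the temporary `d`. Variables are kept in the even
registers, temporaries in the odd registers. -/
def Ex.code : Ex → ℕ → List Instr
  | var r, d => [.const (2 * d + 1) 0, .op .add (2 * d + 1) (2 * d + 1) (2 * r)]
  | num k, d => [.const (2 * d + 1) k]
  | bin o a b, d => a.code d ++ b.code (d + 1) ++ [.op o (2 * d + 1) (2 * d + 1) (2 * d + 3)]
  | pop a, d => a.code d ++ [.popcount (2 * d + 1) (2 * d + 1)]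
  | ld a l, d => a.code d ++ l.code (d + 1) ++ [.load (2 * d + 1) (2 * d + 1) (2 * d + 3)]
  | qry q a b, d => a.code d ++ b.code (d + 1) ++ [.query q (2 * d + 1) (2 * d + 1) (2 * d + 3)]

/-- The number of steps that the evaluation of an expression takes. -/
def Ex.cost : Ex → ℕ
  | var _ => 2
  | num _ => 1
  | bin _ a b => a.cost + b.cost + 1
  | pop a => a.cost + 1
  | ld a l => a.cost + l.cost + 1
  | qry _ a b => a.cost + b.cost + 1

theorem Ex.length_code (e : Ex) (d : ℕ) : (e.code d).length = e.cost := by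
  induction e generalizing d <;> simp_all [Ex.code, Ex.cost, add_assoc]

/-- The piece `code` of the program `P` starts at `p`. -/
def CodeAt (P : List Instr) (p : ℕ) (code : List Instr) : Prop :=
  ∃ A B, P = A ++ code ++ B ∧ A.length = p

theorem CodeAt.left {P : List Instr} {p : ℕ} {x y : List Instr} (h : CodeAt P p (x ++ y)) :
    CodeAt P p x := by
  obtain ⟨A, B, rfl, rfl⟩ := h
  exact ⟨A, y ++ B, by simp, rfl⟩

theorem CodeAt.right {P : List Instr} {p : ℕ} {x y : List Instr} (h : CodeAt P p (x ++ y)) :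
    CodeAt P (p + x.length) y := by
  obtain ⟨A, B, rfl, rfl⟩ := h
  exact ⟨A ++ x, B, by simp, by simp⟩

theorem CodeAt.get {P : List Instr} {p : ℕ} {i : Instr} {y : List Instr}
    (h : CodeAt P p (i :: y)) : P[p]? = some i := by
  obtain ⟨A, B, rfl, rfl⟩ := h
  simp

/-- The configuration `c'` is reached from `c` in exactly `t` steps. -/
def Reach (P : List Instr) (t : ℕ) (c c' : Config) : Prop := (step P T w)^[t] c = c'

variable {T w M}

theorem Reach.trans {P : List Instr} {s t : ℕ} {c c' c'' : Config} (h : Reach T w P s c c')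
    (h' : Reach T w P t c' c'') : Reach T w P (s + t) c c'' := by
  unfold Reach at *
  rw [add_comm, Function.iterate_add_apply, h, h']

theorem reach_one {P : List Instr} {c : Config} {i : Instr} (h : P[c.pc]? = some i) :
    Reach T w P 1 c (exec T w i c) := by
  simp [Reach, step, h]

theorem reach_zero {P : List Instr} {c : Config} : Reach T w P 0 c c := rfl

variable (w M) in
/-- Invariants of all configurations. -/
def Config.Good (c : Config) : Prop := (∀ r, c.reg r < 2 ^ w) ∧ c.space ≤ M

theorem update_lt {reg : ℕ → ℕ} (h : ∀ r, reg r < 2 ^ w) {d x : ℕ} (hx : x < 2 ^ w) :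
    ∀ r, Function.update reg d x r < 2 ^ w := by
  intro r
  by_cases hr : r = d
  · subst hr; simpa
  · simpa [hr] using h r

/-- Temporaries form a stack: code compiled at depth `d` changes only odd registers from `2 * d + 1`
on. Therefore the variables survive, and the first operand, held in temporary `d`, survives the
evaluation of the second one at depth `d + 1`. -/
theorem Ex.reach (hw : 0 < w) (e : Ex) (v : ℕ → ℕ) {P : List Instr} (d : ℕ) (c : Config)
    (hP : CodeAt P c.pc (e.code d)) (hv : ∀ r, c.reg (2 * r) = v r) (hc : c.Good w M)
    (ok : e.ok T w M c.mem v) :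
    ∃ c', Reach T w P e.cost c c' ∧ c'.pc = c.pc + e.cost ∧
      c'.reg (2 * d + 1) = e.val T c.mem v ∧
      (∀ r, (∀ k, d ≤ k → r ≠ 2 * k + 1) → c'.reg r = c.reg r) ∧ c'.Good w M ∧
      c'.mem = c.mem ∧ c'.out = c.out := by
  have h2 : 1 < 2 ^ w := Nat.one_lt_two_pow hw.ne'
  -- the combination of two evaluations
  have two : ∀ (a b : Ex) (tail : List Instr) (d : ℕ) (c : Config),
      (∀ (d : ℕ) (c : Config), CodeAt P c.pc (a.code d) → (∀ r, c.reg (2 * r) = v r) →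
        c.Good w M → a.ok T w M c.mem v → ∃ c', Reach T w P a.cost c c' ∧ c'.pc = c.pc + a.cost ∧
        c'.reg (2 * d + 1) = a.val T c.mem v ∧
        (∀ r, (∀ k, d ≤ k → r ≠ 2 * k + 1) → c'.reg r = c.reg r) ∧ c'.Good w M ∧
        c'.mem = c.mem ∧ c'.out = c.out) →
      (∀ (d : ℕ) (c : Config), CodeAt P c.pc (b.code d) → (∀ r, c.reg (2 * r) = v r) →
        c.Good w M → b.ok T w M c.mem v → ∃ c', Reach T w P b.cost c c' ∧ c'.pc = c.pc + b.cost ∧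
        c'.reg (2 * d + 1) = b.val T c.mem v ∧
        (∀ r, (∀ k, d ≤ k → r ≠ 2 * k + 1) → c'.reg r = c.reg r) ∧ c'.Good w M ∧
        c'.mem = c.mem ∧ c'.out = c.out) →
      CodeAt P c.pc (a.code d ++ b.code (d + 1) ++ tail) → (∀ r, c.reg (2 * r) = v r) →
      c.Good w M → a.ok T w M c.mem v → b.ok T w M c.mem v →
      ∃ c', Reach T w P (a.cost + b.cost) c c' ∧ CodeAt P c'.pc tail ∧
        c'.pc = c.pc + (a.cost + b.cost) ∧
        c'.reg (2 * d + 1) = a.val T c.mem v ∧ c'.reg (2 * d + 3) = b.val T c.mem v ∧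
        (∀ r, (∀ k, d ≤ k → r ≠ 2 * k + 1) → c'.reg r = c.reg r) ∧ c'.Good w M ∧
        c'.mem = c.mem ∧ c'.out = c.out := by
    intro a b tail d c iha ihb hP hv hc oka okb
    obtain ⟨c1, r1, p1, v1, f1, g1, m1, o1⟩ := iha d c hP.left.left hv hc oka
    have hb : CodeAt P c1.pc (b.code (d + 1)) := by
      have := hP.left.right
      rwa [length_code, ← p1] at this
    obtain ⟨c2, r2, p2, v2, f2, g2, m2, o2⟩ := ihb (d + 1) c1 hb
      (fun r => by rw [f1 _ (fun k _ => by omega), hv]) g1 (by rwa [m1])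
    refine ⟨c2, r1.trans r2, ?_, by omega, ?_, ?_, ?_, g2, by rw [m2, m1], by rw [o2, o1]⟩
    · have := hP.right
      rw [List.length_append, length_code, length_code] at this
      rwa [p2, p1, add_assoc]
    · rw [f2 _ (fun k _ => by omega), v1]
    · rw [show 2 * d + 3 = 2 * (d + 1) + 1 by ring, v2, m1]
    · intro r hr
      rw [f2 r (fun k hk => hr k (by omega)), f1 r hr]
  induction e generalizing d c with
  -- The instruction set has no move, so the variable is added to a zeroed temporary.
  | var r =>
    refine ⟨_, (reach_one hP.get).trans (reach_one (i := .op .add (2 * d + 1) (2 * d + 1) (2 * r))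
      ?_), ?_, ?_, ?_, ⟨?_, ?_⟩, ?_, ?_⟩
    · exact (CodeAt.right (x := [.const (2 * d + 1) 0]) (by simpa [Ex.code] using hP)).get
    · simp [exec, Ex.cost]
    · have : c.reg (2 * r) < 2 ^ w := hc.1 _
      rw [hv] at this
      simp [exec, BinOp.eval, Ex.val, hv, Nat.mod_eq_of_lt this,
        Function.update_of_ne (show 2 * r ≠ 2 * d + 1 by omega)]
    · intro r' hr'
      have := hr' d le_rfl
      simp [exec, this]
    · refine update_lt (update_lt hc.1 ?_) ?_ <;> exact Nat.mod_lt _ (by omega)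
    · exact hc.2
    · rfl
    · rfl
  | num k =>
    refine ⟨_, reach_one hP.get, ?_, ?_, ?_, ⟨?_, ?_⟩, ?_, ?_⟩
    · simp [exec, Ex.cost]
    · simpa [exec, Ex.val] using Nat.mod_eq_of_lt ok
    · intro r' hr'
      have := hr' d le_rfl
      simp [exec, this]
    · exact update_lt hc.1 (Nat.mod_lt _ (by omega))
    · exact hc.2
    · rfl
    · rfl
  | bin o a b iha ihb =>
    obtain ⟨c2, r2, hP2, p2, v1, v2, f2, g2, m2, o2⟩ := two a b _ d c iha ihb hP hv hc ok.1 ok.2.1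
    refine ⟨_, r2.trans (reach_one hP2.get), ?_, ?_, ?_, ⟨?_, ?_⟩, ?_, ?_⟩
    · simp [exec, p2, Ex.cost, add_assoc]
    · have l1 := g2.1 (2 * d + 1)
      have l2 := g2.1 (2 * d + 3)
      rw [v1] at l1
      rw [v2] at l2
      simpa [exec, v1, v2, Ex.val] using eval_eq_opVal hw o l1 l2 ok.2.2
    · intro r' hr'
      have := hr' d le_rfl
      simp [exec, this, f2 r' hr']
    · exact update_lt g2.1 (Nat.mod_lt _ (by omega))
    · exact g2.2
    · exact m2
    · exact o2
  | pop a iha =>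
    obtain ⟨c1, r1, p1, v1, f1, g1, m1, o1⟩ := iha d c hP.left hv hc ok
    have hb := hP.right
    rw [length_code, ← p1] at hb
    refine ⟨_, r1.trans (reach_one hb.get), ?_, ?_, ?_, ⟨?_, ?_⟩, ?_, ?_⟩
    · simp [exec, p1, Ex.cost, add_assoc]
    · have l1 := g1.1 (2 * d + 1)
      rw [v1] at l1
      simpa [exec, v1, Ex.val] using Nat.mod_eq_of_lt ((Nat.digit_sum_le _ _).trans_lt l1)
    · intro r' hr'
      have := hr' d le_rfl
      simp [exec, this, f1 r' hr']
    · exact update_lt g1.1 (Nat.mod_lt _ (by omega))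
    · exact g1.2
    · exact m1
    · exact o1
  | ld a l iha ihb =>
    obtain ⟨c2, r2, hP2, p2, v1, v2, f2, g2, m2, o2⟩ := two a l _ d c iha ihb hP hv hc ok.1 ok.2.1
    have hmin : min (l.val T c.mem v) w = l.val T c.mem v := min_eq_left ok.2.2.1
    refine ⟨_, r2.trans (reach_one hP2.get), ?_, ?_, ?_, ⟨?_, ?_⟩, ?_, ?_⟩
    · simp [exec, p2, Ex.cost, add_assoc]
    · simp [exec, v1, v2, Ex.val, hmin, m2]
    · intro r' hr'
      have := hr' d le_rfl
      simp [exec, this, f2 r' hr']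
    · refine update_lt g2.1 ((readField_lt _ _ _).trans_le (Nat.pow_le_pow_right (by omega) ?_))
      exact min_le_right _ _
    · simp only [exec, v1, v2, hmin]
      exact max_le g2.2 ok.2.2.2
    · exact m2
    · exact o2
  | qry q a b iha ihb =>
    obtain ⟨c2, r2, hP2, p2, v1, v2, f2, g2, m2, o2⟩ := two a b _ d c iha ihb hP hv hc ok.1 ok.2.1
    refine ⟨_, r2.trans (reach_one hP2.get), ?_, ?_, ?_, ⟨?_, ?_⟩, ?_, ?_⟩
    · simp [exec, p2, Ex.cost, add_assoc]
    · simpa [exec, v1, v2, Ex.val] using Nat.mod_eq_of_lt ok.2.2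
    · intro r' hr'
      have := hr' d le_rfl
      simp [exec, this, f2 r' hr']
    · exact update_lt g2.1 (Nat.mod_lt _ (by omega))
    · exact g2.2
    · exact m2
    · exact o2

/-- Structured programs. -/
inductive Cmd where
  | assign (x : ℕ) (e : Ex)
  | store (a l s : Ex)
  | seq (c₁ c₂ : Cmd)
  | ite (e : Ex) (c₁ c₂ : Cmd)
  | loop (e : Ex) (c : Cmd)
  | putFresh (e : Ex)
  | putRef (a b : Ex)
  | skip

instance : Append Cmd := ⟨.seq⟩

/-- The length of the compiled code. -/
def Cmd.len : Cmd → ℕ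
  | assign _ e => e.cost + 2
  | store a l s => a.cost + l.cost + s.cost + 1
  | seq c₁ c₂ => c₁.len + c₂.len
  | ite e c₁ c₂ => e.cost + 1 + c₁.len + 1 + c₂.len
  | loop e c => e.cost + 1 + c.len + 1
  | putFresh e => e.cost + 1
  | putRef a b => a.cost + b.cost + 1
  | skip => 0

/-- The compiled code, to be placed at `p`. -/
def Cmd.code : Cmd → ℕ → List Instr
  | assign x e, _ => e.code 0 ++ [.const (2 * x) 0, .op .add (2 * x) (2 * x) 1]
  | store a l s, _ => a.code 0 ++ l.code 1 ++ s.code 2 ++ [.store 1 3 5]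
  | seq c₁ c₂, p => c₁.code p ++ c₂.code (p + c₁.len)
  | ite e c₁ c₂, p => e.code 0 ++ .jz 1 (p + e.cost + 1 + c₁.len + 1) ::
      (c₁.code (p + e.cost + 1) ++ .jmp (p + e.cost + 1 + c₁.len + 1 + c₂.len) ::
        c₂.code (p + e.cost + 1 + c₁.len + 1))
  | loop e c, p => e.code 0 ++ .jz 1 (p + e.cost + 1 + c.len + 1) ::
      (c.code (p + e.cost + 1) ++ [.jmp p])
  | putFresh e, _ => e.code 0 ++ [.outFresh 1]
  | putRef a b, _ => a.code 0 ++ b.code 1 ++ [.outRef 1 3]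
  | skip, _ => []

theorem Cmd.length_code (c : Cmd) (p : ℕ) : (c.code p).length = c.len := by
  induction c generalizing p <;>
    simp_all [Cmd.code, Cmd.len, Ex.length_code, add_assoc, add_comm, add_left_comm]

/-- The state of a structured program: the variables, the memory, the output, and the number of
steps so far. -/
structure St where
  v : ℕ → ℕ
  mem : ℕ → Bool
  out : List Code
  time : ℕ

/-- Assign to a variable. -/
def St.set (s : St) (x a : ℕ) (k : ℕ) : St :=
  { s with v := Function.update s.v x a, time := s.time + k }

/-- Let time pass. -/
def St.tick (s : St) (k : ℕ) : St := { s with time := s.time + k }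

/-- Write to the memory. -/
def St.put (s : St) (a l x : ℕ) (k : ℕ) : St :=
  { s with mem := writeField s.mem a l x, time := s.time + k }

/-- Write to the output. -/
def St.emit (s : St) (o : Code) (k : ℕ) : St :=
  { s with out := s.out ++ [o], time := s.time + k }

/-- The value of an expression in a state. -/
abbrev St.val (T : List (Fin σ)) (s : St) (e : Ex) : ℕ := e.val T s.mem s.v

variable (T w M) in
/-- The expression can be evaluated in a state. -/
abbrev St.ok (s : St) (e : Ex) : Prop := e.ok T w M s.mem s.v

variable (T w M) in
/-- The semantics of structured programs. -/
inductive Ev : Cmd → St → St → Prop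
  | assign {x e s} (h : s.ok T w M e) : Ev (.assign x e) s (s.set x (s.val T e) (e.cost + 2))
  | store {a l x s} (ha : s.ok T w M a) (hl : s.ok T w M l) (hx : s.ok T w M x)
      (hlw : s.val T l ≤ w) (hM : s.val T a + s.val T l ≤ M) :
      Ev (.store a l x) s
        (s.put (s.val T a) (s.val T l) (s.val T x) (a.cost + l.cost + x.cost + 1))
  | seq {c₁ c₂ s s' s''} (h : Ev c₁ s s') (h' : Ev c₂ s' s'') : Ev (.seq c₁ c₂) s s''
  | iteTrue {e c₁ c₂ s s'} (he : s.ok T w M e) (h0 : s.val T e ≠ 0)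
      (h : Ev c₁ (s.tick (e.cost + 2)) s') : Ev (.ite e c₁ c₂) s s'
  | iteFalse {e c₁ c₂ s s'} (he : s.ok T w M e) (h0 : s.val T e = 0)
      (h : Ev c₂ (s.tick (e.cost + 2)) s') : Ev (.ite e c₁ c₂) s s'
  | loopTrue {e c s s' s''} (he : s.ok T w M e) (h0 : s.val T e ≠ 0)
      (h : Ev c (s.tick (e.cost + 2)) s') (h' : Ev (.loop e c) s' s'') : Ev (.loop e c) s s''
  | loopFalse {e c s} (he : s.ok T w M e) (h0 : s.val T e = 0) :
      Ev (.loop e c) s (s.tick (e.cost + 2))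
  | putFresh {e s} (h : s.ok T w M e) :
      Ev (.putFresh e) s (s.emit (.fresh (s.val T e)) (e.cost + 1))
  | putRef {a b s} (h : s.ok T w M a) (h' : s.ok T w M b) :
      Ev (.putRef a b) s (s.emit (.ref (s.val T a) (s.val T b)) (a.cost + b.cost + 1))
  | skip {s} : Ev .skip s s

/-- The configuration represents the state. -/
def Config.Rep (c : Config) (s : St) : Prop :=
  (∀ r, c.reg (2 * r) = s.v r) ∧ c.mem = s.mem ∧ c.out = s.out

theorem Ex.reach' (hw : 0 < w) (e : Ex) {P : List Instr} (d : ℕ) (c : Config) {s : St}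
    (hP : CodeAt P c.pc (e.code d)) (hr : c.Rep s) (hc : c.Good w M)
    (ok : s.ok T w M e) :
    ∃ c', Reach T w P e.cost c c' ∧ c'.pc = c.pc + e.cost ∧
      c'.reg (2 * d + 1) = s.val T e ∧
      (∀ k, k < d → c'.reg (2 * k + 1) = c.reg (2 * k + 1)) ∧ c'.Good w M ∧ c'.Rep s := by
  obtain ⟨c1, r1, p1, v1, f1, g1, m1, o1⟩ := e.reach hw s.v d c hP hr.1 hc (by rw [hr.2.1]; exact ok)
  refine ⟨c1, r1, p1, by rw [v1, hr.2.1], fun k hk => f1 _ fun k' hk' => by omega, g1,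
    fun r => ?_, by rw [m1, hr.2.1], by rw [o1, hr.2.2]⟩
  rw [f1 _ (fun k' hk' => by omega), hr.1]

/-- Induction on the derivation; a derivation is finite, so termination is built into `Ev`. The time
is only an upper bound, since a test that fails is charged for a jump that is executed only when it
succeeds. -/
theorem Ev.reach (hw : 0 < w) {cmd : Cmd} {s s' : St} (h : Ev T w M cmd s s') {P : List Instr}
    (c : Config) (hP : CodeAt P c.pc (cmd.code c.pc)) (hr : c.Rep s) (hc : c.Good w M) :
    ∃ c' t, s.time + t ≤ s'.time ∧ Reach T w P t c c' ∧ c'.pc = c.pc + cmd.len ∧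
      c'.Rep s' ∧ c'.Good w M := by
  have h2 : 1 < 2 ^ w := Nat.one_lt_two_pow hw.ne'
  induction h generalizing c with
  | @assign x e s h =>
    obtain ⟨c1, r1, p1, v1, f1, g1, R1⟩ := e.reach' hw 0 c hP.left hr hc h
    have hb := hP.right
    rw [Ex.length_code, ← p1] at hb
    have hb' : CodeAt P (c1.pc + 1) [.op .add (2 * x) (2 * x) 1] :=
      CodeAt.right (x := [.const (2 * x) 0]) hb
    refine ⟨_, _, ?_, r1.trans ((reach_one hb.get).trans (reach_one hb'.get)), ?_, ⟨?_, ?_, ?_⟩,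
      ?_, ?_⟩
    · simp [St.set]
    · simp [exec, p1, Cmd.len, add_assoc]
    · intro r
      have hlt := g1.1 1
      by_cases hx : r = x
      · subst hx
        simp only [mul_zero, zero_add] at v1
        simp [exec, BinOp.eval, Function.update_of_ne (show (1 : ℕ) ≠ 2 * r by omega),
          St.set, v1, Nat.mod_eq_of_lt (v1 ▸ hlt)]
      · simp [exec, Function.update_of_ne (show 2 * r ≠ 2 * x by omega),
          Function.update_of_ne hx, St.set, R1.1]
    · exact R1.2.1
    · exact R1.2.2
    · refine update_lt (update_lt g1.1 ?_) ?_ <;> exact Nat.mod_lt _ (by omega)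
    · exact g1.2
  | @store a l x s ha hl hx hlw hM =>
    obtain ⟨c1, r1, p1, v1, f1, g1, R1⟩ := a.reach' hw 0 c hP.left.left.left hr hc ha
    have h1 := hP.left.left.right
    rw [Ex.length_code, ← p1] at h1
    obtain ⟨c2, r2, p2, v2, f2, g2, R2⟩ := l.reach' hw 1 c1 h1 R1 g1 hl
    have h2 := hP.left.right
    rw [List.length_append, Ex.length_code, Ex.length_code, ← add_assoc, ← p1, ← p2] at h2
    obtain ⟨c3, r3, p3, v3, f3, g3, R3⟩ := x.reach' hw 2 c2 h2 R2 g2 hx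
    have h3 := hP.right
    rw [List.length_append, List.length_append, Ex.length_code, Ex.length_code, Ex.length_code,
      ← add_assoc, ← add_assoc, ← p1, ← p2, ← p3] at h3
    have e1 : c3.reg 1 = s.val T a := by
      have := f3 0 (by omega)
      have h' := f2 0 (by omega)
      simp only [mul_zero, zero_add] at *
      rw [this, h', v1]
    have e2 : c3.reg 3 = s.val T l := by
      have := f3 1 (by omega)
      simp only [mul_one, Nat.reduceAdd] at *
      rw [this, v2]
    have e3 : c3.reg 5 = s.val T x := v3
    have hmin : min (c3.reg 3) w = s.val T l := by rw [e2]; exact min_eq_left hlw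
    refine ⟨_, _, ?_, ((r1.trans r2).trans r3).trans (reach_one h3.get), ?_, ⟨?_, ?_, ?_⟩, ?_, ?_⟩
    · simp [St.put]
    · simp [exec, p1, p2, p3, Cmd.len, add_assoc]
    · exact R3.1
    · simp only [exec, hmin, e1, e3, R3.2.1, St.put]
    · exact R3.2.2
    · exact g3.1
    · simp only [exec, hmin, e1]
      exact max_le g3.2 hM
  | @seq c₁ c₂ s s' s'' _ _ ih1 ih2 =>
    obtain ⟨c1, t1, h1, r1, p1, R1, g1⟩ := ih1 c hP.left hr hc
    have hb := hP.right
    rw [Cmd.length_code, ← p1] at hb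
    obtain ⟨c2, t2, h2, r2, p2, R2, g2⟩ := ih2 c1 hb R1 g1
    exact ⟨c2, t1 + t2, by omega, r1.trans r2, by simp [p2, p1, Cmd.len, add_assoc], R2, g2⟩
  | @iteTrue e c₁ c₂ s s' he h0 _ ih =>
    obtain ⟨c1, r1, p1, v1, f1, g1, R1⟩ := e.reach' hw 0 c hP.left hr hc he
    have hb := hP.right
    rw [Ex.length_code, ← p1] at hb
    have hv : c1.reg 1 ≠ 0 := by
      simp only [mul_zero, zero_add] at v1; rwa [v1]
    have hb1 := CodeAt.right (x := [.jz 1 _]) hb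
    obtain ⟨c2, t2, h2, r2, p2, R2, g2⟩ := ih (exec T w (.jz 1
      (c1.pc + 1 + c₁.len + 1)) c1)
      (by simpa [exec, hv, p1] using hb1.left) ⟨R1.1, R1.2.1, R1.2.2⟩ g1
    have hb2 := hb1.right
    rw [Cmd.length_code] at hb2
    have hpc : c2.pc = c1.pc + 1 + c₁.len := by simp [p2, exec, hv]
    rw [List.length_singleton, ← hpc] at hb2
    refine ⟨_, _, ?_, (r1.trans ((reach_one hb.get).trans r2)).trans (reach_one hb2.get), ?_,
      ⟨R2.1, R2.2.1, R2.2.2⟩, g2⟩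
    · simp only [St.tick] at h2; omega
    · simp [exec, Cmd.len]; omega
  | @iteFalse e c₁ c₂ s s' he h0 _ ih =>
    obtain ⟨c1, r1, p1, v1, f1, g1, R1⟩ := e.reach' hw 0 c hP.left hr hc he
    have hb := hP.right
    rw [Ex.length_code, ← p1] at hb
    have hv : c1.reg 1 = 0 := by
      simp only [mul_zero, zero_add] at v1; rwa [v1]
    have hb1 := CodeAt.right (x := [.jz 1 _]) hb
    have hb2 := hb1.right
    rw [Cmd.length_code] at hb2
    have hb3 := CodeAt.right (x := [.jmp _]) hb2
    obtain ⟨c2, t2, h2, r2, p2, R2, g2⟩ := ih (exec T w (.jz 1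
      (c1.pc + 1 + c₁.len + 1)) c1)
      (by simpa [exec, hv, p1] using hb3) ⟨R1.1, R1.2.1, R1.2.2⟩ g1
    refine ⟨_, _, ?_, r1.trans ((reach_one hb.get).trans r2), ?_,
      ⟨R2.1, R2.2.1, R2.2.2⟩, g2⟩
    · simp only [St.tick] at h2; omega
    · simp [p2, exec, Cmd.len, hv]; omega
  | @loopTrue e c₁ s s' s'' he h0 _ _ ih ih' =>
    obtain ⟨c1, r1, p1, v1, f1, g1, R1⟩ := e.reach' hw 0 c hP.left hr hc he
    have hb := hP.right
    rw [Ex.length_code, ← p1] at hb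
    have hv : c1.reg 1 ≠ 0 := by
      simp only [mul_zero, zero_add] at v1; rwa [v1]
    have hb1 := CodeAt.right (x := [.jz 1 _]) hb
    obtain ⟨c2, t2, h2, r2, p2, R2, g2⟩ := ih (exec T w (.jz 1
      (c1.pc + 1 + c₁.len + 1)) c1)
      (by simpa [exec, hv, p1] using hb1.left) ⟨R1.1, R1.2.1, R1.2.2⟩ g1
    have hb2 := hb1.right
    rw [Cmd.length_code] at hb2
    have hpc : c2.pc = c1.pc + 1 + c₁.len := by simp [p2, exec, hv]
    rw [List.length_singleton, ← hpc] at hb2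
    -- The closing jump leads back to the address of the test, where the same code is found, so the
    -- induction hypothesis for the remaining iterations applies.
    obtain ⟨c3, t3, h3, r3, p3, R3, g3⟩ := ih' (exec T w (.jmp c.pc) c2) hP
      ⟨R2.1, R2.2.1, R2.2.2⟩ g2
    refine ⟨c3, _, ?_, ((r1.trans ((reach_one hb.get).trans r2)).trans
      (reach_one hb2.get)).trans r3, p3, R3, g3⟩
    simp only [St.tick] at h2; omega
  | @loopFalse e c₁ s he h0 =>
    obtain ⟨c1, r1, p1, v1, f1, g1, R1⟩ := e.reach' hw 0 c hP.left hr hc he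
    have hb := hP.right
    rw [Ex.length_code, ← p1] at hb
    have hv : c1.reg 1 = 0 := by
      simp only [mul_zero, zero_add] at v1; rwa [v1]
    refine ⟨_, _, ?_, r1.trans (reach_one hb.get), ?_, ⟨R1.1, R1.2.1, R1.2.2⟩, g1⟩
    · simp only [St.tick]; omega
    · simp [exec, Cmd.len, hv, p1]; ring
  | @putFresh e s h =>
    obtain ⟨c1, r1, p1, v1, f1, g1, R1⟩ := e.reach' hw 0 c hP.left hr hc h
    have hb := hP.right
    rw [Ex.length_code, ← p1] at hb
    simp only [mul_zero, zero_add] at v1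
    refine ⟨_, _, ?_, r1.trans (reach_one hb.get), ?_, ⟨R1.1, R1.2.1, ?_⟩, g1⟩
    · simp [St.emit]
    · simp [exec, Cmd.len, p1, add_assoc]
    · simp [exec, St.emit, v1, R1.2.2]
  | @putRef a b s h h' =>
    obtain ⟨c1, r1, p1, v1, f1, g1, R1⟩ := a.reach' hw 0 c hP.left.left hr hc h
    have h1 := hP.left.right
    rw [Ex.length_code, ← p1] at h1
    obtain ⟨c2, r2, p2, v2, f2, g2, R2⟩ := b.reach' hw 1 c1 h1 R1 g1 h'
    have hb := hP.right
    rw [List.length_append, Ex.length_code, Ex.length_code, ← add_assoc, ← p1, ← p2] at hb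
    have e1 : c2.reg 1 = s.val T a := by
      have := f2 0 (by omega)
      simp only [mul_zero, zero_add] at *
      rw [this, v1]
    have e2 : c2.reg 3 = s.val T b := v2
    refine ⟨_, _, ?_, (r1.trans r2).trans (reach_one hb.get), ?_, ⟨R2.1, R2.2.1, ?_⟩, g2⟩
    · simp [St.emit]
    · simp [exec, Cmd.len, p1, p2, add_assoc]
    · simp [exec, St.emit, e1, e2, R2.2.2]
  | @skip s => exact ⟨c, 0, le_rfl, reach_zero, rfl, hr, hc⟩

/-- The program counter ends at the length of the code, which means that the machine has halted. The
invariant `Config.Good` supplies the space bound. -/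
theorem Ev.run (hw : 0 < w) {cmd : Cmd} {s' : St}
    (h : Ev T w M cmd ⟨fun _ => 0, fun _ => false, [], 0⟩ s') :
    ∃ t ≤ s'.time, (cmd.code 0).length ≤ (run (cmd.code 0) T w t).pc ∧
      (run (cmd.code 0) T w t).out = s'.out ∧ (run (cmd.code 0) T w t).space ≤ M := by
  have h2 : 0 < 2 ^ w := Nat.two_pow_pos w
  obtain ⟨c', t, ht, hr, hpc, hrep, hg⟩ := h.reach hw (P := cmd.code 0)
    ⟨0, fun _ => 0, fun _ => false, 0, []⟩ ⟨[], [], by simp, rfl⟩ ⟨fun _ => rfl, rfl, rfl⟩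
    ⟨fun _ => h2, Nat.zero_le _⟩
  refine ⟨t, by simpa using ht, ?_⟩
  unfold LZ.run
  rw [show _ = c' from hr]
  exact ⟨by rw [Cmd.length_code, hpc]; simp, hrep.2.2, hg.2⟩

variable (T w M) in
/-- Total correctness: `c` terminates from `s` in a state that satisfies `Q`. -/
def wp (c : Cmd) (Q : St → Prop) (s : St) : Prop := ∃ s', Ev T w M c s s' ∧ Q s'

theorem wp.mono {c : Cmd} {Q Q' : St → Prop} {s : St} (h : wp T w M c Q s)
    (hQ : ∀ s', Q s' → Q' s') : wp T w M c Q' s :=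
  let ⟨s', h1, h2⟩ := h; ⟨s', h1, hQ s' h2⟩

theorem wp_assign {x : ℕ} {e : Ex} {Q : St → Prop} {s : St} (h : s.ok T w M e)
    (hQ : Q (s.set x (s.val T e) (e.cost + 2))) : wp T w M (.assign x e) Q s := ⟨_, .assign h, hQ⟩

theorem wp_store {a l x : Ex} {Q : St → Prop} {s : St} (ha : s.ok T w M a) (hl : s.ok T w M l)
    (hx : s.ok T w M x) (hlw : s.val T l ≤ w) (hM : s.val T a + s.val T l ≤ M)
    (hQ : Q (s.put (s.val T a) (s.val T l) (s.val T x) (a.cost + l.cost + x.cost + 1))) :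
    wp T w M (.store a l x) Q s := ⟨_, .store ha hl hx hlw hM, hQ⟩

theorem wp_seq {c₁ c₂ : Cmd} {Q : St → Prop} {s : St} (h : wp T w M c₁ (wp T w M c₂ Q) s) :
    wp T w M (c₁ ++ c₂) Q s :=
  let ⟨_, h1, s'', h2, h3⟩ := h; ⟨s'', .seq h1 h2, h3⟩

theorem wp_ite {e : Ex} {c₁ c₂ : Cmd} {Q : St → Prop} {s : St} (he : s.ok T w M e)
    (h1 : s.val T e ≠ 0 → wp T w M c₁ Q (s.tick (e.cost + 2)))
    (h2 : s.val T e = 0 → wp T w M c₂ Q (s.tick (e.cost + 2))) : wp T w M (.ite e c₁ c₂) Q s := by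
  by_cases h : s.val T e = 0
  · obtain ⟨s', h3, h4⟩ := h2 h
    exact ⟨s', .iteFalse he h h3, h4⟩
  · obtain ⟨s', h3, h4⟩ := h1 h
    exact ⟨s', .iteTrue he h h3, h4⟩

theorem wp_skip {Q : St → Prop} {s : St} (h : Q s) : wp T w M .skip Q s := ⟨s, .skip, h⟩

theorem wp_putFresh {e : Ex} {Q : St → Prop} {s : St} (h : s.ok T w M e)
    (hQ : Q (s.emit (.fresh (s.val T e)) (e.cost + 1))) : wp T w M (.putFresh e) Q s :=
  ⟨_, .putFresh h, hQ⟩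

theorem wp_putRef {a b : Ex} {Q : St → Prop} {s : St} (h : s.ok T w M a) (h' : s.ok T w M b)
    (hQ : Q (s.emit (.ref (s.val T a) (s.val T b)) (a.cost + b.cost + 1))) :
    wp T w M (.putRef a b) Q s := ⟨_, .putRef h h', hQ⟩

/-- Loops with a known number of iterations. -/
theorem wp_loop {e : Ex} {c : Cmd} {Q : St → Prop} (N : ℕ) (I : ℕ → St → Prop)
    (step : ∀ i < N, ∀ s, I i s → s.ok T w M e ∧ s.val T e ≠ 0 ∧
      wp T w M c (I (i + 1)) (s.tick (e.cost + 2)))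
    (final : ∀ s, I N s → s.ok T w M e ∧ s.val T e = 0 ∧ Q (s.tick (e.cost + 2)))
    {s : St} (h0 : I 0 s) : wp T w M (.loop e c) Q s := by
  have key : ∀ k i s, i + k = N → I i s → wp T w M (.loop e c) Q s := by
    intro k
    induction k with
    | zero =>
      intro i s hi hs
      obtain rfl : i = N := by omega
      obtain ⟨h1, h2, h3⟩ := final s hs
      exact ⟨_, .loopFalse h1 h2, h3⟩
    | succ k ih =>
      intro i s hi hs
      obtain ⟨h1, h2, s', h3, h4⟩ := step i (by omega) s hs
      obtain ⟨s'', h5, h6⟩ := ih (i + 1) s' (by omega) h4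
      exact ⟨s'', .loopTrue h1 h2 h3 h5, h6⟩
  exact key N 0 s (by omega) h0

end Semantics

end LZ

namespace LZ

/-! ### Fields, arrays, and packed arrays in memory -/

theorem readField_succ (mem : ℕ → Bool) (a l : ℕ) :
    readField mem a (l + 1) = readField mem a l + if mem (a + l) then 2 ^ l else 0 := by
  rw [readField, Finset.sum_range_succ]; rfl

theorem readField_succ' (mem : ℕ → Bool) (a l : ℕ) :
    readField mem a (l + 1) = 2 * readField mem (a + 1) l + if mem a then 1 else 0 := by
  rw [readField, Finset.sum_range_succ', readField, Finset.mul_sum]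
  congr 1
  refine Finset.sum_congr rfl fun i _ => ?_
  rw [show a + (i + 1) = a + 1 + i by ring]
  split_ifs <;> ring

theorem readField_one (mem : ℕ → Bool) (a : ℕ) :
    readField mem a 1 = if mem a then 1 else 0 := by simp [readField]

theorem readField_congr {mem mem' : ℕ → Bool} {a l : ℕ}
    (h : ∀ k, a ≤ k → k < a + l → mem k = mem' k) : readField mem a l = readField mem' a l := by
  refine Finset.sum_congr rfl fun i hi => ?_
  rw [h (a + i) (by omega) (by have := Finset.mem_range.1 hi; omega)]

theorem readField_mod (mem : ℕ → Bool) (a : ℕ) {k l : ℕ} (h : k ≤ l) :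
    readField mem a l % 2 ^ k = readField mem a k := by
  induction l, h using Nat.le_induction with
  | base => exact Nat.mod_eq_of_lt (readField_lt _ _ _)
  | succ l hl ih =>
    rw [readField_succ]
    split_ifs
    · rw [show 2 ^ l = 2 ^ k * 2 ^ (l - k) by rw [← pow_add]; congr 1; omega,
        Nat.add_mul_mod_self_left, ih]
    · simpa using ih

theorem readField_div (mem : ℕ → Bool) (a k l : ℕ) :
    readField mem a (k + l) / 2 ^ k = readField mem (a + k) l := by
  induction k generalizing a with
  | zero => simp
  | succ k ih =>
    rw [show k + 1 + l = k + l + 1 by ring, readField_succ', pow_succ', ← Nat.div_div_eq_div_mul,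
      show a + (k + 1) = a + 1 + k by ring, ← ih]
    congr 1
    split_ifs <;> omega

theorem readField_bit (mem : ℕ → Bool) (a : ℕ) {k l : ℕ} (h : k < l) :
    readField mem a l / 2 ^ k % 2 = if mem (a + k) then 1 else 0 := by
  obtain ⟨m, rfl⟩ := Nat.exists_eq_add_of_lt h
  rw [add_assoc, readField_div, readField_succ']
  split_ifs <;> omega

theorem readField_testBit (x l : ℕ) : readField x.testBit 0 l = x % 2 ^ l := by
  induction l with
  | zero => simp [readField, Nat.mod_one]
  | succ l ih => 
    rw [readField_succ, ih, zero_add, Nat.mod_pow_succ, Nat.testBit_eq_decide_div_mod_eq]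
    rcases Nat.mod_two_eq_zero_or_one (x / 2 ^ l) with h | h <;> simp [h]

theorem readField_writeField (mem : ℕ → Bool) (a l x : ℕ) :
    readField (writeField mem a l x) a l = x % 2 ^ l := by
  rw [← readField_testBit]
  refine Finset.sum_congr rfl fun i hi => ?_
  have := Finset.mem_range.1 hi
  simp [writeField, this]

theorem writeField_of_not_mem (mem : ℕ → Bool) {a l : ℕ} (x : ℕ) {k : ℕ} (h : k < a ∨ a + l ≤ k) :
    writeField mem a l x k = mem k := by
  rw [writeField, if_neg (by omega)]

theorem readField_writeField_of_disjoint (mem : ℕ → Bool) {a l a' l' : ℕ} (x : ℕ)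
    (h : a' + l' ≤ a ∨ a + l ≤ a') :
    readField (writeField mem a l x) a' l' = readField mem a' l' :=
  readField_congr fun k h1 h2 => writeField_of_not_mem _ _ (by omega)

theorem writeField_one (mem : ℕ → Bool) (a x : ℕ) :
    writeField mem a 1 x = Function.update mem a (x % 2 = 1) := by
  funext k
  by_cases h : k = a
  · subst h; simp [writeField, Nat.testBit_zero]
  · simp [writeField, h]; intros; omega

/-- The number of ones in the binary representation. -/
def pop (x : ℕ) : ℕ := (Nat.digits 2 x).sum

theorem pop_zero : pop 0 = 0 := by simp [pop]

theorem pop_two_mul (x : ℕ) : pop (2 * x) = pop x := by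
  rcases Nat.eq_zero_or_pos x with rfl | h
  · simp
  · unfold pop
    rw [Nat.digits_def' (by omega) (by omega)]; simp

theorem pop_two_mul_add_one (x : ℕ) : pop (2 * x + 1) = pop x + 1 := by
  unfold pop
  rw [Nat.digits_def' (by omega) (by omega), show (2 * x + 1) % 2 = 1 by omega,
    show (2 * x + 1) / 2 = x by omega]
  simp [add_comm]

theorem pop_readField (mem : ℕ → Bool) (a l : ℕ) :
    pop (readField mem a l) = ∑ i ∈ Finset.range l, if mem (a + i) then 1 else 0 := by
  induction l generalizing a with
  | zero => simp [readField, pop_zero]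
  | succ l ih =>
    rw [Finset.sum_range_succ', readField_succ']
    have e : ∑ i ∈ Finset.range l, (if mem (a + (i + 1)) then 1 else 0) =
        pop (readField mem (a + 1) l) := by
      rw [ih]
      exact Finset.sum_congr rfl fun i _ => by rw [show a + (i + 1) = a + 1 + i by ring]
    rw [e, add_zero]
    split_ifs
    · exact pop_two_mul_add_one _
    · exact pop_two_mul _

theorem index_le {i N w : ℕ} (h : i < N) : i * w + w ≤ N * w := by
  rw [← Nat.succ_mul]; exact Nat.mul_le_mul_right w h

/-! #### Numbers in base `H` -/

theorem sum_digits_lt {H : ℕ} (d : ℕ → ℕ) (k : ℕ) (hd : ∀ i < k, d i < H) :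
    ∑ i ∈ Finset.range k, d i * H ^ i < H ^ k := by
  induction k with
  | zero => simp
  | succ k ih =>
    rw [Finset.sum_range_succ, pow_succ]
    have h1 := ih fun i hi => hd i (by omega)
    have h2 := hd k (by omega)
    have : (d k + 1) * H ^ k ≤ H * H ^ k := Nat.mul_le_mul_right _ h2
    rw [mul_comm (H ^ k) H]
    linarith [add_mul (d k) 1 (H ^ k)]

theorem sum_digits_digit {H : ℕ} (d : ℕ → ℕ) {k p : ℕ} (hp : p < k) (hd : ∀ i < k, d i < H) :
    (∑ i ∈ Finset.range k, d i * H ^ i) / H ^ p % H = d p := by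
  have hH : 0 < H := (Nat.zero_le _).trans_lt (hd p hp)
  obtain ⟨m, rfl⟩ := Nat.exists_eq_add_of_lt hp
  have e : ∑ i ∈ Finset.range (p + m + 1), d i * H ^ i =
      ∑ i ∈ Finset.range p, d i * H ^ i +
        H ^ p * (d p + H * ∑ i ∈ Finset.range m, d (p + 1 + i) * H ^ i) := by
    rw [show p + m + 1 = p + 1 + m by ring, Finset.sum_range_add, Finset.sum_range_succ,
      Finset.mul_sum, mul_add, Finset.mul_sum, ← add_assoc]
    congr 1
    · ring
    · refine Finset.sum_congr rfl fun i _ => ?_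
      ring
  have h1 := sum_digits_lt (H := H) d p fun i hi => hd i (by omega)
  rw [e, Nat.add_mul_div_left _ _ (pow_pos hH p), Nat.div_eq_of_lt h1, zero_add,
    Nat.add_mul_mod_self_left]
  exact Nat.mod_eq_of_lt (hd p hp)

/-- The new multiple of `H ^ p` is added before the old one is removed; the subtraction of natural
numbers is exact because the old multiple is one of the summands. -/
theorem sum_digits_update {H : ℕ} (d : ℕ → ℕ) {k p : ℕ} (hp : p < k) (x : ℕ) :
    ∑ i ∈ Finset.range k, Function.update d p x i * H ^ i =
      ∑ i ∈ Finset.range k, d i * H ^ i + x * H ^ p - d p * H ^ p := by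
  have hm : p ∈ Finset.range k := Finset.mem_range.2 hp
  rw [← Finset.add_sum_erase _ _ hm, ← Finset.add_sum_erase _ _ hm]
  have : ∑ i ∈ (Finset.range k).erase p, Function.update d p x i * H ^ i =
      ∑ i ∈ (Finset.range k).erase p, d i * H ^ i :=
    Finset.sum_congr rfl fun i hi => by rw [Function.update_of_ne (Finset.ne_of_mem_erase hi)]
  rw [this, Function.update_self]
  omega

/-- A packed array: in every block, the high parts of `k` entries form a number in base `H` that is
stored in `e` bits, and the low parts are stored in fields of `t` bits. -/
def Packed (mem : ℕ → Bool) (base k H e t nb : ℕ) (f : ℕ → ℕ) : Prop :=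
  (∀ i, f i / 2 ^ t < H) ∧
  ∀ j < nb, readField mem (base + j * (e + k * t)) e =
      ∑ p ∈ Finset.range k, f (j * k + p) / 2 ^ t * H ^ p ∧
    ∀ p < k, readField mem (base + j * (e + k * t) + e + p * t) t = f (j * k + p) % 2 ^ t

theorem Packed.congr {mem mem' : ℕ → Bool} {base k H e t nb : ℕ} {f : ℕ → ℕ}
    (h : Packed mem base k H e t nb f)
    (hm : ∀ i, base ≤ i → i < base + nb * (e + k * t) → mem' i = mem i) :
    Packed mem' base k H e t nb f := by
  refine ⟨h.1, fun j hj => ⟨?_, fun p hp => ?_⟩⟩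
  · have := index_le (w := e + k * t) hj
    rw [← (h.2 j hj).1]
    exact readField_congr fun i h1 h2 => hm i (by omega) (by omega)
  · have := index_le (w := e + k * t) hj
    have := index_le (w := t) hp
    rw [← (h.2 j hj).2 p hp]
    exact readField_congr fun i h1 h2 => hm i (by omega) (by omega)

section

variable {mem : ℕ → Bool} {base k H e t nb : ℕ} {f : ℕ → ℕ}

theorem Packed.digit (h : Packed mem base k H e t nb f) {j p : ℕ} (hj : j < nb) (hp : p < k) :
    readField mem (base + j * (e + k * t)) e / H ^ p % H = f (j * k + p) / 2 ^ t := by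
  rw [(h.2 j hj).1]
  exact sum_digits_digit _ hp fun i _ => h.1 _

theorem Packed.get (h : Packed mem base k H e t nb f) {j p : ℕ} (hj : j < nb) (hp : p < k) :
    readField mem (base + j * (e + k * t)) e / H ^ p % H * 2 ^ t +
      readField mem (base + j * (e + k * t) + e + p * t) t = f (j * k + p) := by
  rw [h.digit hj hp, (h.2 j hj).2 p hp, mul_comm]
  exact Nat.div_add_mod _ _

/-- A digit in base `H` is replaced by adding the new multiple of `H ^ p` and subtracting the old
one, without decoding the other digits. By `he` the result still fits into the field of `e` bits. -/
theorem Packed.set (h : Packed mem base k H e t nb f) (he : H ^ k ≤ 2 ^ e) {j p x : ℕ}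
    (hj : j < nb) (hp : p < k) (hx : x / 2 ^ t < H) :
    Packed (writeField (writeField mem (base + j * (e + k * t)) e
      (readField mem (base + j * (e + k * t)) e + x / 2 ^ t * H ^ p - f (j * k + p) / 2 ^ t * H ^ p))
      (base + j * (e + k * t) + e + p * t) t x) base k H e t nb
      (Function.update f (j * k + p) x) := by
  have hk : 0 < k := by omega
  -- An index determines its block and its offset, so no other entry is affected.
  have inj : ∀ j' p', p' < k → (j' * k + p' = j * k + p ↔ j' = j ∧ p' = p) := by
    intro j' p' hp'
    constructor
    · intro h
      have h1 : (p' + k * j') / k = (p + k * j) / k := by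
        rw [mul_comm k, mul_comm k, add_comm, h, add_comm]
      rw [Nat.add_mul_div_left _ _ hk, Nat.add_mul_div_left _ _ hk, Nat.div_eq_of_lt hp,
        Nat.div_eq_of_lt hp'] at h1
      simp only [zero_add] at h1
      subst h1; omega
    · rintro ⟨rfl, rfl⟩; rfl
  have hp1 := index_le (w := t) hp
  refine ⟨fun i => ?_, fun j' hj' => ?_⟩
  · by_cases hi : i = j * k + p
    · simpa [hi] using hx
    · simpa [hi] using h.1 i
  · by_cases hjj : j' = j
    · subst hjj
      constructor
      · rw [readField_writeField_of_disjoint _ _ (by omega), readField_writeField,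
          (h.2 j' hj').1]
        have e1 : ∀ i, (Function.update f (j' * k + p) x (j' * k + i)) / 2 ^ t =
            Function.update (fun i => f (j' * k + i) / 2 ^ t) p (x / 2 ^ t) i := by
          intro i
          by_cases hi : i = p
          · simp [hi]
          · simp [hi]
        simp only [e1]
        have := sum_digits_update (H := H) (fun i => f (j' * k + i) / 2 ^ t) hp (x / 2 ^ t)
        rw [← this]
        refine Nat.mod_eq_of_lt ((sum_digits_lt _ _ fun i hi => ?_).trans_le he)
        by_cases hi' : i = p
        · simpa [hi'] using hx
        · simpa [hi'] using h.1 _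
      · intro p' hp'
        by_cases hpp : p' = p
        · subst hpp
          rw [readField_writeField, Function.update_self]
        · rw [Function.update_of_ne (by omega), readField_writeField_of_disjoint,
            readField_writeField_of_disjoint _ _ (by omega), (h.2 j' hj').2 p' hp']
          rcases Nat.lt_or_gt_of_ne hpp with h' | h'
          · have := index_le (w := t) h'; omega
          · have := index_le (w := t) h'; omega
    · have hd : j' * (e + k * t) + (e + k * t) ≤ j * (e + k * t) ∨
          j * (e + k * t) + (e + k * t) ≤ j' * (e + k * t) := by
        rcases Nat.lt_or_gt_of_ne hjj with h' | h'
        · exact Or.inl (index_le h')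
        · exact Or.inr (index_le h')
      constructor
      · rw [readField_writeField_of_disjoint _ _ (by omega),
          readField_writeField_of_disjoint _ _ (by omega), (h.2 j' hj').1]
        refine Finset.sum_congr rfl fun i hi => ?_
        rw [Function.update_of_ne]
        rw [Ne, inj j' i (Finset.mem_range.1 hi)]; tauto
      · intro p' hp'
        have := index_le (w := t) hp'
        rw [readField_writeField_of_disjoint _ _ (by omega),
          readField_writeField_of_disjoint _ _ (by omega), (h.2 j' hj').2 p' hp',
          Function.update_of_ne]
        rw [Ne, inj j' p' hp']; tauto

/-- If all high parts are zero, the memory represents some packed array. -/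
theorem Packed.init (hH : 0 < H) (hk : 0 < k)
    (hz : ∀ j < nb, readField mem (base + j * (e + k * t)) e = 0) :
    Packed mem base k H e t nb
      (fun i => readField mem (base + i / k * (e + k * t) + e + i % k * t) t) := by
  -- Any `t` bits are a legal low part, so the low fields may hold leftovers; only the high fields,
  -- whose digits must stay below `H`, have to be cleared.
  have h0 : ∀ i, readField mem i t / 2 ^ t = 0 := fun i => Nat.div_eq_of_lt (readField_lt _ _ _)
  refine ⟨fun i => by rw [h0]; exact hH, fun j hj => ⟨?_, fun p hp => ?_⟩⟩
  · simp [h0, hz j hj]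
  · dsimp only
    rw [show j * k + p = p + k * j by ring, Nat.add_mul_div_left _ _ hk, Nat.div_eq_of_lt hp,
      Nat.add_mul_mod_self_left, Nat.mod_eq_of_lt hp, zero_add,
      Nat.mod_eq_of_lt (readField_lt _ _ _)]

end

end LZ

namespace LZ

/-! ### Prefixes, lexicographic order and positions in lists -/

section Strings

variable {σ : ℕ}

theorem append_cons_lt (u x y : List (Fin σ)) {a b : Fin σ} (h : a < b) :
    u ++ a :: x < u ++ b :: y := by
  induction u with
  | nil => exact List.Lex.rel h
  | cons c u ih => exact List.Lex.cons ih

theorem lt_of_prefix {u v : List (Fin σ)} (h : u <+: v) (hne : u ≠ v) : u < v := by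
  obtain ⟨t, rfl⟩ := h
  cases t with
  | nil => simp at hne
  | cons a t =>
  clear hne
  induction u with
  | nil => exact List.Lex.nil
  | cons c u ih => exact List.Lex.cons ih

theorem le_of_prefix {u v : List (Fin σ)} (h : u <+: v) : u ≤ v := by
  by_cases h' : u = v
  · exact h'.le
  · exact (lt_of_prefix h h').le

theorem prefix_antisymm {u v : List (Fin σ)} (h : u <+: v) (h' : v <+: u) : u = v :=
  h.eq_of_length (le_antisymm h.length_le h'.length_le)

theorem prefix_total {u v x : List (Fin σ)} (h : u <+: x) (h' : v <+: x) : u <+: v ∨ v <+: u := by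
  rcases le_total u.length v.length with hl | hl
  · exact Or.inl (List.prefix_of_prefix_length_le h h' hl)
  · exact Or.inr (List.prefix_of_prefix_length_le h' h hl)

/-- The longest common prefix. -/
def lcp : List (Fin σ) → List (Fin σ) → List (Fin σ)
  | a :: u, b :: v => if a = b then a :: lcp u v else []
  | _, _ => []

theorem lcp_prefix (u v : List (Fin σ)) : lcp u v <+: u ∧ lcp u v <+: v := by
  induction u generalizing v with
  | nil => simp [lcp]
  | cons a u ih =>
    cases v with
    | nil => simp [lcp]
    | cons b v =>
      unfold lcp
      split_ifs with h
      · subst h; simpa using ih v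
      · simp

theorem prefix_lcp {x u v : List (Fin σ)} (h : x <+: u) (h' : x <+: v) : x <+: lcp u v := by
  induction x generalizing u v with
  | nil => simp
  | cons c x ih =>
    obtain ⟨s, rfl⟩ := h
    obtain ⟨t, rfl⟩ := h'
    simpa [lcp] using ih (u := x ++ s) (v := x ++ t) (by simp) (by simp)

theorem lcp_branch {u v : List (Fin σ)} (h : ¬ u <+: v) (h' : ¬ v <+: u) :
    ∃ a b x y, a ≠ b ∧ u = lcp u v ++ a :: x ∧ v = lcp u v ++ b :: y := by
  induction u generalizing v with
  | nil => simp at h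
  | cons a u ih =>
    cases v with
    | nil => simp at h'
    | cons b v =>
      unfold lcp
      split_ifs with hab
      · subst hab
        obtain ⟨a', b', x, y, h1, h2, h3⟩ := ih (v := v) (by simpa using h) (by simpa using h')
        exact ⟨a', b', x, y, h1, by simpa using h2, by simpa using h3⟩
      · exact ⟨a, b, u, v, hab, rfl, rfl⟩

theorem sortedLT_filter {α : Type*} [LinearOrder α] {l : List α} (h : l.SortedLT) (p : α → Bool) :
    (l.filter p).SortedLT :=
  (h.pairwise.filter p).sortedLT

section PosOf

variable {α : Type*} [DecidableEq α] {l : List α} {a b : α}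

theorem posOf_of_mem (h : a ∈ l) : posOf l a = l.idxOf a + 1 := if_pos h

theorem posOf_pos (h : a ∈ l) : 1 ≤ posOf l a := by rw [posOf_of_mem h]; omega

theorem posOf_le (l : List α) (a : α) : posOf l a ≤ l.length := by
  unfold posOf
  split_ifs with h
  · exact List.idxOf_lt_length_iff.2 h
  · omega

theorem nth_posOf (h : a ∈ l) : nth l (posOf l a) = some a := by
  have := List.idxOf_lt_length_iff.2 h
  simp [posOf_of_mem h, nth, List.getElem?_eq_getElem this, List.getElem_idxOf]

theorem posOf_inj (ha : a ∈ l) (h : posOf l a = posOf l b) : a = b := by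
  have hb : b ∈ l := by
    by_contra hb
    have h1 : posOf l b = 0 := if_neg hb
    have := posOf_pos ha
    omega
  have := nth_posOf ha
  rw [h, nth_posOf hb] at this
  simpa using this.symm

end PosOf

end Strings

/-! ### The suffix tree of a text with a unique end marker -/

section Tree

variable {σ : ℕ} {T : List (Fin σ)}

theorem IsText.pos (hT : IsText T) : 1 ≤ T.length := by
  obtain ⟨⟨b, c, rfl, -⟩, -⟩ := hT
  simp

theorem IsText.exists_end (hT : IsText T) : ∃ c, ∀ k, T[k]? = some c ↔ k + 1 = T.length := by
  obtain ⟨⟨b, c, rfl, hc⟩, -⟩ := hT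
  refine ⟨c, fun k => ?_⟩
  rw [List.length_append, List.length_singleton]
  rcases lt_trichotomy k b.length with h | h | h
  · rw [List.getElem?_append_left h]
    constructor
    · intro h'; exact absurd (List.mem_of_getElem? h') hc
    · intro; omega
  · simp [h]
  · rw [List.getElem?_eq_none (by simp; omega)]
    simp; omega

theorem length_suffix (T : List (Fin σ)) (j : ℕ) : (suffix T j).length = T.length - (j - 1) := by
  simp [suffix]

theorem suffix_ne_nil {j : ℕ} (h1 : 1 ≤ j) (hj : j ≤ T.length) : suffix T j ≠ [] := by
  intro h
  have := congrArg List.length h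
  rw [length_suffix] at this
  simp at this; omega

theorem getElem?_suffix (T : List (Fin σ)) (j k : ℕ) : (suffix T j)[k]? = T[j - 1 + k]? := by
  simp [suffix]

theorem suffix_add {j : ℕ} (h : 1 ≤ j) (k : ℕ) : suffix T (j + k) = (suffix T j).drop k := by
  simp only [suffix, List.drop_drop]
  congr 1; omega

theorem isLeaf_suffix {j : ℕ} (h1 : 1 ≤ j) (hj : j ≤ T.length) : IsLeaf T (suffix T j) :=
  ⟨suffix_ne_nil h1 hj, List.drop_suffix _ _⟩

theorem isLeaf_iff {u : List (Fin σ)} :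
    IsLeaf T u ↔ ∃ j, 1 ≤ j ∧ j ≤ T.length ∧ u = suffix T j := by
  constructor
  · rintro ⟨h1, h2⟩
    have hl := h2.length_le
    have : u.length ≠ 0 := by simpa using h1
    refine ⟨T.length - u.length + 1, by omega, by omega, ?_⟩
    rw [suffix, Nat.add_sub_cancel]
    exact List.suffix_iff_eq_drop.1 h2
  · rintro ⟨j, h1, h2, rfl⟩
    exact isLeaf_suffix h1 h2

/-- The end marker sits at offset `n - i` of suffix `i`, where `n` is the text length. A suffix with
the same character at this offset must start at the same position. -/
theorem suffix_prefix_inj (hT : IsText T) {i j : ℕ} (hi : 1 ≤ i) (hi' : i ≤ T.length) (hj : 1 ≤ j)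
    (h : suffix T i <+: suffix T j) : i = j := by
  obtain ⟨c, hc⟩ := hT.exists_end
  have h1 : (suffix T i)[T.length - i]? = some c := by
    rw [getElem?_suffix, hc]; omega
  have h2 : (suffix T j)[T.length - i]? = some c := by
    obtain ⟨t, ht⟩ := h
    rw [← ht, List.getElem?_append_left (by rw [length_suffix]; omega), h1]
  rw [getElem?_suffix, hc] at h2
  omega

theorem leaf_eq_of_prefix (hT : IsText T) {u v : List (Fin σ)} (hu : IsLeaf T u) (hv : IsLeaf T v)
    (h : u <+: v) : u = v := by
  obtain ⟨i, h1, h2, rfl⟩ := isLeaf_iff.1 hu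
  obtain ⟨j, h3, h4, rfl⟩ := isLeaf_iff.1 hv
  rw [suffix_prefix_inj hT h1 h2 h3 h]

theorem infix_iff_suffix {u : List (Fin σ)} (hu : u ≠ []) :
    u <:+: T ↔ ∃ j, 1 ≤ j ∧ j ≤ T.length ∧ u <+: suffix T j := by
  rw [List.infix_iff_prefix_suffix]
  constructor
  · rintro ⟨t, h1, h2⟩
    have : IsLeaf T t := ⟨fun h => hu (by simpa [h] using h1), h2⟩
    obtain ⟨j, h3, h4, rfl⟩ := isLeaf_iff.1 this
    exact ⟨j, h3, h4, h1⟩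
  · rintro ⟨j, -, -, h⟩
    exact ⟨_, h, List.drop_suffix _ _⟩

theorem IsNode.infix {u : List (Fin σ)} (h : IsNode T u) : u <:+: T := by
  rcases h with rfl | h | ⟨a, b, -, h, -⟩
  · simp
  · exact h.2.isInfix
  · exact ((List.prefix_append u [a]).isInfix).trans h

theorem mem_nodes {u : List (Fin σ)} : u ∈ nodes T ↔ IsNode T u := by
  unfold nodes nodeSet
  rw [Finset.mem_sort, Finset.mem_filter]
  refine ⟨fun h => h.2, fun h => ⟨?_, h⟩⟩
  have := h.infix
  rw [List.infix_iff_prefix_suffix] at this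
  simp only [List.mem_toFinset, List.mem_flatMap, List.mem_tails, List.mem_inits]
  obtain ⟨t, h1, h2⟩ := this
  exact ⟨t, h2, h1⟩

theorem mem_nodeSet {u : List (Fin σ)} : u ∈ nodeSet T ↔ IsNode T u := by
  rw [← mem_nodes, nodes, Finset.mem_sort]

theorem nodes_sorted (T : List (Fin σ)) : (nodes T).SortedLT := Finset.sortedLT_sort _

theorem mem_leaves {u : List (Fin σ)} : u ∈ leaves T ↔ IsLeaf T u := by
  simp only [leaves, List.mem_filter, mem_nodes, decide_eq_true_eq]
  exact ⟨fun h => h.2, fun h => ⟨Or.inr (Or.inl h), h⟩⟩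

theorem leaves_sorted (T : List (Fin σ)) : (leaves T).SortedLT := sortedLT_filter (nodes_sorted T) _

theorem mem_internals {u : List (Fin σ)} : u ∈ internals T ↔ IsNode T u ∧ ¬ IsLeaf T u := by
  simp [internals, mem_nodes]

theorem internals_sorted (T : List (Fin σ)) : (internals T).SortedLT :=
  sortedLT_filter (nodes_sorted T) _

theorem isNode_suffix {j : ℕ} (h1 : 1 ≤ j) (hj : j ≤ T.length) : IsNode T (suffix T j) :=
  Or.inr (Or.inl (isLeaf_suffix h1 hj))

theorem isNode_nil : IsNode T [] := Or.inl rfl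

theorem not_isLeaf_nil : ¬ IsLeaf T [] := fun h => h.1 rfl

theorem length_leaves (hT : IsText T) : (leaves T).length = T.length := by
  have : (leaves T).Perm ((List.range' 1 T.length).map (suffix T)) := by
    rw [List.perm_ext_iff_of_nodup (leaves_sorted T).nodup]
    · intro a
      rw [mem_leaves, isLeaf_iff, List.mem_map]
      simp only [List.mem_range'_1]
      constructor
      · rintro ⟨j, h1, h2, rfl⟩; exact ⟨j, ⟨h1, by omega⟩, rfl⟩
      · rintro ⟨j, ⟨h1, h2⟩, rfl⟩; exact ⟨j, h1, by omega, rfl⟩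
    · refine List.Nodup.map_on (fun x hx y hy h => ?_) List.nodup_range'
      rw [List.mem_range'_1] at hx hy
      exact suffix_prefix_inj hT hx.1 (by omega) hy.1 (h ▸ List.prefix_rfl)
  rw [this.length_eq]; simp

/-! #### Ancestors -/

theorem mem_ancestors {u a : List (Fin σ)} :
    a ∈ ancestors T u ↔ IsNode T a ∧ a <+: u ∧ a ≠ u := by
  simp [ancestors, mem_nodes]

theorem ancestors_sorted (T u : List (Fin σ)) : (ancestors T u).SortedLT :=
  sortedLT_filter (nodes_sorted T) _

/-- The ancestors of `u` are prefixes of `u` and so form a chain. The longest is the parent, and the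
others are exactly the ancestors of the parent; root paths therefore grow by one node at a time. -/
theorem exists_parent {u : List (Fin σ)} (hu : u ≠ []) :
    ∃ p, ancestors T u = ancestors T p ++ [p] ∧ IsNode T p ∧ p <+: u ∧ p ≠ u := by
  have hne : ancestors T u ≠ [] := by
    refine List.ne_nil_of_mem (a := []) ?_
    rw [mem_ancestors]
    exact ⟨isNode_nil, List.nil_prefix, fun h => hu h.symm⟩
  have e := (List.dropLast_append_getLast hne).symm
  set p := (ancestors T u).getLast hne with hp
  set A := (ancestors T u).dropLast with hA
  have hs := ancestors_sorted T u
  have hpm := mem_ancestors.1 (List.getLast_mem hne)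
  rw [← hp] at hpm
  refine ⟨p, ?_, hpm⟩
  rw [e]
  congr 1
  have hs' := hs.pairwise
  rw [e, List.pairwise_append] at hs'
  have hA' : A.SortedLT := hs'.1.sortedLT
  refine hA'.eq_of_mem_iff (ancestors_sorted T p) fun a => ?_
  have hmem : a ∈ ancestors T u ↔ a ∈ A ∨ a = p := by rw [e]; simp
  rw [mem_ancestors] at hmem ⊢
  constructor
  · intro ha
    have hlt : a < p := hs'.2.2 a ha p (by simp)
    obtain ⟨h1, h2, h3⟩ := hmem.2 (Or.inl ha)
    refine ⟨h1, ?_, hlt.ne⟩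
    rcases prefix_total h2 hpm.2.1 with h | h
    · exact h
    · exact absurd (le_of_prefix h) (not_le.2 hlt)
  · rintro ⟨h1, h2, h3⟩
    have := hmem.1 ⟨h1, h2.trans hpm.2.1, fun h => hpm.2.2 (prefix_antisymm hpm.2.1 (h ▸ h2))⟩
    tauto

theorem parent_eq {u p : List (Fin σ)} (h : ancestors T u = ancestors T p ++ [p]) :
    parent T u = some p := by simp [parent, h]

theorem ancestors_nil : ancestors T [] = [] := by
  simp [ancestors]

theorem climbPath_of_parent {u p : List (Fin σ)} (h : ancestors T u = ancestors T p ++ [p])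
    (hp : p ≠ []) : climbPath T u = p :: climbPath T p := by
  simp [climbPath, h, hp]

theorem climbPath_of_parent_nil {u : List (Fin σ)}
    (h : ancestors T u = ancestors T [] ++ [[]]) : climbPath T u = [] := by
  simp [climbPath, h, ancestors_nil]

theorem mem_climbPath {u a : List (Fin σ)} :
    a ∈ climbPath T u ↔ IsNode T a ∧ a <+: u ∧ a ≠ u ∧ a ≠ [] := by
  simp [climbPath, mem_ancestors, and_assoc]

theorem climbPath_sorted (T u : List (Fin σ)) : (climbPath T u).Pairwise (fun a b => b <+: a) := by
  unfold climbPath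
  refine List.Pairwise.filter _ (List.pairwise_reverse.2 ?_)
  refine (ancestors_sorted T u).pairwise.imp_of_mem fun {a b} ha hb hab => ?_
  rcases prefix_total (mem_ancestors.1 ha).2.1 (mem_ancestors.1 hb).2.1 with h | h
  · exact h
  · exact absurd (le_of_prefix h) (not_le.2 hab)

/-! #### Lowest common ancestors -/

/-- Distinct suffixes are not prefixes of each other, so they continue their longest common prefix
with different characters, which makes it a branching node. It is not a leaf, because a leaf that is
a prefix of a leaf is equal to it. -/
theorem isNode_lcp (hT : IsText T) {i j : ℕ} (hi : 1 ≤ i) (hi' : i ≤ T.length) (hj : 1 ≤ j)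
    (hj' : j ≤ T.length) (hij : i ≠ j) :
    IsNode T (lcp (suffix T i) (suffix T j)) ∧ ¬ IsLeaf T (lcp (suffix T i) (suffix T j)) := by
  obtain ⟨a, b, x, y, hab, h1, h2⟩ := lcp_branch (u := suffix T i) (v := suffix T j)
    (fun h => hij (suffix_prefix_inj hT hi hi' hj h))
    (fun h => hij (suffix_prefix_inj hT hj hj' hi h).symm)
  refine ⟨Or.inr (Or.inr ⟨a, b, hab, ?_, ?_⟩), fun h => ?_⟩
  · rw [infix_iff_suffix (by simp)]
    exact ⟨i, hi, hi', x, by simpa using h1.symm⟩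
  · rw [infix_iff_suffix (by simp)]
    exact ⟨j, hj, hj', y, by simpa using h2.symm⟩
  · have := leaf_eq_of_prefix hT h (isLeaf_suffix hi hi') (lcp_prefix _ _).1
    have e1 := congrArg List.length this
    have e2 := congrArg List.length h1
    simp only [List.length_append, List.length_cons] at e2
    omega

/-- Every common ancestor is a prefix of the longest common prefix, which is itself a node. Prefixes
come first in the lexicographic order, so it is the last common ancestor in the list. -/
theorem lca_eq_lcp (hT : IsText T) {i j : ℕ} (hi : 1 ≤ i) (hi' : i ≤ T.length) (hj : 1 ≤ j)
    (hj' : j ≤ T.length) (hij : i ≠ j) :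
    lca T (suffix T i) (suffix T j) = lcp (suffix T i) (suffix T j) := by
  set c := lcp (suffix T i) (suffix T j) with hc
  set l := (nodes T).filter (fun a => a <+: suffix T i ∧ a <+: suffix T j) with hl
  have hcl : c ∈ l := by
    rw [hl, List.mem_filter]
    exact ⟨mem_nodes.2 (isNode_lcp hT hi hi' hj hj' hij).1, decide_eq_true (lcp_prefix _ _)⟩
  have hne : l ≠ [] := List.ne_nil_of_mem hcl
  have hlast : l.getLast hne = c := by
    have e := List.dropLast_append_getLast hne
    have hs := (sortedLT_filter (nodes_sorted T)
      (fun a => a <+: suffix T i ∧ a <+: suffix T j)).pairwise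
    rw [← hl, ← e, List.pairwise_append] at hs
    have hm := List.getLast_mem hne
    have hle : l.getLast hne <+: c := by
      have hm' := (List.mem_filter.1 (show _ ∈ (nodes T).filter _ from hm)).2
      simp only [decide_eq_true_eq] at hm'
      exact prefix_lcp hm'.1 hm'.2
    rw [← e] at hcl
    rcases List.mem_append.1 hcl with h | h
    · exact absurd (le_of_prefix hle) (not_le.2 (hs.2.2 c h _ (by simp)))
    · exact (List.mem_singleton.1 h).symm
  unfold lca
  rw [← hl, List.getLastD_eq_getLast?, List.getLast?_eq_getLast_of_ne_nil hne, hlast]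
  rfl

/-! #### The child of the root above a leaf -/

/-- On the root path the empty string is followed by the shortest non-empty prefix that is a node.
This child of the root stands in for the first character, which cannot be read from the text. -/
theorem exists_top {u : List (Fin σ)} (hu : IsNode T u) (hne : u ≠ []) :
    ∃ x, levelAnc T u 1 = some x ∧ IsNode T x ∧ x ≠ [] ∧ x <+: u ∧ ancestors T x = [[]] ∧
      ∀ y, IsNode T y → y ≠ [] → y <+: u → x <+: y := by
  set l := ancestors T u ++ [u] with hl
  have hm : ∀ a, a ∈ l ↔ IsNode T a ∧ a <+: u := by
    intro a
    rw [hl, List.mem_append, mem_ancestors, List.mem_singleton]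
    constructor
    · rintro (h | rfl)
      · exact ⟨h.1, h.2.1⟩
      · exact ⟨hu, List.prefix_rfl⟩
    · intro h
      by_cases h' : a = u
      · exact Or.inr h'
      · exact Or.inl ⟨h.1, h.2, h'⟩
  have hs : l.Pairwise (· < ·) := by
    rw [hl, List.pairwise_append]
    refine ⟨(ancestors_sorted T u).pairwise, by simp, fun a ha b hb => ?_⟩
    rw [List.mem_singleton.1 hb]
    exact lt_of_prefix (mem_ancestors.1 ha).2.1 (mem_ancestors.1 ha).2.2
  have h0 : [] ∈ l := (hm _).2 ⟨isNode_nil, List.nil_prefix⟩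
  have h1 : u ∈ l := (hm _).2 ⟨hu, List.prefix_rfl⟩
  obtain ⟨a, b, r, hr⟩ : ∃ a b r, l = a :: b :: r := by
    match l, h0, h1 with
    | [], h0, _ => simp at h0
    | [a], h0, h1 =>
      rw [List.mem_singleton] at h0 h1
      exact absurd (h1.trans h0.symm) hne
    | a :: b :: r, _, _ => exact ⟨a, b, r, rfl⟩
  rw [hr] at hs hm h0
  rw [List.pairwise_cons] at hs
  have ha : a = [] := by
    rcases List.mem_cons.1 h0 with h | h
    · exact h.symm
    · exact absurd (hs.1 _ h) (not_lt.2 (le_of_prefix List.nil_prefix))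
  subst ha
  obtain ⟨hb1, hb2⟩ := (hm b).1 (by simp)
  have hb0 : b ≠ [] := (hs.1 b (by simp)).ne'
  have hmin : ∀ y, IsNode T y → y ≠ [] → y <+: u → b <+: y := by
    intro y hy hy0 hyu
    have : y ∈ b :: r := by
      have := (hm y).2 ⟨hy, hyu⟩
      rcases List.mem_cons.1 this with h | h
      · exact absurd h hy0
      · exact h
    rcases List.mem_cons.1 this with rfl | h
    · exact List.prefix_rfl
    · have hlt := (List.pairwise_cons.1 hs.2).1 y h
      rcases prefix_total hb2 hyu with h | h
      · exact h
      · exact absurd (le_of_prefix h) (not_le.2 hlt)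
  refine ⟨b, ?_, hb1, hb0, hb2, ?_, hmin⟩
  · unfold levelAnc; rw [← hl, hr]; rfl
  · refine (ancestors_sorted T b).eq_of_mem_iff (List.pairwise_singleton _ _).sortedLT fun y => ?_
    rw [mem_ancestors, List.mem_singleton]
    constructor
    · rintro ⟨h1, h2, h3⟩
      by_contra h0
      exact h3 (prefix_antisymm h2 (hmin y h1 h0 (h2.trans hb2)))
    · rintro rfl; exact ⟨isNode_nil, List.nil_prefix, hb0.symm⟩

theorem head?_eq_of_prefix {x u : List (Fin σ)} (h : x <+: u) (hx : x ≠ []) :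
    u.head? = x.head? := by
  obtain ⟨t, rfl⟩ := h
  cases x with
  | nil => exact absurd rfl hx
  | cons a x => simp

/-- If two different suffixes share their first character, then their longest common prefix is a
non-empty node, and both children of the root are prefixes of it. By minimality each is a prefix of
the other. -/
theorem levelAnc_one_eq_iff (hT : IsText T) {i j : ℕ} (hi : 1 ≤ i) (hi' : i ≤ T.length)
    (hj : 1 ≤ j) (hj' : j ≤ T.length) :
    levelAnc T (suffix T i) 1 = levelAnc T (suffix T j) 1 ↔
      (suffix T i).head? = (suffix T j).head? := by
  obtain ⟨x, ex, hx1, hx2, hx3, -, hx4⟩ := exists_top (isNode_suffix hi hi') (suffix_ne_nil hi hi')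
  obtain ⟨y, ey, hy1, hy2, hy3, -, hy4⟩ := exists_top (isNode_suffix hj hj') (suffix_ne_nil hj hj')
  rw [ex, ey, Option.some_inj]
  constructor
  · rintro rfl
    rw [head?_eq_of_prefix hx3 hx2, head?_eq_of_prefix hy3 hx2]
  · intro h
    by_cases hij : i = j
    · subst hij; rw [ex] at ey; simpa using ey
    have hl := (isNode_lcp hT hi hi' hj hj' hij).1
    have hl0 : lcp (suffix T i) (suffix T j) ≠ [] := by
      obtain ⟨a, t, ha⟩ := List.exists_cons_of_ne_nil (suffix_ne_nil hi hi')
      rw [ha] at h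
      obtain ⟨s, hs⟩ := List.head?_eq_some_iff.1 h.symm
      simp [ha, hs, lcp]
    have h1 := hx4 _ hl hl0 (lcp_prefix _ _).1
    have h2 := hy4 _ hl hl0 (lcp_prefix _ _).2
    exact prefix_antisymm (hx4 y hy1 hy2 (h2.trans (lcp_prefix _ _).1))
      (hy4 x hx1 hx2 (h1.trans (lcp_prefix _ _).2))

theorem mem_children_nil {x : List (Fin σ)} :
    x ∈ children T [] ↔ IsNode T x ∧ x ≠ [] ∧ ∀ y, IsNode T y → y ≠ [] → y <+: x → y = x := by
  simp only [children, List.mem_filter, mem_nodes, decide_eq_true_eq]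
  refine and_congr_right fun hx => ?_
  constructor
  · intro h
    have h0 : x ≠ [] := by rintro rfl; simp [parent, ancestors_nil] at h
    refine ⟨h0, fun y hy hy0 hyx => ?_⟩
    obtain ⟨p, hp, -⟩ := exists_parent (T := T) h0
    rw [parent_eq hp, Option.some_inj] at h
    subst h
    by_contra hne
    have : y ∈ ancestors T x := mem_ancestors.2 ⟨hy, hyx, hne⟩
    rw [hp, ancestors_nil] at this
    simp at this
    exact hy0 this
  · rintro ⟨h0, h⟩
    obtain ⟨p, hp, hp1, hp2, hp3⟩ := exists_parent (T := T) h0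
    rw [parent_eq hp, Option.some_inj]
    by_contra hne
    exact hp3 (h p hp1 hne hp2)

theorem headChar_eq {u v : List (Fin σ)} (hu : u ≠ []) (hv : v ≠ []) :
    headChar u = headChar v ↔ u.head? = v.head? := by
  obtain ⟨a, u, rfl⟩ := List.exists_cons_of_ne_nil hu
  obtain ⟨b, v, rfl⟩ := List.exists_cons_of_ne_nil hv
  simp [headChar, Fin.ext_iff]

/-- Two children of the root with the same first character would have a node between them and the
root. Hence their first characters increase strictly, and since the alphabet is effective every
character occurs: the child ranks are the characters themselves. -/
theorem children_nil_map (hT : IsText T) : (children T []).map headChar = List.range σ := by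
  refine List.SortedLT.eq_of_mem_iff ?_ (List.sortedLT_range σ) ?_
  · refine (List.pairwise_map.2 ?_).sortedLT
    refine (sortedLT_filter (nodes_sorted T) _).pairwise.imp_of_mem fun {u v} hu hv huv => ?_
    change u ∈ children T [] at hu
    change v ∈ children T [] at hv
    rw [mem_children_nil] at hu hv
    have hne : headChar u ≠ headChar v := by
      rw [Ne, headChar_eq hu.2.1 hv.2.1]
      intro h
      have huv' : ¬ u <+: v := fun h' => huv.ne (hv.2.2 u hu.1 hu.2.1 h')
      have hvu' : ¬ v <+: u := fun h' => huv.ne' (hu.2.2 v hv.1 hv.2.1 h')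
      obtain ⟨a, b, x, y, hab, h1, h2⟩ := lcp_branch huv' hvu'
      have hnode : IsNode T (lcp u v) := by
        refine Or.inr (Or.inr ⟨a, b, hab, ?_, ?_⟩)
        · refine List.IsInfix.trans ?_ hu.1.infix
          exact (show lcp u v ++ [a] <+: u from ⟨x, by simpa using h1.symm⟩).isInfix
        · refine List.IsInfix.trans ?_ hv.1.infix
          exact (show lcp u v ++ [b] <+: v from ⟨y, by simpa using h2.symm⟩).isInfix
      have hl0 : lcp u v ≠ [] := by
        obtain ⟨a, t, rfl⟩ := List.exists_cons_of_ne_nil hu.2.1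
        obtain ⟨s, rfl⟩ := List.head?_eq_some_iff.1 h.symm
        simp [lcp]
      have := hu.2.2 _ hnode hl0 (lcp_prefix u v).1
      rw [this] at h1
      simp at h1
    refine lt_of_le_of_ne (not_lt.1 fun hlt => ?_) hne
    obtain ⟨a, u, rfl⟩ := List.exists_cons_of_ne_nil hu.2.1
    obtain ⟨b, v, rfl⟩ := List.exists_cons_of_ne_nil hv.2.1
    exact huv.not_gt (append_cons_lt [] v u (a := b) (b := a) hlt)
  · intro k
    rw [List.mem_map, List.mem_range]
    constructor
    · rintro ⟨u, hu, rfl⟩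
      rw [mem_children_nil] at hu
      obtain ⟨a, u, rfl⟩ := List.exists_cons_of_ne_nil hu.2.1
      exact a.2
    · intro hk
      obtain ⟨m, hm⟩ := List.getElem?_of_mem (hT.2 ⟨k, hk⟩)
      have hmn : m < T.length := by
        by_contra h; rw [List.getElem?_eq_none (by omega)] at hm; simp at hm
      have h1 : 1 ≤ m + 1 := by omega
      obtain ⟨x, -, hx1, hx2, hx3, -, hx4⟩ :=
        exists_top (isNode_suffix h1 hmn) (suffix_ne_nil h1 hmn)
      refine ⟨x, mem_children_nil.2 ⟨hx1, hx2, fun y hy hy0 hyx =>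
        prefix_antisymm hyx (hx4 y hy hy0 (hyx.trans hx3))⟩, ?_⟩
      have h2 : (suffix T (m + 1)).head? = some ⟨k, hk⟩ := by
        rw [List.head?_eq_getElem?, getElem?_suffix]; simpa using hm
      rw [head?_eq_of_prefix hx3 hx2] at h2
      obtain ⟨s, rfl⟩ := List.head?_eq_some_iff.1 h2
      rfl

theorem idxOf_children_nil (hT : IsText T) {x : List (Fin σ)} (hx : x ∈ children T []) :
    (children T []).idxOf x = headChar x := by
  have h := List.idxOf_lt_length_iff.2 hx
  have e := children_nil_map hT
  have : ((children T []).map headChar)[(children T []).idxOf x]? = some (headChar x) := by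
    rw [List.getElem?_map, List.getElem?_eq_getElem h, List.getElem_idxOf]; rfl
  rw [e, List.getElem?_range] at this
  · simpa using this
  · have := congrArg List.length e; simp at this; omega

/-! #### The leaves below an inner node -/

/-- The branching node has continuations `a < b`. Its leftmost leaf continues with a character at
most `a` and its rightmost leaf with one at least `b`. These two suffixes thus agree along `u` and
differ right after it, which is how the string depth is detected; the last two bounds keep the
lookups inside the text. -/
theorem leavesBelow_ends {u : List (Fin σ)} (hu : IsNode T u) (hl : ¬ IsLeaf T u)
    (h0 : u ≠ []) : ∃ i j, 1 ≤ i ∧ i ≤ T.length ∧ 1 ≤ j ∧ j ≤ T.length ∧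
      (leavesBelow T u).head? = some (suffix T i) ∧ (leavesBelow T u).getLast? = some (suffix T j) ∧
      u <+: suffix T i ∧ u <+: suffix T j ∧
      (suffix T (i + u.length)).head? ≠ (suffix T (j + u.length)).head? ∧
      i + u.length ≤ T.length ∧ j + u.length ≤ T.length := by
  obtain ⟨a, b, hab, ha, hb⟩ : ∃ a b : Fin σ, a < b ∧ (u ++ [a]) <:+: T ∧ (u ++ [b]) <:+: T := by
    rcases hu with h | h | ⟨a, b, hab, ha, hb⟩
    · exact absurd h h0
    · exact absurd h hl
    · rcases lt_or_gt_of_ne hab with h | h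
      · exact ⟨a, b, h, ha, hb⟩
      · exact ⟨b, a, h, hb, ha⟩
  have hmem : ∀ x, x ∈ leavesBelow T u ↔ IsLeaf T x ∧ u <+: x := by
    intro x; simp [leavesBelow, mem_leaves]
  have hs : (leavesBelow T u).Pairwise (· < ·) := (sortedLT_filter (leaves_sorted T) _).pairwise
  obtain ⟨i₁, hi1, hi2, x₁, hx₁⟩ := (infix_iff_suffix (by simp)).1 ha
  obtain ⟨j₁, hj1, hj2, y₁, hy₁⟩ := (infix_iff_suffix (by simp)).1 hb
  rw [List.append_assoc] at hx₁ hy₁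
  have m1 : suffix T i₁ ∈ leavesBelow T u := (hmem _).2 ⟨isLeaf_suffix hi1 hi2, _, hx₁⟩
  have m2 : suffix T j₁ ∈ leavesBelow T u := (hmem _).2 ⟨isLeaf_suffix hj1 hj2, _, hy₁⟩
  have hne : leavesBelow T u ≠ [] := List.ne_nil_of_mem m1
  -- every leaf below continues with some character
  have cont : ∀ x, IsLeaf T x → u <+: x → ∃ c t, x = u ++ c :: t := by
    rintro x hx ⟨t, rfl⟩
    cases t with
    | nil => simp at hx; exact absurd hx hl
    | cons c t => exact ⟨c, t, rfl⟩
  have hh := List.head_mem hne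
  have hg := List.getLast_mem hne
  have le1 : (leavesBelow T u).head hne ≤ suffix T i₁ := by
    obtain ⟨c, t, e⟩ := List.exists_cons_of_ne_nil hne
    simp only [e] at hs m1 ⊢
    rcases List.mem_cons.1 m1 with h | h
    · rw [h]; rfl
    · exact ((List.pairwise_cons.1 hs).1 _ h).le
  have le2 : suffix T j₁ ≤ (leavesBelow T u).getLast hne := by
    have e := List.dropLast_append_getLast hne
    have hs' := hs
    rw [← e, List.pairwise_append] at hs'
    rw [← e] at m2
    rcases List.mem_append.1 m2 with h | h
    · exact (hs'.2.2 _ h _ (by simp)).le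
    · exact (List.mem_singleton.1 h).le
  obtain ⟨hx1, hx2⟩ := (hmem _).1 hh
  obtain ⟨hy1, hy2⟩ := (hmem _).1 hg
  obtain ⟨c, s, hc⟩ := cont _ hx1 hx2
  obtain ⟨d, t, hd⟩ := cont _ hy1 hy2
  obtain ⟨i, h1, h2, hi⟩ := isLeaf_iff.1 hx1
  obtain ⟨j, h3, h4, hj⟩ := isLeaf_iff.1 hy1
  have hca : c ≤ a := by
    by_contra h
    rw [hc, ← hx₁] at le1
    exact absurd le1 (not_le.2 (append_cons_lt u _ _ (not_le.1 h)))
  have hbd : b ≤ d := by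
    by_contra h
    rw [hd, ← hy₁] at le2
    exact absurd le2 (not_le.2 (append_cons_lt u _ _ (not_le.1 h)))
  rw [hi] at hc hx2
  rw [hj] at hd hy2
  refine ⟨i, j, h1, h2, h3, h4, ?_, ?_, hx2, hy2, ?_, ?_, ?_⟩
  · rw [List.head?_eq_some_head hne, hi]
  · rw [List.getLast?_eq_some_getLast hne, hj]
  · rw [suffix_add h1, suffix_add h3, hc, hd]
    simp only [List.drop_left, List.head?_cons, ne_eq, Option.some_inj]
    exact ne_of_lt (lt_of_le_of_lt hca (lt_of_lt_of_le hab hbd))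
  · have := congrArg List.length hc
    rw [length_suffix] at this
    simp at this; omega
  · have := congrArg List.length hd
    rw [length_suffix] at this
    simp at this; omega

/-! #### The number of nodes -/

/-- `u` is the longest prefix of the suffix `j` that occurs at an earlier position. -/
def IsLongest (T : List (Fin σ)) (j : ℕ) (u : List (Fin σ)) : Prop :=
  u <+: suffix T j ∧ (∃ i, 1 ≤ i ∧ i < j ∧ u <+: suffix T i) ∧
    ∀ i x, 1 ≤ i → i < j → x <+: suffix T i → x <+: suffix T j → x <+: u

theorem IsLongest.unique {j : ℕ} {u v : List (Fin σ)} (hu : IsLongest T j u)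
    (hv : IsLongest T j v) : u = v := by
  obtain ⟨i, hi, hij, h⟩ := hu.2.1
  obtain ⟨i', hi', hij', h'⟩ := hv.2.1
  exact prefix_antisymm (hv.2.2 i u hi hij h hu.1) (hu.2.2 i' v hi' hij' h' hv.1)

/-- Take the first position `j` at which a second continuation of `u` shows up. An earlier suffix
shares `u` with suffix `j`, but none continues `u` in the same way, so nothing longer than `u` is
repeated. This charges `u` to `j`. -/
theorem exists_isLongest {u : List (Fin σ)} {a b : Fin σ} (hab : a ≠ b)
    (ha : (u ++ [a]) <:+: T) (hb : (u ++ [b]) <:+: T) :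
    ∃ j, 1 ≤ j ∧ j ≤ T.length ∧ IsLongest T j u := by
  classical
  have h1 : ∃ i, 1 ≤ i ∧ i ≤ T.length ∧ ∃ c, u ++ [c] <+: suffix T i := by
    obtain ⟨i, h1, h2, h3⟩ := (infix_iff_suffix (by simp)).1 ha
    exact ⟨i, h1, h2, a, h3⟩
  -- Here `i` is the first position at which `u` occurs with a continuation, and `c` is that
  -- continuation; `j` below is the first position with another one.
  obtain ⟨hi1, hi2, c, hc⟩ := Nat.find_spec h1
  have hmin := fun m (hm : m < Nat.find h1) => Nat.find_min h1 hm
  generalize Nat.find h1 = i at hi1 hi2 hc hmin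
  have h2 : ∃ j, 1 ≤ j ∧ j ≤ T.length ∧ ∃ d, d ≠ c ∧ u ++ [d] <+: suffix T j := by
    by_cases hac : a = c
    · obtain ⟨i, h1, h2, h3⟩ := (infix_iff_suffix (by simp)).1 hb
      exact ⟨i, h1, h2, b, fun h => hab (hac.trans h.symm), h3⟩
    · obtain ⟨i, h1, h2, h3⟩ := (infix_iff_suffix (by simp)).1 ha
      exact ⟨i, h1, h2, a, hac, h3⟩
  obtain ⟨hj1, hj2, d, hdc, hd⟩ := Nat.find_spec h2
  have hmin' := fun m (hm : m < Nat.find h2) => Nat.find_min h2 hm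
  generalize Nat.find h2 = j at hj1 hj2 hd hmin'
  have next : ∀ {y : List (Fin σ)} {e f : Fin σ}, u ++ [e] <+: y → u ++ [f] <+: y → e = f := by
    rintro y e f ⟨s, rfl⟩ ⟨t, ht⟩
    simp at ht
    exact ht.1.symm
  have hij : i < j := by
    refine lt_of_le_of_ne (not_lt.1 fun h => hmin j h ⟨hj1, hj2, d, hd⟩) ?_
    rintro rfl
    exact hdc (next hd hc)
  refine ⟨j, hj1, hj2, (List.prefix_append _ _).trans hd,
    ⟨i, hi1, hij, (List.prefix_append _ _).trans hc⟩, fun m x hm hmj hxm hxj => ?_⟩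
  rcases prefix_total hxj ((List.prefix_append _ _).trans hd) with h | h
  · exact h
  · obtain ⟨t, rfl⟩ := h
    cases t with
    | nil => simp
    | cons e t =>
      exfalso
      have he : u ++ [e] <+: u ++ e :: t := ⟨t, by simp⟩
      have hed : e = d := next (he.trans hxj) hd
      exact hmin' m hmj ⟨hm, by omega, e, hed ▸ hdc, he.trans hxm⟩

/-- A position has only one longest repeated prefix, so the charging of `exists_isLongest` is
injective. The root, which need not branch, is charged to position `1`; no other node is charged
there, because nothing starts before it. -/
theorem length_internals_le (hT : IsText T) : (internals T).length ≤ T.length := by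
  have := hT.pos
  rw [← List.toFinset_card_of_nodup (internals_sorted T).nodup,
    show T.length = (Finset.Icc 1 T.length).card by simp]
  refine Finset.card_le_card_of_forall_subsingleton
    (fun u j => IsLongest T j u ∨ (j = 1 ∧ u = [])) (fun u hu => ?_) (fun j _ => ?_)
  · rw [List.mem_toFinset, mem_internals] at hu
    rcases hu.1 with rfl | h | ⟨a, b, hab, ha, hb⟩
    · exact ⟨1, by simpa using this, Or.inr ⟨rfl, rfl⟩⟩
    · exact absurd h hu.2
    · obtain ⟨j, h1, h2, h3⟩ := exists_isLongest hab ha hb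
      exact ⟨j, by simp [h1, h2], Or.inl h3⟩
  · rintro u ⟨-, hu⟩ v ⟨-, hv⟩
    have h1 : ∀ x, ¬ IsLongest T 1 x := by
      rintro x ⟨-, ⟨i, hi, hi', -⟩, -⟩; omega
    rcases hu with hu | ⟨rfl, rfl⟩
    · rcases hv with hv | ⟨rfl, rfl⟩
      · exact hu.unique hv
      · exact absurd hu (h1 _)
    · rcases hv with hv | ⟨-, rfl⟩
      · exact absurd hv (h1 _)
      · rfl

theorem length_nodes_le (hT : IsText T) : (nodes T).length ≤ 2 * T.length := by
  have h1 := length_internals_le hT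
  have h2 := length_leaves hT
  have := List.length_eq_length_filter_add (l := nodes T) (fun u => decide (IsLeaf T u))
  have e : (nodes T).filter (fun u => !decide (IsLeaf T u)) = internals T := by
    simp [internals]
  rw [e] at this
  change _ = (leaves T).length + _ at this
  omega

end Tree

end LZ

namespace LZ

/-! ### What the queries return -/

section Answers

variable {σ : ℕ} {T : List (Fin σ)}

theorem onNode_preorder {u : List (Fin σ)} (hu : IsNode T u) (f : List (Fin σ) → ℕ) :
    onNode T (preorder T u) f = f u := by
  simp [onNode, preorder, nth_posOf (mem_nodes.2 hu)]

theorem posOf_nil {l : List (List (Fin σ))} (hl : l.SortedLT) (h : [] ∈ l) : posOf l [] = 1 := by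
  rw [posOf_of_mem h]
  cases l with
  | nil => simp at h
  | cons a l =>
    rcases List.mem_cons.1 h with h | h
    · simp [← h]
    · exact absurd ((List.pairwise_cons.1 hl.pairwise).1 _ h)
        (not_lt.2 (le_of_prefix List.nil_prefix))

theorem preorder_nil : preorder T [] = 1 := posOf_nil (nodes_sorted T) (mem_nodes.2 isNode_nil)

theorem preorder_pos {u : List (Fin σ)} (hu : IsNode T u) : 1 ≤ preorder T u :=
  posOf_pos (mem_nodes.2 hu)

theorem preorder_inj {u v : List (Fin σ)} (hu : IsNode T u) (h : preorder T u = preorder T v) :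
    u = v := posOf_inj (mem_nodes.2 hu) h

theorem preorder_lt_two {u : List (Fin σ)} (hu : IsNode T u) : preorder T u < 2 ↔ u = [] := by
  constructor
  · intro h
    have := preorder_pos hu
    exact preorder_inj hu (by rw [preorder_nil]; omega)
  · rintro rfl; rw [preorder_nil]; omega

/-- The rank of an inner node. -/
def rk (T u : List (Fin σ)) : ℕ := posOf (internals T) u

theorem rk_nil : rk T [] = 1 :=
  posOf_nil (internals_sorted T) (mem_internals.2 ⟨isNode_nil, not_isLeaf_nil⟩)

theorem rk_le (hT : IsText T) (u : List (Fin σ)) : rk T u ≤ T.length :=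
  (posOf_le _ _).trans (length_internals_le hT)

theorem rk_inj {u v : List (Fin σ)} (hu : u ∈ internals T) (h : rk T u = rk T v) : u = v :=
  posOf_inj hu h

theorem isa_le (hT : IsText T) (j : ℕ) : isa T j ≤ T.length :=
  (posOf_le _ _).trans (length_leaves hT).le

theorem nth_isa {j : ℕ} (h1 : 1 ≤ j) (hj : j ≤ T.length) :
    nth (leaves T) (isa T j) = some (suffix T j) :=
  nth_posOf (mem_leaves.2 (isLeaf_suffix h1 hj))

theorem psi_isa {j : ℕ} (h1 : 1 ≤ j) (hj : j < T.length) : psi T (isa T j) = isa T (j + 1) := by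
  have : sa T (isa T j) = j := by
    simp only [sa, nth_isa h1 hj.le, length_suffix]; omega
  simp only [psi, this]
  rw [if_neg (by omega), if_neg (by omega)]

theorem preorderOpt_le (hT : IsText T) (u : Option (List (Fin σ))) :
    preorderOpt T u ≤ 2 * T.length := by
  cases u with
  | none => exact Nat.zero_le _
  | some u => exact (posOf_le _ _).trans (length_nodes_le hT)

theorem onNode_le {v B : ℕ} {f : List (Fin σ) → ℕ} (h : ∀ u, f u ≤ B) : onNode T v f ≤ B := by
  unfold onNode
  split
  · exact Nat.zero_le _
  · exact h _

/-- All answers are numbers or ranks of nodes, depths or single bits, and there are at most `2 *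
T.length` nodes. Hence no answer is truncated to the word size. -/
theorem answer_le (hT : IsText T) (q : Query) (a b : ℕ) : answer T q a b ≤ 2 * T.length := by
  have hn := hT.pos
  have hN := length_nodes_le hT
  have hO := preorderOpt_le hT
  have hfl : ∀ (p : List (Fin σ) → Bool), ((nodes T).filter p).length ≤ 2 * T.length :=
    fun p => (List.length_filter_le _ _).trans hN
  cases q <;> simp only [answer]
  case psi =>
    unfold psi
    have h1 := isa_le hT 1
    have h2 := isa_le hT (sa T a + 1)
    split_ifs <;> omega
  case bp => split_ifs <;> omega
  case smallestLeaf => exact hO (some _)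
  case parent => exact onNode_le fun u => hO _
  case depth => exact onNode_le fun u => hfl _
  case levelAnc => exact onNode_le fun u => hO _
  case leftmostLeaf => exact onNode_le fun u => hO _
  case rightmostLeaf => exact onNode_le fun u => hO _
  case leafSelect => exact hO _
  case leafRank => exact onNode_le fun u => (posOf_le _ _).trans (hfl _)
  case internalSelect => exact hO _
  case internalRank => exact onNode_le fun u => (posOf_le _ _).trans (hfl _)
  case isLeaf => exact onNode_le fun u => by split_ifs <;> omega
  case childRank =>
    refine onNode_le fun u => ?_
    split
    · exact Nat.zero_le _
    · exact List.idxOf_le_length.trans (hfl _)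
  case child => exact onNode_le fun u => hO _

theorem answer_parent {u p : List (Fin σ)} (hu : IsNode T u)
    (h : ancestors T u = ancestors T p ++ [p]) (b : ℕ) :
    answer T .parent (preorder T u) b = preorder T p := by
  simp only [answer, onNode_preorder hu, parent_eq h]; rfl

theorem answer_internalRank {u : List (Fin σ)} (hu : IsNode T u) (b : ℕ) :
    answer T .internalRank (preorder T u) b = rk T u := by
  simp only [answer, onNode_preorder hu]; rfl

theorem answer_leafRank {j : ℕ} (h1 : 1 ≤ j) (hj : j ≤ T.length) (b : ℕ) :
    answer T .leafRank (preorder T (suffix T j)) b = isa T j := by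
  simp only [answer, onNode_preorder (isNode_suffix h1 hj)]; rfl

theorem answer_leafSelect {j : ℕ} (h1 : 1 ≤ j) (hj : j ≤ T.length) (b : ℕ) :
    answer T .leafSelect (isa T j) b = preorder T (suffix T j) := by
  simp only [answer, nth_isa h1 hj]; rfl

theorem answer_psi {j : ℕ} (h1 : 1 ≤ j) (hj : j < T.length) (b : ℕ) :
    answer T .psi (isa T j) b = isa T (j + 1) := psi_isa h1 hj

theorem posOf_getElem {α : Type*} [DecidableEq α] {l : List α} (h : l.Nodup) {i : ℕ}
    (hi : i < l.length) : posOf l l[i] = i + 1 := by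
  rw [posOf_of_mem (List.getElem_mem hi), h.idxOf_getElem]

/-- The machine is not told the text length; it is the leaf rank of the rightmost leaf below the
root, whose pre-order number is `1`. -/
theorem answer_length (hT : IsText T) (b b' : ℕ) :
    answer T .leafRank (answer T .rightmostLeaf 1 b) b' = T.length := by
  have e1 : answer T .rightmostLeaf 1 b = preorderOpt T (leaves T).getLast? := by
    rw [← preorder_nil (T := T)]
    simp only [answer, onNode_preorder isNode_nil, leavesBelow, List.nil_prefix, decide_true,
      List.filter_true]
  have hl := length_leaves hT
  have hne : leaves T ≠ [] := by
    intro h; rw [h] at hl; have := hT.pos; simp at hl; omega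
  have hn : IsNode T ((leaves T).getLast hne) :=
    Or.inr (Or.inl (mem_leaves.1 (List.getLast_mem hne)))
  rw [e1, List.getLast?_eq_some_getLast hne]
  change answer T .leafRank (preorder T _) b' = _
  simp only [answer, onNode_preorder hn]
  rw [List.getLast_eq_getElem, posOf_getElem (leaves_sorted T).nodup]
  have := hT.pos
  omega

theorem answer_top {j : ℕ} (h1 : 1 ≤ j) (hj : j ≤ T.length) :
    answer T .levelAnc (preorder T (suffix T j)) 1 =
      preorderOpt T (levelAnc T (suffix T j) 1) := by
  simp only [answer, onNode_preorder (isNode_suffix h1 hj)]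

/-- Comparing the pre-order numbers of two children of the root replaces comparing two characters of
the text. -/
theorem answer_top_eq_iff (hT : IsText T) {i j : ℕ} (hi : 1 ≤ i) (hi' : i ≤ T.length)
    (hj : 1 ≤ j) (hj' : j ≤ T.length) :
    answer T .levelAnc (preorder T (suffix T i)) 1 =
      answer T .levelAnc (preorder T (suffix T j)) 1 ↔
      (suffix T i).head? = (suffix T j).head? := by
  rw [← levelAnc_one_eq_iff hT hi hi' hj hj', answer_top hi hi', answer_top hj hj']
  obtain ⟨x, ex, hx, -⟩ := exists_top (isNode_suffix hi hi') (suffix_ne_nil hi hi')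
  obtain ⟨y, ey, -⟩ := exists_top (isNode_suffix hj hj') (suffix_ne_nil hj hj')
  rw [ex, ey, Option.some_inj]
  exact ⟨fun h => preorder_inj hx h, fun h => by rw [h]⟩

/-- The children of the root correspond, in order, to the characters `0, …, σ - 1`, so a child rank
yields the character of a fresh factor. -/
theorem answer_headChar (hT : IsText T) {j : ℕ} (h1 : 1 ≤ j) (hj : j ≤ T.length) (b : ℕ) :
    answer T .childRank (answer T .levelAnc (preorder T (suffix T j)) 1) b =
      headChar (suffix T j) := by
  obtain ⟨x, ex, hx, hx0, hxu, hxa, -⟩ := exists_top (isNode_suffix h1 hj) (suffix_ne_nil h1 hj)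
  rw [answer_top h1 hj, ex]
  change answer T .childRank (preorder T x) b = _
  have hp : parent T x = some [] := by simp [parent, hxa]
  have hc : x ∈ children T [] := by
    simp [children, mem_nodes, hx, hp]
  simp only [answer, onNode_preorder hx, hp, idxOf_children_nil hT hc]
  rw [headChar_eq hx0 (suffix_ne_nil h1 hj), head?_eq_of_prefix hxu hx0]

theorem answer_leaf_ends {u x y : List (Fin σ)} (hu : IsNode T u)
    (h : (leavesBelow T u).head? = some x) (h' : (leavesBelow T u).getLast? = some y) (b : ℕ) :
    answer T .leftmostLeaf (preorder T u) b = preorder T x ∧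
      answer T .rightmostLeaf (preorder T u) b = preorder T y := by
  simp only [answer, onNode_preorder hu, h, h']
  exact ⟨rfl, rfl⟩

end Answers

/-! ### Visited nodes, stop nodes and the factorization -/

section Passes

variable {σ : ℕ} (T : List (Fin σ))

open Classical in
/-- The nodes that are visited before the leaf labeled `j` is processed. -/
noncomputable def vis (j : ℕ) : Finset (List (Fin σ)) :=
  (nodeSet T).filter (fun x => x ≠ [] ∧ ¬ IsLeaf T x ∧ ∃ i ∈ Finset.Ico 1 j, x <+: suffix T i)

/-- The node at which the climb from the leaf labeled `j` stops. -/
noncomputable def stopAt (j : ℕ) : Option (List (Fin σ)) := stopNode T (vis T j) (suffix T j)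

/-- The length of a factor that starts at `j`. -/
noncomputable def flen (j : ℕ) : ℕ := match stopAt T j with
  | some v => v.length
  | none => 1

/-- The next factor position after the leaf labeled `m` is processed. -/
noncomputable def nxt : ℕ → ℕ
  | 0 => 1
  | m + 1 => if m + 1 = nxt m then nxt m + flen T (m + 1) else nxt m

/-- The factor positions up to `m`. -/
noncomputable def facPos (m : ℕ) : List ℕ := (List.range' 1 m).filter (fun j => nxt T (j - 1) = j)

/-- The factors. -/
noncomputable def facs (m : ℕ) : List (List (Fin σ)) :=
  (facPos T m).map fun j => (suffix T j).take (flen T j)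

variable {T}

theorem mem_vis {x : List (Fin σ)} {j : ℕ} : x ∈ vis T j ↔
    (IsNode T x ∧ ¬ IsLeaf T x) ∧ x ≠ [] ∧ ∃ i, 1 ≤ i ∧ i < j ∧ x <+: suffix T i := by
  simp only [vis, Finset.mem_filter, mem_nodeSet, Finset.mem_Ico, and_assoc]
  tauto

theorem mem_climbPath_suffix (hT : IsText T) {j : ℕ} (h1 : 1 ≤ j) (hj : j ≤ T.length)
    {x : List (Fin σ)} : x ∈ climbPath T (suffix T j) ↔
      (IsNode T x ∧ ¬ IsLeaf T x) ∧ x ≠ [] ∧ x <+: suffix T j := by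
  rw [mem_climbPath]
  constructor
  · rintro ⟨h2, h3, h4, h5⟩
    exact ⟨⟨h2, fun h => h4 (leaf_eq_of_prefix hT h (isLeaf_suffix h1 hj) h3)⟩, h5, h3⟩
  · rintro ⟨⟨h2, h3⟩, h4, h5⟩
    exact ⟨h2, h5, fun h => h3 (h ▸ isLeaf_suffix h1 hj), h4⟩

theorem newlyVisited_append (V : Finset (List (Fin σ))) (l : List (Fin σ)) :
    newlyVisited T V l ++ (climbPath T l).dropWhile (· ∉ V) = climbPath T l :=
  List.takeWhile_append_dropWhile

/-- With a node, all its non-root ancestors are visited, and the climb runs from longer to shorter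
prefixes. From the first visited node on, the whole path is visited, so `takeWhile` selects exactly
the unvisited nodes. -/
theorem mem_newlyVisited (hT : IsText T) {j : ℕ} (h1 : 1 ≤ j) (hj : j ≤ T.length)
    {x : List (Fin σ)} : x ∈ newlyVisited T (vis T j) (suffix T j) ↔
      x ∈ climbPath T (suffix T j) ∧ x ∉ vis T j := by
  have e := newlyVisited_append (T := T) (vis T j) (suffix T j)
  constructor
  · intro h
    refine ⟨by rw [← e]; exact List.mem_append_left _ h, ?_⟩
    have := List.mem_takeWhile_imp h
    simpa using this
  · rintro ⟨h, hx⟩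
    rw [← e] at h
    rcases List.mem_append.1 h with h | h
    · exact h
    · exfalso
      set d := (climbPath T (suffix T j)).dropWhile (· ∉ vis T j) with hd
      have hs := climbPath_sorted T (suffix T j)
      rw [← e, List.pairwise_append] at hs
      match hdd : d with
      | [] => simp at h
      | y :: r =>
        have hy : y ∈ vis T j := by
          have := List.head?_dropWhile_not (fun x => decide (x ∉ vis T j))
            (climbPath T (suffix T j))
          rw [← hd] at this
          simpa using this
        rcases List.mem_cons.1 h with rfl | h
        · exact hx hy
        · refine hx ?_
          have hxy := (List.pairwise_cons.1 hs.2.1).1 x h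
          have hxm : x ∈ climbPath T (suffix T j) := by
            rw [← e]; exact List.mem_append_right _ (List.mem_cons_of_mem _ h)
          rw [mem_climbPath_suffix hT h1 hj] at hxm
          rw [mem_vis] at hy ⊢
          obtain ⟨-, -, i, hi, hij, hyi⟩ := hy
          exact ⟨hxm.1, hxm.2.1, i, hi, hij, hxy.trans hyi⟩

theorem vis_succ (hT : IsText T) {j : ℕ} (h1 : 1 ≤ j) (hj : j ≤ T.length) :
    vis T (j + 1) = vis T j ∪ (newlyVisited T (vis T j) (suffix T j)).toFinset := by
  ext x
  rw [Finset.mem_union, List.mem_toFinset, mem_newlyVisited hT h1 hj,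
    mem_climbPath_suffix hT h1 hj]
  by_cases hx : x ∈ vis T j
  · simp only [hx, not_true, and_false, or_false, iff_true]
    rw [mem_vis] at hx ⊢
    obtain ⟨h2, h3, i, hi, hij, h⟩ := hx
    exact ⟨h2, h3, i, hi, by omega, h⟩
  · simp only [hx, false_or, not_false_iff, and_true]
    rw [mem_vis] at hx ⊢
    constructor
    · rintro ⟨h2, h3, i, hi, hij, h⟩
      refine ⟨h2, h3, ?_⟩
      rcases Nat.lt_succ_iff_lt_or_eq.1 hij with h' | rfl
      · exact absurd ⟨h2, h3, i, hi, h', h⟩ hx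
      · exact h
    · rintro ⟨h2, h3, h⟩
      exact ⟨h2, h3, j, h1, by omega, h⟩

theorem vis_one : vis T 1 = ∅ := by
  ext x
  rw [mem_vis]
  simp only [Finset.notMem_empty, iff_false]
  rintro ⟨-, -, i, h1, h2, -⟩
  omega

theorem vis_subset (j : ℕ) : vis T j ⊆ (internals T).toFinset := by
  intro x hx
  rw [List.mem_toFinset, mem_internals]
  exact (mem_vis.1 hx).1

theorem card_vis_le (hT : IsText T) (j : ℕ) : (vis T j).card ≤ T.length :=
  (Finset.card_le_card (vis_subset j)).trans
    ((List.toFinset_card_le _).trans (length_internals_le hT))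

theorem nodup_newlyVisited (V : Finset (List (Fin σ))) (l : List (Fin σ)) :
    (newlyVisited T V l).Nodup := by
  refine List.Nodup.sublist (List.takeWhile_sublist _) ?_
  exact (List.nodup_reverse.2 (ancestors_sorted T l).nodup).filter _

/-- This amortises the climbs: their lengths telescope to the number of visited nodes, which is at
most the number of inner nodes. -/
theorem card_vis_succ (hT : IsText T) {j : ℕ} (h1 : 1 ≤ j) (hj : j ≤ T.length) :
    (vis T (j + 1)).card =
      (vis T j).card + (newlyVisited T (vis T j) (suffix T j)).length := by
  rw [vis_succ hT h1 hj, Finset.card_union_of_disjoint,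
    List.toFinset_card_of_nodup (nodup_newlyVisited _ _)]
  rw [Finset.disjoint_right]
  intro x hx
  exact ((mem_newlyVisited hT h1 hj).1 (List.mem_toFinset.1 hx)).2

/-- A non-empty repeat shared with an earlier suffix shows up in the tree as a node on the climb
that is already visited. This links repeats in the text with the place where the climb stops. -/
theorem lcp_climbPath (hT : IsText T) {i j : ℕ} (hi : 1 ≤ i) (hij : i < j) (hj : j ≤ T.length)
    (h : lcp (suffix T i) (suffix T j) ≠ []) :
    lcp (suffix T i) (suffix T j) ∈ climbPath T (suffix T j) ∧
      lcp (suffix T i) (suffix T j) ∈ vis T j := by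
  have h1 := isNode_lcp hT hi (by omega) (by omega) hj hij.ne
  rw [mem_climbPath_suffix hT (by omega) hj, mem_vis]
  exact ⟨⟨h1, h, (lcp_prefix _ _).2⟩, h1, h, i, hi, hij, (lcp_prefix _ _).1⟩

/-- The stop node is visited, hence repeated. Conversely, a string shared with an earlier suffix is
a prefix of their longest common prefix, which is empty or a visited node on the climb, and thus
lies at or above the first visited node. -/
theorem stop_eq_some (hT : IsText T) {j : ℕ} (h1 : 1 ≤ j) (hj : j ≤ T.length)
    {v : List (Fin σ)} (h : stopAt T j = some v) :
    IsLongest T j v ∧ v ∈ vis T j ∧ v ∈ climbPath T (suffix T j) := by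
  have e := newlyVisited_append (T := T) (vis T j) (suffix T j)
  unfold stopAt stopNode at h
  obtain ⟨r, hr⟩ := List.head?_eq_some_iff.1 h
  rw [hr] at e
  have hv : v ∈ vis T j := by
    have := List.head?_dropWhile_not (fun x => decide (x ∉ vis T j)) (climbPath T (suffix T j))
    rw [h] at this
    simpa using this
  have hvc : v ∈ climbPath T (suffix T j) := by rw [← e]; simp
  refine ⟨⟨(mem_climbPath.1 hvc).2.1, (mem_vis.1 hv).2.2, fun i x hi hij hxi hxj => ?_⟩, hv, hvc⟩
  have hx := prefix_lcp hxi hxj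
  by_cases h0 : lcp (suffix T i) (suffix T j) = []
  · rw [h0] at hx; exact hx.trans List.nil_prefix
  obtain ⟨h2, h3⟩ := lcp_climbPath hT hi hij hj h0
  refine hx.trans ?_
  have hs := climbPath_sorted T (suffix T j)
  rw [← e, List.pairwise_append] at hs
  have hnot : lcp (suffix T i) (suffix T j) ∉ newlyVisited T (vis T j) (suffix T j) :=
    fun h' => ((mem_newlyVisited hT h1 hj).1 h').2 h3
  rw [← e] at h2
  rcases List.mem_append.1 h2 with h2 | h2
  · exact absurd h2 hnot
  rcases List.mem_cons.1 h2 with h2 | h2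
  · rw [h2]
  · exact (List.pairwise_cons.1 hs.2.1).1 _ h2

/-- A non-empty shared string would make a longest common prefix a visited node on the climb, but
all nodes on a climb that reaches the root are unvisited. -/
theorem stop_eq_none (hT : IsText T) {j : ℕ} (h1 : 1 ≤ j) (hj : j ≤ T.length)
    (h : stopAt T j = none) {i : ℕ} {x : List (Fin σ)} (hi : 1 ≤ i) (hij : i < j)
    (hxi : x <+: suffix T i) (hxj : x <+: suffix T j) : x = [] := by
  have e := newlyVisited_append (T := T) (vis T j) (suffix T j)
  unfold stopAt stopNode at h
  rw [List.head?_eq_none_iff.1 h, List.append_nil] at e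
  have hx := prefix_lcp hxi hxj
  by_contra h0
  have h0 : lcp (suffix T i) (suffix T j) ≠ [] := fun h => h0 (by simpa [h] using hx)
  obtain ⟨h2, h3⟩ := lcp_climbPath hT hi hij hj h0
  rw [← e] at h2
  exact ((mem_newlyVisited hT h1 hj).1 h2).2 h3

theorem flen_pos (hT : IsText T) {j : ℕ} (h1 : 1 ≤ j) (hj : j ≤ T.length) : 1 ≤ flen T j := by
  unfold flen
  split
  · rename_i v hv
    have := (mem_vis.1 (stop_eq_some hT h1 hj hv).2.1).2.1
    exact List.length_pos_iff.2 this
  · exact le_rfl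

theorem flen_le (hT : IsText T) {j : ℕ} (h1 : 1 ≤ j) (hj : j ≤ T.length) :
    j + flen T j ≤ T.length + 1 := by
  unfold flen
  split
  · rename_i v hv
    have := (stop_eq_some hT h1 hj hv).1.1.length_le
    rw [length_suffix] at this
    omega
  · omega

/-- Inside a referencing factor, the climbs stopAt before the root. -/
theorem stop_succ (hT : IsText T) {j : ℕ} (h1 : 1 ≤ j) (hj : j < T.length)
    {v : List (Fin σ)} (h : stopAt T j = some v) (hv : 2 ≤ v.length) :
    ∃ v', stopAt T (j + 1) = some v' ∧ v.length ≤ v'.length + 1 := by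
  obtain ⟨h2, ⟨i, hi, hij, h3⟩, -⟩ := (stop_eq_some hT h1 hj.le h).1
  have h4 : v.drop 1 <+: suffix T (i + 1) := by
    rw [suffix_add hi]; exact h3.drop 1
  have h5 : v.drop 1 <+: suffix T (j + 1) := by
    rw [suffix_add h1]; exact h2.drop 1
  rcases hs : stopAt T (j + 1) with _ | v'
  · have := stop_eq_none hT (by omega) hj hs (by omega) (by omega) h4 h5
    have := congrArg List.length this
    simp at this; omega
  · refine ⟨v', rfl, ?_⟩
    have := ((stop_eq_some hT (by omega) hj hs).1.2.2 _ _ (by omega) (by omega) h4 h5).length_le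
    simp at this; omega

/-- Inside a factor, the stop node of the current leaf is long enough to reach the end of the
factor; this survives from one position to the next by dropping the first character (`stop_succ`).
So no climb reaches the root there, which is why pass 1 may advance at the root without testing that
the leaf is at a factor position. -/
theorem nxt_spec (hT : IsText T) {m : ℕ} (hm : m ≤ T.length) :
    m + 1 ≤ nxt T m ∧ nxt T m ≤ T.length + 1 ∧
      (m + 1 < nxt T m → ∃ v, stopAt T (m + 1) = some v ∧ nxt T m ≤ m + 1 + v.length) := by
  induction m with
  | zero => simp [nxt]
  | succ m ih =>
    obtain ⟨ih1, ih2, ih3⟩ := ih (by omega)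
    have hp := flen_pos hT (j := m + 1) (by omega) hm
    have hl := flen_le hT (j := m + 1) (by omega) hm
    have key : ∀ v, stopAt T (m + 1) = some v → m + 2 < m + 1 + v.length →
        ∃ v', stopAt T (m + 2) = some v' ∧ v.length ≤ v'.length + 1 := by
      intro v hv hlt
      have := (stop_eq_some hT (by omega) hm hv).1.1.length_le
      rw [length_suffix] at this
      exact stop_succ hT (by omega) (by omega) hv (by omega)
    simp only [nxt]
    split_ifs with h
    · rw [← h]
      refine ⟨by omega, hl, fun hlt => ?_⟩
      have hs : ∃ v, stopAt T (m + 1) = some v := by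
        rcases hs : stopAt T (m + 1) with _ | v
        · have : flen T (m + 1) = 1 := by simp [flen, hs]
          omega
        · exact ⟨v, rfl⟩
      obtain ⟨v, hv⟩ := hs
      have hf : flen T (m + 1) = v.length := by simp [flen, hv]
      obtain ⟨v', hv', hle⟩ := key v hv (by omega)
      exact ⟨v', hv', by omega⟩
    · refine ⟨by omega, ih2, fun hlt => ?_⟩
      obtain ⟨v, hv, hle⟩ := ih3 (by omega)
      obtain ⟨v', hv', hle'⟩ := key v hv (by omega)
      exact ⟨v', hv', by omega⟩

theorem facPos_succ (m : ℕ) :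
    facPos T (m + 1) = facPos T m ++ if nxt T m = m + 1 then [m + 1] else [] := by
  unfold facPos
  rw [List.range'_1_concat, List.filter_append]
  congr 1
  by_cases h : nxt T m = m + 1
  · simp [h, add_comm 1 m]
  · simp [h, add_comm 1 m]

theorem flatten_facs (hT : IsText T) {m : ℕ} (hm : m ≤ T.length) :
    (facs T m).flatten = T.take (nxt T m - 1) := by
  induction m with
  | zero => simp [facs, facPos, nxt]
  | succ m ih =>
    have ih := ih (by omega)
    unfold facs at ih ⊢
    rw [facPos_succ, List.map_append, List.flatten_append, ih]
    simp only [nxt]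
    by_cases h : nxt T m = m + 1
    · simp only [h, if_true, List.map_singleton, List.flatten_singleton, suffix,
        Nat.add_sub_cancel, ← List.take_add]
      congr 1
      have := flen_pos hT (j := m + 1) (by omega) hm
      omega
    · rw [if_neg h, if_neg (Ne.symm h)]; simp

theorem mem_facPos {m p : ℕ} : p ∈ facPos T m ↔ (1 ≤ p ∧ p ≤ m) ∧ nxt T (p - 1) = p := by
  simp only [facPos, List.mem_filter, List.mem_range'_1, decide_eq_true_eq]
  exact and_congr_left fun _ => and_congr_right fun _ => by omega

theorem factorPos_facs (hT : IsText T) {x : ℕ} (hx : x < (facPos T T.length).length)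
    (hx' : x < (facs T T.length).length) :
    factorPos (facs T T.length) x = (facPos T T.length)[x] ∧
      (facs T T.length)[x] = (suffix T (facPos T T.length)[x]).take
        (flen T (facPos T T.length)[x]) := by
  refine ⟨?_, by simp [facs]⟩
  set p := (facPos T T.length)[x] with hp
  obtain ⟨⟨h1, h2⟩, h3⟩ := mem_facPos.1 (List.getElem_mem hx)
  rw [← hp] at h1 h2 h3
  -- The positions listed before `p` are those of `facPos T (p - 1)`, and by `flatten_facs` their
  -- factors make up the first `p - 1` characters; `factorPos` therefore returns `p`.
  have hsplit : facPos T T.length = facPos T (p - 1) ++ p :: (facPos T T.length).drop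
      ((facPos T (p - 1)).length + 1) := by
    have : ∃ r, facPos T T.length = facPos T (p - 1) ++ p :: r := by
      have e := facPos_succ (T := T) (p - 1)
      rw [Nat.sub_add_cancel h1, if_pos h3] at e
      have : ∃ r, facPos T T.length = facPos T p ++ r := by
        refine ⟨((List.range' (p + 1) (T.length - p)).filter (fun j => nxt T (j - 1) = j)), ?_⟩
        unfold facPos
        rw [← List.filter_append]
        congr 1
        have := List.range'_append_1 (s := 1) (m := p) (n := T.length - p)
        rw [show 1 + p = p + 1 by ring, show p + (T.length - p) = T.length by omega] at this
        exact this.symm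
      obtain ⟨r, hr⟩ := this
      exact ⟨r, by rw [hr, e]; simp⟩
    obtain ⟨r, hr⟩ := this
    rw [hr]
    congr 2
    simp
  have hxl : x = (facPos T (p - 1)).length := by
    have hnd : (facPos T T.length).Nodup := (List.nodup_range' (step := 1)).filter _
    have hlt : (facPos T (p - 1)).length < (facPos T T.length).length := by
      rw [hsplit]; simp
    refine (hnd.getElem_inj_iff (hi := hx) (hj := hlt)).1 ?_
    rw [← hp]
    conv_rhs => rw [List.getElem_of_eq hsplit]
    simp
  have hF : (facs T T.length).take x = facs T (p - 1) := by
    unfold facs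
    rw [← List.map_take]
    congr 1
    conv_lhs => rw [hsplit]
    rw [hxl, List.take_left]
  unfold factorPos
  rw [hF, flatten_facs hT (by omega), h3, List.length_take]
  omega

/-- Lowest common ancestors with earlier leaves are longest common prefixes. All of them are
prefixes of suffix `j`, so the lowest one is the longest repeat. -/
theorem isWitness_iff (hT : IsText T) {j : ℕ} (hj : j ≤ T.length) (u : List (Fin σ)) :
    IsWitness T j u ↔ IsLongest T j u := by
  unfold IsWitness
  have e : ∀ i, 1 ≤ i → i < j → lca T (suffix T j) (suffix T i) =
      lcp (suffix T j) (suffix T i) := fun i h1 h2 =>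
    lca_eq_lcp hT (by omega) hj h1 (by omega) (by omega)
  constructor
  · rintro ⟨⟨i, h1, h2, h3⟩, h4⟩
    rw [e i h1 h2] at h3
    refine ⟨h3 ▸ (lcp_prefix _ _).1, ⟨i, h1, h2, h3 ▸ (lcp_prefix _ _).2⟩,
      fun i x hi hij hxi hxj => ?_⟩
    have := h4 i hi hij
    rw [e i hi hij] at this
    exact (prefix_lcp hxj hxi).trans this
  · rintro ⟨h1, ⟨i, hi, hij, h2⟩, h3⟩
    refine ⟨⟨i, hi, hij, ?_⟩, fun i hi hij => ?_⟩
    · rw [e i hi hij]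
      exact prefix_antisymm (prefix_lcp h1 h2)
        (h3 i _ hi hij (lcp_prefix _ _).2 (lcp_prefix _ _).1)
    · rw [e i hi hij]
      exact h3 i _ hi hij (lcp_prefix _ _).2 (lcp_prefix _ _).1

theorem take_flen (hT : IsText T) {j : ℕ} (h1 : 1 ≤ j) (hj : j ≤ T.length) :
    (∀ v, stopAt T j = some v → (suffix T j).take (flen T j) = v) ∧
    (stopAt T j = none → ∃ a : Fin σ, (suffix T j).take (flen T j) = [a] ∧
      a.val = headChar (suffix T j)) := by
  constructor
  · intro v hv
    have := (stop_eq_some hT h1 hj hv).1.1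
    simp only [flen, hv]
    exact (List.prefix_iff_eq_take.1 this).symm
  · intro h
    obtain ⟨a, t, ha⟩ := List.exists_cons_of_ne_nil (suffix_ne_nil h1 hj)
    exact ⟨a, by simp [flen, h, ha], by simp [ha, headChar]⟩

/-- A factor given by a stop node is the longest repeat, and being non-empty it is no shorter than a
single character. If the root is reached, only the empty string is repeated, and single characters
are the longest candidates. -/
theorem isLZ77_facs (hT : IsText T) : IsLZ77 T (facs T T.length) := by
  refine ⟨?_, fun x hx => ?_⟩
  · rw [flatten_facs hT le_rfl]
    have := nxt_spec hT le_rfl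
    rw [List.take_of_length_le (by omega)]
  · have hx' : x < (facPos T T.length).length := by simpa [facs] using hx
    obtain ⟨e1, e2⟩ := factorPos_facs hT hx' hx
    rw [e1, e2]
    obtain ⟨⟨h1, h2⟩, h3⟩ := mem_facPos.1 (List.getElem_mem hx')
    generalize (facPos T T.length)[x] = p at h1 h2 h3
    obtain ⟨ts, tn⟩ := take_flen hT h1 h2
    rcases hs : stopAt T p with _ | v
    · obtain ⟨a, ha, -⟩ := tn hs
      rw [ha]
      refine ⟨Or.inr ⟨a, rfl⟩, fun S hS hSp => ?_⟩
      rcases hS with ⟨i, hi, hip, hSi⟩ | ⟨b, rfl⟩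
      · rw [stop_eq_none hT h1 h2 hs hi hip hSi hSp]; simp
      · simp
    · rw [ts v hs]
      obtain ⟨hl1, hl2, hl3⟩ := (stop_eq_some hT h1 h2 hs).1
      have hv := (mem_vis.1 (stop_eq_some hT h1 h2 hs).2.1).2.1
      refine ⟨Or.inl hl2, fun S hS hSp => ?_⟩
      rcases hS with ⟨i, hi, hip, hSi⟩ | ⟨b, rfl⟩
      · exact (hl3 i S hi hip hSi hSp).length_le
      · exact List.length_pos_iff.2 hv

end Passes

end LZ

namespace LZ

/-! ### The states and the output of the two passes -/

section PassStates

variable {σ : ℕ} (T : List (Fin σ))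

/-- The state of the first pass after the leaves `1, …, m`. -/
def oneAt (m : ℕ) : StateOne σ := (List.range' 1 m).foldl (stepOne T) ⟨∅, ∅, 1⟩

/-- The state of the second pass after the leaves `1, …, m`. -/
def twoAt (M : Finset (List (Fin σ))) (m : ℕ) : StateTwo σ :=
  (List.range' 1 m).foldl (stepTwo T M) ⟨∅, fun _ => 0, 1, []⟩

/-- The smallest label of a leaf below a node. -/
noncomputable def firstLabel (v : List (Fin σ)) : ℕ :=
  sInf {i | 1 ≤ i ∧ i ≤ T.length ∧ v <+: suffix T i}

/-- The output for the factor at `p`. -/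
noncomputable def facCode (p : ℕ) : Code :=
  match stopAt T p with
  | some v => .ref (firstLabel T v) v.length
  | none => .fresh (headChar (suffix T p))

variable {T}

theorem oneAt_succ (m : ℕ) : oneAt T (m + 1) = stepOne T (oneAt T m) (m + 1) := by
  simp [oneAt, List.range'_1_concat, add_comm 1 m]

theorem twoAt_succ (M : Finset (List (Fin σ))) (m : ℕ) :
    twoAt T M (m + 1) = stepTwo T M (twoAt T M m) (m + 1) := by
  simp [twoAt, List.range'_1_concat, add_comm 1 m]

/-- By `nxt_spec`, a climb that reaches the root cannot start strictly inside a factor. -/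
theorem nxt_succ_of_none (hT : IsText T) {m : ℕ} (hm : m < T.length)
    (h : stopAt T (m + 1) = none) : nxt T m = m + 1 ∧ nxt T (m + 1) = nxt T m + 1 := by
  have h1 := nxt_spec hT hm.le
  have h2 : nxt T m = m + 1 := by
    by_contra hne
    obtain ⟨v, hv, -⟩ := h1.2.2 (by omega)
    rw [hv] at h; simp at h
  refine ⟨h2, ?_⟩
  rw [nxt, if_pos h2.symm, flen, h]

theorem nxt_succ_of_some {m : ℕ} {v : List (Fin σ)} (h : stopAt T (m + 1) = some v) :
    nxt T (m + 1) = if m + 1 = nxt T m then nxt T m + v.length else nxt T m := by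
  rw [nxt, flen, h]

theorem oneAt_spec (hT : IsText T) {m : ℕ} (hm : m ≤ T.length) :
    (oneAt T m).visited = vis T (m + 1) ∧ (oneAt T m).next = nxt T m ∧
      ∀ v, v ∈ (oneAt T m).marked ↔ ∃ p ∈ facPos T m, stopAt T p = some v := by
  induction m with
  | zero => simp [oneAt, vis_one, nxt, facPos]
  | succ m ih =>
    obtain ⟨ih1, ih2, ih3⟩ := ih (by omega)
    rw [oneAt_succ]
    unfold stepOne
    simp only [ih1, ih2]
    rw [vis_succ hT (by omega) hm]
    have es : stopNode T (vis T (m + 1)) (suffix T (m + 1)) = stopAt T (m + 1) := rfl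
    simp only [es]
    rcases hs : stopAt T (m + 1) with _ | v
    · obtain ⟨h1, h2⟩ := nxt_succ_of_none hT hm hs
      refine ⟨rfl, h2.symm, fun v => ?_⟩
      dsimp only
      rw [ih3, facPos_succ, if_pos h1]
      simp only [List.mem_append, List.mem_singleton, or_and_right, exists_or, exists_eq_left, hs]
      simp
    · rw [nxt_succ_of_some hs]
      dsimp only
      by_cases h : m + 1 = nxt T m
      · rw [if_pos h, if_pos h]
        refine ⟨rfl, rfl, fun u => ?_⟩
        dsimp only
        rw [Finset.mem_insert, ih3, facPos_succ, if_pos h.symm]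
        simp only [List.mem_append, List.mem_singleton, or_and_right, exists_or, exists_eq_left,
          hs, Option.some_inj]
        rw [or_comm, eq_comm]
      · rw [if_neg h, if_neg h]
        refine ⟨rfl, rfl, fun u => ?_⟩
        dsimp only
        rw [ih3, facPos_succ, if_neg (Ne.symm h), List.append_nil]

theorem mem_marked (hT : IsText T) {v : List (Fin σ)} : v ∈ (passOne T).marked ↔
    ∃ p ∈ facPos T T.length, stopAt T p = some v := (oneAt_spec hT le_rfl).2.2 v

theorem marked_subset (hT : IsText T) {v : List (Fin σ)} (hv : v ∈ (passOne T).marked) :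
    v ∈ internals T ∧ v ≠ [] := by
  obtain ⟨p, hp, hs⟩ := (mem_marked hT).1 hv
  obtain ⟨⟨h1, h2⟩, -⟩ := mem_facPos.1 hp
  have := mem_vis.1 (stop_eq_some hT h1 h2 hs).2.1
  exact ⟨mem_internals.2 this.1, this.2.1⟩

theorem facs_mem_iff (hT : IsText T) {p : ℕ} (h1 : 1 ≤ p) (h2 : p ≤ T.length) :
    (suffix T p).take (flen T p) ∈ substringsBefore T p ↔ ∃ v, stopAt T p = some v := by
  obtain ⟨ts, tn⟩ := take_flen hT h1 h2
  rcases hs : stopAt T p with _ | v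
  · obtain ⟨a, ha, -⟩ := tn hs
    rw [ha]
    simp only [reduceCtorEq, exists_false, iff_false]
    rintro ⟨i, hi, hip, h⟩
    have := stop_eq_none hT h1 h2 hs hi hip h (by rw [← ha]; exact List.take_prefix _ _)
    simp at this
  · rw [ts v hs]
    exact ⟨fun _ => ⟨v, rfl⟩, fun _ => (stop_eq_some hT h1 h2 hs).1.2.1⟩

/-- At a referencing factor both the stop node and the witness are the longest repeat, and this is
unique. -/
theorem marked_iff_witness (hT : IsText T) (u : List (Fin σ)) : u ∈ (passOne T).marked ↔
    ∃ (x : ℕ) (hx : x < (facs T T.length).length),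
      (facs T T.length)[x] ∈ substringsBefore T (factorPos (facs T T.length) x) ∧
      IsWitness T (factorPos (facs T T.length) x) u := by
  have key : ∀ p, 1 ≤ p → p ≤ T.length → (stopAt T p = some u ↔
      ((suffix T p).take (flen T p) ∈ substringsBefore T p ∧ IsWitness T p u)) := by
    intro p h1 h2
    rw [facs_mem_iff hT h1 h2, isWitness_iff hT h2]
    constructor
    · intro h; exact ⟨⟨u, h⟩, (stop_eq_some hT h1 h2 h).1⟩
    · rintro ⟨⟨v, hv⟩, hu⟩
      rw [hv, (stop_eq_some hT h1 h2 hv).1.unique hu]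
  rw [mem_marked hT]
  constructor
  · rintro ⟨p, hp, hs⟩
    obtain ⟨⟨h1, h2⟩, -⟩ := mem_facPos.1 hp
    obtain ⟨x, hx, rfl⟩ := List.getElem_of_mem hp
    have hx' : x < (facs T T.length).length := by simpa [facs] using hx
    obtain ⟨e1, e2⟩ := factorPos_facs hT hx hx'
    exact ⟨x, hx', by rw [e1, e2]; exact (key _ h1 h2).1 hs⟩
  · rintro ⟨x, hx', h⟩
    have hx : x < (facPos T T.length).length := by simpa [facs] using hx'
    obtain ⟨e1, e2⟩ := factorPos_facs hT hx hx'
    rw [e1, e2] at h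
    have hp := List.getElem_mem hx
    obtain ⟨⟨h1, h2⟩, -⟩ := mem_facPos.1 hp
    exact ⟨_, hp, (key _ h1 h2).2 h⟩

theorem foldl_update {α : Type*} (f : α → ℕ) (j : ℕ) (l : List α) (A : ℕ → ℕ) (k : ℕ) :
    (∀ v ∈ l, f v ≠ k) → l.foldl (fun A v => Function.update A (f v) j) A k = A k := by
  induction l generalizing A with
  | nil => simp
  | cons a l ih =>
    intro h
    rw [List.foldl_cons, ih _ fun v hv => h v (List.mem_cons_of_mem _ hv)]
    rw [Function.update_of_ne (h a (by simp)).symm]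

/-- All updates of the fold write the same value, so a later update with the same index does no harm
and `f` may be any function. -/
theorem foldl_update_mem {α : Type*} (f : α → ℕ) (j : ℕ) (l : List α) (A : ℕ → ℕ) {v : α}
    (hv : v ∈ l) : l.foldl (fun A v => Function.update A (f v) j) A (f v) = j := by
  induction l generalizing A with
  | nil => simp at hv
  | cons a l ih =>
    rw [List.foldl_cons]
    by_cases h : v ∈ l
    · exact ih _ h
    · obtain rfl : v = a := by simpa [h] using hv
      by_cases h' : ∃ u ∈ l, f u = f v
      · obtain ⟨u, hu, he⟩ := h'
        have : ∀ (l : List α) (A : ℕ → ℕ), A (f v) = j →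
            l.foldl (fun A v => Function.update A (f v) j) A (f v) = j := by
          intro l
          induction l with
          | nil => intro A h; exact h
          | cons a l ih =>
            intro A h
            refine ih _ ?_
            change Function.update A (f a) j (f v) = j
            by_cases h' : f v = f a
            · rw [h', Function.update_self]
            · rw [Function.update_of_ne h', h]
        exact this l _ (Function.update_self ..)
      · push Not at h'
        rw [foldl_update f j l _ _ h', Function.update_self]

theorem isLeast_firstLabel {i : ℕ} {v : List (Fin σ)} (h1 : 1 ≤ i) (h2 : i ≤ T.length)
    (h : v <+: suffix T i) :
    IsLeast {i : ℕ | 1 ≤ i ∧ i ≤ T.length ∧ v <+: suffix T i} (firstLabel T v) :=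
  ⟨Nat.sInf_mem ⟨i, h1, h2, h⟩, fun _ hx => Nat.sInf_le hx⟩

/-- A leaf with a smaller label below `v` would have caused `v` to be visited earlier. -/
theorem firstLabel_eq_of_new (hT : IsText T) {j : ℕ} (h1 : 1 ≤ j) (hj : j ≤ T.length)
    {v : List (Fin σ)} (h : v ∈ newlyVisited T (vis T j) (suffix T j)) : firstLabel T v = j := by
  rw [mem_newlyVisited hT h1 hj, mem_climbPath_suffix hT h1 hj] at h
  have hl := isLeast_firstLabel h1 hj h.1.2.2
  refine le_antisymm (hl.2 ⟨h1, hj, h.1.2.2⟩) (not_lt.1 fun hlt => h.2 ?_)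
  rw [mem_vis]
  exact ⟨h.1.1, h.1.2.1, _, hl.1.1, hlt, hl.1.2.2⟩

theorem mem_marked_nodes {M : Finset (List (Fin σ))} (hM : ∀ v ∈ M, IsNode T v)
    {v : List (Fin σ)} : v ∈ (nodes T).filter (· ∈ M) ↔ v ∈ M := by
  simp only [List.mem_filter, mem_nodes, decide_eq_true_eq, and_iff_right_iff_imp]
  exact hM v

theorem witnessId_inj {M : Finset (List (Fin σ))} (hM : ∀ v ∈ M, IsNode T v)
    {u v : List (Fin σ)} (hu : u ∈ M) (h : witnessId T M u = witnessId T M v) : u = v :=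
  posOf_inj ((mem_marked_nodes hM).2 hu) h

/-- The entries of the array of the second pass that have been set are smallest labels. -/
def ArrayOk (T : List (Fin σ)) (M : Finset (List (Fin σ))) (A : ℕ → ℕ) (j : ℕ) : Prop :=
  ∀ v ∈ M, v ∈ vis T j → A (witnessId T M v) = firstLabel T v

theorem arrayOk_succ (hT : IsText T) {M : Finset (List (Fin σ))} (hM : ∀ v ∈ M, IsNode T v)
    {A : ℕ → ℕ} {j : ℕ} (h1 : 1 ≤ j) (hj : j ≤ T.length) (h : ArrayOk T M A j) :
    ArrayOk T M (((newlyVisited T (vis T j) (suffix T j)).filter (· ∈ M)).foldl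
      (fun A v => Function.update A (witnessId T M v) j) A) (j + 1) := by
  intro v hv hvis
  rw [vis_succ hT h1 hj, Finset.mem_union, List.mem_toFinset] at hvis
  by_cases hn : v ∈ newlyVisited T (vis T j) (suffix T j)
  · rw [foldl_update_mem, firstLabel_eq_of_new hT h1 hj hn]
    simp [hn, hv]
  · rw [foldl_update, h v hv (by tauto)]
    intro u hu he
    rw [List.mem_filter, decide_eq_true_eq] at hu
    rw [witnessId_inj hM hu.2 he] at hu
    exact hn hu.1

theorem twoAt_spec (hT : IsText T) {m : ℕ} (hm : m ≤ T.length) :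
    (twoAt T (passOne T).marked m).visited = vis T (m + 1) ∧
      (twoAt T (passOne T).marked m).next = nxt T m ∧
      (twoAt T (passOne T).marked m).out = (facPos T m).map (facCode T) ∧
      ArrayOk T (passOne T).marked (twoAt T (passOne T).marked m).array (m + 1) := by
  have hM : ∀ v ∈ (passOne T).marked, IsNode T v := fun v hv =>
    (mem_internals.1 (marked_subset hT hv).1).1
  set M := (passOne T).marked with hMdef
  induction m with
  | zero => simp [twoAt, vis_one, nxt, facPos, ArrayOk]
  | succ m ih =>
    obtain ⟨ih1, ih2, ih3, ih4⟩ := ih (by omega)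
    have hA := arrayOk_succ hT hM (j := m + 1) (by omega) hm ih4
    rw [twoAt_succ]
    unfold stepTwo
    simp only [ih1, ih2, ih3]
    set A := ((newlyVisited T (vis T (m + 1)) (suffix T (m + 1))).filter (· ∈ M)).foldl
      (fun A v => Function.update A (witnessId T M v) (m + 1)) (twoAt T M m).array with hAdef
    have hv := vis_succ hT (j := m + 1) (by omega) hm
    rw [← hv, facPos_succ]
    have es : stopNode T (vis T (m + 1)) (suffix T (m + 1)) = stopAt T (m + 1) := rfl
    simp only [es]
    rcases hs : stopAt T (m + 1) with _ | v
    · obtain ⟨h1, h2⟩ := nxt_succ_of_none hT hm hs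
      dsimp only
      rw [if_pos h1.symm, if_pos h1, h2]
      exact ⟨rfl, rfl, by simp [facCode, hs], hA⟩
    · rw [nxt_succ_of_some hs]
      dsimp only
      by_cases h : m + 1 = nxt T m
      · have hvM : v ∈ M := by
          rw [hMdef, mem_marked hT]
          exact ⟨m + 1, mem_facPos.2 ⟨⟨by omega, hm⟩, h.symm⟩, hs⟩
        -- The stop node was visited from an earlier leaf, so its entry is set before it is read.
        have hvv : v ∈ vis T (m + 1 + 1) := by
          rw [hv]
          exact Finset.mem_union_left _ (stop_eq_some hT (by omega) hm hs).2.1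
        rw [if_pos h, if_pos h, if_pos h.symm]
        exact ⟨rfl, rfl, by simp [facCode, hs, hA v hvM hvv], hA⟩
      · rw [if_neg h, if_neg h, if_neg (Ne.symm h)]
        exact ⟨rfl, rfl, by simp, hA⟩

theorem twoPass_eq (hT : IsText T) : twoPass T = (facPos T T.length).map (facCode T) :=
  (twoAt_spec hT le_rfl).2.2.1

theorem isLeast_array (hT : IsText T) {u : List (Fin σ)} (hu : u ∈ (passOne T).marked) :
    IsLeast {i : ℕ | 1 ≤ i ∧ i ≤ T.length ∧ u <+: suffix T i}
      ((passTwo T (passOne T).marked).array (witnessId T (passOne T).marked u)) := by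
  obtain ⟨p, hp, hs⟩ := (mem_marked hT).1 hu
  obtain ⟨⟨h1, h2⟩, -⟩ := mem_facPos.1 hp
  have h := stop_eq_some hT h1 h2 hs
  have hv : u ∈ vis T (T.length + 1) := by
    obtain ⟨h3, h4, i, h5, h6, h7⟩ := mem_vis.1 h.2.1
    exact mem_vis.2 ⟨h3, h4, i, h5, by omega, h7⟩
  have e : (passTwo T (passOne T).marked).array (witnessId T (passOne T).marked u) =
      firstLabel T u := (twoAt_spec hT le_rfl).2.2.2 u hu hv
  rw [e]
  exact isLeast_firstLabel h1 h2 h.1.1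

theorem isCoding_twoPass (hT : IsText T) : IsCoding T (facs T T.length) (twoPass T) := by
  rw [twoPass_eq hT]
  refine ⟨by simp [facs], fun x hx' hx'' => ?_⟩
  have hx : x < (facPos T T.length).length := by simpa [facs] using hx'
  obtain ⟨e1, e2⟩ := factorPos_facs hT hx hx'
  rw [e1, e2, List.getElem_map]
  obtain ⟨⟨h1, h2⟩, -⟩ := mem_facPos.1 (List.getElem_mem hx)
  generalize (facPos T T.length)[x] = p at h1 h2
  obtain ⟨ts, tn⟩ := take_flen hT h1 h2
  rcases hs : stopAt T p with _ | v
  · obtain ⟨a, ha, ha'⟩ := tn hs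
    simp only [facCode, hs]
    refine ⟨⟨a, ha, ha'⟩, ?_⟩
    rw [facs_mem_iff hT h1 h2]
    simp [hs]
  · simp only [facCode, hs, ts v hs]
    obtain ⟨h3, ⟨i, hi, hip, h4⟩, -⟩ := (stop_eq_some hT h1 h2 hs).1
    -- The stop node lies above an earlier leaf `i`, so the smallest label below it is strictly
    -- smaller than `p`, as a referred position must be.
    have hl := isLeast_firstLabel hi (by omega) h4
    exact ⟨trivial, hl.1.1, (hl.2 ⟨hi, by omega, h4⟩).trans_lt hip, hl.1.2.2⟩

end PassStates

end LZ

namespace LZ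

/-! ### Tools for the verification of programs -/

section Tools

variable {σ : ℕ} {T : List (Fin σ)} {w M : ℕ}

abbrev Ex.shl (a b : Ex) : Ex := .bin .shl a b
abbrev Ex.shr (a b : Ex) : Ex := .bin .shr a b
abbrev Ex.lt (a b : Ex) : Ex := .bin .lt a b
abbrev Ex.eq (a b : Ex) : Ex := .bin .eq a b

/-- The entry with index `i` of the array with base address `base` and fields of width `l`. -/
abbrev Ex.get (base l i : Ex) : Ex := .ld (base + i * l) l

/-- Set the entry with index `i`. -/
abbrev Cmd.put (base l i x : Ex) : Cmd := .store (base + i * l) l x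

section Simp

variable (mem : ℕ → Bool) (v : ℕ → ℕ) (a b : Ex) (k : ℕ) (q : Query)

theorem val_var : (Ex.var k).val T mem v = v k := rfl
theorem val_num : (no_index (OfNat.ofNat k) : Ex).val T mem v = OfNat.ofNat k := rfl
theorem val_add : (a + b).val T mem v = a.val T mem v + b.val T mem v := rfl
theorem val_sub : (a - b).val T mem v = a.val T mem v - b.val T mem v := rfl
theorem val_mul : (a * b).val T mem v = a.val T mem v * b.val T mem v := rfl
theorem val_div : (a / b).val T mem v = a.val T mem v / b.val T mem v := rfl
theorem val_mod : (a % b).val T mem v = a.val T mem v % b.val T mem v := rfl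
theorem val_shl : (Ex.bin .shl a b).val T mem v = a.val T mem v * 2 ^ b.val T mem v := rfl
theorem val_shr : (Ex.bin .shr a b).val T mem v = a.val T mem v / 2 ^ b.val T mem v := rfl
theorem val_lt : (Ex.bin .lt a b).val T mem v =
  if a.val T mem v < b.val T mem v then 1 else 0 := rfl
theorem val_eq : (Ex.bin .eq a b).val T mem v =
  if a.val T mem v = b.val T mem v then 1 else 0 := rfl
theorem val_pop : (Ex.pop a).val T mem v = pop (a.val T mem v) := rfl
theorem val_ld : (Ex.ld a b).val T mem v = readField mem (a.val T mem v) (b.val T mem v) := rfl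
theorem val_qry : (Ex.qry q a b).val T mem v = answer T q (a.val T mem v) (b.val T mem v) := rfl

theorem ok_var : (Ex.var k).ok T w M mem v ↔ True := Iff.rfl
theorem ok_num : (no_index (OfNat.ofNat k) : Ex).ok T w M mem v ↔ OfNat.ofNat k < 2 ^ w := Iff.rfl
theorem ok_add : (a + b).ok T w M mem v ↔ a.ok T w M mem v ∧ b.ok T w M mem v ∧
  a.val T mem v + b.val T mem v < 2 ^ w := Iff.rfl
theorem ok_sub : (a - b).ok T w M mem v ↔ a.ok T w M mem v ∧ b.ok T w M mem v ∧
  b.val T mem v ≤ a.val T mem v := Iff.rfl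
theorem ok_mul : (a * b).ok T w M mem v ↔ a.ok T w M mem v ∧ b.ok T w M mem v ∧
  a.val T mem v * b.val T mem v < 2 ^ w := Iff.rfl
theorem ok_div : (a / b).ok T w M mem v ↔ a.ok T w M mem v ∧ b.ok T w M mem v ∧ True := Iff.rfl
theorem ok_mod : (a % b).ok T w M mem v ↔ a.ok T w M mem v ∧ b.ok T w M mem v ∧ True := Iff.rfl
theorem ok_shl : (Ex.bin .shl a b).ok T w M mem v ↔ a.ok T w M mem v ∧ b.ok T w M mem v ∧
  a.val T mem v * 2 ^ b.val T mem v < 2 ^ w := Iff.rfl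
theorem ok_shr : (Ex.bin .shr a b).ok T w M mem v ↔ a.ok T w M mem v ∧ b.ok T w M mem v ∧ True :=
  Iff.rfl
theorem ok_lt : (Ex.bin .lt a b).ok T w M mem v ↔ a.ok T w M mem v ∧ b.ok T w M mem v ∧ True :=
  Iff.rfl
theorem ok_eq : (Ex.bin .eq a b).ok T w M mem v ↔ a.ok T w M mem v ∧ b.ok T w M mem v ∧ True :=
  Iff.rfl
theorem ok_pop : (Ex.pop a).ok T w M mem v ↔ a.ok T w M mem v := Iff.rfl
theorem ok_ld : (Ex.ld a b).ok T w M mem v ↔ a.ok T w M mem v ∧ b.ok T w M mem v ∧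
  b.val T mem v ≤ w ∧ a.val T mem v + b.val T mem v ≤ M := Iff.rfl
theorem ok_qry : (Ex.qry q a b).ok T w M mem v ↔ a.ok T w M mem v ∧ b.ok T w M mem v ∧
  answer T q (a.val T mem v) (b.val T mem v) < 2 ^ w := Iff.rfl

theorem cost_var : (Ex.var k).cost = 2 := rfl
theorem cost_num : (no_index (OfNat.ofNat k) : Ex).cost = 1 := rfl
theorem cost_add : (a + b).cost = a.cost + b.cost + 1 := rfl
theorem cost_sub : (a - b).cost = a.cost + b.cost + 1 := rfl
theorem cost_mul : (a * b).cost = a.cost + b.cost + 1 := rfl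
theorem cost_div : (a / b).cost = a.cost + b.cost + 1 := rfl
theorem cost_mod : (a % b).cost = a.cost + b.cost + 1 := rfl
theorem cost_bin (o : BinOp) : (Ex.bin o a b).cost = a.cost + b.cost + 1 := rfl
theorem cost_pop : (Ex.pop a).cost = a.cost + 1 := rfl
theorem cost_ld : (Ex.ld a b).cost = a.cost + b.cost + 1 := rfl
theorem cost_qry : (Ex.qry q a b).cost = a.cost + b.cost + 1 := rfl

variable (s : St) (x l y : ℕ) (o : Code)

theorem set_v : (s.set x y k).v = Function.update s.v x y := rfl
theorem set_mem : (s.set x y k).mem = s.mem := rfl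
theorem set_out : (s.set x y k).out = s.out := rfl
theorem set_time : (s.set x y k).time = s.time + k := rfl
theorem tick_v : (s.tick k).v = s.v := rfl
theorem tick_mem : (s.tick k).mem = s.mem := rfl
theorem tick_out : (s.tick k).out = s.out := rfl
theorem tick_time : (s.tick k).time = s.time + k := rfl
theorem put_v : (s.put x l y k).v = s.v := rfl
theorem put_mem : (s.put x l y k).mem = writeField s.mem x l y := rfl
theorem put_out : (s.put x l y k).out = s.out := rfl
theorem put_time : (s.put x l y k).time = s.time + k := rfl
theorem emit_v : (s.emit o k).v = s.v := rfl
theorem emit_mem : (s.emit o k).mem = s.mem := rfl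
theorem emit_out : (s.emit o k).out = s.out ++ [o] := rfl
theorem emit_time : (s.emit o k).time = s.time + k := rfl

end Simp

attribute [simp] val_var val_num val_add val_sub val_mul val_div val_mod val_shl val_shr val_lt
  val_eq val_pop val_ld val_qry ok_var ok_num ok_add ok_sub ok_mul ok_div ok_mod ok_shl ok_shr
  ok_lt ok_eq ok_pop ok_ld ok_qry cost_var cost_num cost_add cost_sub cost_mul cost_div cost_mod
  cost_bin cost_pop cost_ld cost_qry set_v set_mem set_out set_time tick_v tick_mem tick_out
  tick_time put_v put_mem put_out put_time emit_v emit_mem emit_out emit_time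

/-- The variables that a program assigns to. -/
def Cmd.writes : Cmd → List ℕ
  | assign x _ => [x]
  | seq c₁ c₂ => c₁.writes ++ c₂.writes
  | ite _ c₁ c₂ => c₁.writes ++ c₂.writes
  | loop _ c => c.writes
  | _ => []

@[simp] theorem writes_append (c₁ c₂ : Cmd) : (c₁ ++ c₂).writes = c₁.writes ++ c₂.writes := rfl

/-- The program does not write to the output. -/
def Cmd.silent : Cmd → Bool
  | seq c₁ c₂ => c₁.silent && c₂.silent
  | ite _ c₁ c₂ => c₁.silent && c₂.silent
  | loop _ c => c.silent
  | putFresh _ => false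
  | putRef _ _ => false
  | _ => true

/-- The program does not write to the memory. -/
def Cmd.readOnly : Cmd → Bool
  | seq c₁ c₂ => c₁.readOnly && c₂.readOnly
  | ite _ c₁ c₂ => c₁.readOnly && c₂.readOnly
  | loop _ c => c.readOnly
  | store _ _ _ => false
  | _ => true

theorem Ev.frame {c : Cmd} {s s' : St} (h : Ev T w M c s s') :
    (∀ r, r ∉ c.writes → s'.v r = s.v r) ∧ (c.silent → s'.out = s.out) ∧
      (c.readOnly → s'.mem = s.mem) := by
  induction h with
  | assign h =>
    refine ⟨fun r hr => ?_, fun _ => rfl, fun _ => rfl⟩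
    rw [set_v, Function.update_of_ne]
    simpa [Cmd.writes] using hr
  | store => exact ⟨fun r _ => rfl, fun _ => rfl, fun h => absurd h (by simp [Cmd.readOnly])⟩
  | seq _ _ ih1 ih2 =>
    simp only [Cmd.writes, List.mem_append, not_or, Cmd.silent, Cmd.readOnly, Bool.and_eq_true]
    exact ⟨fun r hr => (ih2.1 r hr.2).trans (ih1.1 r hr.1),
      fun h => (ih2.2.1 h.2).trans (ih1.2.1 h.1), fun h => (ih2.2.2 h.2).trans (ih1.2.2 h.1)⟩
  | iteTrue _ _ _ ih =>
    simp only [Cmd.writes, List.mem_append, not_or, Cmd.silent, Cmd.readOnly, Bool.and_eq_true]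
    exact ⟨fun r hr => ih.1 r hr.1, fun h => ih.2.1 h.1, fun h => ih.2.2 h.1⟩
  | iteFalse _ _ _ ih =>
    simp only [Cmd.writes, List.mem_append, not_or, Cmd.silent, Cmd.readOnly, Bool.and_eq_true]
    exact ⟨fun r hr => ih.1 r hr.2, fun h => ih.2.1 h.2, fun h => ih.2.2 h.2⟩
  | loopTrue _ _ _ _ ih1 ih2 =>
    exact ⟨fun r hr => (ih2.1 r hr).trans (ih1.1 r hr),
      fun h => (ih2.2.1 h).trans (ih1.2.1 h), fun h => (ih2.2.2 h).trans (ih1.2.2 h)⟩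
  | loopFalse => exact ⟨fun r _ => rfl, fun _ => rfl, fun _ => rfl⟩
  | putFresh => exact ⟨fun r _ => rfl, fun h => absurd h (by simp [Cmd.silent]), fun _ => rfl⟩
  | putRef => exact ⟨fun r _ => rfl, fun h => absurd h (by simp [Cmd.silent]), fun _ => rfl⟩
  | skip => exact ⟨fun r _ => rfl, fun _ => rfl, fun _ => rfl⟩

/-- Total correctness with the facts about unmodified parts of the state. -/
theorem wp.use {c : Cmd} {Q Q' : St → Prop} {s : St} (h : wp T w M c Q s)
    (hQ : ∀ s', (∀ r, r ∉ c.writes → s'.v r = s.v r) → (c.silent → s'.out = s.out) →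
      (c.readOnly → s'.mem = s.mem) → Q s' → Q' s') : wp T w M c Q' s :=
  let ⟨s', h1, h2⟩ := h; ⟨s', h1, hQ s' h1.frame.1 h1.frame.2.1 h1.frame.2.2 h2⟩

/-! #### Bit lengths and powers -/

/-- Assign the bit length of variable `x` to variable `y`, using the variable `z`. -/
def sizeC (x y z : ℕ) : Cmd :=
  .assign y 0 ++ .assign z (.var x) ++
  .loop (.var z) (.assign z (.var z / 2) ++ .assign y (.var y + 1))

theorem size_div_two {x : ℕ} (hx : x ≠ 0) : Nat.size x = Nat.size (x / 2) + 1 := by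
  have h := Nat.bit_bodd_div2 x
  have hx' : Nat.bit x.bodd x.div2 ≠ 0 := by rwa [h]
  conv_lhs => rw [← h, Nat.size_bit hx']
  rw [Nat.div2_val]

theorem size_le_self (x : ℕ) : Nat.size x ≤ x := Nat.size_le.2 Nat.lt_two_pow_self

theorem wp_sizeC {x y z : ℕ} (hyz : y ≠ z) (hxy : x ≠ y) {s : St} (h2 : 2 < 2 ^ w)
    (hx : s.v x < 2 ^ w) :
    wp T w M (sizeC x y z) (fun s' => s'.v y = Nat.size (s.v x) ∧
      s'.time ≤ s.time + 11 + 16 * Nat.size (s.v x)) s := by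
  have hsz := size_le_self (s.v x)
  refine wp_seq (wp_seq (wp_assign ?_ (wp_assign ?_ ?_)))
  · simp only [ok_num]; omega
  · simp only [ok_var]
  refine wp_loop (Nat.size (s.v x)) (fun i s' => s'.v y = i ∧
    Nat.size (s'.v z) + i = Nat.size (s.v x) ∧ s'.time ≤ s.time + 7 + 16 * i) ?_ ?_ ?_
  · rintro i hi s' ⟨h1, h3, h4⟩
    have h5 : s'.v z ≠ 0 := by
      intro h
      rw [h] at h3
      simp at h3; omega
    refine ⟨by simp only [ok_var], by simpa only [val_var] using h5, ?_⟩
    refine wp_seq (wp_assign ?_ (wp_assign ?_ ⟨?_, ?_, ?_⟩))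
    · simpa only [ok_div, ok_var, ok_num, true_and, and_true] using h2
    · simp only [ok_add, ok_var, ok_num, val_var, val_num, set_v, tick_v,
        Function.update_of_ne hyz, h1]
      refine ⟨trivial, by omega, by omega⟩
    · simp [val_add, val_var, val_num, set_v, tick_v, Function.update_of_ne hyz, h1]
    · rw [size_div_two h5] at h3
      simp [val_div, val_var, val_num, set_v, tick_v, Function.update_of_ne hyz.symm]
      omega
    · simp only [set_time, tick_time, cost_add, cost_div, cost_var, cost_num]; omega
  · rintro s' ⟨h1, h3, h4⟩
    have h5 : s'.v z = 0 := by
      have : Nat.size (s'.v z) = 0 := by omega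
      exact Nat.size_eq_zero.1 this
    refine ⟨by simp only [ok_var], by simpa only [val_var] using h5, h1, ?_⟩
    simp only [tick_time, cost_var]; omega
  · simp [set_v, set_time, Function.update_of_ne hyz, val_var, val_num, cost_var, cost_num,
      Function.update_of_ne hxy]

end Tools

end LZ

namespace LZ

/-! ### Parameters and memory layout -/

section Parameters

/-- The bit length of the text length. -/
def pL (n : ℕ) : ℕ := Nat.size n
/-- The number of entries per block of a packed array. -/
def pg (n : ℕ) : ℕ := Nat.size (pL n)
/-- The number of bits per block of the compressed bit vector. -/
def pb (n : ℕ) : ℕ := pL n / 8 + 1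
/-- The width of the fields that belong to a block. -/
def pv (n : ℕ) : ℕ := 2 * pg n
/-- The width of fields that hold text positions or addresses. -/
def pw (n : ℕ) : ℕ := pL n + 1
/-- The width of the low parts of packed entries. -/
def pt (n : ℕ) : ℕ := pL n - 1 - pg n
/-- The base of the high parts of packed entries. -/
def pH (n : ℕ) : ℕ := n / 2 ^ pt n + 1
/-- The width of the field for the high parts of a packed block. -/
def pe (n : ℕ) : ℕ := Nat.size (pH n ^ pg n)
/-- The width of a packed block. -/
def pB (n : ℕ) : ℕ := pe n + pg n * pt n
/-- The number of patterns of a block. -/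
def pP (n : ℕ) : ℕ := 2 ^ pb n
/-- The number of blocks of the bit vector. -/
def pK (n : ℕ) : ℕ := n / pb n + 1

/-- Memory map. The table that encodes patterns starts at address `0`. It is followed by the
decoding table, the counters of the classes, the code lengths, the powers of `pH n`, the block and
superblock directories and the plain bit vector. The region from `aSTR n` on holds the list of ranks
in pass 1, and later the codes of the compressed bit vector followed by the array of labels. -/
def aDEC (n : ℕ) : ℕ := pP n * pw n
def aCNT (n : ℕ) : ℕ := aDEC n + (pb n + 1) * pP n * pw n
def aLEN (n : ℕ) : ℕ := aCNT n + (pb n + 1) * pw n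
def aPOW (n : ℕ) : ℕ := aLEN n + (pb n + 1) * pw n
def aBLK (n : ℕ) : ℕ := aPOW n + pg n * pe n
def aSUP (n : ℕ) : ℕ := aBLK n + 3 * pK n * pv n
def aBV (n : ℕ) : ℕ := aSUP n + 2 * (pK n / pL n + 1) * pw n
def aSTR (n : ℕ) : ℕ := aBV n + pK n * pb n

variable {n : ℕ}

theorem pL_pos (hn : 1 ≤ n) : 1 ≤ pL n := Nat.size_pos.2 hn

theorem lt_two_pow_pL (n : ℕ) : n < 2 ^ pL n := Nat.lt_size_self n

theorem pL_le (n : ℕ) : pL n ≤ n := size_le_self n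

theorem two_pow_pL_le (hn : 1 ≤ n) : 2 ^ (pL n - 1) ≤ n := by
  have := pL_pos hn
  exact Nat.lt_size.1 (show pL n - 1 < Nat.size n by unfold pL at *; omega)

theorem pg_pos (hn : 1 ≤ n) : 1 ≤ pg n := Nat.size_pos.2 (pL_pos hn)

theorem pL_lt (n : ℕ) : pL n < 2 ^ pg n := Nat.lt_size_self _

theorem pg_le (n : ℕ) : pg n ≤ pL n := size_le_self _

theorem two_pow_pg_le (hn : 1 ≤ n) : 2 ^ (pg n - 1) ≤ pL n := by
  have := pg_pos hn
  exact Nat.lt_size.1 (show pg n - 1 < Nat.size (pL n) by unfold pg at *; omega)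

theorem mul_succ_le_two_pow (g : ℕ) : (g + 1) * g ≤ 2 * 2 ^ g := by
  induction g with
  | zero => simp
  | succ g ih =>
    have : g + 1 ≤ 2 ^ g := Nat.lt_two_pow_self
    rw [pow_succ]
    nlinarith

theorem pg_mul_le (hn : 1 ≤ n) : (pg n + 1) * pg n ≤ 4 * pL n := by
  have h1 := mul_succ_le_two_pow (pg n)
  have h2 := two_pow_pg_le hn
  have h3 := pg_pos hn
  have : 2 ^ pg n = 2 * 2 ^ (pg n - 1) := by rw [← pow_succ']; congr 1; omega
  omega

theorem pb_pos (n : ℕ) : 1 ≤ pb n := by unfold pb; omega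

theorem pb_le (hn : 1 ≤ n) : pb n ≤ pL n := by
  have := pL_pos hn
  unfold pb; omega

theorem pH_pos (n : ℕ) : 0 < pH n := Nat.succ_pos _

theorem pH_le (n : ℕ) : pH n ≤ 2 ^ (pg n + 1) := by
  have h1 := lt_two_pow_pL n
  unfold pH
  have : n < 2 ^ pt n * 2 ^ (pg n + 1) := by
    rw [← pow_add]
    exact h1.trans_le (Nat.pow_le_pow_right (by omega) (by unfold pt; omega))
  exact Nat.succ_le_of_lt (Nat.div_lt_of_lt_mul this)

theorem div_lt_pH {x : ℕ} (h : x ≤ n) : x / 2 ^ pt n < pH n :=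
  Nat.lt_succ_of_le (Nat.div_le_div_right h)

theorem pow_lt_pe (n : ℕ) : pH n ^ pg n < 2 ^ pe n := Nat.lt_size_self _

/-- The base is at most `2 ^ (pg n + 1)`, so the joint number has at most about `pg n * (pg n + 1)`
bits. As `pg n` is the bit length of `pL n`, this is linear in `pL n` (`pg_mul_le`), and the high
parts of a block can be handled in one word. -/
theorem pe_le (hn : 1 ≤ n) : pe n ≤ 4 * pL n + 1 := by
  unfold pe
  rw [Nat.size_le]
  refine (Nat.pow_le_pow_left (pH_le n) _).trans_lt ?_
  rw [← pow_mul]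
  have := pg_mul_le hn
  exact Nat.pow_lt_pow_right (by omega) (by omega)

theorem pe_pos (n : ℕ) : 1 ≤ pe n := Nat.size_pos.2 (pow_pos (pH_pos n) _)

theorem two_pow_pe_le (n : ℕ) : 2 ^ (pe n - 1) ≤ pH n ^ pg n := by
  have := pe_pos n
  exact Nat.lt_size.1 (show pe n - 1 < Nat.size (pH n ^ pg n) by unfold pe at *; omega)

theorem pt_le (n : ℕ) : pt n ≤ pL n := by unfold pt; omega

/-- A superblock consists of `pL n` blocks of `pb n` bits, so pointers and ranks relative to its
start fit into fields of `pv n` bits. -/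
theorem pb_mul_lt (hn : 1 ≤ n) : pb n * pL n < 2 ^ pv n := by
  have h1 := pb_le hn
  have h2 := pL_lt n
  unfold pv
  rw [two_mul, pow_add]
  have := pL_pos hn
  calc pb n * pL n ≤ pL n * pL n := Nat.mul_le_mul_right _ h1
    _ < 2 ^ pg n * 2 ^ pg n := Nat.mul_lt_mul'' h2 h2

theorem add_pb_lt (hn : 1 ≤ n) : n + pb n < 2 ^ pw n := by
  have h1 := lt_two_pow_pL n
  have h2 := pb_le hn
  have h3 := pL_le n
  unfold pw
  rw [pow_succ]; omega

theorem pP_le (hn : 1 ≤ n) : pP n ≤ 2 ^ pL n := Nat.pow_le_pow_right (by omega) (pb_le hn)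

theorem pP_lt (hn : 1 ≤ n) : pP n < 2 ^ pw n :=
  Nat.pow_lt_pow_right (by omega) (by have := pb_le hn; unfold pw; omega)

theorem pP_pos (n : ℕ) : 0 < pP n := Nat.two_pow_pos _

theorem pP_le_two_mul (hn : 1 ≤ n) : pP n ≤ 2 * n := by
  refine (pP_le hn).trans ?_
  have h1 := two_pow_pL_le hn
  have h3 := pL_pos hn
  have : 2 ^ pL n = 2 * 2 ^ (pL n - 1) := by rw [← pow_succ']; congr 1; omega
  omega

/-- Strict, because the bit positions are ranks of inner nodes, which start at `1` and can be as
large as `n`. -/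
theorem lt_pK_mul (n : ℕ) : n < pK n * pb n := by
  have := pb_pos n
  unfold pK
  rw [mul_comm]
  exact Nat.lt_mul_div_succ n this

theorem pK_mul_le (n : ℕ) : pK n * pb n ≤ n + pb n := by
  unfold pK
  rw [add_mul, one_mul]
  have := Nat.div_mul_le_self n (pb n)
  omega

theorem pK_le (hn : 1 ≤ n) : pK n ≤ 2 * n := by
  have := Nat.div_le_self n (pb n)
  unfold pK; omega

/-- The parameters are held by the first twenty variables. -/
structure Params (n : ℕ) (v : ℕ → ℕ) : Prop where
  hn : v 0 = n
  hL : v 1 = pL n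
  hg : v 2 = pg n
  hb : v 3 = pb n
  hv : v 4 = pv n
  hw : v 5 = pw n
  ht : v 6 = pt n
  hH : v 7 = pH n
  he : v 8 = pe n
  hB : v 9 = pB n
  hP : v 10 = pP n
  hK : v 11 = pK n
  hDEC : v 12 = aDEC n
  hCNT : v 13 = aCNT n
  hLEN : v 14 = aLEN n
  hPOW : v 15 = aPOW n
  hBLK : v 16 = aBLK n
  hSUP : v 17 = aSUP n
  hBV : v 18 = aBV n
  hSTR : v 19 = aSTR n

theorem Params.congr {v v' : ℕ → ℕ} (h : Params n v) (hv : ∀ r < 20, v' r = v r) :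
    Params n v' := by
  constructor <;> rw [hv _ (by omega)]
  exacts [h.hn, h.hL, h.hg, h.hb, h.hv, h.hw, h.ht, h.hH, h.he, h.hB, h.hP, h.hK, h.hDEC, h.hCNT, h.hLEN, h.hPOW,
    h.hBLK, h.hSUP, h.hBV, h.hSTR]

theorem Params.update {v : ℕ → ℕ} (h : Params n v) {x : ℕ} (hx : 20 ≤ x) (a : ℕ) :
    Params n (Function.update v x a) :=
  h.congr fun r hr => Function.update_of_ne (by omega) _ _

end Parameters

/-- The assumptions under which the program is verified. -/
structure Env {σ : ℕ} (T : List (Fin σ)) (w M : ℕ) : Prop where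
  text : IsText T
  word : 16 * pL T.length ≤ w
  mem : M < 2 ^ w
  str : aSTR T.length ≤ M

/-! ### Computing the parameters on the machine -/

section Init

variable {σ : ℕ} {T : List (Fin σ)} {w M : ℕ}

theorem Env.pos (E : Env T w M) : 1 ≤ T.length := E.text.pos

theorem Env.pow_le (E : Env T w M) : 2 ^ (16 * pL T.length) ≤ 2 ^ w :=
  Nat.pow_le_pow_right (by omega) E.word

theorem Env.big (E : Env T w M) : 32768 * (T.length + 1) ≤ 2 ^ w := by
  refine le_trans ?_ E.pow_le
  have h1 := lt_two_pow_pL T.length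
  have h2 := pL_pos E.pos
  calc 32768 * (T.length + 1) ≤ 2 ^ 15 * 2 ^ pL T.length := by
        exact Nat.mul_le_mul (by norm_num) h1
    _ = 2 ^ (15 + pL T.length) := (pow_add _ _ _).symm
    _ ≤ _ := Nat.pow_le_pow_right (by omega) (by omega)

theorem Env.sixteen_le (E : Env T w M) : 16 ≤ w := by
  have := E.word
  have := pL_pos E.pos
  omega

theorem Env.answer_lt (E : Env T w M) (q : Query) (a b : ℕ) : answer T q a b < 2 ^ w := by
  have := answer_le E.text q a b
  have := E.big
  omega

/-- Compute the parameters that do not concern the memory layout. -/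
def initSizes : Cmd :=
  .assign 0 (.qry .leafRank (.qry .rightmostLeaf 1 0) 0) ++
  (sizeC 0 1 31 ++ (sizeC 1 2 31 ++
  (.assign 3 (.var 1 / 8 + 1) ++ (.assign 4 (2 * .var 2) ++ (.assign 5 (.var 1 + 1) ++
  (.ite (.lt (.var 2) (.var 1)) (.assign 6 (.var 1 - 1 - .var 2)) (.assign 6 0) ++
  (.assign 7 (.var 0 / .shl 1 (.var 6) + 1) ++
  (.assign 30 1 ++ (.assign 31 0 ++
  (.loop (.lt (.var 31) (.var 2)) (.assign 30 (.var 30 * .var 7) ++ .assign 31 (.var 31 + 1)) ++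
  sizeC 30 8 31))))))))))

/-- Compute the memory layout. -/
def initLayout : Cmd :=
  .assign 9 (.var 8 + .var 2 * .var 6) ++ (.assign 10 (.shl 1 (.var 3)) ++
  (.assign 11 (.var 0 / .var 3 + 1) ++ (.assign 12 (.var 10 * .var 5) ++
  (.assign 13 (.var 12 + (.var 3 + 1) * .var 10 * .var 5) ++
  (.assign 14 (.var 13 + (.var 3 + 1) * .var 5) ++
  (.assign 15 (.var 14 + (.var 3 + 1) * .var 5) ++ (.assign 16 (.var 15 + .var 2 * .var 8) ++
  (.assign 17 (.var 16 + 3 * .var 11 * .var 4) ++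
  (.assign 18 (.var 17 + 2 * (.var 11 / .var 1 + 1) * .var 5) ++
  .assign 19 (.var 18 + .var 11 * .var 3))))))))))

theorem wp_initSizes (E : Env T w M) (s : St) :
    wp T w M initSizes (fun s' => (s'.v 0 = T.length ∧ s'.v 1 = pL T.length ∧
      s'.v 2 = pg T.length ∧ s'.v 3 = pb T.length ∧ s'.v 4 = pv T.length ∧ s'.v 5 = pw T.length ∧
      s'.v 6 = pt T.length ∧ s'.v 7 = pH T.length ∧ s'.v 8 = pe T.length) ∧
      s'.time ≤ s.time + 400 * T.length) s := by
  have hbig := E.big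
  have hw16 := E.sixteen_le
  have hn := E.pos
  have h1 := pL_le T.length
  have h2 := pg_le T.length
  have h3 := pL_pos hn
  have h4 := pg_pos hn
  have h5 := pe_le hn
  have hpt : 2 ^ pt T.length < 2 ^ w := Nat.pow_lt_pow_right (by omega) (by
    have := pt_le T.length; have := E.word; omega)
  have hHe : 2 ^ pe T.length < 2 ^ w := Nat.pow_lt_pow_right (by omega) (by
    have := E.word; omega)
  have hHi : ∀ i ≤ pg T.length, pH T.length ^ i < 2 ^ w := fun i hi =>
    (Nat.pow_le_pow_right (pH_pos _) hi).trans_lt ((pow_lt_pe _).trans hHe)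
  have hdiv : T.length / 2 ^ pt T.length ≤ T.length := Nat.div_le_self _ _
  refine wp_seq (wp_assign ?_ ?_)
  · simp only [ok_qry, ok_num, val_qry, val_num]
    exact ⟨⟨by omega, by omega, E.answer_lt _ _ _⟩, by omega, E.answer_lt _ _ _⟩
  simp only [val_qry, val_num, answer_length E.text]
  refine wp_seq ((wp_sizeC (by omega) (by omega) (by omega) (by simp; omega)).use ?_)
  rintro s1 f1 - - ⟨h11, h12⟩
  simp only [sizeC, writes_append, Cmd.writes] at f1
  have e0 : s1.v 0 = T.length := by rw [f1 0 (by decide)]; simp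
  simp only [set_v, Function.update_self, set_time, cost_qry, cost_num] at h11 h12
  change _ = pL _ at h11
  refine wp_seq ((wp_sizeC (by omega) (by omega) (by omega) (by omega)).use ?_)
  rintro s2 f2 - - ⟨h21, h22⟩
  simp only [sizeC, writes_append, Cmd.writes] at f2
  have e20 : s2.v 0 = T.length := by rw [f2 0 (by decide), e0]
  have e21 : s2.v 1 = pL T.length := by rw [f2 1 (by decide), h11]
  rw [h11] at h21 h22
  change _ = pg _ at h21
  change s2.time ≤ _ + 11 + 16 * pg _ at h22
  change s1.time ≤ _ + 11 + 16 * pL _ at h12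
  refine wp_seq (wp_assign ?_ (wp_seq (wp_assign ?_ (wp_seq (wp_assign ?_ (wp_seq ?_))))))
  · simp [e21]; omega
  · simp [h21]; omega
  · simp [e21]; omega
  have hb : pL T.length / 8 + 1 = pb T.length := rfl
  simp only [val_add, val_div, val_mul, val_var, val_num, set_v,
    Function.update_of_ne (show (2 : ℕ) ≠ 3 by omega),
    Function.update_of_ne (show (1 : ℕ) ≠ 3 by omega),
    Function.update_of_ne (show (1 : ℕ) ≠ 4 by omega), e21, h21, hb,
    cost_add, cost_div, cost_mul, cost_var, cost_num]
  -- The subtraction of the machine wraps around, while `pt` truncates at zero; the case distinction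
  -- supplies the zero for small texts.
  have key : ∀ Q : St → Prop, (∀ s3 : St, s3.v 0 = T.length → s3.v 1 = pL T.length →
      s3.v 2 = pg T.length → s3.v 3 = pb T.length → s3.v 4 = pv T.length →
      s3.v 5 = pw T.length → s3.v 6 = pt T.length → s3.time ≤ s2.time + 50 → Q s3) →
      wp T w M (.ite (.lt (.var 2) (.var 1)) (.assign 6 (.var 1 - 1 - .var 2)) (.assign 6 0)) Q
        (((s2.set 3 (pb T.length) (2 + 1 + 1 + 1 + 1 + 2)).set 4 (2 * pg T.length)
          (1 + 2 + 1 + 2)).set 5 (pL T.length + 1) (2 + 1 + 1 + 2)) := by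
    intro Q hQ
    refine wp_ite (by simp) (fun h => wp_assign ?_ (hQ _ ?_ ?_ ?_ ?_ ?_ ?_ ?_ ?_))
      (fun h => wp_assign ?_ (hQ _ ?_ ?_ ?_ ?_ ?_ ?_ ?_ ?_))
    all_goals simp [e20, e21, h21] at h ⊢
    all_goals first | rfl | (unfold pt; omega) | omega
  refine key _ fun s3 e0 e1 e2 e3 e4 e5 e6 ht => ?_
  refine wp_seq (wp_assign ?_ (wp_seq (wp_assign ?_ (wp_seq (wp_assign ?_ (wp_seq ?_))))))
  · simp [e0, e6]; omega
  · simp; omega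
  · simp
  refine wp_loop (pg T.length) (fun i s' => (s'.v 0 = T.length ∧ s'.v 1 = pL T.length ∧
    s'.v 2 = pg T.length ∧ s'.v 3 = pb T.length ∧ s'.v 4 = pv T.length ∧
    s'.v 5 = pw T.length ∧ s'.v 6 = pt T.length ∧ s'.v 7 = pH T.length) ∧
    s'.v 30 = pH T.length ^ i ∧ s'.v 31 = i ∧ s'.time ≤ s2.time + 80 + 30 * i) ?_ ?_ ?_
  · rintro i hi s' ⟨⟨g0, g1, g2, g3, g4, g5, g6, g7⟩, g8, g9, ht'⟩
    have := hHi (i + 1) (by omega)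
    refine ⟨by simp, by simp [g9, g2, hi], wp_seq (wp_assign ?_ (wp_assign ?_ ?_))⟩
    · simp [g8, g7, ← pow_succ, this]
    · simp [g9]; omega
    · simp [g0, g1, g2, g3, g4, g5, g6, g7, g8, g9, pow_succ]; omega
  · rintro s' ⟨⟨g0, g1, g2, g3, g4, g5, g6, g7⟩, g8, g9, ht'⟩
    refine ⟨by simp, by simp [g9, g2], ?_⟩
    refine (wp_sizeC (by omega) (by omega) (by omega) (by simp [g8]; exact hHi _ le_rfl)).use ?_
    rintro s4 f4 - - ⟨h41, h42⟩
    simp only [sizeC, writes_append, Cmd.writes, tick_v, tick_time] at f4 h41 h42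
    rw [g8] at h41 h42
    change _ = pe _ at h41
    change s4.time ≤ _ + 11 + 16 * pe _ at h42
    refine ⟨⟨?_, ?_, ?_, ?_, ?_, ?_, ?_, ?_, h41⟩, ?_⟩
    · rw [f4 _ (by decide), g0]
    · rw [f4 _ (by decide), g1]
    · rw [f4 _ (by decide), g2]
    · rw [f4 _ (by decide), g3]
    · rw [f4 _ (by decide), g4]
    · rw [f4 _ (by decide), g5]
    · rw [f4 _ (by decide), g6]
    · rw [f4 _ (by decide), g7]
    · simp at h42 h22 h12 ⊢; omega
  · simp [e0, e1, e2, e3, e4, e5, e6]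
    exact ⟨rfl, by omega⟩

theorem wp_initLayout (E : Env T w M) {s : St} (h : s.v 0 = T.length ∧ s.v 1 = pL T.length ∧
      s.v 2 = pg T.length ∧ s.v 3 = pb T.length ∧ s.v 4 = pv T.length ∧ s.v 5 = pw T.length ∧
      s.v 6 = pt T.length ∧ s.v 7 = pH T.length ∧ s.v 8 = pe T.length) :
    wp T w M initLayout (fun s' => Params T.length s'.v ∧ s'.time ≤ s.time + 130) s := by
  obtain ⟨h0, h1, h2, h3, h4, h5, h6, h7, h8⟩ := h
  have hbig := E.big
  have hw16 := E.sixteen_le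
  have hn := E.pos
  have hM := E.str.trans_lt E.mem
  have hL := pL_pos hn
  have hg := pg_pos hn
  have hb := pb_pos T.length
  have hbL := pb_le hn
  have hgL := pg_le T.length
  have hLn := pL_le T.length
  have hv : 1 ≤ pv T.length := by unfold pv; omega
  have hw : 1 ≤ pw T.length := by unfold pw; omega
  have he := pe_pos T.length
  have hK : 1 ≤ pK T.length := Nat.succ_pos _
  have hKn := pK_le hn
  have hP := pP_pos T.length
  have hPn := pP_le_two_mul hn
  have hpP : 2 ^ pb T.length = pP T.length := rfl
  have hpK : T.length / pb T.length + 1 = pK T.length := rfl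
  have heL := pe_le hn
  have htL := pt_le T.length
  -- Excludes overflow in the width of a packed block: from `g + 1 ≤ 2 ^ g` and `t ≤ 2 ^ t` the
  -- product `(g + 1) * t` is at most `2 ^ (L - 1)`, unless `t` is zero. Here `g`, `t`, `L` are the
  -- parameters `pg`, `pt`, `pL`.
  have hgt : pg T.length * pt T.length ≤ 4 * T.length := by
    have h1 := pg_mul_le hn
    have h2 : (pg T.length + 1) * pt T.length ≤ 2 ^ pL T.length * 2 := by
      have e1 : pg T.length + 1 ≤ 2 ^ pg T.length := Nat.lt_two_pow_self
      have e2 : pt T.length ≤ 2 ^ pt T.length := Nat.lt_two_pow_self.le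
      by_cases h : pt T.length = 0
      · rw [h]; simp
      calc _ ≤ 2 ^ pg T.length * 2 ^ pt T.length := Nat.mul_le_mul e1 e2
        _ = 2 ^ (pL T.length - 1) := by
          have e3 : pt T.length = pL T.length - 1 - pg T.length := rfl
          rw [← pow_add]; congr 1; omega
        _ ≤ 2 ^ pL T.length * 2 := by
          rw [← pow_succ]; exact Nat.pow_le_pow_right (by omega) (by omega)
    have h3 := two_pow_pL_le hn
    have e3 : 2 ^ pL T.length = 2 * 2 ^ (pL T.length - 1) := by rw [← pow_succ']; congr 1; omega
    have h4 : pg T.length * pt T.length ≤ (pg T.length + 1) * pt T.length :=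
      Nat.mul_le_mul_right _ (by omega)
    omega
  have eB : pB T.length = pe T.length + pg T.length * pt T.length := rfl
  have eDEC : aDEC T.length = pP T.length * pw T.length := rfl
  have eCNT : aCNT T.length = aDEC T.length + (pb T.length + 1) * pP T.length * pw T.length := rfl
  have eLEN : aLEN T.length = aCNT T.length + (pb T.length + 1) * pw T.length := rfl
  have ePOW : aPOW T.length = aLEN T.length + (pb T.length + 1) * pw T.length := rfl
  have eBLK : aBLK T.length = aPOW T.length + pg T.length * pe T.length := rfl
  have eSUP : aSUP T.length = aBLK T.length + 3 * pK T.length * pv T.length := rfl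
  have eBV : aBV T.length = aSUP T.length +
    2 * (pK T.length / pL T.length + 1) * pw T.length := rfl
  have eSTR : aSTR T.length = aBV T.length + pK T.length * pb T.length := rfl
  have m1 := Nat.le_mul_of_pos_right (pP T.length) hw
  have m2 := Nat.le_mul_of_pos_right ((pb T.length + 1) * pP T.length) hw
  have m3 := Nat.le_mul_of_pos_right (3 * pK T.length) hv
  have m4 := Nat.le_mul_of_pos_right (2 * (pK T.length / pL T.length + 1)) hw
  have m5 : pK T.length / pL T.length ≤ pK T.length := Nat.div_le_self _ _
  have m6 : T.length / pb T.length ≤ T.length := Nat.div_le_self _ _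
  unfold initLayout
  refine wp_seq (wp_assign ?_ (wp_seq (wp_assign ?_ (wp_seq (wp_assign ?_ (wp_seq (wp_assign ?_
    (wp_seq (wp_assign ?_ (wp_seq (wp_assign ?_ (wp_seq (wp_assign ?_ (wp_seq (wp_assign ?_
    (wp_seq (wp_assign ?_ (wp_seq (wp_assign ?_ (wp_assign ?_ ?_))))))))))))))))))))
  all_goals simp [h0, h1, h2, h3, h4, h5, h6, h8, hpP, hpK, ← eB, ← eDEC, ← eCNT, ← eLEN,
    ← ePOW, ← eBLK, ← eSUP, ← eBV, ← eSTR]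
  on_goal 12 => constructor <;> simp [h0, h1, h2, h3, h4, h5, h6, h7, h8]
  all_goals omega

/-- Compute the parameters. -/
def initParams : Cmd := initSizes ++ initLayout

theorem wp_initParams (E : Env T w M) (s : St) :
    wp T w M initParams (fun s' => Params T.length s'.v ∧
      s'.time ≤ s.time + 530 * T.length) s := by
  refine wp_seq ((wp_initSizes E s).mono fun s1 h1 => (wp_initLayout E h1.1).mono fun s2 h2 =>
    ⟨h2.1, ?_⟩)
  have := E.pos
  have := h1.2
  have := h2.2
  omega

end Init

end LZ

namespace LZ

/-! ### Tables -/

/-- The entry with index `i` of an array. -/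
def fld (mem : ℕ → Bool) (base l i : ℕ) : ℕ := readField mem (base + i * l) l

theorem fld_put (mem : ℕ → Bool) (base l i j x : ℕ) :
    fld (writeField mem (base + j * l) l x) base l i =
      if i = j then x % 2 ^ l else fld mem base l i := by
  unfold fld
  split_ifs with h
  · rw [h, readField_writeField]
  · rw [readField_writeField_of_disjoint]
    rcases Nat.lt_or_gt_of_ne h with h' | h'
    · have := index_le (w := l) h'; omega
    · have := index_le (w := l) h'; omega

theorem fld_congr {mem mem' : ℕ → Bool} {base l i N : ℕ} (hi : i < N)
    (h : ∀ k, base ≤ k → k < base + N * l → mem' k = mem k) :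
    fld mem' base l i = fld mem base l i := by
  have := index_le (w := l) hi
  exact readField_congr fun k h1 h2 => h k (by omega) (by omega)

theorem fld_below {mem : ℕ → Bool} {base l i N a : ℕ} (l' x : ℕ) (hi : i < N)
    (h : base + N * l ≤ a) : fld (writeField mem a l' x) base l i = fld mem base l i :=
  fld_congr hi fun k _ h2 => writeField_of_not_mem _ _ (Or.inl (by omega))

theorem fld_above {mem : ℕ → Bool} {base l i a l' : ℕ} (x : ℕ) (h : a + l' ≤ base) :
    fld (writeField mem a l' x) base l i = fld mem base l i :=
  fld_congr (Nat.lt_succ_self i) fun k h1 _ => writeField_of_not_mem _ _ (Or.inr (by omega))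

section Access

variable {σ : ℕ} {T : List (Fin σ)} {w M : ℕ}

theorem ok_get (hM : M < 2 ^ w) {mem : ℕ → Bool} {v : ℕ → ℕ} {base l i : Ex} (N : ℕ)
    (hb : base.ok T w M mem v) (hl : l.ok T w M mem v) (hi : i.ok T w M mem v)
    (hlw : l.val T mem v ≤ w) (hiN : i.val T mem v < N)
    (h : base.val T mem v + N * l.val T mem v ≤ M) : (Ex.get base l i).ok T w M mem v := by
  have := index_le (w := l.val T mem v) hiN
  simp only [ok_ld, ok_add, ok_mul, val_add, val_mul]
  exact ⟨⟨hb, ⟨hi, hl, by omega⟩, by omega⟩, hl, hlw, by omega⟩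

theorem val_get (mem : ℕ → Bool) (v : ℕ → ℕ) (base l i : Ex) :
    (Ex.get base l i).val T mem v =
      fld mem (base.val T mem v) (l.val T mem v) (i.val T mem v) := rfl

theorem wp_put (hM : M < 2 ^ w) {s : St} {base l i x : Ex} {Q : St → Prop} (N : ℕ)
    (hb : s.ok T w M base) (hl : s.ok T w M l) (hi : s.ok T w M i) (hx : s.ok T w M x)
    (hlw : s.val T l ≤ w) (hiN : s.val T i < N) (h : s.val T base + N * s.val T l ≤ M)
    (hQ : Q (s.put (s.val T base + s.val T i * s.val T l) (s.val T l) (s.val T x)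
      (base.cost + i.cost + 2 * l.cost + x.cost + 3))) :
    wp T w M (Cmd.put base l i x) Q s := by
  have := index_le (w := s.val T l) hiN
  refine wp_store ⟨hb, ⟨hi, hl, ?_⟩, ?_⟩ hl hx hlw ?_ ?_
  · change s.val T i * s.val T l < _; omega
  · change s.val T base + s.val T i * s.val T l < _; omega
  · change s.val T base + s.val T i * s.val T l + _ ≤ _; omega
  · have e : (base + i * l).cost + l.cost + x.cost + 1 =
        base.cost + i.cost + 2 * l.cost + x.cost + 3 := by
      simp only [cost_add, cost_mul]; ring
    rw [e]
    exact hQ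

theorem Params.frame {n : ℕ} {v v' : ℕ → ℕ} (h : Params n v) {c : Cmd}
    (hv : ∀ r, r ∉ c.writes → v' r = v r) (hc : ∀ r ∈ c.writes, 20 ≤ r) : Params n v' :=
  h.congr fun r hr => hv r fun hr' => by have := hc r hr'; omega

end Access

/-! #### Enumeration of the patterns with a given number of ones -/

/-- The number of patterns below `x` with `c` ones. -/
def popCount (x c : ℕ) : ℕ := ((Finset.range x).filter (pop · = c)).card

/-- The index of a pattern among the patterns with the same number of ones. -/
def enc (x : ℕ) : ℕ := popCount x (pop x)

theorem popCount_zero (c : ℕ) : popCount 0 c = 0 := rfl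

theorem popCount_succ (x c : ℕ) :
    popCount (x + 1) c = popCount x c + if pop x = c then 1 else 0 := by
  unfold popCount
  rw [Finset.range_add_one, Finset.filter_insert]
  split_ifs
  · rw [Finset.card_insert_of_notMem (by simp)]
  · rfl

theorem popCount_mono {x y : ℕ} (h : x ≤ y) (c : ℕ) : popCount x c ≤ popCount y c :=
  Finset.card_le_card (Finset.filter_subset_filter _ (Finset.range_subset_range.2 h))

theorem popCount_le (x c : ℕ) : popCount x c ≤ x :=
  (Finset.card_filter_le _ _).trans (Finset.card_range x).le

theorem enc_le (x : ℕ) : enc x ≤ x := popCount_le _ _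

/-- The index counts the smaller patterns of the same class, so it increases strictly within a
class. -/
theorem enc_inj {x y : ℕ} (h1 : pop x = pop y) (h2 : enc x = enc y) : x = y := by
  have key : ∀ x y, pop x = pop y → x < y → enc x < enc y := by
    intro x y h1 h
    have := popCount_mono (Nat.succ_le_of_lt h) (pop y)
    rw [Nat.succ_eq_add_one, popCount_succ, if_pos h1] at this
    unfold enc
    rw [h1]; omega
  rcases lt_trichotomy x y with h | h | h
  · have := key x y h1 h; omega
  · exact h
  · have := key y x h1.symm h; omega

theorem pop_le {x b : ℕ} (h : x < 2 ^ b) : pop x ≤ b := by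
  have := pop_readField x.testBit 0 b
  rw [readField_testBit, Nat.mod_eq_of_lt h] at this
  rw [this]
  refine (Finset.sum_le_card_nsmul _ _ 1 fun i _ => ?_).trans (by simp)
  split_ifs <;> simp

/-- The numbers below `2 * x` are `2 * y` and `2 * y + 1` with `y < x`, and the latter have one
additional one. For powers of two this becomes Pascal's rule. -/
theorem popCount_two_mul (x c : ℕ) :
    popCount (2 * x) c = popCount x c + if c = 0 then 0 else popCount x (c - 1) := by
  induction x with
  | zero => simp [popCount_zero]
  | succ x ih =>
    rw [show 2 * (x + 1) = 2 * x + 1 + 1 by ring, popCount_succ, popCount_succ, ih, popCount_succ,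
      popCount_succ, pop_two_mul_add_one, pop_two_mul]
    rcases c with _ | c
    · simp
    · simp; ring

theorem popCount_two_pow (b c : ℕ) : popCount (2 ^ b) c = b.choose c := by
  induction b generalizing c with
  | zero =>
    rw [pow_zero, show 1 = 0 + 1 from rfl, popCount_succ, popCount_zero, pop_zero]
    rcases c with _ | c <;> simp
  | succ b ih =>
    rw [pow_succ', popCount_two_mul, ih]
    rcases c with _ | c
    · simp
    · rw [Nat.choose_succ_succ]; simp [ih]; ring

/-- The number of bits needed for the indices of the patterns with `c` ones. -/
def clen (b c : ℕ) : ℕ := Nat.size (b.choose c - 1)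

theorem enc_lt {x b : ℕ} (h : x < 2 ^ b) : enc x < 2 ^ clen b (pop x) := by
  have h1 := popCount_mono (Nat.succ_le_of_lt h) (pop x)
  rw [Nat.succ_eq_add_one, popCount_succ, if_pos rfl, popCount_two_pow] at h1
  refine lt_of_le_of_lt ?_ (Nat.lt_size_self _)
  unfold enc; omega

theorem clen_le (b c : ℕ) : clen b c ≤ b := by
  unfold clen
  rw [Nat.size_le]
  have h1 : b.choose c ≤ 2 ^ b := by
    rw [← popCount_two_pow]; exact popCount_le _ _
  have := Nat.two_pow_pos b
  omega

/-- Rounding an index up to whole bits costs at most one bit; this is the summand `1` per block in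
the entropy bound. -/
theorem two_pow_clen_le {b c : ℕ} (h : c ≤ b) : 2 ^ clen b c ≤ 2 * b.choose c := by
  have h0 := Nat.choose_pos h
  rcases Nat.eq_zero_or_pos (clen b c) with h1 | h1
  · rw [h1]; omega
  · have : 2 ^ (clen b c - 1) ≤ b.choose c - 1 := Nat.lt_size.1 (by unfold clen at *; omega)
    have e : 2 ^ clen b c = 2 * 2 ^ (clen b c - 1) := by rw [← pow_succ']; congr 1; omega
    omega

/-- The index `o` is the largest one among `o + 1` patterns, so one more bit is needed exactly when
`o` does not fit into the current length. This lets the table of code lengths be maintained while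
the patterns are enumerated. -/
theorem size_succ_eq (o : ℕ) :
    Nat.size (o + 1 - 1) = Nat.size (o - 1) + if o < 2 ^ Nat.size (o - 1) then 0 else 1 := by
  rw [Nat.add_sub_cancel]
  rcases Nat.eq_zero_or_pos o with rfl | ho
  · simp
  have h1 : Nat.size (o - 1) ≤ Nat.size o := Nat.size_le_size (by omega)
  have h2 : o - 1 < 2 ^ Nat.size (o - 1) := Nat.lt_size_self _
  split_ifs with h
  · have := Nat.size_le.2 h; omega
  · have h3 : Nat.size (o - 1) < Nat.size o := Nat.lt_size.2 (by omega)
    have h4 : Nat.size o ≤ Nat.size (o - 1) + 1 := Nat.size_le.2 (by rw [pow_succ]; omega)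
    omega

section Tables

/-- The tables for the encoding and decoding of patterns and for packed arrays. -/
structure Tab (n : ℕ) (mem : ℕ → Bool) : Prop where
  enc : ∀ x < pP n, fld mem 0 (pw n) x = enc x
  dec : ∀ x < pP n, fld mem (aDEC n) (pw n) (pop x * pP n + LZ.enc x) = x
  len : ∀ c ≤ pb n, fld mem (aLEN n) (pw n) c = clen (pb n) c
  pow : ∀ i < pg n, fld mem (aPOW n) (pe n) i = pH n ^ i

theorem dec_index_lt {n x : ℕ} (hx : x < pP n) : pop x * pP n + enc x < (pb n + 1) * pP n := by
  have h1 := pop_le (b := pb n) hx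
  have h2 := enc_le x
  have h3 := index_le (w := pP n) (Nat.lt_succ_of_le h1)
  rw [Nat.succ_eq_add_one] at h3
  omega

theorem Tab.congr {n : ℕ} {mem mem' : ℕ → Bool} (h : Tab n mem)
    (hm : ∀ k < aBLK n, mem' k = mem k) : Tab n mem' := by
  have h1 : aDEC n = pP n * pw n := rfl
  have h2 : aCNT n = aDEC n + (pb n + 1) * pP n * pw n := rfl
  have h3 : aLEN n = aCNT n + (pb n + 1) * pw n := rfl
  have h4 : aPOW n = aLEN n + (pb n + 1) * pw n := rfl
  have h5 : aBLK n = aPOW n + pg n * pe n := rfl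
  refine ⟨fun x hx => ?_, fun x hx => ?_, fun c hc => ?_, fun i hi => ?_⟩
  · rw [← h.enc x hx]
    exact fld_congr hx fun k _ hk => hm k (by omega)
  · rw [fld_congr (dec_index_lt hx) fun k _ hk => hm k (by omega), h.dec x hx]
  · rw [← h.len c hc]
    exact fld_congr (Nat.lt_succ_of_le hc) fun k _ hk => hm k (by
      rw [Nat.succ_eq_add_one] at hk; omega)
  · rw [← h.pow i hi]
    exact fld_congr hi fun k _ hk => hm k (by omega)

/-- Fill the tables for the patterns. -/
def patterns : Cmd :=
  .assign 30 0 ++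
  .loop (.lt (.var 30) (.var 10)) (.assign 31 (.pop (.var 30)) ++
    (.assign 32 (.get (.var 13) (.var 5) (.var 31)) ++
    (.put 0 (.var 5) (.var 30) (.var 32) ++
    (.put (.var 12) (.var 5) (.var 31 * .var 10 + .var 32) (.var 30) ++
    (.put (.var 13) (.var 5) (.var 31) (.var 32 + 1) ++
    (.assign 33 (.get (.var 14) (.var 5) (.var 31)) ++
    (.ite (.lt (.var 32) (.shl 1 (.var 33))) .skip
      (.put (.var 14) (.var 5) (.var 31) (.var 33 + 1)) ++
    .assign 30 (.var 30 + 1))))))))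

/-- Fill the table of powers. -/
def powers : Cmd :=
  .assign 30 1 ++ (.assign 31 0 ++
  .loop (.lt (.var 31) (.var 2)) (.put (.var 15) (.var 8) (.var 31) (.var 30) ++
    (.assign 30 (.var 30 * .var 7) ++ .assign 31 (.var 31 + 1))))

variable {σ : ℕ} {T : List (Fin σ)} {w M : ℕ}

/-- The state of the tables after the patterns below `x` are processed. -/
structure PatInv (n x : ℕ) (mem : ℕ → Bool) : Prop where
  enc : ∀ y < x, fld mem 0 (pw n) y = enc y
  dec : ∀ y < x, fld mem (aDEC n) (pw n) (pop y * pP n + LZ.enc y) = y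
  cnt : ∀ c ≤ pb n, fld mem (aCNT n) (pw n) c = popCount x c
  len : ∀ c ≤ pb n, fld mem (aLEN n) (pw n) c = Nat.size (popCount x c - 1)
  free : ∀ k, aPOW n ≤ k → mem k = false

theorem Env.pw_le (E : Env T w M) : pw T.length ≤ w := by
  have := E.word
  have := pL_pos E.pos
  have : pw T.length = pL T.length + 1 := rfl
  omega

theorem Env.pe_le (E : Env T w M) : pe T.length ≤ w := by
  have := E.word
  have := pL_pos E.pos
  have := LZ.pe_le E.pos
  omega

/-- Patterns are enumerated in increasing order, so the counter of the class of `x` equals the index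
of `x` when `x` is reached. One table access thus yields the code, and no binomial coefficient is
computed. -/
theorem PatInv.step {n x : ℕ} {mem : ℕ → Bool} (h : PatInv n x mem) (hn : 1 ≤ n) (hx : x < pP n) :
    PatInv n (x + 1)
      (let m1 := writeField (writeField (writeField mem (0 + x * pw n) (pw n) (LZ.enc x))
        (aDEC n + (pop x * pP n + LZ.enc x) * pw n) (pw n) x)
        (aCNT n + pop x * pw n) (pw n) (LZ.enc x + 1)
      if LZ.enc x < 2 ^ Nat.size (LZ.enc x - 1) then m1 else
        writeField m1 (aLEN n + pop x * pw n) (pw n) (Nat.size (LZ.enc x - 1) + 1)) := by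
  have h1 : aDEC n = pP n * pw n := rfl
  have h2 : aCNT n = aDEC n + (pb n + 1) * pP n * pw n := rfl
  have h3 : aLEN n = aCNT n + (pb n + 1) * pw n := rfl
  have h4 : aPOW n = aLEN n + (pb n + 1) * pw n := rfl
  have hc := pop_le (b := pb n) hx
  have hi := dec_index_lt hx
  have hPw := pP_lt hn
  have he := enc_le x
  have l1 := index_le (w := pw n) hx
  have l2 := index_le (w := pw n) hi
  have l3 := index_le (w := pw n) (Nat.lt_succ_of_le hc)
  rw [Nat.succ_eq_add_one] at l3
  set m1 := writeField (writeField (writeField mem (0 + x * pw n) (pw n) (LZ.enc x))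
        (aDEC n + (pop x * pP n + LZ.enc x) * pw n) (pw n) x)
        (aCNT n + pop x * pw n) (pw n) (LZ.enc x + 1) with hm1
  have key : (∀ y < x + 1, fld m1 0 (pw n) y = LZ.enc y) ∧
      (∀ y < x + 1, fld m1 (aDEC n) (pw n) (pop y * pP n + LZ.enc y) = y) ∧
      (∀ c ≤ pb n, fld m1 (aCNT n) (pw n) c = popCount (x + 1) c) ∧
      (∀ c ≤ pb n, fld m1 (aLEN n) (pw n) c = Nat.size (popCount x c - 1)) ∧
      ∀ k, aPOW n ≤ k → m1 k = false := by
    refine ⟨fun y hy => ?_, fun y hy => ?_, fun c hc' => ?_, fun c hc' => ?_, fun k hk => ?_⟩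
    · have hy' : y < pP n := by omega
      rw [hm1, fld_below (N := pP n) _ _ hy' (by omega), fld_below (N := pP n) _ _ hy' (by omega),
        fld_put]
      split_ifs with hyx
      · rw [hyx, Nat.mod_eq_of_lt (by omega)]
      · exact h.enc y (by omega)
    · have hy' : y < pP n := by omega
      rw [hm1, fld_below (N := (pb n + 1) * pP n) _ _ (dec_index_lt hy') (by omega), fld_put,
        fld_above _ (by omega)]
      have hey := enc_le y
      split_ifs with hyx
      · rw [Nat.mod_eq_of_lt (by omega)]
        -- Indices are below `pP n`, so quotient and remainder recover the class and the index; two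
        -- patterns never share an entry of the decoding table.
        have h0 : ∀ a, (a * pP n + LZ.enc y) / pP n = a ∧ (a * pP n + LZ.enc y) % pP n = LZ.enc y :=
          fun a => by
            rw [add_comm, mul_comm, Nat.add_mul_div_left _ _ (pP_pos n), Nat.add_mul_mod_self_left,
              Nat.div_eq_of_lt (by omega), Nat.mod_eq_of_lt (by omega), zero_add]
            exact ⟨rfl, rfl⟩
        have h0' : (pop x * pP n + LZ.enc x) / pP n = pop x ∧
            (pop x * pP n + LZ.enc x) % pP n = LZ.enc x := by
          rw [add_comm, mul_comm, Nat.add_mul_div_left _ _ (pP_pos n), Nat.add_mul_mod_self_left,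
            Nat.div_eq_of_lt (by omega), Nat.mod_eq_of_lt (by omega), zero_add]
          exact ⟨rfl, rfl⟩
        refine enc_inj ?_ ?_
        · rw [← h0'.1, ← hyx, (h0 _).1]
        · rw [← h0'.2, ← hyx, (h0 _).2]
      · refine h.dec y ?_
        rcases Nat.lt_succ_iff_lt_or_eq.1 hy with h | rfl
        · exact h
        · exact absurd rfl hyx
    · rw [hm1, fld_put, fld_above _ (by omega), fld_above _ (by omega), popCount_succ]
      split_ifs with h5 h6 h6
      · rw [h5, Nat.mod_eq_of_lt (by omega)]; rfl
      · exact absurd h5.symm h6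
      · exact absurd h6.symm h5
      · exact h.cnt c hc'
    · rw [hm1, fld_above _ (by omega), fld_above _ (by omega), fld_above _ (by omega)]
      exact h.len c hc'
    · rw [hm1, writeField_of_not_mem _ _ (by omega), writeField_of_not_mem _ _ (by omega),
        writeField_of_not_mem _ _ (by omega)]
      exact h.free k hk
  obtain ⟨k1, k2, k3, k4, k5⟩ := key
  have hs := size_succ_eq (LZ.enc x)
  have hlen : ∀ c, popCount (x + 1) c = if c = pop x then LZ.enc x + 1 else popCount x c := by
    intro c
    rw [popCount_succ]
    by_cases h : c = pop x
    · rw [h, if_pos rfl, if_pos rfl]; rfl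
    · rw [if_neg h, if_neg (Ne.symm h), add_zero]
  split_ifs with hlt
  · refine ⟨k1, k2, k3, fun c hc' => ?_, k5⟩
    rw [k4 c hc', hlen]
    split_ifs with h5
    · rw [hs, if_pos hlt, h5]; rfl
    · rfl
  · refine ⟨fun y hy => ?_, fun y hy => ?_, fun c hc' => ?_, fun c hc' => ?_, fun k hk => ?_⟩
    · rw [fld_below (N := pP n) _ _ (by omega) (by omega), k1 y hy]
    · rw [fld_below (N := (pb n + 1) * pP n) _ _ (dec_index_lt (by omega)) (by omega), k2 y hy]
    · rw [fld_below (N := pb n + 1) _ _ (by omega) (by omega), k3 c hc']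
    · have := size_le_self (LZ.enc x - 1)
      rw [fld_put, k4 c hc', hlen]
      split_ifs with h5
      · rw [hs, if_neg hlt, Nat.mod_eq_of_lt (by omega)]
      · rfl
    · rw [writeField_of_not_mem _ _ (by omega), k5 k hk]

theorem wp_patterns (E : Env T w M) {s : St} (hp : Params T.length s.v)
    (hm : ∀ k, s.mem k = false) :
    wp T w M patterns (fun s' => PatInv T.length (pP T.length) s'.mem ∧
      s'.time ≤ s.time + 300 * T.length + 10) s := by
  have hn := E.pos
  have hbig := E.big
  have hw16 := E.sixteen_le
  have hpw := E.pw_le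
  have hPn := pP_le_two_mul hn
  have hM := E.mem
  have hstr := E.str
  have h1 : aDEC T.length = pP T.length * pw T.length := rfl
  have h2 : aCNT T.length = aDEC T.length + (pb T.length + 1) * pP T.length * pw T.length := rfl
  have h3 : aLEN T.length = aCNT T.length + (pb T.length + 1) * pw T.length := rfl
  have h4 : aPOW T.length = aLEN T.length + (pb T.length + 1) * pw T.length := rfl
  have h5 : aBLK T.length = aPOW T.length + pg T.length * pe T.length := rfl
  have h6 : aSUP T.length = aBLK T.length + 3 * pK T.length * pv T.length := rfl
  have h7 : aBV T.length = aSUP T.length + 2 * (pK T.length / pL T.length + 1) * pw T.length := rfl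
  have h8 : aSTR T.length = aBV T.length + pK T.length * pb T.length := rfl
  refine wp_seq (wp_assign (by simp) ?_)
  refine wp_loop (pP T.length) (fun i s' => s'.v 30 = i ∧ Params T.length s'.v ∧
    PatInv T.length i s'.mem ∧ s'.time ≤ s.time + 5 + 140 * i) ?_ ?_ ?_
  · rintro i hi s' ⟨e30, hp', inv, ht⟩
    refine ⟨by simp, by simp [e30, hp'.hP, hi], ?_⟩
    have hc := pop_le (b := pb T.length) hi
    have he := enc_le i
    have hix := dec_index_lt hi
    have hix' := Nat.le_mul_of_pos_right ((pb T.length + 1) * pP T.length) 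
      (show 0 < pw T.length from Nat.succ_pos _)
    have hcnt : fld s'.mem (aCNT T.length) (pw T.length) (pop i) = LZ.enc i := inv.cnt _ hc
    have hlen := inv.len _ hc
    have hst := inv.step hn hi
    change fld s'.mem (aLEN T.length) (pw T.length) (pop i) = Nat.size (LZ.enc i - 1) at hlen
    have hs1 := size_le_self (LZ.enc i - 1)
    have hs2 : 2 ^ Nat.size (LZ.enc i - 1) < 2 ^ w := by
      refine Nat.pow_lt_pow_right (by omega) ?_
      have h1 : Nat.size (LZ.enc i - 1) ≤ pb T.length := Nat.size_le.2 (by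
        have : pP T.length = 2 ^ pb T.length := rfl
        omega)
      have h2 := pb_le hn
      have h3 := E.word
      have h4 := pL_pos hn
      omega
    have a1 := hp'.hw
    have a2 := hp'.hCNT
    have a3 := hp'.hDEC
    have a4 := hp'.hLEN
    have a5 := hp'.hP
    refine wp_seq (wp_assign (by simp) (wp_seq (wp_assign ?_ ?_)))
    · refine ok_get hM (pb T.length + 1) (by simp) (by simp) (by simp) ?_ ?_ ?_
      · simp [a1, hpw]
      · simp [e30]; omega
      · simp [a1, a2]; omega
    simp only [val_get]
    simp only [val_pop, val_var, tick_v, tick_mem, set_v, set_mem, e30, Function.update_self,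
      Function.update_of_ne (show (13 : ℕ) ≠ 31 by omega),
      Function.update_of_ne (show (5 : ℕ) ≠ 31 by omega), a1, a2, hcnt]
    refine wp_seq (wp_put hM (pP T.length) (by simp) (by simp) (by simp) (by simp) ?_ ?_ ?_ ?_)
    · simp [a1, hpw]
    · simp [e30, hi]
    · simp [a1]; omega
    refine wp_seq (wp_put hM ((pb T.length + 1) * pP T.length) (by simp) (by simp) ?_ (by simp)
      ?_ ?_ ?_ ?_)
    · simp [a5]; omega
    · simp [a1, hpw]
    · simp [a5, hix]
    · simp [a1, a3]; omega
    refine wp_seq (wp_put hM (pb T.length + 1) (by simp) (by simp) (by simp) ?_ ?_ ?_ ?_ ?_)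
    · simp; omega
    · simp [a1, hpw]
    · simp; omega
    · simp [a1, a2]; omega
    set m1 := writeField (writeField (writeField s'.mem (0 + i * pw T.length) (pw T.length)
        (LZ.enc i)) (aDEC T.length + (pop i * pP T.length + LZ.enc i) * pw T.length)
        (pw T.length) i) (aCNT T.length + pop i * pw T.length) (pw T.length) (LZ.enc i + 1)
      with hm1
    have l1 := index_le (w := pw T.length) hi
    have l2 := index_le (w := pw T.length) hix
    have l3 := index_le (w := pw T.length) (Nat.lt_succ_of_le hc)
    rw [Nat.succ_eq_add_one] at l3
    have hlen1 : fld m1 (aLEN T.length) (pw T.length) (pop i) = Nat.size (LZ.enc i - 1) := by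
      rw [hm1, fld_above _ (by omega), fld_above _ (by omega), fld_above _ (by omega), hlen]
    have gen : ∀ s3 : St, s3.mem = m1 →
        s3.v = Function.update (Function.update s'.v 31 (pop i)) 32 (LZ.enc i) →
        s3.time ≤ s'.time + 90 →
        wp T w M (.assign 33 (.get (.var 14) (.var 5) (.var 31)) ++
          (.ite (.lt (.var 32) (.shl 1 (.var 33))) .skip
            (.put (.var 14) (.var 5) (.var 31) (.var 33 + 1)) ++
          .assign 30 (.var 30 + 1))) (fun s' => s'.v 30 = i + 1 ∧ Params T.length s'.v ∧
            PatInv T.length (i + 1) s'.mem ∧ s'.time ≤ s.time + 5 + 140 * (i + 1)) s3 := by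
      intro s3 hm3 hv3 ht3
      have hp3 : Params T.length s3.v := by
        rw [hv3]; exact (hp'.update (by omega) _).update (by omega) _
      refine wp_seq (wp_assign ?_ ?_)
      · refine ok_get hM (pb T.length + 1) (by simp) (by simp) (by simp) ?_ ?_ ?_
        · simp [hv3, a1, hpw]
        · simp [hv3]; omega
        · simp [hv3, a1, a4]; omega
      have vg : s3.val T (.get (.var 14) (.var 5) (.var 31)) = Nat.size (LZ.enc i - 1) := by
        rw [St.val, val_get]
        simp [hv3, hm3, a1, a4, hlen1]
      rw [vg]
      refine wp_seq (wp_ite ?_ ?_ ?_)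
      · simp [hs2]; omega
      · intro hlt
        have hlt' : LZ.enc i < 2 ^ Nat.size (LZ.enc i - 1) := by
          by_contra hh
          simp [hv3, hh] at hlt
        rw [if_pos hlt', ← hm3] at hst
        refine wp_skip (wp_assign ?_ ⟨?_, ?_, hst, ?_⟩)
        · simp [hv3, e30]; omega
        · simp [hv3, e30]
        · exact (hp3.update (by omega) _).update (by omega) _
        · simp; omega
      · intro hlt
        have hlt' : ¬ LZ.enc i < 2 ^ Nat.size (LZ.enc i - 1) := by
          intro hh
          simp [hv3, hh] at hlt
        rw [if_neg hlt', ← hm3] at hst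
        refine wp_put hM (pb T.length + 1) (by simp) (by simp) (by simp) ?_ ?_ ?_ ?_
          (wp_assign ?_ ⟨?_, ?_, ?_, ?_⟩)
        · simp; omega
        · simp [hv3, a1, hpw]
        · simp [hv3]; omega
        · simp [hv3, a1, a4]; omega
        · simp [hv3, e30]; omega
        · simp [hv3, e30]
        · exact (hp3.update (by omega) _).update (by omega) _
        · convert hst using 1
          simp [hv3, a1, a4]
        · simp; omega
    refine gen _ ?_ ?_ ?_
    · simp [a1, a2, a3, a5, e30, hm1]
    · simp
    · simp
  · rintro s' ⟨e30, hp', inv, ht⟩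
    refine ⟨by simp, by simp [e30, hp'.hP], inv, ?_⟩
    simp; omega
  · refine ⟨by simp, hp.update (by omega) _, ⟨by simp, by simp, fun c _ => ?_, fun c _ => ?_, ?_⟩,
      by simp⟩
    · simp [fld, readField, hm, popCount_zero]
    · simp [fld, readField, hm, popCount_zero]
    · simp [hm]

theorem wp_powers (E : Env T w M) {s : St} (hp : Params T.length s.v)
    (hm : PatInv T.length (pP T.length) s.mem) :
    wp T w M powers (fun s' => Tab T.length s'.mem ∧ (∀ k, aBLK T.length ≤ k → s'.mem k = false) ∧
      s'.time ≤ s.time + 60 * T.length + 20) s := by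
  have hn := E.pos
  have hbig := E.big
  have hw16 := E.sixteen_le
  have hpe := E.pe_le
  have hM := E.mem
  have hstr := E.str
  have hgL := pg_le T.length
  have hLn := pL_le T.length
  have h1 : aDEC T.length = pP T.length * pw T.length := rfl
  have h2 : aCNT T.length = aDEC T.length + (pb T.length + 1) * pP T.length * pw T.length := rfl
  have h3 : aLEN T.length = aCNT T.length + (pb T.length + 1) * pw T.length := rfl
  have h4 : aPOW T.length = aLEN T.length + (pb T.length + 1) * pw T.length := rfl
  have h5 : aBLK T.length = aPOW T.length + pg T.length * pe T.length := rfl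
  have h6 : aSUP T.length = aBLK T.length + 3 * pK T.length * pv T.length := rfl
  have h7 : aBV T.length = aSUP T.length + 2 * (pK T.length / pL T.length + 1) * pw T.length := rfl
  have h8 : aSTR T.length = aBV T.length + pK T.length * pb T.length := rfl
  have hlt := pow_lt_pe T.length
  have hpow : 2 ^ pe T.length ≤ 2 ^ w := Nat.pow_le_pow_right (by omega) hpe
  refine wp_seq (wp_assign (by simp; omega) (wp_seq (wp_assign (by simp) ?_)))
  refine wp_loop (pg T.length) (fun i s' => s'.v 30 = pH T.length ^ i ∧ s'.v 31 = i ∧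
    Params T.length s'.v ∧ (∀ k < aPOW T.length, s'.mem k = s.mem k) ∧
    (∀ j < i, fld s'.mem (aPOW T.length) (pe T.length) j = pH T.length ^ j) ∧
    (∀ k, aBLK T.length ≤ k → s'.mem k = false) ∧
    s'.time ≤ s.time + 10 + 45 * i) ?_ ?_ ?_
  · rintro i hi s' ⟨e30, e31, hp', m1, m2, m3, ht⟩
    have a1 := hp'.he
    have a2 := hp'.hPOW
    have a3 := hp'.hg
    have a4 := hp'.hH
    have l1 := index_le (w := pe T.length) hi
    have hle : pH T.length ^ i * pH T.length ≤ pH T.length ^ pg T.length := by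
      rw [← pow_succ]; exact Nat.pow_le_pow_right (pH_pos _) hi
    have hle' : pH T.length ^ i ≤ pH T.length ^ pg T.length :=
      Nat.pow_le_pow_right (pH_pos _) hi.le
    refine ⟨by simp, by simp [e31, a3, hi], ?_⟩
    refine wp_seq (wp_put hM (pg T.length) (by simp) (by simp) (by simp) (by simp) ?_ ?_ ?_
      (wp_seq (wp_assign ?_ (wp_assign ?_ ⟨?_, ?_, ?_, ?_, ?_, ?_, ?_⟩))))
    · simp [a1, hpe]
    · simp [e31, hi]
    · simp [a1, a2]; omega
    · simp [e30, a4]; omega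
    · simp [e31]; omega
    · simp [e30, a4, pow_succ]
    · simp [e31]
    · exact (hp'.update (by omega) _).update (by omega) _
    · intro k hk
      simp [a1, a2, e31]
      rw [writeField_of_not_mem _ _ (by omega), m1 k hk]
    · intro j hj
      simp only [set_mem, put_mem, tick_mem, val_var, tick_v, a1, a2, e31, e30]
      rw [fld_put]
      split_ifs with hji
      · rw [hji, Nat.mod_eq_of_lt (by omega)]
      · exact m2 j (by omega)
    · intro k hk
      simp [a1, a2, e31]
      rw [writeField_of_not_mem _ _ (by omega), m3 k hk]
    · simp; omega
  · rintro s' ⟨e30, e31, hp', m1, m2, m3, ht⟩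
    refine ⟨by simp, by simp [e31, hp'.hg], ⟨fun x hx => ?_, fun x hx => ?_, fun c hc => ?_,
      fun i hi => m2 i hi⟩, m3, ?_⟩
    · rw [tick_mem, fld_congr hx fun k _ hk => m1 k (by omega), hm.enc x hx]
    · rw [tick_mem, fld_congr (dec_index_lt hx) fun k _ hk => m1 k (by omega), hm.dec x hx]
    · rw [tick_mem, fld_congr (Nat.lt_succ_of_le hc) fun k _ hk => m1 k (by
        rw [Nat.succ_eq_add_one] at hk; omega), hm.len c hc, clen]
      rw [show pP T.length = 2 ^ pb T.length from rfl, popCount_two_pow]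
    · simp; omega
  · refine ⟨by simp, by simp, (hp.update (by omega) _).update (by omega) _, by simp, by simp,
      fun k hk => ?_, by simp⟩
    simp [hm.free k (by omega)]

/-- Compute the parameters and the tables. -/
def setup : Cmd := initParams ++ (patterns ++ powers)

theorem wp_setup (E : Env T w M) {s : St} (hm : ∀ k, s.mem k = false) :
    wp T w M setup (fun s' => Params T.length s'.v ∧ Tab T.length s'.mem ∧
      (∀ k, aBLK T.length ≤ k → s'.mem k = false) ∧
      s'.time ≤ s.time + 940 * T.length) s := by
  have := E.pos
  refine wp_seq ((wp_initParams E s).use fun s1 _ _ f1 h1 => ?_)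
  have f1 := f1 (by decide)
  refine wp_seq ((wp_patterns E h1.1 fun k => by rw [f1, hm]).use fun s2 f2 _ _ h2 => ?_)
  have hp2 : Params T.length s2.v := h1.1.frame f2 (by decide)
  refine (wp_powers E hp2 h2.1).use fun s3 f3 _ _ h3 => ⟨hp2.frame f3 (by decide), h3.1, h3.2.1, ?_⟩
  have := h1.2
  have := h2.2
  have := h3.2.2
  omega

end Tables

end LZ

namespace LZ

/-! ### Access to packed arrays -/

section PackedAccess

variable {σ : ℕ} {T : List (Fin σ)} {w M : ℕ}

/-- Locate the entry whose index is in variable `x` of the packed array whose base address is in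
variable `b`. -/
def locate (b x : ℕ) : Cmd :=
  .assign 31 (.var b + .var x / .var 2 * .var 9) ++ (.assign 32 (.var x % .var 2) ++
  .assign 33 (.get (.var 15) (.var 8) (.var 32)))

/-- Read the entry whose index is in variable `x` into variable `y`. -/
def getPacked (b x y : ℕ) : Cmd :=
  locate b x ++ (.assign 34 (.ld (.var 31) (.var 8) / .var 33 % .var 7) ++
  .assign y (.shl (.var 34) (.var 6) + .ld (.var 31 + .var 8 + .var 32 * .var 6) (.var 6)))

/-- Set the entry whose index is in variable `x` to the value of variable `z`. -/
def setPacked (b x z : ℕ) : Cmd :=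
  locate b x ++ (.assign 34 (.ld (.var 31) (.var 8)) ++ (.assign 35 (.var 34 / .var 33 % .var 7) ++
  (.store (.var 31) (.var 8) (.var 34 + .shr (.var z) (.var 6) * .var 33 - .var 35 * .var 33) ++
  .store (.var 31 + .var 8 + .var 32 * .var 6) (.var 6) (.var z))))

/-- A packed array with the parameters of the program. -/
abbrev PArr (n : ℕ) (mem : ℕ → Bool) (base nb : ℕ) (f : ℕ → ℕ) : Prop :=
  Packed mem base (pg n) (pH n) (pe n) (pt n) nb f

theorem aPOW_le (n : ℕ) : aPOW n + pg n * pe n ≤ aSTR n := by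
  have h5 : aBLK n = aPOW n + pg n * pe n := rfl
  have h6 : aSUP n = aBLK n + 3 * pK n * pv n := rfl
  have h7 : aBV n = aSUP n + 2 * (pK n / pL n + 1) * pw n := rfl
  have h8 : aSTR n = aBV n + pK n * pb n := rfl
  omega

theorem block_le {n i nb : ℕ} (hi : i / pg n < nb) (hg : 1 ≤ pg n) :
    i / pg n * pB n + pe n + i % pg n * pt n + pt n ≤ nb * pB n := by
  have h1 := index_le (w := pB n) hi
  have h2 := index_le (w := pt n) (Nat.mod_lt i hg)
  have h3 : pB n = pe n + pg n * pt n := rfl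
  omega

theorem wp_locate (E : Env T w M) {s : St} {b x base nb i : ℕ} (hb : b < 31) (hx : x < 31)
    (hp : Params T.length s.v) (ht : Tab T.length s.mem) (hvb : s.v b = base) (hvx : s.v x = i)
    (hi : i / pg T.length < nb) (hM : base + nb * pB T.length ≤ M) :
    wp T w M (locate b x) (fun s' => s'.v 31 = base + i / pg T.length * pB T.length ∧
      s'.v 32 = i % pg T.length ∧ s'.v 33 = pH T.length ^ (i % pg T.length) ∧
      s'.time ≤ s.time + 40) s := by
  have hg := pg_pos E.pos
  have hm := Nat.mod_lt i hg
  have hbl := block_le hi hg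
  have hMw := E.mem
  have hstr := E.str
  have hpow := aPOW_le T.length
  have a1 := hp.hg
  have a2 := hp.hB
  have a3 := hp.hPOW
  have a4 := hp.he
  have b31 : b ≠ 31 := by omega
  have x31 : x ≠ 31 := by omega
  refine wp_seq (wp_assign ?_ (wp_seq (wp_assign ?_ (wp_assign ?_ ⟨?_, ?_, ?_, ?_⟩))))
  · simp [hvb, hvx, a1, a2]; omega
  · simp
  · refine ok_get hMw (pg T.length) (by simp) (by simp) (by simp) ?_ ?_ ?_
    · simp [a4, E.pe_le]
    · simp [x31, hvx, a1, hm]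
    · simp [a3, a4]; omega
  · simp [hvb, hvx, a1, a2]
  · simp [x31, hvx, a1]
  · simp only [set_v, Function.update_self]
    rw [St.val, val_get]
    simp [x31, hvx, a1, a3, a4, ht.pow _ hm]
  · simp

theorem wp_getPacked (E : Env T w M) {s : St} {b x y base nb i : ℕ} {f : ℕ → ℕ} (hb : b < 31)
    (hx : x < 31) (hp : Params T.length s.v) (ht : Tab T.length s.mem) (hvb : s.v b = base)
    (hvx : s.v x = i) (hi : i / pg T.length < nb) (hM : base + nb * pB T.length ≤ M)
    (hf : PArr T.length s.mem base nb f) :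
    wp T w M (getPacked b x y) (fun s' => s'.v y = f i ∧ s'.time ≤ s.time + 80) s := by
  have hg := pg_pos E.pos
  have hm := Nat.mod_lt i hg
  have hbl := block_le hi hg
  have hMw := E.mem
  have hget := hf.get hi hm
  have hge : i / pg T.length * pg T.length + i % pg T.length = i := Nat.div_add_mod' _ _
  rw [hge, show pe T.length + pg T.length * pt T.length = pB T.length from rfl] at hget
  refine wp_seq ((wp_locate E hb hx hp ht hvb hvx hi hM).use ?_)
  rintro s1 f1 - m1 ⟨e31, e32, e33, t1⟩
  have m1 := m1 rfl
  have hp1 : Params T.length s1.v := hp.frame f1 (by simp [locate, Cmd.writes])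
  have a1 := hp1.he
  have a2 := hp1.hH
  have a3 := hp1.ht
  -- An entry has at most `pt + pg + 1` bits, so putting its two parts together does not overflow.
  have hlt : f i < 2 ^ w := by
    have h1 := hf.1 i
    have h2 : f i < 2 ^ (pt T.length + (pg T.length + 1)) := by
      rw [pow_add]
      have := Nat.lt_mul_of_div_lt h1 (Nat.two_pow_pos (pt T.length))
      rw [mul_comm]
      exact this.trans_le (Nat.mul_le_mul_right _ (pH_le _))
    refine h2.trans_le (Nat.pow_le_pow_right (by omega) ?_)
    have h3 := E.word
    have h4 := pL_pos E.pos
    have h5 := pt_le T.length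
    have h6 := pg_le T.length
    omega
  have hti : i % pg T.length * pt T.length + pt T.length ≤ M := by omega
  have hew := E.pe_le
  have htw : pt T.length ≤ w := by
    have h3 := E.word
    have h5 := pt_le T.length
    omega
  refine wp_seq (wp_assign ?_ (wp_assign ?_ ⟨?_, ?_⟩))
  · simp [e31, a1, hew]; omega
  · simp [e31, e32, e33, m1, a1, a2, a3, htw]; omega
  · simp [e31, e32, e33, m1, a1, a2, a3, hget]
  · simp; omega

theorem wp_setPacked (E : Env T w M) {s : St} {b x z base nb i y : ℕ} {f : ℕ → ℕ} (hb : b < 31)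
    (hx : x < 31) (hz : z < 31) (hp : Params T.length s.v) (ht : Tab T.length s.mem)
    (hvb : s.v b = base) (hvx : s.v x = i) (hvz : s.v z = y) (hy : y ≤ T.length)
    (hi : i / pg T.length < nb) (hM : base + nb * pB T.length ≤ M)
    (hf : PArr T.length s.mem base nb f) :
    wp T w M (setPacked b x z) (fun s' => PArr T.length s'.mem base nb (Function.update f i y) ∧
      (∀ k, k < base ∨ base + nb * pB T.length ≤ k → s'.mem k = s.mem k) ∧
      s'.time ≤ s.time + 110) s := by
  have hg := pg_pos E.pos
  have hm := Nat.mod_lt i hg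
  have hbl := block_le hi hg
  have hMw := E.mem
  have hyH := div_lt_pH hy
  have hset := hf.set (pow_lt_pe T.length).le hi hm hyH
  have hdig := hf.digit hi hm
  have hge : i / pg T.length * pg T.length + i % pg T.length = i := Nat.div_add_mod' _ _
  rw [hge, show pe T.length + pg T.length * pt T.length = pB T.length from rfl] at hset hdig
  refine wp_seq ((wp_locate E hb hx hp ht hvb hvx hi hM).use ?_)
  rintro s1 f1 - m1 ⟨e31, e32, e33, t1⟩
  have m1 := m1 rfl
  have hp1 : Params T.length s1.v := hp.frame f1 (by simp [locate, Cmd.writes])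
  have a1 := hp1.he
  have a2 := hp1.hH
  have a3 := hp1.ht
  have ez : s1.v z = y := by
    rw [← hvz]; refine f1 z ?_
    simp only [locate, writes_append, Cmd.writes, List.mem_append, List.mem_singleton]; omega
  have hew := E.pe_le
  have htw : pt T.length ≤ w := by
    have h3 := E.word
    have h5 := pt_le T.length
    omega
  have hti : i % pg T.length * pt T.length + pt T.length ≤ M := by omega
  have hbig := E.big
  set q := readField s.mem (base + i / pg T.length * pB T.length) (pe T.length) with hq
  have hqlt : q < 2 ^ pe T.length := readField_lt _ _ _
  have hHg : y / 2 ^ pt T.length * pH T.length ^ (i % pg T.length) < 2 ^ pe T.length := by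
    refine lt_of_lt_of_le ?_ (pow_lt_pe T.length).le
    calc _ < pH T.length * pH T.length ^ (i % pg T.length) :=
          Nat.mul_lt_mul_of_pos_right hyH (pow_pos (pH_pos _) _)
      _ = pH T.length ^ (i % pg T.length + 1) := (pow_succ' _ _).symm
      _ ≤ _ := Nat.pow_le_pow_right (pH_pos _) hm
  have hsub : q / pH T.length ^ (i % pg T.length) % pH T.length *
      pH T.length ^ (i % pg T.length) ≤ q :=
    (Nat.mul_le_mul_right _ (Nat.mod_le _ _)).trans (Nat.div_mul_le_self _ _)
  -- The new multiple is added before the old one is subtracted, so the intermediate sum may need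
  -- one bit more than the field.
  have hpe1 : 2 ^ pe T.length * 2 ≤ 2 ^ w := by
    rw [← pow_succ]
    refine Nat.pow_le_pow_right (by omega) ?_
    have h3 := E.word
    have h4 := pL_pos E.pos
    have h5 := pe_le E.pos
    omega
  have z34 : z ≠ 34 := by omega
  have z35 : z ≠ 35 := by omega
  refine wp_seq (wp_assign ?_ (wp_seq (wp_assign ?_ (wp_seq (wp_store ?_ ?_ ?_ ?_ ?_
    (wp_store ?_ ?_ ?_ ?_ ?_ ⟨?_, ?_, ?_⟩))))))
  · simp [e31, a1, hew]; omega
  · simp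
  · simp
  · simp
  · simp [e31, e33, m1, a1, a2, a3, ← hq, ez, z34, z35]; omega
  · simp [a1, hew]
  · simp [e31, a1]; omega
  · simp [e31, e32, a1, a3]; omega
  · simp
  · simp
  · simp [a3, htw]
  · simp [e31, e32, a1, a3]; omega
  · convert hset using 1
    simp [e31, e32, e33, m1, a1, a2, a3, ← hq, ez, z34, z35, hdig]
  · intro k hk
    simp only [put_mem, set_mem, St.val, val_add, val_mul, val_var, put_v, set_v,
      Function.update_of_ne (show (31 : ℕ) ≠ 35 by omega),
      Function.update_of_ne (show (31 : ℕ) ≠ 34 by omega),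
      Function.update_of_ne (show (32 : ℕ) ≠ 35 by omega),
      Function.update_of_ne (show (32 : ℕ) ≠ 34 by omega),
      Function.update_of_ne (show (8 : ℕ) ≠ 35 by omega),
      Function.update_of_ne (show (8 : ℕ) ≠ 34 by omega),
      Function.update_of_ne (show (6 : ℕ) ≠ 35 by omega),
      Function.update_of_ne (show (6 : ℕ) ≠ 34 by omega), e31, e32, a1, a3, m1]
    rw [writeField_of_not_mem _ _ (by omega), writeField_of_not_mem _ _ (by omega)]
  · simp; omega

end PackedAccess

end LZ

namespace LZ

/-! ### The compressed bit vector -/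

section BitVector

variable (X : ℕ → Bool) (b : ℕ)

/-- The `i`-th block of a bit vector. -/
def blk (i : ℕ) : ℕ := readField X (i * b) b

/-- The position of the code of the `i`-th block. -/
def bptr (i : ℕ) : ℕ := ∑ j ∈ Finset.range i, clen b (pop (blk X b j))

/-- The number of ones before the `i`-th block. -/
def brnk (i : ℕ) : ℕ := ∑ j ∈ Finset.range i, pop (blk X b j)

/-- The number of ones before position `q`. -/
def ones (q : ℕ) : ℕ := ∑ k ∈ Finset.range q, if X k then 1 else 0

variable {X b}

theorem blk_lt (i : ℕ) : blk X b i < 2 ^ b := readField_lt _ _ _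

theorem readField_shift (mem : ℕ → Bool) (base a l : ℕ) :
    readField mem (base + a) l = readField (fun k => mem (base + k)) a l := by
  unfold readField
  exact Finset.sum_congr rfl fun i _ => by rw [add_assoc]

theorem pop_blk_le (i : ℕ) : pop (blk X b i) ≤ b := pop_le (blk_lt i)

theorem ones_add (a r : ℕ) : ones X (a + r) = ones X a + pop (readField X a r) := by
  rw [pop_readField, ones, Finset.sum_range_add]; rfl

theorem brnk_eq (i : ℕ) : brnk X b i = ones X (i * b) := by
  induction i with
  | zero => simp [brnk, ones]
  | succ i ih =>
    rw [brnk, Finset.sum_range_succ, ← brnk, ih, add_mul, one_mul, ones_add]; rfl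

theorem sum_le_mul {a : ℕ → ℕ} {b : ℕ} (h : ∀ i, a i ≤ b) (i : ℕ) :
    ∑ j ∈ Finset.range i, a j ≤ i * b := by
  refine (Finset.sum_le_card_nsmul _ _ b fun j _ => h j).trans ?_
  simp

theorem sum_add_le {a : ℕ → ℕ} {b : ℕ} (h : ∀ i, a i ≤ b) (i m : ℕ) :
    ∑ j ∈ Finset.range (i + m), a j ≤ ∑ j ∈ Finset.range i, a j + m * b := by
  rw [Finset.sum_range_add]
  exact Nat.add_le_add_left (sum_le_mul (fun _ => h _) m) _

theorem sum_mono {a : ℕ → ℕ} {i i' : ℕ} (h : i ≤ i') :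
    ∑ j ∈ Finset.range i, a j ≤ ∑ j ∈ Finset.range i', a j :=
  Finset.sum_le_sum_of_subset (Finset.range_subset_range.2 h)

theorem bptr_le (i : ℕ) : bptr X b i ≤ i * b := sum_le_mul (fun _ => clen_le _ _) i

theorem brnk_le (i : ℕ) : brnk X b i ≤ i * b := sum_le_mul (fun _ => pop_blk_le _) i

theorem bptr_mono {i i' : ℕ} (h : i ≤ i') : bptr X b i ≤ bptr X b i' := sum_mono h

theorem brnk_mono {i i' : ℕ} (h : i ≤ i') : brnk X b i ≤ brnk X b i' := sum_mono h

theorem bptr_succ (i : ℕ) : bptr X b (i + 1) = bptr X b i + clen b (pop (blk X b i)) :=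
  Finset.sum_range_succ _ _

theorem brnk_succ (i : ℕ) : brnk X b (i + 1) = brnk X b i + pop (blk X b i) :=
  Finset.sum_range_succ _ _

/-- Between the start of a superblock and a block in it there are fewer than `L` blocks, and each
adds at most `b` to the pointer and to the rank. -/
theorem rel_le {L : ℕ} (hL : 0 < L) (i : ℕ) :
    bptr X b i - bptr X b (i / L * L) ≤ b * L ∧ brnk X b i - brnk X b (i / L * L) ≤ b * L := by
  have h := Nat.div_add_mod' i L
  have h1 := sum_add_le (fun j => clen_le b (pop (blk X b j))) (i / L * L) (i % L)
  have h2 := sum_add_le (fun j => pop_blk_le (X := X) (b := b) j) (i / L * L) (i % L)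
  have h3 : i % L * b ≤ b * L := by
    rw [mul_comm]; exact Nat.mul_le_mul_left _ (Nat.mod_lt i hL).le
  rw [h] at h1 h2
  change bptr X b i ≤ bptr X b _ + _ at h1
  change brnk X b i ≤ brnk X b _ + _ at h2
  omega

/-- The memory holds the first `m` blocks of the compressed bit vector `X`. -/
structure Comp (n : ℕ) (mem : ℕ → Bool) (X : ℕ → Bool) (m : ℕ) : Prop where
  cls : ∀ i < m, fld mem (aBLK n) (pv n) (3 * i) = pop (blk X (pb n) i)
  ptr : ∀ i < m, fld mem (aBLK n) (pv n) (3 * i + 1) =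
    bptr X (pb n) i - bptr X (pb n) (i / pL n * pL n)
  rnk : ∀ i < m, fld mem (aBLK n) (pv n) (3 * i + 2) =
    brnk X (pb n) i - brnk X (pb n) (i / pL n * pL n)
  sptr : ∀ i < m, fld mem (aSUP n) (pw n) (2 * (i / pL n)) = bptr X (pb n) (i / pL n * pL n)
  srnk : ∀ i < m, fld mem (aSUP n) (pw n) (2 * (i / pL n) + 1) = brnk X (pb n) (i / pL n * pL n)
  code : ∀ i < m, readField mem (aSTR n + bptr X (pb n) i) (clen (pb n) (pop (blk X (pb n) i))) =
    enc (blk X (pb n) i)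

theorem layout (n : ℕ) : aSUP n = aBLK n + 3 * pK n * pv n ∧
    aBV n = aSUP n + 2 * (pK n / pL n + 1) * pw n ∧ aSTR n = aBV n + pK n * pb n := ⟨rfl, rfl, rfl⟩

theorem sup_index {n i : ℕ} (hi : i < pK n) :
    2 * (i / pL n) + 1 < 2 * (pK n / pL n + 1) := by
  have := Nat.div_le_div_right (c := pL n) hi.le
  omega

/-- Only the directories and the code bits written so far matter. So the plain bit vector between
them can be reused for marks, and further data can be placed directly behind the codes. -/
theorem Comp.congr {n m : ℕ} {mem mem' X : ℕ → Bool} (h : Comp n mem X m) (hm : m ≤ pK n)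
    (h1 : ∀ k, aBLK n ≤ k → k < aBV n → mem' k = mem k)
    (h2 : ∀ k, aSTR n ≤ k → k < aSTR n + bptr X (pb n) m → mem' k = mem k) :
    Comp n mem' X m := by
  obtain ⟨l1, l2, l3⟩ := layout n
  have hb : ∀ i < 3 * pK n, fld mem' (aBLK n) (pv n) i = fld mem (aBLK n) (pv n) i :=
    fun i hi => fld_congr hi fun k h3 h4 => h1 k h3 (by omega)
  have hs : ∀ i < 2 * (pK n / pL n + 1), fld mem' (aSUP n) (pw n) i = fld mem (aSUP n) (pw n) i :=
    fun i hi => fld_congr hi fun k h3 h4 => h1 k (by omega) (by omega)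
  refine ⟨fun i hi => ?_, fun i hi => ?_, fun i hi => ?_, fun i hi => ?_, fun i hi => ?_,
    fun i hi => ?_⟩
  · rw [hb _ (by omega), h.cls i hi]
  · rw [hb _ (by omega), h.ptr i hi]
  · rw [hb _ (by omega), h.rnk i hi]
  · have := sup_index (n := n) (i := i) (by omega)
    rw [hs _ (by omega), h.sptr i hi]
  · have := sup_index (n := n) (i := i) (by omega)
    rw [hs _ (by omega), h.srnk i hi]
  · rw [← h.code i hi]
    have h3 := bptr_mono (X := X) (b := pb n) (Nat.succ_le_of_lt hi)
    rw [Nat.succ_eq_add_one, bptr_succ] at h3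
    exact readField_congr fun k h4 h5 => h2 k (by omega) (by omega)

set_option maxHeartbeats 1000000 in
/-- Writing the data of block `m`. -/
theorem Comp.step {n m : ℕ} {mem X : ℕ → Bool} (h : Comp n mem X m) (hn : 1 ≤ n) (hm : m < pK n)
    {mem1 : ℕ → Bool}
    (h1 : mem1 = if m % pL n = 0 then
        writeField (writeField mem (aSUP n + 2 * (m / pL n) * pw n) (pw n) (bptr X (pb n) m))
          (aSUP n + (2 * (m / pL n) + 1) * pw n) (pw n) (brnk X (pb n) m)
      else mem) :
    Comp n (writeField (writeField (writeField (writeField mem1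
      (aBLK n + 3 * m * pv n) (pv n) (pop (blk X (pb n) m)))
      (aBLK n + (3 * m + 1) * pv n) (pv n) (bptr X (pb n) m - bptr X (pb n) (m / pL n * pL n)))
      (aBLK n + (3 * m + 2) * pv n) (pv n) (brnk X (pb n) m - brnk X (pb n) (m / pL n * pL n)))
      (aSTR n + bptr X (pb n) m) (clen (pb n) (pop (blk X (pb n) m))) (enc (blk X (pb n) m)))
      X (m + 1) := by
  obtain ⟨l1, l2, l3⟩ := layout n
  have hL := pL_pos hn
  have hsup := sup_index hm
  have b0 := index_le (w := pv n) (show 3 * m < 3 * pK n by omega)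
  have b1 := index_le (w := pv n) (show 3 * m + 1 < 3 * pK n by omega)
  have b2 := index_le (w := pv n) (show 3 * m + 2 < 3 * pK n by omega)
  have s0 := index_le (w := pw n) (show 2 * (m / pL n) < 2 * (pK n / pL n + 1) by omega)
  have s1 := index_le (w := pw n) hsup
  have hrel := rel_le (X := X) (b := pb n) hL m
  have hv := pb_mul_lt hn
  have hpv : pop (blk X (pb n) m) < 2 ^ pv n := by
    have h1 := pop_blk_le (X := X) (b := pb n) m
    have h2 := Nat.le_mul_of_pos_right (pb n) hL
    omega
  have hmb : m * pb n ≤ n + pb n := (Nat.mul_le_mul_right _ hm.le).trans (pK_mul_le n)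
  have hw := add_pb_lt hn
  have hp1 : bptr X (pb n) m < 2 ^ pw n := ((bptr_le m).trans hmb).trans_lt hw
  have hp2 : brnk X (pb n) m < 2 ^ pw n := ((brnk_le m).trans hmb).trans_lt hw
  have m1sup : ∀ i < 2 * (pK n / pL n + 1), fld mem1 (aSUP n) (pw n) i =
      if m % pL n = 0 ∧ i = 2 * (m / pL n) then bptr X (pb n) m else
      if m % pL n = 0 ∧ i = 2 * (m / pL n) + 1 then brnk X (pb n) m else
      fld mem (aSUP n) (pw n) i := by
    intro i hi
    rw [h1]
    by_cases h0 : m % pL n = 0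
    · rw [if_pos h0, fld_put, fld_put, Nat.mod_eq_of_lt hp1, Nat.mod_eq_of_lt hp2]
      simp only [h0, true_and]
      split_ifs with c1 c2 c2
      · omega
      all_goals rfl
    · simp [h0]
  have m1out : ∀ k, k < aSUP n ∨ aBV n ≤ k → mem1 k = mem k := by
    intro k hk
    rw [h1]
    split_ifs
    · rw [writeField_of_not_mem _ _ (by omega), writeField_of_not_mem _ _ (by omega)]
    · rfl
  have m1blk : ∀ i < 3 * pK n, fld mem1 (aBLK n) (pv n) i = fld mem (aBLK n) (pv n) i :=
    fun i hi => fld_congr hi fun k _ h4 => m1out k (by omega)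
  have m1str : ∀ a l, aSTR n ≤ a → readField mem1 a l = readField mem a l :=
    fun a l ha => readField_congr fun k _ _ => m1out k (by omega)
  set m5 := writeField (writeField (writeField (writeField mem1
      (aBLK n + 3 * m * pv n) (pv n) (pop (blk X (pb n) m)))
      (aBLK n + (3 * m + 1) * pv n) (pv n) (bptr X (pb n) m - bptr X (pb n) (m / pL n * pL n)))
      (aBLK n + (3 * m + 2) * pv n) (pv n) (brnk X (pb n) m - brnk X (pb n) (m / pL n * pL n)))
      (aSTR n + bptr X (pb n) m) (clen (pb n) (pop (blk X (pb n) m))) (enc (blk X (pb n) m))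
    with hm5
  have m5blk : ∀ i < 3 * pK n, fld m5 (aBLK n) (pv n) i =
      if i = 3 * m + 2 then brnk X (pb n) m - brnk X (pb n) (m / pL n * pL n) else
      if i = 3 * m + 1 then bptr X (pb n) m - bptr X (pb n) (m / pL n * pL n) else
      if i = 3 * m then pop (blk X (pb n) m) else fld mem (aBLK n) (pv n) i := by
    intro i hi
    rw [hm5, fld_below (N := 3 * pK n) _ _ hi (by omega), fld_put, fld_put, fld_put, m1blk i hi,
      Nat.mod_eq_of_lt (by omega), Nat.mod_eq_of_lt (by omega), Nat.mod_eq_of_lt hpv]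
  have m5sup : ∀ i < 2 * (pK n / pL n + 1), fld m5 (aSUP n) (pw n) i =
      fld mem1 (aSUP n) (pw n) i := by
    intro i hi
    rw [hm5, fld_below (N := 2 * (pK n / pL n + 1)) _ _ hi (by omega), fld_above _ (by omega),
      fld_above _ (by omega), fld_above _ (by omega)]
  have hold : ∀ i < m + 1, i = m ∨ (i < m ∧ i < pK n) := fun i hi => by omega
  -- A new superblock entry has a larger index than the entries of all earlier blocks and does not
  -- overwrite them.
  have hdiv : ∀ i < m, m % pL n = 0 → i / pL n < m / pL n := by
    intro i hi h0
    rw [Nat.div_lt_iff_lt_mul hL, Nat.div_mul_cancel (Nat.dvd_of_mod_eq_zero h0)]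
    exact hi
  -- A block that does not start a superblock uses the superblock entry that its predecessor already
  -- relies on.
  have hprev : m % pL n ≠ 0 → m - 1 < m ∧ (m - 1) / pL n = m / pL n := by
    intro h0
    have hm0 : m ≠ 0 := by rintro rfl; simp at h0
    refine ⟨by omega, ?_⟩
    have h3 := Nat.div_add_mod m (pL n)
    have h4 := Nat.mod_lt m hL
    have : m - 1 = (m % pL n - 1) + pL n * (m / pL n) := by omega
    rw [this, Nat.add_mul_div_left _ _ hL, Nat.div_eq_of_lt (by omega), zero_add]
  refine ⟨fun i hi => ?_, fun i hi => ?_, fun i hi => ?_, fun i hi => ?_, fun i hi => ?_,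
    fun i hi => ?_⟩
  · rw [m5blk _ (by omega)]
    rcases hold i hi with rfl | ⟨h3, h4⟩
    · rw [if_neg (by omega), if_neg (by omega), if_pos rfl]
    · rw [if_neg (by omega), if_neg (by omega), if_neg (by omega), h.cls i h3]
  · rw [m5blk _ (by omega)]
    rcases hold i hi with rfl | ⟨h3, h4⟩
    · rw [if_neg (by omega), if_pos rfl]
    · rw [if_neg (by omega), if_neg (by omega), if_neg (by omega), h.ptr i h3]
  · rw [m5blk _ (by omega)]
    rcases hold i hi with rfl | ⟨h3, h4⟩
    · rw [if_pos rfl]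
    · rw [if_neg (by omega), if_neg (by omega), if_neg (by omega), h.rnk i h3]
  · have hsi := sup_index (n := n) (i := i) (by omega)
    rw [m5sup _ (by omega), m1sup _ (by omega)]
    rcases hold i hi with rfl | ⟨h3, h4⟩
    · by_cases h0 : i % pL n = 0
      · rw [if_pos ⟨h0, rfl⟩, Nat.div_mul_cancel (Nat.dvd_of_mod_eq_zero h0)]
      · rw [if_neg (by tauto), if_neg (by tauto)]
        obtain ⟨h5, h6⟩ := hprev h0
        have := h.sptr _ h5
        rwa [h6] at this
    · have := hdiv i h3
      rw [if_neg (by rintro ⟨h5, h6⟩; have := this h5; omega),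
        if_neg (by rintro ⟨h5, h6⟩; have := this h5; omega), h.sptr i h3]
  · have hsi := sup_index (n := n) (i := i) (by omega)
    rw [m5sup _ (by omega), m1sup _ (by omega)]
    rcases hold i hi with rfl | ⟨h3, h4⟩
    · by_cases h0 : i % pL n = 0
      · rw [if_neg (by omega), if_pos ⟨h0, rfl⟩, Nat.div_mul_cancel (Nat.dvd_of_mod_eq_zero h0)]
      · rw [if_neg (by tauto), if_neg (by tauto)]
        obtain ⟨h5, h6⟩ := hprev h0
        have := h.srnk _ h5
        rwa [h6] at this
    · have := hdiv i h3
      rw [if_neg (by rintro ⟨h5, h6⟩; have := this h5; omega),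
        if_neg (by rintro ⟨h5, h6⟩; have := this h5; omega), h.srnk i h3]
  · rcases hold i hi with rfl | ⟨h3, h4⟩
    · rw [hm5, readField_writeField, Nat.mod_eq_of_lt (enc_lt (blk_lt i))]
    · have h5 := bptr_mono (X := X) (b := pb n) (Nat.succ_le_of_lt h3)
      rw [Nat.succ_eq_add_one, bptr_succ] at h5
      rw [hm5, readField_writeField_of_disjoint _ _ (by omega),
        readField_writeField_of_disjoint _ _ (by omega),
        readField_writeField_of_disjoint _ _ (by omega),
        readField_writeField_of_disjoint _ _ (by omega), m1str _ _ (by omega), h.code i h3]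

end BitVector

end LZ

namespace LZ

/-! ### Programs that build and query the compressed bit vector -/

section Compress

/-- Start a new superblock where necessary. -/
def newSuper : Cmd :=
  .ite (.var 30 % .var 1) .skip (.assign 33 (.var 31) ++ (.assign 34 (.var 32) ++
    (.put (.var 17) (.var 5) (2 * (.var 30 / .var 1)) (.var 33) ++
    .put (.var 17) (.var 5) (2 * (.var 30 / .var 1) + 1) (.var 34))))

/-- Encode a block. -/
def encodeBlock : Cmd :=
  .assign 35 (.get (.var 18) (.var 3) (.var 30)) ++ (.assign 36 (.pop (.var 35)) ++
  (.assign 37 (.get (.var 14) (.var 5) (.var 36)) ++ (.assign 38 (.get 0 (.var 5) (.var 35)) ++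
  (.put (.var 16) (.var 4) (3 * .var 30) (.var 36) ++
  (.put (.var 16) (.var 4) (3 * .var 30 + 1) (.var 31 - .var 33) ++
  (.put (.var 16) (.var 4) (3 * .var 30 + 2) (.var 32 - .var 34) ++
  (.store (.var 19 + .var 31) (.var 37) (.var 38) ++
  (.assign 31 (.var 31 + .var 37) ++ (.assign 32 (.var 32 + .var 36) ++
  .assign 30 (.var 30 + 1))))))))))

/-- Compress the bit vector. -/
def compress : Cmd :=
  .assign 30 0 ++ (.assign 31 0 ++ (.assign 32 0 ++ (.assign 33 0 ++ (.assign 34 0 ++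
  (.loop (.lt (.var 30) (.var 11)) (newSuper ++ encodeBlock) ++
  .assign 20 (.var 19 + .var 31))))))

/-- Look up the bit with the index in variable 26. -/
def lookup : Cmd :=
  .assign 35 (.var 26 / .var 3) ++ (.assign 36 (.var 26 % .var 3) ++
  (.assign 37 (.get (.var 16) (.var 4) (3 * .var 35)) ++
  (.assign 38 (.get (.var 16) (.var 4) (3 * .var 35 + 1)) ++
  (.assign 39 (.get (.var 17) (.var 5) (2 * (.var 35 / .var 1))) ++
  (.assign 29 (.get (.var 16) (.var 4) (3 * .var 35 + 2)) ++
  (.assign 40 (.get (.var 17) (.var 5) (2 * (.var 35 / .var 1) + 1)) ++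
  (.assign 41 (.get (.var 14) (.var 5) (.var 37)) ++
  (.assign 42 (.ld (.var 19 + (.var 38 + .var 39)) (.var 41)) ++
  (.assign 43 (.get (.var 12) (.var 5) (.var 37 * .var 10 + .var 42)) ++
  (.assign 28 (.shr (.var 43) (.var 36) % 2) ++
  .assign 29 (.var 29 + .var 40 + .pop (.var 43 % .shl 1 (.var 36)))))))))))))

variable {σ : ℕ} {T : List (Fin σ)} {w M : ℕ}

theorem wp_assign_of {x a : ℕ} {e : Ex} {Q : St → Prop} {s : St} (h : s.ok T w M e)
    (ha : s.val T e = a) (hQ : Q (s.set x a (e.cost + 2))) : wp T w M (.assign x e) Q s :=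
  wp_assign h (ha ▸ hQ)

/-- Assign an entry of an array. -/
theorem wp_get (hM : M < 2 ^ w) {x a : ℕ} {base l i : Ex} {Q : St → Prop} {s : St} (N : ℕ)
    (hb : s.ok T w M base) (hl : s.ok T w M l) (hi : s.ok T w M i) (hlw : s.val T l ≤ w)
    (hiN : s.val T i < N) (h : s.val T base + N * s.val T l ≤ M)
    (ha : fld s.mem (s.val T base) (s.val T l) (s.val T i) = a)
    (hQ : Q (s.set x a ((Ex.get base l i).cost + 2))) : wp T w M (.assign x (.get base l i)) Q s :=
  wp_assign_of (ok_get hM N hb hl hi hlw hiN h) ha hQ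

theorem Env.pv_le (E : Env T w M) : pv T.length ≤ w := by
  have h1 := E.word
  have h2 := pg_le T.length
  have : pv T.length = 2 * pg T.length := rfl
  omega

theorem Env.pb_le (E : Env T w M) : pb T.length ≤ w := by
  have h1 := E.word
  have h2 := LZ.pb_le E.pos
  omega

/-- The addresses of the tables, in order. -/
theorem layout' (n : ℕ) : aDEC n = pP n * pw n ∧
    aCNT n = aDEC n + (pb n + 1) * pP n * pw n ∧ aLEN n = aCNT n + (pb n + 1) * pw n ∧
    aPOW n = aLEN n + (pb n + 1) * pw n ∧ aBLK n = aPOW n + pg n * pe n := ⟨rfl, rfl, rfl, rfl, rfl⟩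

theorem wp_newSuper (E : Env T w M) {X : ℕ → Bool} {s : St} {m : ℕ} (hp : Params T.length s.v)
    (hm : m < pK T.length) (e30 : s.v 30 = m) (e31 : s.v 31 = bptr X (pb T.length) m)
    (e32 : s.v 32 = brnk X (pb T.length) m)
    (e33 : m % pL T.length ≠ 0 → s.v 33 = bptr X (pb T.length) (m / pL T.length * pL T.length) ∧
      s.v 34 = brnk X (pb T.length) (m / pL T.length * pL T.length)) :
    wp T w M newSuper (fun s' =>
      s'.v 33 = bptr X (pb T.length) (m / pL T.length * pL T.length) ∧
      s'.v 34 = brnk X (pb T.length) (m / pL T.length * pL T.length) ∧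
      s'.mem = (if m % pL T.length = 0 then
        writeField (writeField s.mem (aSUP T.length + 2 * (m / pL T.length) * pw T.length)
          (pw T.length) (bptr X (pb T.length) m))
          (aSUP T.length + (2 * (m / pL T.length) + 1) * pw T.length) (pw T.length)
          (brnk X (pb T.length) m)
      else s.mem) ∧ s'.time ≤ s.time + 60) s := by
  obtain ⟨l1, l2, l3⟩ := layout T.length
  have hMw := E.mem
  have hstr := E.str
  have hsup := sup_index hm
  have hw16 := E.sixteen_le
  have hbig := E.big
  have hKn := pK_le E.pos
  have hmL : m / pL T.length ≤ m := Nat.div_le_self _ _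
  have a1 := hp.hL
  have a2 := hp.hw
  have a3 := hp.hSUP
  have hpw := E.pw_le
  refine wp_ite (by simp) (fun h0 => wp_skip ?_) (fun h0 => ?_)
  · simp [e30, a1] at h0
    obtain ⟨h1, h2⟩ := e33 h0
    simp [h0, h1, h2]
  · simp [e30, a1] at h0
    have h1 : m / pL T.length * pL T.length = m := Nat.div_mul_cancel (Nat.dvd_of_mod_eq_zero h0)
    refine wp_seq (wp_assign (by simp) (wp_seq (wp_assign (by simp) (wp_seq
      (wp_put hMw (2 * (pK T.length / pL T.length + 1)) (by simp) (by simp) ?_ (by simp) ?_ ?_ ?_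
      (wp_put hMw (2 * (pK T.length / pL T.length + 1)) (by simp) (by simp) ?_ (by simp) ?_ ?_ ?_
        ⟨?_, ?_, ?_, ?_⟩))))))
    · simp [e30, a1]; omega
    · simp [a2, hpw]
    · simp [e30, a1]; omega
    · simp [a2, a3]; omega
    · simp [e30, a1]; omega
    · simp [a2, hpw]
    · simp [e30, a1]; omega
    · simp [a2, a3]; omega
    · simp [e31, h1]
    · simp [e32, h1]
    · simp [h0, a1, a2, a3, e30, e31, e32]
    · simp

/-- The loop invariant of the compression. -/
structure CompInv (s0 s : St) (n i : ℕ) (X : ℕ → Bool) : Prop where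
  params : Params n s.v
  comp : Comp n s.mem X i
  e30 : s.v 30 = i
  e31 : s.v 31 = bptr X (pb n) i
  e32 : s.v 32 = brnk X (pb n) i
  e33 : i % pL n ≠ 0 → s.v 33 = bptr X (pb n) (i / pL n * pL n) ∧
      s.v 34 = brnk X (pb n) (i / pL n * pL n)
  mem : ∀ k, k < aBLK n ∨ (aBV n ≤ k ∧ k < aSTR n) → s.mem k = s0.mem k
  time : s.time ≤ s0.time + 20 + 250 * i

theorem wp_encodeBlock (E : Env T w M) {X : ℕ → Bool} {s0 s1 s : St} {m : ℕ}
    (h : CompInv s0 s1 T.length m X) (ht : Tab T.length s0.mem)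
    (hX : ∀ k < pK T.length * pb T.length, X k = s0.mem (aBV T.length + k))
    (hM : aSTR T.length + bptr X (pb T.length) (pK T.length) ≤ M) (hm : m < pK T.length)
    (hp : Params T.length s.v) (e30 : s.v 30 = m) (e31 : s.v 31 = bptr X (pb T.length) m)
    (e32 : s.v 32 = brnk X (pb T.length) m)
    (e33 : s.v 33 = bptr X (pb T.length) (m / pL T.length * pL T.length))
    (e34 : s.v 34 = brnk X (pb T.length) (m / pL T.length * pL T.length))
    (hmem : s.mem = (if m % pL T.length = 0 then
        writeField (writeField s1.mem (aSUP T.length + 2 * (m / pL T.length) * pw T.length)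
          (pw T.length) (bptr X (pb T.length) m))
          (aSUP T.length + (2 * (m / pL T.length) + 1) * pw T.length) (pw T.length)
          (brnk X (pb T.length) m)
      else s1.mem)) (htime : s.time ≤ s1.time + 70) :
    wp T w M encodeBlock (fun s' => CompInv s0 s' T.length (m + 1) X) s := by
  obtain ⟨l1, l2, l3⟩ := layout T.length
  obtain ⟨k1, k2, k3, k4, k5⟩ := layout' T.length
  have hMw := E.mem
  have hstr := E.str
  have hsup := sup_index hm
  have hw16 := E.sixteen_le
  have hbig := E.big
  have hn := E.pos
  have hL := pL_pos hn
  have hKn := pK_le hn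
  have hst := h.comp.step hn hm hmem
  have s0' := index_le (w := pw T.length) (show 2 * (m / pL T.length) <
    2 * (pK T.length / pL T.length + 1) by omega)
  have s1' := index_le (w := pw T.length) hsup
  have hsm : ∀ k, k < aBLK T.length ∨ (aBV T.length ≤ k ∧ k < aSTR T.length) →
      s.mem k = s0.mem k := by
    intro k hk
    rw [hmem, ← h.mem k hk]
    split_ifs
    · rw [writeField_of_not_mem _ _ (by omega), writeField_of_not_mem _ _ (by omega)]
    · rfl
  have htab : Tab T.length s.mem := ht.congr fun k hk => hsm k (Or.inl hk)
  have vb : fld s.mem (aBV T.length) (pb T.length) m = blk X (pb T.length) m := by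
    have := index_le (w := pb T.length) hm
    rw [fld_congr hm fun k h1 h2 => hsm k (Or.inr ⟨h1, by omega⟩), fld, readField_shift]
    exact readField_congr fun k h1 h2 => (hX k (by omega)).symm
  have hx : blk X (pb T.length) m < pP T.length := blk_lt m
  have vl := htab.len _ (pop_blk_le (X := X) m)
  have ve := htab.enc _ hx
  have hpopb := pop_blk_le (X := X) (b := pb T.length) m
  have hbL := LZ.pb_le hn
  have hLn := pL_le T.length
  have hmono1 := bptr_mono (X := X) (b := pb T.length) (Nat.div_mul_le_self m (pL T.length))
  have hmono2 := brnk_mono (X := X) (b := pb T.length) (Nat.div_mul_le_self m (pL T.length))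
  have hmono3 := bptr_mono (X := X) (b := pb T.length) (Nat.succ_le_of_lt hm)
  rw [Nat.succ_eq_add_one, bptr_succ] at hmono3
  have hr := brnk_le (X := X) (b := pb T.length) m
  have hmb : m * pb T.length ≤ T.length + pb T.length :=
    (Nat.mul_le_mul_right _ hm.le).trans (pK_mul_le _)
  have hcl := clen_le (pb T.length) (pop (blk X (pb T.length) m))
  have hpw := E.pw_le
  have hpv := E.pv_le
  have hpb := E.pb_le
  have a1 := hp.hw
  have a2 := hp.hv
  have a3 := hp.hb
  have a4 := hp.hBV
  have a5 := hp.hLEN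
  have a6 := hp.hBLK
  have a7 := hp.hSTR
  refine wp_seq (wp_assign ?_ ?_)
  · refine ok_get hMw (pK T.length) (by simp) (by simp) (by simp) ?_ ?_ ?_
    · simp [a3, hpb]
    · simp [e30, hm]
    · simp [a3, a4]; omega
  rw [show s.val T (.get (.var 18) (.var 3) (.var 30)) = blk X (pb T.length) m by
    rw [St.val, val_get]; simp [a3, a4, e30, vb]]
  refine wp_seq (wp_assign (by simp) (wp_seq (wp_assign ?_ ?_)))
  · refine ok_get hMw (pb T.length + 1) (by simp) (by simp) (by simp) ?_ ?_ ?_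
    · simp [a1, hpw]
    · simp; omega
    · simp [a1, a5]; omega
  simp only [St.val, val_get]
  simp only [val_pop, val_var, set_v, set_mem, Function.update_self,
    Function.update_of_ne (show (14 : ℕ) ≠ 36 by omega),
    Function.update_of_ne (show (14 : ℕ) ≠ 35 by omega),
    Function.update_of_ne (show (5 : ℕ) ≠ 36 by omega),
    Function.update_of_ne (show (5 : ℕ) ≠ 35 by omega), a1, a5, vl]
  refine wp_seq (wp_assign ?_ ?_)
  · refine ok_get hMw (pP T.length) (by simp) (by simp) (by simp) ?_ ?_ ?_
    · simp [a1, hpw]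
    · simp [hx]
    · simp [a1]; omega
  simp only [St.val, val_get]
  simp only [val_num, val_var, set_v, set_mem, Function.update_self,
    Function.update_of_ne (show (35 : ℕ) ≠ 36 by omega),
    Function.update_of_ne (show (35 : ℕ) ≠ 37 by omega),
    Function.update_of_ne (show (5 : ℕ) ≠ 36 by omega),
    Function.update_of_ne (show (5 : ℕ) ≠ 37 by omega),
    Function.update_of_ne (show (5 : ℕ) ≠ 35 by omega), a1, ve]
  refine wp_seq (wp_put hMw (3 * pK T.length) (by simp) (by simp) ?_ (by simp) ?_ ?_ ?_
    (wp_seq (wp_put hMw (3 * pK T.length) (by simp) (by simp) ?_ ?_ ?_ ?_ ?_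
    (wp_seq (wp_put hMw (3 * pK T.length) (by simp) (by simp) ?_ ?_ ?_ ?_ ?_
    (wp_seq (wp_store ?_ ?_ ?_ ?_ ?_ (wp_seq (wp_assign ?_ (wp_seq (wp_assign ?_ (wp_assign ?_
      ?_))))))))))))
  · simp [e30]; omega
  · simp [a2, hpv]
  · simp [e30, hm]
  · simp [a2, a6]; omega
  · simp [e30]; omega
  · simp [e31, e33, hmono1]
  · simp [a2, hpv]
  · simp [e30]; omega
  · simp [a2, a6]; omega
  · simp [e30]; omega
  · simp [e32, e34, hmono2]
  · simp [a2, hpv]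
  · simp [e30]; omega
  · simp [a2, a6]; omega
  · simp [a7, e31]; omega
  · simp
  · simp
  · simp; omega
  · simp [a7, e31]; omega
  · simp [e31]; omega
  · simp [e32]; omega
  · simp [e30]; omega
  · have e5 : ∀ {v : ℕ → ℕ} {v' : ℕ → ℕ}, Params T.length v → (∀ r < 20, v' r = v r) →
      Params T.length v' := fun h h' => h.congr h'
    have b0 := index_le (w := pv T.length) (show 3 * m < 3 * pK T.length by omega)
    have b1 := index_le (w := pv T.length) (show 3 * m + 1 < 3 * pK T.length by omega)
    have b2 := index_le (w := pv T.length) (show 3 * m + 2 < 3 * pK T.length by omega)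
    refine ⟨?_, ?_, ?_, ?_, ?_, ?_, ?_, ?_⟩
    · refine hp.congr fun r hr => ?_
      simp [Function.update_of_ne (show r ≠ 30 by omega), Function.update_of_ne (show r ≠ 31 by omega),
        Function.update_of_ne (show r ≠ 32 by omega), Function.update_of_ne (show r ≠ 35 by omega),
        Function.update_of_ne (show r ≠ 36 by omega), Function.update_of_ne (show r ≠ 37 by omega),
        Function.update_of_ne (show r ≠ 38 by omega)]
    · convert hst using 1
      simp [a2, a6, a7, e30, e31, e32, e33, e34]
    · simp [e30]
    · simp [e31, bptr_succ]
    · simp [e32, brnk_succ]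
    · intro h0
      have hdiv : (m + 1) / pL T.length = m / pL T.length := by
        rw [Nat.succ_div, if_neg (fun h => h0 (Nat.mod_eq_zero_of_dvd h)), add_zero]
      simp [e33, e34, hdiv]
    · intro k hk
      simp [a2, a6, a7, e30, e31, e32, e33, e34]
      rw [writeField_of_not_mem _ _ (by omega), writeField_of_not_mem _ _ (by omega),
        writeField_of_not_mem _ _ (by omega), writeField_of_not_mem _ _ (by omega), hsm k hk]
    · have := h.time
      simp; omega

/-- The codes go behind the plain bit vector and the directories lie in front of it, so the blocks
still to be read remain intact. -/
theorem wp_compress (E : Env T w M) {X : ℕ → Bool} {s : St} (hp : Params T.length s.v)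
    (ht : Tab T.length s.mem) (hX : ∀ k < pK T.length * pb T.length, X k = s.mem (aBV T.length + k))
    (hM : aSTR T.length + bptr X (pb T.length) (pK T.length) ≤ M) :
    wp T w M compress (fun s' => Comp T.length s'.mem X (pK T.length) ∧
      s'.v 20 = aSTR T.length + bptr X (pb T.length) (pK T.length) ∧
      s'.v 32 = brnk X (pb T.length) (pK T.length) ∧
      (∀ k, k < aBLK T.length ∨ (aBV T.length ≤ k ∧ k < aSTR T.length) → s'.mem k = s.mem k) ∧
      s'.time ≤ s.time + 600 * T.length) s := by
  have hn := E.pos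
  have hKn := pK_le hn
  have hMw := E.mem
  refine wp_seq (wp_assign (by simp) (wp_seq (wp_assign (by simp) (wp_seq (wp_assign (by simp)
    (wp_seq (wp_assign (by simp) (wp_seq (wp_assign (by simp) (wp_seq ?_))))))))))
  refine wp_loop (pK T.length) (fun i s' => CompInv s s' T.length i X) ?_ ?_ ?_
  · intro i hi s' h
    refine ⟨by simp, by simp [h.e30, h.params.hK, hi], ?_⟩
    refine wp_seq ((wp_newSuper E (s := s'.tick _) h.params hi h.e30 h.e31 h.e32 h.e33).use ?_)
    rintro s1 f1 - - ⟨g1, g2, g3, g4⟩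
    simp only [newSuper, writes_append, Cmd.writes] at f1
    refine wp_encodeBlock E h ht hX hM hi (h.params.congr fun r hr => f1 r ?_) ?_ ?_ ?_ g1 g2 g3 ?_
    · simp; omega
    · rw [f1 _ (by decide), tick_v, h.e30]
    · rw [f1 _ (by decide), tick_v, h.e31]
    · rw [f1 _ (by decide), tick_v, h.e32]
    · simp at g4; omega
  · intro s' h
    refine ⟨by simp, by simp [h.e30, h.params.hK], wp_assign ?_ ⟨h.comp, ?_, ?_, h.mem, ?_⟩⟩
    · simp [h.e31, h.params.hSTR]; omega
    · simp [h.e31, h.params.hSTR]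
    · simp [h.e32]
    · have := h.time
      simp; omega
  · refine ⟨hp.congr fun r hr => ?_, ⟨by simp, by simp, by simp, by simp, by simp, by simp⟩, by simp,
      by simp [bptr], by simp [brnk], by simp, by simp, by simp⟩
    simp [Function.update_of_ne (show r ≠ 30 by omega), Function.update_of_ne (show r ≠ 31 by omega),
        Function.update_of_ne (show r ≠ 32 by omega), Function.update_of_ne (show r ≠ 33 by omega),
        Function.update_of_ne (show r ≠ 34 by omega)]

/-- The superblock entry and the relative entry give the pointer and the rank of the block. The
class determines the length of the code, and the decoding table returns the whole block. The bit is
then read by a shift, and the ones in front of it within the block are counted by a population count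
of the lower bits. -/
theorem wp_lookup (E : Env T w M) {X : ℕ → Bool} {s : St} {q : ℕ} (hp : Params T.length s.v)
    (ht : Tab T.length s.mem) (hc : Comp T.length s.mem X (pK T.length)) (hq : s.v 26 = q)
    (hqn : q ≤ T.length) (hM : aSTR T.length + bptr X (pb T.length) (pK T.length) ≤ M) :
    wp T w M lookup (fun s' => s'.v 28 = (if X q then 1 else 0) ∧ s'.v 29 = ones X q ∧
      s'.time ≤ s.time + 220) s := by
  obtain ⟨l1, l2, l3⟩ := layout T.length
  obtain ⟨k1, k2, k3, k4, k5⟩ := layout' T.length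
  have hMw := E.mem
  have hstr := E.str
  have hw16 := E.sixteen_le
  have hbig := E.big
  have hn := E.pos
  have hL := pL_pos hn
  have hKn := pK_le hn
  have hb0 := pb_pos T.length
  have hi : q / pb T.length < pK T.length := Nat.lt_succ_of_le (Nat.div_le_div_right hqn)
  have hr : q % pb T.length < pb T.length := Nat.mod_lt _ hb0
  have hdm := Nat.div_add_mod' q (pb T.length)
  have hsup := sup_index hi
  set i := q / pb T.length with hidef
  set r := q % pb T.length with hrdef
  have hx : blk X (pb T.length) i < pP T.length := blk_lt i
  have c1 := hc.cls i hi
  have c2 := hc.ptr i hi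
  have c3 := hc.rnk i hi
  have c4 := hc.sptr i hi
  have c5 := hc.srnk i hi
  have c6 := hc.code i hi
  have hpopb := pop_blk_le (X := X) (b := pb T.length) i
  have vl := ht.len _ hpopb
  have vd := ht.dec _ hx
  have hix := dec_index_lt hx
  have hix' := Nat.le_mul_of_pos_right ((pb T.length + 1) * pP T.length) 
      (show 0 < pw T.length from Nat.succ_pos _)
  have hbL := LZ.pb_le hn
  have hLn := pL_le T.length
  have hmono1 := bptr_mono (X := X) (b := pb T.length) (Nat.div_mul_le_self i (pL T.length))
  have hmono2 := brnk_mono (X := X) (b := pb T.length) (Nat.div_mul_le_self i (pL T.length))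
  have hmono3 := bptr_mono (X := X) (b := pb T.length) (Nat.succ_le_of_lt hi)
  rw [Nat.succ_eq_add_one, bptr_succ] at hmono3
  have hrk := brnk_le (X := X) (b := pb T.length) i
  have hmb : i * pb T.length ≤ T.length + pb T.length :=
    (Nat.mul_le_mul_right _ hi.le).trans (pK_mul_le _)
  have hcl := clen_le (pb T.length) (pop (blk X (pb T.length) i))
  have hpw := E.pw_le
  have hpv := E.pv_le
  have hpb := E.pb_le
  have hiL : i / pL T.length ≤ i := Nat.div_le_self _ _
  have h2r : 2 ^ r < 2 ^ w := Nat.pow_lt_pow_right (by omega) (by omega)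
  have hbit : blk X (pb T.length) i / 2 ^ r % 2 = if X q then 1 else 0 := by
    rw [blk, readField_bit _ _ hr, hdm]
  have hones : brnk X (pb T.length) i + pop (blk X (pb T.length) i % 2 ^ r) = ones X q := by
    rw [blk, readField_mod _ _ hr.le, brnk_eq, ← ones_add, hdm]
  have hpr : pop (blk X (pb T.length) i % 2 ^ r) ≤ r := pop_le (Nat.mod_lt _ (Nat.two_pow_pos r))
  have a1 := hp.hw
  have a2 := hp.hv
  have a3 := hp.hb
  have a4 := hp.hL
  have a5 := hp.hLEN
  have a6 := hp.hBLK
  have a7 := hp.hSTR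
  have a8 := hp.hSUP
  have a9 := hp.hDEC
  have a10 := hp.hP
  refine wp_seq (wp_assign_of (a := i) (by simp) (by simp [hq, a3, hidef]) (wp_seq
    (wp_assign_of (a := r) (by simp) (by simp [hq, a3, hrdef]) ?_)))
  refine wp_seq (wp_get hMw (3 * pK T.length) (a := pop (blk X (pb T.length) i)) (by simp) (by simp)
    ?_ ?_ ?_ ?_ ?_ ?_)
  · simp; omega
  · simp [a2, hpv]
  · simp [hi]
  · simp [a2, a6]; omega
  · simp [a2, a6, c1]
  refine wp_seq (wp_get hMw (3 * pK T.length) (by simp) (by simp) ?_ ?_ ?_ ?_ 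
    (by simp [a2, a6, c2]; rfl) ?_)
  · simp; omega
  · simp [a2, hpv]
  · simp; omega
  · simp [a2, a6]; omega
  refine wp_seq (wp_get hMw (2 * (pK T.length / pL T.length + 1)) (by simp) (by simp) ?_ ?_ ?_ ?_ 
    (by simp [a1, a4, a8, c4]; rfl) ?_)
  · simp [a4]; omega
  · simp [a1, hpw]
  · simp [a4]; omega
  · simp [a1, a8]; omega
  refine wp_seq (wp_get hMw (3 * pK T.length) (by simp) (by simp) ?_ ?_ ?_ ?_ 
    (by simp [a2, a6, c3]; rfl) ?_)
  · simp; omega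
  · simp [a2, hpv]
  · simp; omega
  · simp [a2, a6]; omega
  refine wp_seq (wp_get hMw (2 * (pK T.length / pL T.length + 1)) (by simp) (by simp) ?_ ?_ ?_ ?_ 
    (by simp [a1, a4, a8, c5]; rfl) ?_)
  · simp [a4]; omega
  · simp [a1, hpw]
  · simp [a4]; omega
  · simp [a1, a8]; omega
  refine wp_seq (wp_get hMw (pb T.length + 1) (by simp) (by simp) (by simp) ?_ ?_ ?_ 
    (by simp [a1, a5, vl]; rfl) ?_)
  · simp [a1, hpw]
  · simp; omega
  · simp [a1, a5]; omega
  have hadd1 : bptr X (pb T.length) i - bptr X (pb T.length) (i / pL T.length * pL T.length) +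
      bptr X (pb T.length) (i / pL T.length * pL T.length) = bptr X (pb T.length) i := by omega
  have hadd2 : brnk X (pb T.length) i - brnk X (pb T.length) (i / pL T.length * pL T.length) +
      brnk X (pb T.length) (i / pL T.length * pL T.length) = brnk X (pb T.length) i := by omega
  refine wp_seq (wp_assign_of (a := enc (blk X (pb T.length) i)) ?_ ?_ ?_)
  · simp [a7, hadd1]; omega
  · simp [a7, hadd1, c6]
  refine wp_seq (wp_get hMw ((pb T.length + 1) * pP T.length) (a := blk X (pb T.length) i) (by simp)
    (by simp) ?_ ?_ ?_ ?_ ?_ ?_)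
  · simp [a10]; omega
  · simp [a1, hpw]
  · simp [a10, hix]
  · simp [a1, a9]; omega
  · simp [a1, a9, a10, vd]
  refine wp_seq (wp_assign_of (a := if X q then 1 else 0) ?_ ?_ (wp_assign_of (a := ones X q) ?_ ?_
    ⟨?_, ?_, ?_⟩))
  · simp; omega
  · simp [hbit]
  · simp [h2r, hadd2]; omega
  · simp [hadd2, hones]
  · simp
  · simp
  · simp

end Compress

end LZ

namespace LZ

/-! ### Climbs and string depths on the machine -/

section Climb

/-- Climb from a leaf to the lowest visited ancestor. -/
def climb (visit : Cmd) : Cmd :=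
  .assign 25 (.qry .parent (.var 21) 0) ++ (.assign 26 (.qry .internalRank (.var 25) 0) ++
  .loop (.eq (.ld (.var 18 + .var 26) 1) 0) (.store (.var 18 + .var 26) 1 1 ++ (visit ++
    (.assign 25 (.qry .parent (.var 25) 0) ++ .assign 26 (.qry .internalRank (.var 25) 0)))))

/-- Compute the string depth of an inner node. -/
def strDepth : Cmd :=
  .assign 27 0 ++ (.assign 28 (.qry .leafRank (.qry .leftmostLeaf (.var 25) 0) 0) ++
  (.assign 29 (.qry .leafRank (.qry .rightmostLeaf (.var 25) 0) 0) ++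
  .loop (.eq (.qry .levelAnc (.qry .leafSelect (.var 28) 0) 1)
      (.qry .levelAnc (.qry .leafSelect (.var 29) 0) 1))
    (.assign 28 (.qry .psi (.var 28) 0) ++ (.assign 29 (.qry .psi (.var 29) 0) ++
    .assign 27 (.var 27 + 1)))))

/-- A pass over the leaves in text order. -/
def traverse (visit ref fresh : Cmd) : Cmd :=
  .assign 21 (.qry .smallestLeaf 0 0) ++ (.assign 22 1 ++ (.assign 23 1 ++
  .loop (.lt (.var 22) (.var 0 + 1)) (climb visit ++
    (.ite (.eq (.var 22) (.var 23))
      (.ite (.lt (.var 25) 2) (fresh ++ .assign 23 (.var 23 + 1))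
        (strDepth ++ (ref ++ .assign 23 (.var 23 + .var 27)))) .skip ++
    (.assign 22 (.var 22 + 1) ++
    .assign 21 (.qry .leafSelect (.qry .psi (.qry .leafRank (.var 21) 0) 0) 0))))))

variable {σ : ℕ} {T : List (Fin σ)} {w M : ℕ}

/-- The bit vector of the visited nodes. -/
def Marks (T : List (Fin σ)) (mem : ℕ → Bool) (V : Finset (List (Fin σ))) : Prop :=
  ∀ q ≤ T.length, mem (aBV T.length + q) = true ↔ ∃ x ∈ insert [] V, rk T x = q

/-- The program `visit` handles the first visit of a node, and `ref` and `fresh` handle factors,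
where `D P V s` relates the state to the factor positions and the visited nodes so far. -/
structure Hooks (T : List (Fin σ)) (w M : ℕ)
    (D : List ℕ → Finset (List (Fin σ)) → St → Prop) (visit ref fresh : Cmd) (c : ℕ) : Prop where
  stable : ∀ {P V s s'}, D P V s → s'.v 20 = s.v 20 → s'.v 24 = s.v 24 → s'.out = s.out →
    (∀ k, k < aBV T.length ∨ aSTR T.length ≤ k → s'.mem k = s.mem k) → D P V s'
  writes : ∀ r ∈ visit.writes ++ (ref.writes ++ fresh.writes), r = 24 ∨ 28 ≤ r
  visit : ∀ {j V x s}, 1 ≤ j → j ≤ T.length → x ∈ newlyVisited T (vis T j) (suffix T j) →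
    Params T.length s.v → s.v 22 = j → s.v 26 = rk T x → D (facPos T (j - 1)) V s →
    wp T w M visit (fun s' => D (facPos T (j - 1)) (insert x V) s' ∧
      (∀ k, aBV T.length ≤ k → k < aSTR T.length → s'.mem k = s.mem k) ∧
      s'.time ≤ s.time + c) s
  ref : ∀ {j x s}, 1 ≤ j → j ≤ T.length → nxt T (j - 1) = j → stopAt T j = some x →
    Params T.length s.v → s.v 26 = rk T x → s.v 27 = x.length →
    D (facPos T (j - 1)) (vis T (j + 1)) s →
    wp T w M ref (fun s' => D (facPos T j) (vis T (j + 1)) s' ∧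
      (∀ k, aBV T.length ≤ k → k < aSTR T.length → s'.mem k = s.mem k) ∧
      s'.time ≤ s.time + c) s
  fresh : ∀ {j s}, 1 ≤ j → j ≤ T.length → nxt T (j - 1) = j → stopAt T j = none →
    Params T.length s.v → s.v 21 = preorder T (suffix T j) →
    D (facPos T (j - 1)) (vis T (j + 1)) s →
    wp T w M fresh (fun s' => D (facPos T j) (vis T (j + 1)) s' ∧
      (∀ k, aBV T.length ≤ k → k < aSTR T.length → s'.mem k = s.mem k) ∧
      s'.time ≤ s.time + c) s

theorem rk_addr (hT : IsText T) (x : List (Fin σ)) :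
    aBV T.length + rk T x + 1 ≤ aSTR T.length := by
  have h1 := rk_le hT x
  have h2 := lt_pK_mul T.length
  have h3 : aSTR T.length = aBV T.length + pK T.length * pb T.length := rfl
  omega

theorem Marks.iff (hT : IsText T) {mem : ℕ → Bool} {V : Finset (List (Fin σ))}
    (h : Marks T mem V) {x : List (Fin σ)} (hx : x ∈ internals T) :
    mem (aBV T.length + rk T x) = true ↔ x = [] ∨ x ∈ V := by
  rw [h _ (rk_le hT x), ← Finset.mem_insert]
  constructor
  · rintro ⟨y, hy, hyx⟩
    rwa [rk_inj hx hyx.symm]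
  · exact fun h => ⟨x, h, rfl⟩

theorem Marks.insert {mem : ℕ → Bool} {V : Finset (List (Fin σ))} (h : Marks T mem V)
    (x : List (Fin σ)) :
    Marks T (writeField mem (aBV T.length + rk T x) 1 1) (insert x V) := by
  intro q hq
  rw [writeField_one]
  by_cases hqx : rk T x = q
  · subst hqx
    simp only [Function.update_self]
    simp only [decide_true, true_iff]
    exact ⟨x, by simp, rfl⟩
  · rw [Function.update_of_ne (by omega), h q hq]
    simp only [Finset.mem_insert, or_and_right, exists_or, exists_eq_left, hqx, false_or]

theorem Marks.congr {mem mem' : ℕ → Bool} {V : Finset (List (Fin σ))} (h : Marks T mem V)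
    (hm : ∀ k, aBV T.length ≤ k → k < aSTR T.length → mem' k = mem k) : Marks T mem' V := by
  intro q hq
  have h2 := lt_pK_mul T.length
  have h3 : aSTR T.length = aBV T.length + pK T.length * pb T.length := rfl
  rw [hm _ (by omega) (by omega), h q hq]

/-- A node and the nodes on the way to the root, without the root. -/
def upPath (T u : List (Fin σ)) : List (List (Fin σ)) := if u = [] then [] else u :: climbPath T u

theorem parent_upPath {u p : List (Fin σ)} (h : ancestors T u = ancestors T p ++ [p]) :
    upPath T p = climbPath T u := by
  unfold upPath
  split_ifs with hp
  · subst hp; rw [climbPath_of_parent_nil h]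
  · rw [climbPath_of_parent h hp]

/-- The invariant says that after `i` iterations the current node heads the climb path without its
first `i` nodes, and that exactly these have been added to the marks. The root is marked from the
outset, so a single bit test ends the climb both at a visited node and at the root. The iterations
are paid for by the newly visited nodes. -/
theorem wp_climb (E : Env T w M) {D : List ℕ → Finset (List (Fin σ)) → St → Prop}
    {visit ref fresh : Cmd} {c : ℕ} (H : Hooks T w M D visit ref fresh c) {s : St} {j : ℕ}
    (h1 : 1 ≤ j) (hj : j ≤ T.length) (hp : Params T.length s.v)
    (h21 : s.v 21 = preorder T (suffix T j)) (h22 : s.v 22 = j)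
    (hD : D (facPos T (j - 1)) (vis T j) s) (hm : Marks T s.mem (vis T j)) :
    wp T w M (climb visit) (fun s' => ∃ u, IsNode T u ∧ ¬ IsLeaf T u ∧ s'.v 25 = preorder T u ∧
      s'.v 26 = rk T u ∧ ((u = [] ∧ stopAt T j = none) ∨ (u ≠ [] ∧ stopAt T j = some u)) ∧
      D (facPos T (j - 1)) (vis T (j + 1)) s' ∧ Marks T s'.mem (vis T (j + 1)) ∧
      s'.time ≤ s.time + 30 +
        (c + 50) * (newlyVisited T (vis T j) (suffix T j)).length) s := by
  have hT := E.text
  have hMw := E.mem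
  have hstr := E.str
  have hw16 := E.sixteen_le
  have hbig := E.big
  set N := newlyVisited T (vis T j) (suffix T j) with hN
  have hNA := newlyVisited_append (T := T) (vis T j) (suffix T j)
  rw [← hN] at hNA
  have hnd := nodup_newlyVisited (T := T) (vis T j) (suffix T j)
  rw [← hN] at hnd
  have hint : ∀ {u} i, upPath T u = (climbPath T (suffix T j)).drop i →
      ¬ IsLeaf T u := by
    intro u i h
    unfold upPath at h
    split_ifs at h with h0
    · rw [h0]; exact not_isLeaf_nil
    · have : u ∈ climbPath T (suffix T j) := List.mem_of_mem_drop (i := i) (by rw [← h]; simp)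
      exact ((mem_climbPath_suffix hT h1 hj).1 this).1.2
  obtain ⟨p, hpa, hpn, -, -⟩ := exists_parent (T := T) (suffix_ne_nil h1 hj)
  refine wp_seq (wp_assign_of (a := preorder T p) ?_ ?_ (wp_seq (wp_assign_of (a := rk T p)
    ?_ ?_ ?_)))
  · simp; exact E.answer_lt _ _ _
  · simp [h21, answer_parent (isNode_suffix h1 hj) hpa]
  · simp; exact E.answer_lt _ _ _
  · simp [answer_internalRank hpn]
  refine wp_loop N.length (fun i s' => ∃ u, IsNode T u ∧
    upPath T u = (climbPath T (suffix T j)).drop i ∧ s'.v 25 = preorder T u ∧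
    s'.v 26 = rk T u ∧ D (facPos T (j - 1)) (vis T j ∪ (N.take i).toFinset) s' ∧
    Marks T s'.mem (vis T j ∪ (N.take i).toFinset) ∧ (∀ r < 24, s'.v r = s.v r) ∧
    s'.time ≤ s.time + 16 + (c + 50) * i) ?_ ?_ ?_
  · rintro i hi s' ⟨u, hu, hup, e25, e26, hD', hm', hv, ht⟩
    have hp' : Params T.length s'.v := hp.congr fun r hr => hv r (by omega)
    have hul := hint i hup
    have hadr := rk_addr hT u
    have hdrop : (climbPath T (suffix T j)).drop i = N[i] :: (climbPath T (suffix T j)).drop (i + 1) := by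
      rw [← List.cons_getElem_drop_succ (n := i) (h := by rw [← hNA, List.length_append]; omega)]
      congr 1
      rw [List.getElem_of_eq hNA.symm, List.getElem_append_left]
    have huN : u = N[i] ∧ u ≠ [] ∧ climbPath T u = (climbPath T (suffix T j)).drop (i + 1) := by
      rw [hdrop] at hup
      unfold upPath at hup
      split_ifs at hup with h0
      simp only [List.cons.injEq] at hup
      exact ⟨hup.1, h0, hup.2⟩
    obtain ⟨hui, hu0, hcl⟩ := huN
    have huin : u ∈ N := hui ▸ List.getElem_mem hi
    have hnot : u ∉ vis T j ∪ (N.take i).toFinset := by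
      rw [Finset.mem_union, List.mem_toFinset, not_or]
      refine ⟨((mem_newlyVisited hT h1 hj).1 huin).2, fun h => ?_⟩
      rw [List.mem_take_iff_getElem] at h
      obtain ⟨i', hi', he⟩ := h
      rw [hui, hnd.getElem_inj_iff] at he
      omega
    have hbit : s'.mem (aBV T.length + rk T u) = false := by
      rw [← Bool.not_eq_true, hm'.iff hT (mem_internals.2 ⟨hu, hul⟩)]
      simp [hu0, hnot]
    have a1 := hp'.hBV
    obtain ⟨q, hqa, hqn, -, -⟩ := exists_parent (T := T) hu0
    have hins : insert u (vis T j ∪ (N.take i).toFinset) =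
        vis T j ∪ (N.take (i + 1)).toFinset := by
      rw [List.take_succ_eq_append_getElem hi, List.toFinset_append, ← Finset.union_assoc,
        ← hui]
      simp [Finset.union_comm _ {u}]
    refine ⟨?_, ?_, wp_seq (wp_store ?_ ?_ ?_ ?_ ?_ (wp_seq ?_))⟩
    · simp [a1, e26]; omega
    · simp [a1, e26, readField_one, hbit]
    · simp [a1, e26]; omega
    · simp; omega
    · simp; omega
    · simp; omega
    · simp [a1, e26]; omega
    refine (H.visit (s := (s'.tick _).put _ _ _ _) h1 hj huin (V := vis T j ∪ (N.take i).toFinset) hp'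
      (by simp [hv, h22]) (by simp [e26])
      (H.stable hD' rfl rfl rfl fun k hk => ?_)).use ?_
    · simp [a1, e26]
      rw [writeField_of_not_mem _ _ (by omega)]
    rintro s2 f2 - - ⟨g1, g2, g3⟩
    have hwr : ∀ r, r < 24 ∨ r = 25 → s2.v r = s'.v r := fun r hr => by
      rw [f2 r]
      · simp
      · intro hr'
        have := H.writes r (List.mem_append_left _ hr')
        omega
    rw [hins] at g1
    have g4 : Marks T s2.mem (vis T j ∪ (N.take (i + 1)).toFinset) := by
      rw [← hins]
      refine (hm'.insert u).congr fun k h3 h4 => ?_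
      rw [g2 k h3 h4]
      simp [a1, e26]
    refine wp_seq (wp_assign_of (a := preorder T q) ?_ ?_ (wp_assign_of (a := rk T q) ?_ ?_
      ⟨q, hqn, ?_, ?_, ?_, ?_, ?_, ?_, ?_⟩))
    · simp; exact E.answer_lt _ _ _
    · simp [hwr, e25, answer_parent hu hqa]
    · simp; exact E.answer_lt _ _ _
    · simp [answer_internalRank hqn]
    · rw [parent_upPath hqa, hcl]
    · simp
    · simp
    · exact H.stable g1 rfl rfl rfl fun k hk => rfl
    · exact g4
    · intro r hr
      simp only [set_v]
      rw [Function.update_of_ne (by omega), Function.update_of_ne (by omega), hwr r (Or.inl hr),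
        hv r hr]
    · simp at g3 ⊢
      rw [Nat.mul_add]
      omega
  · rintro s' ⟨u, hu, hup, e25, e26, hD', hm', hv, ht⟩
    have hp' : Params T.length s'.v := hp.congr fun r hr => hv r (by omega)
    have hul := hint _ hup
    have hadr := rk_addr hT u
    have a1 := hp'.hBV
    rw [List.take_length, hN, ← vis_succ hT h1 hj] at hD' hm'
    rw [← hNA, List.drop_left] at hup
    -- What remains of the path is the `dropWhile` part, whose head is the stop node; if nothing
    -- remains, the climb has arrived at the root.
    have hend : (u = [] ∧ stopAt T j = none) ∨ (u ≠ [] ∧ stopAt T j = some u) := by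
      unfold stopAt stopNode
      rw [← hup, upPath]
      split_ifs with h0
      · exact Or.inl ⟨h0, rfl⟩
      · exact Or.inr ⟨h0, rfl⟩
    have hbit : s'.mem (aBV T.length + rk T u) = true := by
      rw [hm'.iff hT (mem_internals.2 ⟨hu, hul⟩)]
      rcases hend with h | ⟨-, h⟩
      · exact Or.inl h.1
      · rw [vis_succ hT h1 hj]
        exact Or.inr (Finset.mem_union_left _ (stop_eq_some hT h1 hj h).2.1)
    refine ⟨?_, ?_, u, hu, hul, e25, e26, hend, H.stable hD' rfl rfl rfl fun k hk => rfl, hm', ?_⟩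
    · simp [a1, e26]; omega
    · simp [a1, e26, readField_one, hbit]
    · simp; omega
  · refine ⟨p, hpn, ?_, ?_, ?_, ?_, ?_, ?_, ?_⟩
    · rw [parent_upPath hpa, List.drop_zero]
    · simp
    · simp
    · rw [List.take_zero, List.toFinset_nil, Finset.union_empty]
      exact H.stable hD rfl rfl rfl fun k hk => rfl
    · rw [List.take_zero, List.toFinset_nil, Finset.union_empty]
      exact hm
    · intro r hr
      simp only [set_v]
      rw [Function.update_of_ne (by omega), Function.update_of_ne (by omega)]
    · simp

theorem head?_suffix_eq {u : List (Fin σ)} {i k : ℕ} (hi : 1 ≤ i) (h : u <+: suffix T i)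
    (hk : k < u.length) : (suffix T (i + k)).head? = u[k]? := by
  obtain ⟨t, ht⟩ := h
  rw [suffix_add hi, List.head?_drop, ← ht, List.getElem?_append_left hk]

/-- The leftmost and the rightmost leaf below `u` agree for exactly `u.length` characters
(`leavesBelow_ends`). Advancing both by ψ while they lie below the same child of the root counts
these characters without access to the text. -/
theorem wp_strDepth (E : Env T w M) {s : St} {u : List (Fin σ)} (hu : IsNode T u)
    (hl : ¬ IsLeaf T u) (h0 : u ≠ []) (h25 : s.v 25 = preorder T u) :
    wp T w M strDepth (fun s' => s'.v 27 = u.length ∧ s'.time ≤ s.time + 50 + 50 * u.length) s := by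
  have hT := E.text
  have hw16 := E.sixteen_le
  have hbig := E.big
  obtain ⟨i, j, hi, hi', hj, hj', e1, e2, p1, p2, hne, hiu, hju⟩ := leavesBelow_ends hu hl h0
  have hends := fun b => answer_leaf_ends hu e1 e2 b
  have hans := E.answer_lt
  refine wp_seq (wp_assign (by simp) (wp_seq (wp_assign_of (a := isa T i) ?_ ?_ (wp_seq
    (wp_assign_of (a := isa T j) ?_ ?_ ?_)))))
  · simp [hans]
  · simp [h25, hends, answer_leafRank hi hi']
  · simp [hans]
  · simp [h25, hends, answer_leafRank hj hj']
  refine wp_loop u.length (fun k s' => s'.v 27 = k ∧ s'.v 28 = isa T (i + k) ∧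
    s'.v 29 = isa T (j + k) ∧ s'.time ≤ s.time + 30 + 50 * k) ?_ ?_ ?_
  · rintro k hk s' ⟨g1, g2, g3, g4⟩
    refine ⟨?_, ?_, wp_seq (wp_assign_of (a := isa T (i + (k + 1))) ?_ ?_ (wp_seq
      (wp_assign_of (a := isa T (j + (k + 1))) ?_ ?_ (wp_assign ?_ ⟨?_, ?_, ?_, ?_⟩))))⟩
    · simp [hans]; omega
    · simp only [St.val, val_eq, val_qry, val_var, val_num, g2, g3]
      rw [answer_leafSelect (by omega) (by omega), answer_leafSelect (by omega) (by omega),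
        if_pos ((answer_top_eq_iff hT (by omega) (by omega) (by omega) (by omega)).2
          ((head?_suffix_eq hi p1 hk).trans (head?_suffix_eq hj p2 hk).symm))]
      simp
    · simp [hans]
    · simp [g2]; rw [answer_psi (by omega) (by omega)]; rfl
    · simp [hans]
    · simp [g3]; rw [answer_psi (by omega) (by omega)]; rfl
    · simp [g1]; omega
    · simp [g1]
    · simp
    · simp
    · simp; omega
  · rintro s' ⟨g1, g2, g3, g4⟩
    refine ⟨?_, ?_, g1, ?_⟩
    · simp [hans]; omega
    · simp only [St.val, val_eq, val_qry, val_var, val_num, g2, g3]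
      rw [answer_leafSelect (by omega) (by omega), answer_leafSelect (by omega) (by omega),
        if_neg (fun h => hne
          ((answer_top_eq_iff hT (by omega) (by omega) (by omega) (by omega)).1 h))]
    · simp; omega
  · simp

end Climb

end LZ

namespace LZ

/-! ### A whole pass and its amortised time -/

section Traverse

variable {σ : ℕ} {T : List (Fin σ)} {w M : ℕ}

theorem answer_smallestLeaf (b b' : ℕ) :
    answer T .smallestLeaf b b' = preorder T (suffix T 1) := rfl

/-- Two quantities pay for the loops inside the pass: the number of visited nodes for the climbs and
the next factor position for the string depths. Both are at most `T.length + 1` in the end. -/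
theorem wp_traverse (E : Env T w M) {D : List ℕ → Finset (List (Fin σ)) → St → Prop}
    {visit ref fresh : Cmd} {c : ℕ} (H : Hooks T w M D visit ref fresh c) {s : St}
    (hp : Params T.length s.v) (hD : D [] ∅ s) (hm : Marks T s.mem ∅) :
    wp T w M (traverse visit ref fresh) (fun s' => Params T.length s'.v ∧
      D (facPos T T.length) (vis T (T.length + 1)) s' ∧
      s'.time ≤ s.time + (2 * c + 500) * T.length) s := by
  have hT := E.text
  have hn := E.pos
  have hw16 := E.sixteen_le
  have hbig := E.big
  have hans := E.answer_lt
  have hHw := H.writes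
  simp only [List.mem_append] at hHw
  refine wp_seq (wp_assign_of (a := preorder T (suffix T 1)) ?_ ?_ (wp_seq (wp_assign ?_ (wp_seq
    (wp_assign ?_ ?_)))))
  · simp [hans]
  · simp [answer_smallestLeaf]
  · simp; omega
  · simp; omega
  -- The current leaf is specified only while leaves remain, because ψ wraps around to the first
  -- leaf after the last one. The terms with `card` and `nxt` in the time bound carry the
  -- amortisation.
  refine wp_loop T.length (fun m s' => (m < T.length → s'.v 21 = preorder T (suffix T (m + 1))) ∧
    s'.v 22 = m + 1 ∧ s'.v 23 = nxt T m ∧ Params T.length s'.v ∧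
    D (facPos T m) (vis T (m + 1)) s' ∧ Marks T s'.mem (vis T (m + 1)) ∧
    s'.time ≤ s.time + 20 + (c + 200) * m + (c + 50) * (vis T (m + 1)).card + 50 * nxt T m) ?_ ?_ ?_
  · rintro m hmn s' ⟨e21, e22, e23, hp', hD', hm', ht⟩
    have e21 := e21 hmn
    have hnx := nxt_spec hT (m := m) hmn.le
    have hnx1 := nxt_spec hT (m := m + 1) hmn
    refine ⟨by simp [hp'.hn]; omega, by simp [hp'.hn, e22, hmn], wp_seq ?_⟩
    refine (wp_climb E H (s := s'.tick _) (j := m + 1) (by omega) hmn hp' e21 e22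
      (H.stable hD' rfl rfl rfl fun k hk => rfl) hm').use ?_
    rintro s1 f1 - - ⟨u, hu, hul, e25, e26, hend, hD1, hm1, ht1⟩
    have hw1 : ∀ r < 24, s1.v r = s'.v r := by
      intro r hr
      refine f1 r ?_
      simp only [climb, writes_append, Cmd.writes, List.mem_append, List.mem_singleton,
        List.nil_append]
      have := hHw r
      rintro (h | h | h | h | h)
      all_goals first | omega | (have := this (Or.inl h); omega)
    have hp1 : Params T.length s1.v := hp'.congr fun r hr => hw1 r (by omega)
    have hcard := card_vis_succ hT (j := m + 1) (by omega) hmn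
    -- The common end of all cases: the label is increased, and ψ leads to the leaf of the next
    -- suffix.
    have fin : ∀ s2 : St, (∀ r < 23, s2.v r = s1.v r) → s2.v 23 = nxt T (m + 1) →
        D (facPos T (m + 1)) (vis T (m + 1 + 1)) s2 → Marks T s2.mem (vis T (m + 1 + 1)) →
        s2.time ≤ s1.time + 50 * (nxt T (m + 1) - nxt T m) + c + 100 →
        wp T w M (.assign 22 (.var 22 + 1) ++
          .assign 21 (.qry .leafSelect (.qry .psi (.qry .leafRank (.var 21) 0) 0) 0))
          (fun s' => (m + 1 < T.length → s'.v 21 = preorder T (suffix T (m + 1 + 1))) ∧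
            s'.v 22 = m + 1 + 1 ∧ s'.v 23 = nxt T (m + 1) ∧ Params T.length s'.v ∧
            D (facPos T (m + 1)) (vis T (m + 1 + 1)) s' ∧ Marks T s'.mem (vis T (m + 1 + 1)) ∧
            s'.time ≤ s.time + 20 + (c + 200) * (m + 1) + (c + 50) * (vis T (m + 1 + 1)).card +
              50 * nxt T (m + 1)) s2 := by
      intro s2 hv2 g23 gD gm gt
      refine wp_seq (wp_assign ?_ (wp_assign ?_ ⟨fun hlt => ?_, ?_, ?_, ?_, ?_, gm, ?_⟩))
      · simp [hv2, hw1, e22]; omega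
      · simp [hans]
      · simp [hv2, hw1, e21]
        rw [answer_leafRank (by omega) (by omega), answer_psi (by omega) (by omega),
          answer_leafSelect (by omega) (by omega)]
      · simp [hv2, hw1, e22]
      · simp [g23]
      · refine hp1.congr fun r hr => ?_
        simp only [set_v]
        rw [Function.update_of_ne (by omega), Function.update_of_ne (by omega), hv2 r (by omega)]
      · exact H.stable gD rfl rfl rfl fun k hk => rfl
      · have hmono : nxt T m ≤ nxt T (m + 1) := by
          rw [nxt]; split_ifs <;> omega
        simp at ht1 ⊢
        rw [hcard, Nat.mul_add, Nat.mul_add]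
        omega
    refine wp_seq (wp_ite (by simp) (fun hne => ?_) (fun hne => wp_skip ?_))
    · have heq : nxt T m = m + 1 := by
        simp [hw1, e22, e23] at hne; omega
      refine wp_ite (by simp; omega) (fun hroot => wp_seq ?_) (fun hroot => wp_seq ?_)
      · have hu0 : u = [] := by
          refine (preorder_lt_two hu).1 ?_
          by_contra h
          simp [e25, h] at hroot
        have hs : stopAt T (m + 1) = none := by
          rcases hend with h | h
          · exact h.2
          · exact absurd hu0 h.1
        obtain ⟨-, hnext⟩ := nxt_succ_of_none hT hmn hs
        refine (H.fresh (s := (s1.tick _).tick _) (j := m + 1) (by omega) hmn heq hs hp1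
          (by simp [hw1, e21]) (H.stable hD1 rfl rfl rfl fun k hk => rfl)).use ?_
        rintro s2 f2 - - ⟨g1, g2, g3⟩
        have hw2 : ∀ r < 24, s2.v r = s1.v r := fun r hr => f2 r fun h => by
          have := hHw r (Or.inr (Or.inr h)); omega
        refine wp_assign ?_ (fin _ (fun r hr => ?_) ?_ ?_ ?_ ?_)
        · simp [hw2, hw1, e23]; omega
        · simp only [set_v]
          rw [Function.update_of_ne (by omega), hw2 r (by omega)]
        · simp [hw2, hw1, e23, hnext]
        · exact H.stable g1 rfl rfl rfl fun k hk => rfl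
        · exact hm1.congr g2
        · simp at g3 ⊢; omega
      · have hu0 : u ≠ [] := by
          intro h
          simp [e25, (preorder_lt_two hu).2 h] at hroot
        have hs : stopAt T (m + 1) = some u := by
          rcases hend with h | h
          · exact absurd h.1 hu0
          · exact h.2
        have hnext := nxt_succ_of_some hs
        rw [if_pos heq.symm] at hnext
        refine (wp_strDepth E (s := (s1.tick _).tick _) hu hul hu0 e25).use ?_
        rintro s2 f2 o2 m2 ⟨g1, g2⟩
        have o2 := o2 rfl
        have m2 := m2 rfl
        have hw2 : ∀ r < 27, s2.v r = s1.v r := fun r hr => f2 r fun h => by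
          simp only [strDepth, writes_append, Cmd.writes, List.mem_append, List.mem_singleton] at h
          omega
        refine wp_seq ((H.ref (j := m + 1) (by omega) hmn heq hs
          (hp1.congr fun r hr => hw2 r (by omega))
          (by rw [hw2 _ (by omega), e26]) g1 (H.stable hD1 (hw2 _ (by omega)) (hw2 _ (by omega))
            o2 fun k hk => by rw [m2]; rfl)).use ?_)
        rintro s3 f3 - - ⟨k1, k2, k3⟩
        have hw3 : ∀ r, r < 28 → r ≠ 24 → s3.v r = s2.v r := fun r hr hr' => f3 r fun h => by
          have := hHw r (Or.inr (Or.inl h)); omega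
        refine wp_assign ?_ (fin _ (fun r hr => ?_) ?_ ?_ ?_ ?_)
        · simp [hw3, hw2, hw1, e23, g1]; omega
        · simp only [set_v]
          rw [Function.update_of_ne (by omega), hw3 r (by omega) (by omega), hw2 r (by omega)]
        · simp [hw3, hw2, hw1, e23, g1, hnext]
        · exact H.stable k1 rfl rfl rfl fun k hk => rfl
        · refine hm1.congr fun k h1 h2 => ?_
          rw [set_mem, k2 k h1 h2, m2]; rfl
        · simp at g2 k3 ⊢; omega
    · have hneq : nxt T m ≠ m + 1 := by
        simp [hw1, e22, e23] at hne; omega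
      have hnext : nxt T (m + 1) = nxt T m := by
        rw [nxt, if_neg (Ne.symm hneq)]
      have hfp : facPos T (m + 1) = facPos T m := by
        rw [facPos_succ, if_neg hneq, List.append_nil]
      refine fin _ (fun r hr => rfl) ?_ ?_ hm1 ?_
      · rw [hnext, ← e23]; exact hw1 23 (by omega)
      · rw [hfp]; exact H.stable hD1 rfl rfl rfl fun k hk => rfl
      · simp; omega
  · rintro s' ⟨e21, e22, e23, hp', hD', hm', ht⟩
    have hnx := nxt_spec hT (m := T.length) le_rfl
    have hv := card_vis_le hT (T.length + 1)
    have hcv : c * (vis T (T.length + 1)).card ≤ c * T.length := Nat.mul_le_mul_left _ hv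
    refine ⟨by simp [hp'.hn]; omega, by simp [hp'.hn, e22], hp',
      H.stable hD' rfl rfl rfl fun k hk => rfl, ?_⟩
    simp only [Nat.add_mul] at ht ⊢
    rw [show 2 * c * T.length = c * T.length + c * T.length by ring]
    simp; omega
  · refine ⟨fun _ => by simp, by simp, by simp [nxt], ?_, ?_, ?_, by simp [vis_one, nxt]⟩
    · exact ((hp.update (by omega) _).update (by omega) _).update (by omega) _
    · rw [zero_add, vis_one]
      exact H.stable hD rfl rfl rfl fun k hk => rfl
    · rw [zero_add, vis_one]
      exact hm

end Traverse

end LZ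

namespace LZ

/-! ### The first pass and the bit vector of witnesses -/

section FirstPass

/-- Clear the bit vector. -/
def clearBits : Cmd :=
  .assign 30 0 ++ .loop (.lt (.var 30) (.var 11))
    (.store (.var 18 + .var 30 * .var 3) (.var 3) 0 ++ .assign 30 (.var 30 + 1))

/-- Mark the root only. -/
def clearMarks : Cmd := clearBits ++ .store (.var 18 + 1) 1 1

/-- The first pass appends the rank of the node in variable 26 to a packed array. -/
def appendRank : Cmd := setPacked 19 24 26 ++ .assign 24 (.var 24 + 1)

/-- Mark the nodes whose ranks were collected in the first pass. -/
def scatter : Cmd :=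
  .assign 27 0 ++ .loop (.lt (.var 27) (.var 24))
    (getPacked 19 27 28 ++ (.store (.var 18 + .var 28) 1 1 ++ .assign 27 (.var 27 + 1)))

variable {σ : ℕ} {T : List (Fin σ)} {w M : ℕ}

theorem wp_clearBits (E : Env T w M) {s : St} (hp : Params T.length s.v) :
    wp T w M clearBits (fun s' =>
      (∀ k, aBV T.length ≤ k → k < aSTR T.length → s'.mem k = false) ∧
      (∀ k, k < aBV T.length ∨ aSTR T.length ≤ k → s'.mem k = s.mem k) ∧
      s'.time ≤ s.time + 80 * T.length) s := by
  obtain ⟨l1, l2, l3⟩ := layout T.length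
  have hMw := E.mem
  have hstr := E.str
  have hw16 := E.sixteen_le
  have hbig := E.big
  have hn := E.pos
  have hK := pK_le hn
  have hbw := E.pb_le
  refine wp_seq (wp_assign (by simp) (wp_loop (pK T.length) (fun i s' => Params T.length s'.v ∧
    s'.v 30 = i ∧ (∀ k, aBV T.length ≤ k → k < aBV T.length + i * pb T.length → s'.mem k = false) ∧
    (∀ k, k < aBV T.length ∨ aSTR T.length ≤ k → s'.mem k = s.mem k) ∧
    s'.time ≤ s.time + 5 + 30 * i) ?_ ?_ ?_))
  · rintro i hi s' ⟨hp', e30, h1, h2, ht⟩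
    have hidx := index_le (w := pb T.length) hi
    have a1 := hp'.hBV
    have a2 := hp'.hb
    refine ⟨by simp, by simp [e30, hp'.hK, hi], wp_seq (wp_store ?_ ?_ ?_ ?_ ?_ (wp_assign ?_
      ⟨hp'.update (by omega) _, ?_, fun k h3 h4 => ?_, fun k h3 => ?_, ?_⟩))⟩
    · simp [a1, a2, e30]; omega
    · simp
    · simp
    · simp [a2, hbw]
    · simp [a1, a2, e30]; omega
    · simp [e30]; omega
    · simp [e30]
    · simp only [set_mem, put_mem, St.val, val_add, val_mul, val_var, val_num, tick_v, a1, a2, e30]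
      rw [writeField]
      split_ifs with h5
      · simp
      · refine h1 k h3 ?_
        rw [Nat.succ_mul] at h4
        omega
    · simp only [set_mem, put_mem, St.val, val_add, val_mul, val_var, val_num, tick_v, a1, a2, e30]
      rw [writeField_of_not_mem _ _ (by omega)]
      exact h2 k h3
    · simp; omega
  · rintro s' ⟨hp', e30, h1, h2, ht⟩
    refine ⟨by simp, by simp [e30, hp'.hK], fun k h3 h4 => h1 k h3 (by omega), h2, ?_⟩
    simp; omega
  · refine ⟨hp.update (by omega) _, by simp, fun k h3 h4 => by omega, fun k _ => rfl, by simp⟩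

/-- Marking the root, whose rank is `1`, in advance turns the root into an ordinary stopping point
of the climbs. -/
theorem wp_clearMarks (E : Env T w M) {s : St} (hp : Params T.length s.v) :
    wp T w M clearMarks (fun s' => Marks T s'.mem ∅ ∧
      (∀ k, k < aBV T.length ∨ aSTR T.length ≤ k → s'.mem k = s.mem k) ∧
      s'.time ≤ s.time + 100 * T.length) s := by
  have hMw := E.mem
  have hstr := E.str
  have hw16 := E.sixteen_le
  have hn := E.pos
  have hadr := rk_addr E.text []
  rw [rk_nil] at hadr
  have hlt := lt_pK_mul T.length
  obtain ⟨l1, l2, l3⟩ := layout T.length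
  refine wp_seq ((wp_clearBits E hp).use ?_)
  rintro s1 f1 - - ⟨h1, h2, h3⟩
  have hp1 : Params T.length s1.v := hp.frame f1 (by decide)
  have a1 := hp1.hBV
  refine wp_store ?_ ?_ ?_ ?_ ?_ ⟨fun q hq => ?_, fun k hk => ?_, ?_⟩
  · simp [a1]; omega
  · simp; omega
  · simp; omega
  · simp; omega
  · simp [a1]; omega
  · simp only [put_mem, St.val, val_add, val_var, val_num, a1]
    rw [writeField_one]
    by_cases hq1 : q = 1
    · subst hq1
      simp [rk_nil]
    · rw [Function.update_of_ne (by omega), h1 _ (by omega) (by omega)]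
      simp [rk_nil, Ne.symm hq1]
  · simp only [put_mem, St.val, val_add, val_var, val_num, a1]
    rw [writeField_of_not_mem _ _ (by omega), h2 k hk]
  · simp; omega

/-- The nodes at which the climbs from the factor positions in `P` stop. -/
noncomputable def refs (T : List (Fin σ)) (P : List ℕ) : List (List (Fin σ)) := P.filterMap (stopAt T)

theorem facPos_eq_append {j : ℕ} (h1 : 1 ≤ j) (h : nxt T (j - 1) = j) :
    facPos T j = facPos T (j - 1) ++ [j] := by
  obtain ⟨m, rfl⟩ : ∃ m, j = m + 1 := ⟨j - 1, by omega⟩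
  rw [facPos_succ, if_pos (show nxt T m = m + 1 from h)]
  rfl

theorem facPos_prefix {m n : ℕ} (h : m ≤ n) : facPos T m <+: facPos T n := by
  induction n, h using Nat.le_induction with
  | base => exact List.prefix_rfl
  | succ n _ ih => exact ih.trans (facPos_succ (T := T) n ▸ List.prefix_append _ _)

theorem length_refs_le {m n : ℕ} (h : m ≤ n) :
    (refs T (facPos T m)).length ≤ (refs T (facPos T n)).length :=
  ((facPos_prefix h).filterMap _).length_le

theorem length_facPos_le (n : ℕ) : (facPos T n).length ≤ n :=
  (List.length_filter_le _ _).trans (by simp)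

theorem length_refs_le_facPos (P : List ℕ) : (refs T P).length ≤ P.length :=
  List.length_filterMap_le _ _

theorem mem_refs (hT : IsText T) {v : List (Fin σ)} :
    v ∈ refs T (facPos T T.length) ↔ v ∈ (passOne T).marked := by
  rw [mem_marked hT, refs, List.mem_filterMap]

/-- The data of the first pass after the factor positions `P`. -/
structure FirstData (T : List (Fin σ)) (nb : ℕ) (P : List ℕ) (s : St) : Prop where
  cnt : s.v 24 = (refs T P).length
  out : s.out = []
  tab : Tab T.length s.mem
  arr : ∃ f, PArr T.length s.mem (aSTR T.length) nb f ∧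
    ∀ i x, (refs T P)[i]? = some x → f i = rk T x

theorem aBLK_le (n : ℕ) : aBLK n ≤ aBV n := by
  obtain ⟨l1, l2, l3⟩ := layout n
  omega

/-- Only referencing factors leave a trace here. A node at which several factors stop is listed
several times; the list is still no longer than the number of factors, and repetitions are harmless
when the bits are set later. -/
theorem firstHooks (E : Env T w M)
    {nb : ℕ} (hnb : (refs T (facPos T T.length)).length / pg T.length < nb)
    (hM : aSTR T.length + nb * pB T.length ≤ M) :
    Hooks T w M (fun P _ => FirstData T nb P) .skip appendRank .skip 200 := by
  have hT := E.text
  have hbig := E.big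
  have hadr := aBLK_le T.length
  obtain ⟨l1, l2, l3⟩ := layout T.length
  constructor
  · rintro P V s s' ⟨h1, h2, h3, f, h4, h5⟩ - e24 eo em
    exact ⟨e24.trans h1, eo.trans h2, h3.congr fun k hk => em k (by omega),
      f, h4.congr fun i h6 h7 => em i (by omega), h5⟩
  · decide
  · intro j V x s _ _ _ _ _ _ hD
    exact wp_skip ⟨hD, fun k _ _ => rfl, by omega⟩
  · rintro j x s h1 hj hn hs hp h26 - ⟨e1, e2, e3, f, e4, e5⟩
    have hP := facPos_eq_append h1 hn
    have hR : refs T (facPos T j) = refs T (facPos T (j - 1)) ++ [x] := by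
      rw [hP, refs, List.filterMap_append, refs]
      simp [hs]
    have hle := length_refs_le (T := T) hj
    rw [hR, List.length_append, List.length_singleton] at hle
    have hlen := length_refs_le_facPos (T := T) (facPos T T.length)
    have hlen2 := length_facPos_le (T := T) T.length
    refine wp_seq ((wp_setPacked E (by omega) (by omega) (by omega) hp e3 hp.hSTR e1 h26
      (rk_le hT x) ((Nat.div_le_div_right (by omega)).trans_lt hnb) hM e4).use ?_)
    rintro s1 f1 o1 - ⟨g1, g2, g3⟩
    have c24 : s1.v 24 = s.v 24 := f1 _ (by decide)
    refine wp_assign ?_ ⟨⟨?_, ?_, ?_, _, g1, ?_⟩, ?_, ?_⟩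
    · simp [c24, e1]; have := E.sixteen_le; omega
    · simp [c24, e1, hR]
    · exact (o1 rfl).trans e2
    · exact e3.congr fun k hk => g2 k (by omega)
    · intro i y hi
      rw [hR] at hi
      by_cases hlt : i = (refs T (facPos T (j - 1))).length
      · subst hlt
        simp at hi
        rw [Function.update_self, hi]
      · rw [Function.update_of_ne hlt]
        rw [List.getElem?_append] at hi
        split_ifs at hi with h
        · exact e5 i y hi
        · rw [List.getElem?_eq_none (by simp; omega)] at hi
          exact absurd hi (by simp)
    · exact fun k h6 h7 => g2 k (by omega)
    · simp; omega
  · intro j s h1 hj hn hs hp _ hD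
    have hP := facPos_eq_append h1 hn
    have hR : refs T (facPos T j) = refs T (facPos T (j - 1)) := by
      rw [hP, refs, List.filterMap_append, refs]
      simp [hs]
    refine wp_skip ⟨⟨hR ▸ hD.cnt, hD.out, hD.tab, hR ▸ hD.arr⟩, fun k _ _ => rfl, by omega⟩

open Classical in
/-- The bit vector that marks the ranks of the witnesses. -/
noncomputable def markBit (T : List (Fin σ)) (q : ℕ) : Bool :=
  decide (∃ v ∈ (passOne T).marked, rk T v = q)

/-- Once pass 1 is over its marks are obsolete, so B_W, indexed by the ranks of inner nodes, is
built in the same, now cleared, bits. -/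
theorem wp_scatter (E : Env T w M) {nb : ℕ} {s : St}
    (hnb : (refs T (facPos T T.length)).length / pg T.length < nb)
    (hM : aSTR T.length + nb * pB T.length ≤ M) (hp : Params T.length s.v)
    (hD : FirstData T nb (facPos T T.length) s)
    (hz : ∀ k, aBV T.length ≤ k → k < aSTR T.length → s.mem k = false) :
    wp T w M scatter (fun s' =>
      (∀ k < pK T.length * pb T.length, markBit T k = s'.mem (aBV T.length + k)) ∧
      Tab T.length s'.mem ∧ s'.time ≤ s.time + 150 * T.length) s := by
  have hT := E.text
  have hMw := E.mem
  have hstr := E.str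
  have hw16 := E.sixteen_le
  have hbig := E.big
  have hn := E.pos
  have hadr := aBLK_le T.length
  obtain ⟨l1, l2, l3⟩ := layout T.length
  obtain ⟨e24, eo, et, f, ef, hf⟩ := hD
  set R := refs T (facPos T T.length) with hR
  have hRn : R.length ≤ T.length :=
    (length_refs_le_facPos _).trans (length_facPos_le _)
  refine wp_seq (wp_assign (by simp) (wp_loop R.length (fun i s' => Params T.length s'.v ∧
    s'.v 24 = R.length ∧ s'.v 27 = i ∧
    (∀ k < pK T.length * pb T.length, s'.mem (aBV T.length + k) = true ↔
      ∃ x ∈ R.take i, rk T x = k) ∧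
    (∀ k, k < aBV T.length ∨ aSTR T.length ≤ k → s'.mem k = s.mem k) ∧
    s'.time ≤ s.time + 5 + 130 * i) ?_ ?_ ?_))
  · rintro i hi s' ⟨hp', c24, c27, h1, h2, ht⟩
    refine ⟨by simp, by simp [c24, c27, hi], ?_⟩
    have hi' : i / pg T.length < nb := (Nat.div_le_div_right hi.le).trans_lt hnb
    refine wp_seq ((wp_getPacked E (by omega) (by omega) (s := s'.tick _) hp'
      (et.congr fun k hk => h2 k (by omega)) hp'.hSTR c27 hi' hM
      (ef.congr fun k h3 h4 => h2 k (by omega))).use ?_)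
    rintro s1 f1 - m1 ⟨g1, g2⟩
    have m1 := m1 rfl
    have hp1 : Params T.length s1.v := hp'.frame f1 (by decide)
    have a1 := hp1.hBV
    rw [hf i R[i] (List.getElem?_eq_getElem hi)] at g1
    have hra := rk_addr hT R[i]
    have d27 : s1.v 27 = i := (f1 _ (by decide)).trans c27
    have d24 : s1.v 24 = R.length := (f1 _ (by decide)).trans c24
    refine wp_seq (wp_store ?_ ?_ ?_ ?_ ?_ (wp_assign ?_
      ⟨hp1.update (by omega) _, ?_, ?_, fun k hk => ?_, fun k hk => ?_, ?_⟩))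
    · simp [a1, g1]; omega
    · simp; omega
    · simp; omega
    · simp; omega
    · simp [a1, g1]; omega
    · simp [d27]; omega
    · simp [d24]
    · simp [d27]
    · simp only [set_mem, put_mem, St.val, val_add, val_var, val_num, a1, g1, m1, tick_mem]
      rw [writeField_one, List.take_succ_eq_append_getElem hi]
      simp only [List.mem_append, List.mem_singleton, or_and_right, exists_or, exists_eq_left]
      by_cases hk' : k = rk T R[i]
      · rw [hk']
        simp
      · rw [Function.update_of_ne (by omega), h1 k hk, or_iff_left (Ne.symm hk')]
    · simp only [set_mem, put_mem, St.val, val_add, val_var, val_num, a1, g1, m1, tick_mem]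
      rw [writeField_of_not_mem _ _ (by omega), h2 k hk]
    · simp at g2 ⊢; omega
  · rintro s' ⟨hp', c24, c27, h1, h2, ht⟩
    refine ⟨by simp, by simp [c24, c27], fun k hk => ?_, et.congr fun k hk => h2 k (by omega), ?_⟩
    · rw [Bool.eq_iff_iff, tick_mem, h1 k hk, List.take_length, markBit, decide_eq_true_eq]
      simp only [hR, mem_refs hT]
    · simp; omega
  · refine ⟨hp.update (by omega) _, by simp [e24], by simp, fun k hk => ?_, fun k _ => rfl, by simp⟩
    simp [hz (aBV T.length + k) (by omega) (by omega)]

end FirstPass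

end LZ

namespace LZ

/-! ### The second pass and the complete program -/

section SecondPass

theorem ones_succ (X : ℕ → Bool) (q : ℕ) : ones X (q + 1) = ones X q + if X q then 1 else 0 :=
  Finset.sum_range_succ _ _

theorem ones_mono (X : ℕ → Bool) {q r : ℕ} (h : q ≤ r) : ones X q ≤ ones X r := sum_mono h

/-- The number of ones before a marked bit identifies it, so it can serve as a witness id. -/
theorem ones_lt {X : ℕ → Bool} {q r : ℕ} (hq : X q = true) (h : q < r) : ones X q < ones X r := by
  have h1 := ones_succ X q
  have h2 := ones_mono X (Nat.succ_le_of_lt h)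
  rw [hq, if_pos rfl] at h1
  rw [Nat.succ_eq_add_one] at h2
  omega

/-- Store the current label when a witness is visited for the first time. -/
def storeLabel : Cmd := lookup ++ .ite (.var 28) (setPacked 20 29 22) .skip

/-- Output the code of a referencing factor. -/
def emitRef : Cmd := lookup ++ (getPacked 20 29 30 ++ .putRef (.var 30) (.var 27))

/-- Output the code of a fresh factor. -/
def emitFresh : Cmd := .putFresh (.qry .childRank (.qry .levelAnc (.var 21) 1) 0)

/-- Zero the high parts of the array of labels. -/
def zeroHigh : Cmd :=
  .assign 36 (.var 32 / .var 2 + 1) ++ (.assign 30 0 ++ .loop (.lt (.var 30) (.var 36))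
    (.store (.var 20 + .var 30 * .var 9) (.var 8) 0 ++ .assign 30 (.var 30 + 1)))

/-- The two passes. -/
def program : Cmd :=
  setup ++ (clearMarks ++ (.assign 24 0 ++ (traverse .skip appendRank .skip ++
    (clearBits ++ (scatter ++ (compress ++ (zeroHigh ++ (clearMarks ++
      traverse storeLabel emitRef emitFresh))))))))

variable {σ : ℕ} {T : List (Fin σ)} {w M : ℕ}

theorem markBit_rk (x : List (Fin σ)) (hx : x ∈ internals T) :
    markBit T (rk T x) = true ↔ x ∈ (passOne T).marked := by
  rw [markBit, decide_eq_true_eq]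
  constructor
  · rintro ⟨v, hv, he⟩
    rwa [rk_inj hx he.symm]
  · exact fun h => ⟨x, h, rfl⟩

/-- The number of witnesses. -/
noncomputable def numWit (T : List (Fin σ)) : ℕ := brnk (markBit T) (pb T.length) (pK T.length)

/-- The address of the array of labels. -/
noncomputable def aLAB (T : List (Fin σ)) : ℕ :=
  aSTR T.length + bptr (markBit T) (pb T.length) (pK T.length)

theorem ones_rk_le (hT : IsText T) (x : List (Fin σ)) : ones (markBit T) (rk T x) ≤ numWit T := by
  rw [numWit, brnk_eq]
  exact ones_mono _ ((rk_le hT x).trans (lt_pK_mul _).le)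

/-- The data of the second pass after the factor positions `P` when the nodes in `V` are visited. -/
structure SecondData (T : List (Fin σ)) (P : List ℕ) (V : Finset (List (Fin σ))) (s : St) :
    Prop where
  base : s.v 20 = aLAB T
  out : s.out = P.map (facCode T)
  tab : Tab T.length s.mem
  comp : Comp T.length s.mem (markBit T) (pK T.length)
  arr : ∃ f, PArr T.length s.mem (aLAB T) (numWit T / pg T.length + 1) f ∧
    ∀ v ∈ (passOne T).marked, v ∈ V → f (ones (markBit T) (rk T v)) = firstLabel T v

/-- The machine numbers a witness by the ones strictly before its bit, so its ids start at `0`,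
whereas `witnessId` starts at `1`. Only injectivity on the witnesses matters: each entry is compared
with the smallest label itself and not with an entry of the abstract array. -/
theorem secondHooks (E : Env T w M)
    (hM : aLAB T + (numWit T / pg T.length + 1) * pB T.length ≤ M) :
    Hooks T w M (SecondData T) storeLabel emitRef emitFresh 400 := by
  have hT := E.text
  have hbig := E.big
  have hw16 := E.sixteen_le
  have hadr := aBLK_le T.length
  have hans := E.answer_lt
  obtain ⟨l1, l2, l3⟩ := layout T.length
  have hlab : aLAB T = aSTR T.length + bptr (markBit T) (pb T.length) (pK T.length) := rfl
  have hidx : ∀ x, ones (markBit T) (rk T x) / pg T.length < numWit T / pg T.length + 1 := fun x =>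
    Nat.lt_succ_of_le (Nat.div_le_div_right (ones_rk_le hT x))
  constructor
  · rintro P V s s' ⟨h1, h2, h3, h4, f, h5, h6⟩ e20 - eo em
    exact ⟨e20.trans h1, eo.trans h2, h3.congr fun k hk => em k (by omega),
      h4.congr le_rfl (fun k h7 h8 => em k (by omega)) (fun k h7 h8 => em k (by omega)),
      f, h5.congr fun i h7 h8 => em i (by omega), h6⟩
  · decide
  · rintro j V x s h1 hj hx hp h22 h26 ⟨e1, e2, e3, e4, f, e5, e6⟩
    have hxi : x ∈ internals T := by
      have := ((mem_climbPath_suffix hT h1 hj).1 ((mem_newlyVisited hT h1 hj).1 hx).1).1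
      exact mem_internals.2 this
    have hfl := firstLabel_eq_of_new hT h1 hj hx
    refine wp_seq ((wp_lookup E hp e3 e4 h26 (rk_le hT x) (by omega)).use ?_)
    rintro s1 f1 o1 m1 ⟨g1, g2, g3⟩
    have o1 := o1 rfl
    have m1 := m1 rfl
    have hp1 : Params T.length s1.v := hp.frame f1 (by decide)
    refine wp_ite (by simp) (fun hne => ?_) (fun h0 => wp_skip ?_)
    · have hb : markBit T (rk T x) = true := by
        by_contra h
        simp [g1, h] at hne
      refine (wp_setPacked E (s := s1.tick _) (by omega) (by omega) (by omega) hp1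
        (e3.congr fun k hk => by rw [tick_mem, m1]) ((f1 20 (by decide)).trans e1) g2
        ((f1 22 (by decide)).trans h22) hj (hidx x) hM
        (e5.congr fun k _ _ => by rw [tick_mem, m1])).use ?_
      rintro s2 f2 o2 - ⟨k1, k2, k3⟩
      have o2 := o2 rfl
      have hout : ∀ k, k < aLAB T → s2.mem k = s.mem k := fun k hk => by
        rw [k2 k (by omega), tick_mem, m1]
      refine ⟨⟨?_, ?_, e3.congr fun k hk => hout k (by omega), e4.congr le_rfl
        (fun k h7 h8 => hout k (by omega)) (fun k h7 h8 => hout k (by omega)), _, k1, ?_⟩, ?_, ?_⟩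
      · rw [f2 20 (by decide), tick_v, f1 20 (by decide), e1]
      · rw [o2, tick_out, o1, e2]
      · intro v hv hvV
        rcases Finset.mem_insert.1 hvV with rfl | hvV
        · rw [Function.update_self, hfl]
        · by_cases hvx : v = x
          · rw [hvx, Function.update_self, hfl]
          · have hvi := (marked_subset hT hv).1
            rw [Function.update_of_ne, e6 v hv hvV]
            intro he
            have hvb := (markBit_rk v hvi).2 hv
            rcases lt_trichotomy (rk T v) (rk T x) with h | h | h
            · exact absurd he (ones_lt hvb h).ne
            · exact hvx (rk_inj hvi h)
            · exact absurd he (ones_lt hb h).ne'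
      · exact fun k h7 h8 => hout k (by omega)
      · simp at k3 ⊢; omega
    · have hb : x ∉ (passOne T).marked := by
        rw [← markBit_rk x hxi]
        intro h
        simp [g1, h] at h0
      refine ⟨⟨?_, ?_, e3.congr fun k hk => ?_, e4.congr le_rfl (fun k _ _ => ?_) (fun k _ _ => ?_), f,
        e5.congr fun k _ _ => ?_, fun v hv hvV => ?_⟩, fun k _ _ => ?_, ?_⟩
      · rw [tick_v, f1 20 (by decide), e1]
      · rw [tick_out, o1, e2]
      · rw [tick_mem, m1]
      · rw [tick_mem, m1]
      · rw [tick_mem, m1]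
      · rw [tick_mem, m1]
      · rcases Finset.mem_insert.1 hvV with rfl | hvV
        · exact absurd hv hb
        · exact e6 v hv hvV
      · rw [tick_mem, m1]
      · simp; omega
  · rintro j x s h1 hj hn hs hp h26 h27 ⟨e1, e2, e3, e4, f, e5, e6⟩
    have hP := facPos_eq_append h1 hn
    have hxm : x ∈ (passOne T).marked :=
      (mem_marked hT).2 ⟨j, mem_facPos.2 ⟨⟨h1, hj⟩, hn⟩, hs⟩
    have hxv : x ∈ vis T (j + 1) := by
      rw [vis_succ hT h1 hj]
      exact Finset.mem_union_left _ (stop_eq_some hT h1 hj hs).2.1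
    refine wp_seq ((wp_lookup E hp e3 e4 h26 (rk_le hT x) (by omega)).use ?_)
    rintro s1 f1 o1 m1 ⟨g1, g2, g3⟩
    have o1 := o1 rfl
    have m1 := m1 rfl
    have hp1 : Params T.length s1.v := hp.frame f1 (by decide)
    refine wp_seq ((wp_getPacked E (by omega) (by omega) hp1
        (e3.congr fun k hk => by rw [m1]) ((f1 20 (by decide)).trans e1) g2
        (hidx x) hM (e5.congr fun k _ _ => by rw [m1])).use ?_)
    rintro s2 f2 o2 m2 ⟨k1, k2⟩
    have o2 := o2 rfl
    have m2 := m2 rfl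
    -- The stop node is a witness that is already visited, so its entry holds its smallest label.
    rw [e6 x hxm hxv] at k1
    have c27 : s2.v 27 = x.length := by rw [f2 27 (by decide), f1 27 (by decide), h27]
    have hm : ∀ k, (s2.emit (.ref (s2.val T (.var 30)) (s2.val T (.var 27)))
        ((Ex.var 30).cost + (Ex.var 27).cost + 1)).mem k = s.mem k := fun k => by
      rw [emit_mem, m2, m1]
    refine wp_putRef (by simp) (by simp) ⟨⟨?_, ?_, e3.congr fun k hk => hm k,
      e4.congr le_rfl (fun k _ _ => hm k) (fun k _ _ => hm k), f, e5.congr fun k _ _ => hm k, e6⟩,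
      fun k _ _ => hm k, ?_⟩
    · rw [emit_v, f2 20 (by decide), f1 20 (by decide), e1]
    · rw [emit_out, o2, o1, e2, hP, List.map_append]
      simp [facCode, hs, k1, c27]
    · simp; omega
  · rintro j s h1 hj hn hs hp h21 ⟨e1, e2, e3, e4, f, e5, e6⟩
    have hP := facPos_eq_append h1 hn
    refine wp_putFresh (by simp [hans]; omega) ⟨⟨e1, ?_, e3, e4, f, e5, e6⟩, fun k _ _ => rfl, ?_⟩
    · rw [emit_out, e2, hP, List.map_append]
      simp [facCode, hs, h21, answer_headChar hT h1 hj]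
    · simp

/-- The memory still contains remains of the list of ranks. Clearing one field per block makes it a
packed array with unspecified entries (`Packed.init`), which suffices because an entry is written
before it is used. -/
theorem wp_zeroHigh (E : Env T w M) {s : St} (hp : Params T.length s.v)
    (hM : aLAB T + (numWit T / pg T.length + 1) * pB T.length ≤ M) (hW : numWit T ≤ T.length)
    (h20 : s.v 20 = aLAB T) (h32 : s.v 32 = numWit T) :
    wp T w M zeroHigh (fun s' =>
      (∃ f, PArr T.length s'.mem (aLAB T) (numWit T / pg T.length + 1) f) ∧
      (∀ k, k < aLAB T → s'.mem k = s.mem k) ∧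
      s'.time ≤ s.time + 100 * T.length) s := by
  have hn := E.pos
  have hMw := E.mem
  have hbig := E.big
  have hw16 := E.sixteen_le
  have hew := E.pe_le
  have hB : pB T.length = pe T.length + pg T.length * pt T.length := rfl
  set nb := numWit T / pg T.length + 1 with hnb
  have hnbn : nb ≤ 2 * T.length := by
    have := Nat.div_le_self (numWit T) (pg T.length)
    omega
  refine wp_seq (wp_assign_of (a := nb) ?_ ?_ (wp_seq (wp_assign (by simp) (wp_loop nb
    (fun i s' => Params T.length s'.v ∧ s'.v 20 = aLAB T ∧ s'.v 36 = nb ∧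
    s'.v 30 = i ∧ (∀ j < i, readField s'.mem (aLAB T + j * pB T.length) (pe T.length) = 0) ∧
    (∀ k, k < aLAB T → s'.mem k = s.mem k) ∧
    s'.time ≤ s.time + 20 + 30 * i) ?_ ?_ ?_))))
  · simp [h32, hp.hg]; omega
  · simp [h32, hp.hg, hnb]
  · rintro i hi s' ⟨hp', e20, e36, e30, h1, h2, ht⟩
    have hidx := index_le (w := pB T.length) hi
    have a1 := hp'.he
    have a2 := hp'.hB
    refine ⟨by simp, by simp [e30, e36, hi], wp_seq (wp_store ?_ ?_ ?_ ?_ ?_ (wp_assign ?_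
      ⟨hp'.update (by omega) _, ?_, ?_, ?_, fun j hj => ?_, fun k h3 => ?_, ?_⟩))⟩
    · simp [a2, e30, e20]; omega
    · simp
    · simp
    · simp [a1, hew]
    · simp [a1, a2, e30, e20]; omega
    · simp [e30]; omega
    · simp [e20]
    · simp [e36]
    · simp [e30]
    · simp only [set_mem, put_mem, St.val, val_add, val_mul, val_var, val_num, tick_v, tick_mem,
        a1, a2, e30, e20]
      rcases Nat.lt_succ_iff_lt_or_eq.1 hj with hj | rfl
      · have := index_le (w := pB T.length) hj
        rw [readField_writeField_of_disjoint _ _ (by omega), h1 j hj]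
      · rw [readField_writeField, Nat.zero_mod]
    · simp only [set_mem, put_mem, St.val, val_add, val_mul, val_var, val_num, tick_v, tick_mem,
        a1, a2, e30, e20]
      rw [writeField_of_not_mem _ _ (by omega), h2 k h3]
    · simp; omega
  · rintro s' ⟨hp', e20, e36, e30, h1, h2, ht⟩
    refine ⟨by simp, by simp [e30, e36], ⟨_, Packed.init (pH_pos _) (pg_pos hn) h1⟩, h2, ?_⟩
    simp; omega
  · exact ⟨(hp.update (by omega) _).update (by omega) _, by simp [h20], by simp, by simp,
      by simp, fun k _ => rfl, by simp⟩

-- Every one of the bit vector is the rank of a listed node, so repetitions in the list can only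
-- make it longer than the number of witnesses.
open Classical in
theorem numWit_le_length_refs (hT : IsText T) :
    numWit T ≤ (refs T (facPos T T.length)).length := by
  rw [numWit, brnk_eq, ones, ← Finset.card_filter]
  refine le_trans (Finset.card_le_card (t := (passOne T).marked.image (rk T)) ?_) ?_
  · intro q hq
    rw [Finset.mem_filter, markBit, decide_eq_true_eq] at hq
    exact Finset.mem_image.2 hq.2
  · refine Finset.card_image_le.trans (le_trans (Finset.card_le_card
      (t := (refs T (facPos T T.length)).toFinset) ?_) (List.toFinset_card_le _))
    intro v hv
    rw [List.mem_toFinset, mem_refs hT]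
    exact hv

/-- The two space hypotheses are the needs of the two phases: the list of ranks in pass 1, and the
compressed bit vector with the labels in pass 2. Both lie behind the same plain bit vector and do
not coexist, so `M` has to exceed their maximum only. -/
theorem wp_program (E : Env T w M)
    (hM1 : aSTR T.length + ((refs T (facPos T T.length)).length / pg T.length + 1) * pB T.length ≤ M)
    (hM2 : aLAB T + (numWit T / pg T.length + 1) * pB T.length ≤ M) :
    wp T w M program (fun s => s.out = twoPass T ∧ s.time ≤ 5000 * T.length)
      ⟨fun _ => 0, fun _ => false, [], 0⟩ := by
  have hT := E.text
  have hn := E.pos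
  have hadr := aBLK_le T.length
  obtain ⟨l1, l2, l3⟩ := layout T.length
  have hlab : aLAB T = aSTR T.length + bptr (markBit T) (pb T.length) (pK T.length) := rfl
  have hW := numWit_le_length_refs hT
  have hR := (length_refs_le_facPos (T := T) (facPos T T.length)).trans (length_facPos_le _)
  refine wp_seq ((wp_setup E (fun _ => rfl)).use ?_)
  rintro s1 - o1 - ⟨hp1, t1, z1, c1⟩
  have o1 : s1.out = [] := o1 (by decide)
  refine wp_seq ((wp_clearMarks E hp1).use ?_)
  rintro s2 f2 o2 - ⟨m2, g2, c2⟩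
  have o2 := (o2 (by decide)).trans o1
  have hp2 : Params T.length s2.v := hp1.frame f2 (by decide)
  refine wp_seq (wp_assign (by simp) (wp_seq ((wp_traverse E (s := s2.set _ _ _) (firstHooks E (Nat.lt_succ_self _) hM1)
    (hp2.update (by omega) _) ⟨?_, o2, t1.congr fun k hk => g2 k (by omega), ?_⟩ m2).use ?_)))
  · simp [refs]
  -- Nothing has been written behind the plain bit vector yet, so all high parts there are zero.
  · refine ⟨_, Packed.init (pH_pos _) (pg_pos hn) fun j hj => ?_, by simp [refs]⟩
    rw [readField]
    refine Finset.sum_eq_zero fun i hi => ?_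
    rw [if_neg]
    rw [set_mem, g2 _ (by omega), z1 _ (by omega)]
    simp
  rintro s3 - - - ⟨hp3, d3, c3⟩
  have o3 := d3.out
  refine wp_seq ((wp_clearBits E hp3).use ?_)
  rintro s4 f4 o4 - ⟨z4, g4, c4⟩
  have o4 := (o4 (by decide)).trans o3
  have hp4 : Params T.length s4.v := hp3.frame f4 (by decide)
  have d4 : FirstData T _ (facPos T T.length) s4 :=
    (firstHooks E (Nat.lt_succ_self _) hM1).stable (V := ∅) d3 (f4 20 (by decide))
      (f4 24 (by decide)) (o4.trans o3.symm) g4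
  refine wp_seq ((wp_scatter E (Nat.lt_succ_self _) hM1 hp4 d4 z4).use ?_)
  rintro s5 f5 o5 - ⟨x5, t5, c5⟩
  have o5 := (o5 (by decide)).trans o4
  have hp5 : Params T.length s5.v := hp4.frame f5 (by decide)
  -- The codes may overwrite the list of ranks, which `scatter` has consumed.
  refine wp_seq ((wp_compress E hp5 t5 x5 (by omega)).use ?_)
  rintro s6 f6 o6 - ⟨k6, e6, w6, g6, c6⟩
  have o6 := (o6 (by decide)).trans o5
  have hp6 : Params T.length s6.v := hp5.frame f6 (by decide)
  have t6 : Tab T.length s6.mem := t5.congr fun k hk => g6 k (Or.inl hk)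
  refine wp_seq ((wp_zeroHigh E hp6 hM2 (hW.trans hR) e6 w6).use ?_)
  rintro s7 f7 o7 - ⟨⟨f, p7⟩, g7, c7⟩
  have o7 := (o7 (by decide)).trans o6
  have hp7 : Params T.length s7.v := hp6.frame f7 (by decide)
  -- From here on B_W exists in compressed form only, and its plain copy gives way to the marks of
  -- pass 2.
  refine wp_seq ((wp_clearMarks E hp7).use ?_)
  rintro s8 f8 o8 - ⟨m8, g8, c8⟩
  have o8 := (o8 (by decide)).trans o7
  have hp8 : Params T.length s8.v := hp7.frame f8 (by decide)
  have d8 : SecondData T [] ∅ s8 := by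
    refine ⟨?_, o8, t6.congr fun k hk => ?_, k6.congr le_rfl (fun k h1 h2 => ?_) (fun k h1 h2 => ?_),
      f, p7.congr fun k h1 h2 => g8 k (by omega), by simp⟩
    · rw [f8 20 (by decide), f7 20 (by decide)]; exact e6
    all_goals rw [g8 k (by omega), g7 k (by omega)]
  refine (wp_traverse E (secondHooks E hM2) hp8 d8 m8).mono ?_
  rintro s9 ⟨-, d9, c9⟩
  refine ⟨d9.out.trans (twoPass_eq hT).symm, ?_⟩
  simp only [set_time] at c3
  simp at c1 c3
  omega

end SecondPass

end LZ

namespace LZ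

/-! ### The space bound -/

section Sizes

variable {n : ℕ}

/-- A bound `x = O(n / pg n)` is stated as `pg n * x ≤ C * n` to stay within natural numbers. A
block has about one eighth of `pL n` bits, so there are only about `n ^ (1/8)` patterns. With `q =
pL n / 8` each of the four factors `pL n + 1` is at most `8 * 2 ^ q`, and the product is of order `2
^ (5 * q)`, while `2 ^ (8 * q) ≤ 2 * n`. -/
theorem pow_mul_pP_le (hn : 1 ≤ n) : pg n * (pP n * (pL n + 1) ^ 3) ≤ 16384 * n := by
  have h1 := two_pow_pL_le hn
  have h2 := pL_pos hn
  have h3 := pg_le n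
  set q := pL n / 8 with hq
  have hb : pb n = q + 1 := rfl
  have h4 : pL n + 1 ≤ 8 * 2 ^ q := by
    have : q < 2 ^ q := Nat.lt_two_pow_self
    omega
  have h5 : 2 ^ (8 * q) ≤ 2 * n := by
    calc 2 ^ (8 * q) ≤ 2 ^ (pL n - 1 + 1) := Nat.pow_le_pow_right (by omega) (by omega)
      _ = 2 * 2 ^ (pL n - 1) := by rw [pow_succ, mul_comm]
      _ ≤ 2 * n := by omega
  calc pg n * (pP n * (pL n + 1) ^ 3) ≤ (pL n + 1) * (pP n * (pL n + 1) ^ 3) :=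
        Nat.mul_le_mul_right _ (by omega)
    _ = 2 * 2 ^ q * (pL n + 1) ^ 4 := by rw [pP, hb]; ring
    _ ≤ 2 * 2 ^ q * (8 * 2 ^ q) ^ 4 := by gcongr
    _ = 8192 * 2 ^ (5 * q) := by ring
    _ ≤ 8192 * 2 ^ (8 * q) := by gcongr <;> omega
    _ ≤ 16384 * n := by omega

theorem pL_mul_pK_le (n : ℕ) : pL n * pK n ≤ 9 * n := by
  have h1 : pL n ≤ 8 * pb n := by unfold pb; omega
  have h2 := Nat.div_mul_le_self n (pb n)
  have h3 := pL_le n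
  calc pL n * pK n = pL n * (n / pb n) + pL n := by unfold pK; ring
    _ ≤ 8 * pb n * (n / pb n) + pL n := by gcongr
    _ = 8 * (n / pb n * pb n) + pL n := by ring
    _ ≤ 9 * n := by omega

theorem pg_mul_pK_le (n : ℕ) : pg n * pK n ≤ 9 * n :=
  (Nat.mul_le_mul_right _ (pg_le n)).trans (pL_mul_pK_le n)

theorem small_le (hn : 1 ≤ n) {x : ℕ} (c : ℕ) (hx : x ≤ c * (pP n * (pL n + 1) ^ 3)) :
    pg n * x ≤ c * 16384 * n := by
  have := pow_mul_pP_le hn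
  calc pg n * x ≤ pg n * (c * (pP n * (pL n + 1) ^ 3)) := Nat.mul_le_mul_left _ hx
    _ = c * (pg n * (pP n * (pL n + 1) ^ 3)) := by ring
    _ ≤ c * (16384 * n) := Nat.mul_le_mul_left _ this
    _ = _ := by ring

theorem sq_le_small (n : ℕ) : (pL n + 1) ^ 2 ≤ pP n * (pL n + 1) ^ 3 := by
  calc (pL n + 1) ^ 2 = 1 * (pL n + 1) ^ 2 := (one_mul _).symm
    _ ≤ pP n * (pL n + 1) ^ 3 :=
      Nat.mul_le_mul (pP_pos n) (Nat.pow_le_pow_right (by omega) (by omega))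

/-- The plain bit vector contributes the leading `n`. The tables are small by `small_le`, and the
directories have fields of `O(pg n)` bits for each block or of `O(pL n)` bits for each superblock.
-/
theorem pg_mul_aSTR_le (hn : 1 ≤ n) : pg n * aSTR n ≤ pg n * n + 500000 * n := by
  have hL := pL_pos hn
  have hg := pg_pos hn
  have hgL := pg_le n
  have hb := pb_le hn
  have he := pe_le hn
  have hgg := pg_mul_le hn
  have hLK := pL_mul_pK_le n
  have hgK := pg_mul_pK_le n
  have hKb := pK_mul_le n
  have hP := pP_pos n
  have hsq := sq_le_small n
  set S := pP n * (pL n + 1) ^ 3 with hS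
  have t1 : pP n * pw n + (pb n + 1) * pP n * pw n ≤ 2 * S := by
    have h1 : pP n * pw n ≤ S := by
      rw [hS, pw]
      exact Nat.mul_le_mul_left _ (Nat.le_self_pow (by omega) _)
    have h2 : (pb n + 1) * pP n * pw n ≤ S := by
      calc (pb n + 1) * pP n * pw n ≤ (pL n + 1) * pP n * (pL n + 1) := by
            rw [pw]; gcongr
        _ = pP n * (pL n + 1) ^ 2 := by ring
        _ ≤ S := Nat.mul_le_mul_left _ (Nat.pow_le_pow_right (by omega) (by omega))
    omega
  have t2 : 2 * ((pb n + 1) * pw n) + pg n * pe n + 2 * pw n + pb n ≤ 20 * S := by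
    have h1 : (pb n + 1) * pw n ≤ (pL n + 1) ^ 2 := by
      rw [pw, sq]; gcongr
    have h2 : pg n * pe n ≤ 4 * (pL n + 1) ^ 2 := by
      calc pg n * pe n ≤ (pL n + 1) * (4 * (pL n + 1)) := Nat.mul_le_mul (by omega) (by omega)
        _ = _ := by ring
    have h3 : pL n + 1 ≤ (pL n + 1) ^ 2 := Nat.le_self_pow (by omega) _
    have h4 : pw n = pL n + 1 := rfl
    omega
  -- The fields have `2 * pg n` bits, so the square of `pg n` appears; it is at most `4 * pL n`, and
  -- `pL n * pK n` is linear in `n`.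
  have t3 : pg n * (3 * pK n * pv n) ≤ 216 * n := by
    calc pg n * (3 * pK n * pv n) = 6 * (pg n * pg n) * pK n := by rw [pv]; ring
      _ ≤ 6 * (4 * pL n) * pK n := by
        rw [Nat.add_mul] at hgg
        exact Nat.mul_le_mul_right _ (Nat.mul_le_mul_left _ (by omega))
      _ = 24 * (pL n * pK n) := by ring
      _ ≤ 216 * n := by omega
  have t4 : pg n * (2 * (pK n / pL n * pw n)) ≤ 36 * n := by
    have h1 : pK n / pL n * pw n ≤ 2 * pK n := by
      calc pK n / pL n * pw n ≤ pK n / pL n * (2 * pL n) := by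
            rw [pw]; gcongr; omega
        _ = 2 * (pK n / pL n * pL n) := by ring
        _ ≤ 2 * pK n := Nat.mul_le_mul_left _ (Nat.div_mul_le_self _ _)
    calc pg n * (2 * (pK n / pL n * pw n)) ≤ pg n * (2 * (2 * pK n)) := by gcongr
      _ = 4 * (pg n * pK n) := by ring
      _ ≤ 36 * n := by omega
  have t5 := small_le hn (x := pP n * pw n + (pb n + 1) * pP n * pw n +
    (2 * ((pb n + 1) * pw n) + pg n * pe n + 2 * pw n + pb n)) 22 (by rw [← hS]; omega)
  have e : aSTR n + pb n = (pP n * pw n + (pb n + 1) * pP n * pw n +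
      (2 * ((pb n + 1) * pw n) + pg n * pe n + 2 * pw n + pb n)) + 3 * pK n * pv n +
      2 * (pK n / pL n * pw n) + pK n * pb n := by
    unfold aSTR aBV aSUP aBLK aPOW aLEN aCNT aDEC; ring
  have e2 : aSTR n ≤ (pP n * pw n + (pb n + 1) * pP n * pw n +
      (2 * ((pb n + 1) * pw n) + pg n * pe n + 2 * pw n + pb n)) + 3 * pK n * pv n +
      2 * (pK n / pL n * pw n) + n := by omega
  calc pg n * aSTR n ≤ _ := Nat.mul_le_mul_left _ e2
    _ ≤ pg n * n + 500000 * n := by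
      rw [Nat.mul_add, Nat.mul_add, Nat.mul_add]
      omega

theorem pB_le (hn : 1 ≤ n) : pB n ≤ 5 * (pL n + 1) ^ 2 := by
  have hgL := pg_le n
  have he := pe_le hn
  have ht := pt_le n
  have h1 : pg n * pt n ≤ (pL n + 1) ^ 2 := by rw [sq]; gcongr <;> omega
  have h2 : pL n + 1 ≤ (pL n + 1) ^ 2 := Nat.le_self_pow (by omega) _
  have h3 : pB n = pe n + pg n * pt n := rfl
  omega

/-- Normally the exponents add up to `pL n - 1`. If the low parts are empty because the subtraction
truncates, `2 ^ pg n ≤ 2 * pL n` is used instead. -/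
theorem two_pow_pt_le (hn : 1 ≤ n) : 2 ^ pt n * 2 ^ pg n ≤ 2 * n := by
  have h1 := two_pow_pL_le hn
  have h2 := two_pow_pg_le hn
  have h3 := pL_le n
  have h4 := pg_pos hn
  have h5 : 2 ^ pg n = 2 * 2 ^ (pg n - 1) := by
    rw [← pow_succ']; congr 1; omega
  rw [← pow_add]
  by_cases h : pg n ≤ pL n - 1
  · rw [show pt n + pg n = pL n - 1 by unfold pt; omega]
    omega
  · rw [show pt n = 0 by unfold pt; omega, zero_add]
    omega

/-- The memory that is used for any number of witnesses fits into the address space. -/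
theorem space_lt (hn : 1 ≤ n) {c k : ℕ} (hc : c ≤ pK n * pb n) (hk : k ≤ n) :
    aSTR n + c + (k / pg n + 1) * pB n < 2 ^ (16 * pL n) := by
  have hL := pL_pos hn
  have hgL := pg_le n
  have hb := pb_le hn
  have he := pe_le hn
  have hKn := pK_le hn
  have hKb := pK_mul_le n
  have hB := pB_le hn
  have hnX := lt_two_pow_pL n
  have hLX : pL n + 1 ≤ 2 ^ pL n := Nat.lt_two_pow_self
  have hPX := pP_le hn
  have hX2 : 2 ≤ 2 ^ pL n := by omega
  rw [show 2 ^ (16 * pL n) = (2 ^ pL n) ^ 16 by rw [← pow_mul, mul_comm]]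
  set X := 2 ^ pL n with hX
  have hw : pw n ≤ X := hLX
  have hkg : k / pg n ≤ k := Nat.div_le_self _ _
  have hKL : pK n / pL n ≤ pK n := Nat.div_le_self _ _
  have m1 : pP n * pw n ≤ X ^ 3 := by
    calc pP n * pw n ≤ X * X := Nat.mul_le_mul hPX hw
      _ = X ^ 2 := by ring
      _ ≤ X ^ 3 := Nat.pow_le_pow_right (by omega) (by omega)
  have m2 : (pb n + 1) * pP n * pw n ≤ X ^ 3 := by
    calc (pb n + 1) * pP n * pw n ≤ X * X * X := by gcongr; omega
      _ = X ^ 3 := by ring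
  have hsq : X ^ 2 ≤ X ^ 3 := Nat.pow_le_pow_right (by omega) (by omega)
  have hone : X ≤ X ^ 3 := Nat.le_self_pow (by omega) _
  have m3 : (pb n + 1) * pw n ≤ X ^ 2 := by
    rw [sq]; exact Nat.mul_le_mul (by omega) hw
  have m4 : pg n * pe n ≤ 4 * X ^ 2 := by
    calc pg n * pe n ≤ X * (4 * X) := Nat.mul_le_mul (by omega) (by omega)
      _ = _ := by ring
  have m5 : 3 * pK n * pv n ≤ 12 * X ^ 2 := by
    calc 3 * pK n * pv n ≤ 3 * (2 * X) * (2 * X) := by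
          rw [pv]; gcongr <;> omega
      _ = _ := by ring
  have m6 : 2 * (pK n / pL n + 1) * pw n ≤ 6 * X ^ 2 := by
    calc 2 * (pK n / pL n + 1) * pw n ≤ 2 * (3 * X) * X := by gcongr; omega
      _ = _ := by ring
  have m7 : (k / pg n + 1) * pB n ≤ 5 * X ^ 3 := by
    calc (k / pg n + 1) * pB n ≤ X * (5 * X ^ 2) := by
          refine Nat.mul_le_mul (by omega) (hB.trans ?_)
          gcongr
      _ = _ := by ring
  have e : aSTR n = pP n * pw n + (pb n + 1) * pP n * pw n + 2 * ((pb n + 1) * pw n) +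
      pg n * pe n + 3 * pK n * pv n + 2 * (pK n / pL n + 1) * pw n + pK n * pb n := by
    unfold aSTR aBV aSUP aBLK aPOW aLEN aCNT aDEC; ring
  -- Every region takes at most a small multiple of `X ^ 3` bits, and `X ≥ 2`; the generous exponent
  -- `16` absorbs the constants.
  have h13 : 2 ^ 13 * X ^ 3 ≤ X ^ 16 := by
    calc 2 ^ 13 * X ^ 3 ≤ X ^ 13 * X ^ 3 := by gcongr
      _ = X ^ 16 := by ring
  omega

end Sizes

/-! ### Code lengths of blocks and of packed arrays -/

section Entropy

open Real

/-- A single term of the binomial expansion of `(p + (1 - p)) ^ b = 1` is at most `1`; take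
logarithms. -/
theorem logb_choose_le {b c : ℕ} (hc : c ≤ b) {p : ℝ} (h0 : 0 < p) (h1 : p < 1) :
    logb 2 (b.choose c) ≤ c * logb 2 (1 / p) + ((b : ℝ) - c) * logb 2 (1 / (1 - p)) := by
  have h2 : 0 < 1 - p := by linarith
  have hch : (0 : ℝ) < b.choose c := by exact_mod_cast Nat.choose_pos hc
  have hle : p ^ c * (1 - p) ^ (b - c) * b.choose c ≤ 1 := by
    have h := add_pow p (1 - p) b
    rw [show p + (1 - p) = 1 by ring, one_pow] at h
    refine le_of_le_of_eq ?_ h.symm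
    exact Finset.single_le_sum (f := fun m => p ^ m * (1 - p) ^ (b - m) * (b.choose m : ℝ))
      (fun i _ => by positivity) (Finset.mem_range.2 (Nat.lt_succ_of_le hc))
  have hlog := logb_le_logb_of_le (b := 2) (by norm_num) (by positivity) hle
  rw [logb_one, logb_mul (by positivity) hch.ne', logb_mul (by positivity) (by positivity),
    logb_pow, logb_pow, Nat.cast_sub hc] at hlog
  rw [one_div, one_div, logb_inv, logb_inv]
  linarith

theorem clen_le_logb {b c : ℕ} (hc : c ≤ b) {p : ℝ} (h0 : 0 < p) (h1 : p < 1) :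
    (clen b c : ℝ) ≤ 1 + (c * logb 2 (1 / p) + ((b : ℝ) - c) * logb 2 (1 / (1 - p))) := by
  have h := two_pow_clen_le hc
  have hch : (0 : ℝ) < b.choose c := by exact_mod_cast Nat.choose_pos hc
  have h' : (2 : ℝ) ^ clen b c ≤ 2 * b.choose c := by exact_mod_cast h
  have hlog := logb_le_logb_of_le (b := 2) (by norm_num) (by positivity) h'
  rw [logb_mul (by norm_num) hch.ne', logb_self_eq_one (by norm_num), logb_pow,
    logb_self_eq_one (by norm_num), mul_one] at hlog
  linarith [logb_choose_le hc h0 h1]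

/-- The same `p` is used in all blocks, so the estimates of the blocks add up to the one for the
whole vector, and only the rounding costs one bit per block. -/
theorem bptr_le_logb (X : ℕ → Bool) (b m : ℕ) {p : ℝ} (h0 : 0 < p) (h1 : p < 1) :
    (bptr X b m : ℝ) ≤ m + (brnk X b m * logb 2 (1 / p) +
      ((m : ℝ) * b - brnk X b m) * logb 2 (1 / (1 - p))) := by
  induction m with
  | zero => simp [bptr, brnk]
  | succ m ih =>
    have := clen_le_logb (pop_blk_le (X := X) (b := b) m) h0 h1
    rw [bptr_succ, brnk_succ]
    push_cast
    linarith

theorem logb_one_add_le {x : ℝ} (hx : 0 ≤ x) : logb 2 (1 + x) ≤ 2 * x := by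
  have h1 : log (1 + x) ≤ x := by
    have := log_le_sub_one_of_pos (show 0 < 1 + x by linarith)
    linarith
  have h2 : (1 : ℝ) / 2 < log 2 := by linarith [log_two_gt_d9]
  rw [logb, div_le_iff₀ (by linarith)]
  nlinarith

/-- Since `pH n * 2 ^ pt n ≤ n + 2 ^ pt n`, an entry takes at most `lg n + 2 * 2 ^ pt n / n` bits
before rounding. The excess over a block of `pg n` entries is at most `4` by `two_pow_pt_le`, and
rounding the joint field up adds `1`. So the loss per entry is `5 / pg n`, which tends to zero. -/
theorem pB_le_logb {n : ℕ} (hn : 1 ≤ n) : (pB n : ℝ) ≤ 5 + pg n * logb 2 n := by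
  have hn' : (0 : ℝ) < n := by exact_mod_cast hn
  have hg : (0 : ℝ) < pg n := by exact_mod_cast pg_pos hn
  have hH : (0 : ℝ) < pH n := by exact_mod_cast pH_pos n
  have h1 : (2 : ℝ) ^ (pe n - 1) ≤ (pH n : ℝ) ^ pg n := by exact_mod_cast two_pow_pe_le n
  have h2 := logb_le_logb_of_le (b := 2) (by norm_num) (by positivity) h1
  rw [logb_pow, logb_pow, logb_self_eq_one (by norm_num), Nat.cast_sub (pe_pos n)] at h2
  have h3 : (pH n : ℝ) * 2 ^ pt n ≤ n * (1 + 2 ^ pt n / n) := by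
    have : pH n * 2 ^ pt n ≤ n + 2 ^ pt n := by
      have := Nat.div_mul_le_self n (2 ^ pt n)
      rw [pH, Nat.add_mul]
      omega
    rw [mul_add, mul_one, mul_div_cancel₀ _ hn'.ne']
    exact_mod_cast this
  have h4 := logb_le_logb_of_le (b := 2) (by norm_num) (by positivity) h3
  rw [logb_mul hH.ne' (by positivity), logb_mul hn'.ne' (by positivity), logb_pow,
    logb_self_eq_one (by norm_num), mul_one] at h4
  have h5 := logb_one_add_le (x := 2 ^ pt n / (n : ℝ)) (by positivity)
  have h6 : (pg n : ℝ) * (2 ^ pt n / n) ≤ 2 := by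
    rw [← mul_div_assoc, div_le_iff₀ hn']
    have h7 := two_pow_pt_le hn
    have h8 : pg n * 2 ^ pt n ≤ 2 ^ pt n * 2 ^ pg n := by
      rw [mul_comm]
      exact Nat.mul_le_mul_left _ Nat.lt_two_pow_self.le
    exact_mod_cast h8.trans h7
  have h9 : (pB n : ℝ) = pe n + pg n * pt n := by
    rw [pB]; push_cast; ring
  have h10 : (pg n : ℝ) * (logb 2 (pH n) + pt n) ≤ pg n * (logb 2 n + 2 * (2 ^ pt n / n)) :=
    mul_le_mul_of_nonneg_left (by linarith) hg.le
  push_cast at h2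
  nlinarith

/-- The size of a packed array with `k` entries. -/
theorem packed_le {n k : ℕ} (hn : 1 ≤ n) (hk : k ≤ n) :
    (((k / pg n + 1) * pB n : ℕ) : ℝ) ≤ k * logb 2 n + 100000 * (n / pg n) := by
  have hn' : (0 : ℝ) < n := by exact_mod_cast hn
  have hg : (0 : ℝ) < pg n := by exact_mod_cast pg_pos hn
  have h1 : ((k / pg n : ℕ) : ℝ) ≤ k / pg n := Nat.cast_div_le
  have h2 := pB_le_logb hn
  -- The array has one block beyond the quotient; its size is `O(n / pg n)` as well.
  have h3 := small_le hn (x := pB n) 5 ((pB_le hn).trans (Nat.mul_le_mul_left _ (sq_le_small n)))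
  have h4 : (pB n : ℝ) ≤ 81920 * (n / pg n) := by
    rw [← mul_div_assoc, le_div_iff₀ hg, mul_comm]
    exact_mod_cast h3
  have hk' : (k : ℝ) ≤ n := by exact_mod_cast hk
  have h5 : (k : ℝ) / pg n * (5 + pg n * logb 2 n) = 5 * (k / pg n) + k * logb 2 n := by
    field_simp
  have h6 : (k : ℝ) / pg n ≤ n / pg n := by gcongr
  have h7 : ((k / pg n : ℕ) : ℝ) * pB n ≤ k / pg n * (5 + pg n * logb 2 n) :=
    mul_le_mul h1 h2 (by positivity) (by positivity)
  push_cast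
  have h8 : (0 : ℝ) ≤ n / pg n := by positivity
  nlinarith

end Entropy

end LZ

namespace LZ

/-! ### The total space and its error term -/

section SpaceBound

open Real

theorem tendsto_size : Tendsto Nat.size atTop atTop := by
  refine tendsto_atTop.2 fun b => ?_
  filter_upwards [eventually_ge_atTop (2 ^ b)] with n hn
  exact (Nat.lt_size.2 hn).le

/-- `pg n` is the bit length of the bit length of `n` and therefore tends to infinity. -/
theorem isLittleO_div_pg (c : ℝ) :
    (fun n : ℕ => c * ((n : ℝ) / pg n)) =o[atTop] fun n : ℕ => (n : ℝ) := by
  have h1 : Tendsto (fun n : ℕ => c * ((pg n : ℕ) : ℝ)⁻¹) atTop (nhds 0) := by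
    rw [← mul_zero c]
    exact (tendsto_inv_atTop_zero.comp (tendsto_natCast_atTop_atTop.comp
      (tendsto_size.comp tendsto_size))).const_mul c
  have h2 := (isBigO_refl (fun n : ℕ => (n : ℝ)) atTop).mul_isLittleO
    ((isLittleO_one_iff ℝ).2 h1)
  simp only [mul_one] at h2
  exact h2.congr_left fun n => by rw [div_eq_mul_inv]; ring

theorem entropy_mul {n : ℕ} (hn : 1 ≤ n) (z : ℕ) : entropy n z * n =
    z * logb 2 ((n : ℝ) / z) + ((n : ℝ) - z) * logb 2 ((n : ℝ) / ((n : ℝ) - z)) :=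
  div_mul_cancel₀ _ (by positivity)

theorem entropy_mul_nonneg {n z : ℕ} (hz : 1 ≤ z) (hzn : z ≤ n) : 0 ≤ entropy n z * n := by
  have hz' : (1 : ℝ) ≤ z := by exact_mod_cast hz
  have hzn' : (z : ℝ) ≤ n := by exact_mod_cast hzn
  rw [entropy_mul (hz.trans hzn)]
  refine add_nonneg (mul_nonneg (by linarith) (logb_nonneg (by norm_num) ?_)) ?_
  · rw [one_le_div (by linarith)]; exact hzn'
  · rcases hzn'.eq_or_lt with h | h
    · rw [h]; simp
    · refine mul_nonneg (by linarith) (logb_nonneg (by norm_num) ?_)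
      rw [one_le_div (by linarith)]; linarith

theorem logb_le_pL {n : ℕ} (hn : 1 ≤ n) : logb 2 n ≤ pL n := by
  have h : (n : ℝ) ≤ 2 ^ pL n := by exact_mod_cast (lt_two_pow_pL n).le
  have := logb_le_logb_of_le (b := 2) (by norm_num) (by exact_mod_cast hn) h
  rwa [logb_pow, logb_self_eq_one (by norm_num), mul_one] at this

/-- The size of the compressed bit vector, if an array with one word for each of its ones is
added. -/
theorem bptr_add_le (X : ℕ → Bool) {n z : ℕ} (hz : 1 ≤ z) (hzn : z ≤ n)
    (hW : brnk X (pb n) (pK n) ≤ z) :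
    (bptr X (pb n) (pK n) : ℝ) + brnk X (pb n) (pK n) * logb 2 n ≤
      entropy n z * n + z * logb 2 n + 50000 * (n / pg n) := by
  have hn : 1 ≤ n := hz.trans hzn
  have hn' : (1 : ℝ) ≤ n := by exact_mod_cast hn
  have hz' : (1 : ℝ) ≤ z := by exact_mod_cast hz
  have hg : (0 : ℝ) < pg n := by exact_mod_cast pg_pos hn
  have hW' : (brnk X (pb n) (pK n) : ℝ) ≤ z := by exact_mod_cast hW
  have hW0 : (0 : ℝ) ≤ brnk X (pb n) (pK n) := Nat.cast_nonneg _
  have hK : (pK n : ℝ) ≤ 9 * (n / pg n) := by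
    rw [← mul_div_assoc, le_div_iff₀ hg, mul_comm]
    exact_mod_cast pg_mul_pK_le n
  have hs : ((pb n * pL n + 2 * pb n + 2 : ℕ) : ℝ) ≤ 49152 * (n / pg n) := by
    rw [← mul_div_assoc, le_div_iff₀ hg, mul_comm]
    have h1 := sq_le_small n
    have h2 := pb_le hn
    have h3 : pb n * pL n + 2 * pb n + 2 ≤ 3 * (pL n + 1) ^ 2 := by
      calc pb n * pL n + 2 * pb n + 2 ≤ pL n * pL n + 2 * pL n + 2 := by gcongr
        _ ≤ 3 * (pL n + 1) ^ 2 := by nlinarith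
    exact_mod_cast small_le hn 3 (h3.trans (Nat.mul_le_mul_left _ h1))
  push_cast at hs
  have hKb : (pK n : ℝ) * pb n ≤ n + pb n := by exact_mod_cast pK_mul_le n
  have hl0 : 0 ≤ logb 2 (n : ℝ) := logb_nonneg (by norm_num) hn'
  have hlL := logb_le_pL hn
  have hb0 : (0 : ℝ) ≤ pb n := Nat.cast_nonneg _
  have hbl : (pb n : ℝ) * logb 2 n ≤ pb n * pL n := mul_le_mul_of_nonneg_left hlL hb0
  set W : ℝ := (brnk X (pb n) (pK n) : ℝ)
  rcases hzn.lt_or_eq with hlt | rfl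
  · have hlt' : (z : ℝ) + 1 ≤ n := by exact_mod_cast hlt
    have hp0 : (0 : ℝ) < z / n := by positivity
    have hp1 : (z : ℝ) / n < 1 := by rw [div_lt_one (by linarith)]; linarith
    have h := bptr_le_logb X (pb n) (pK n) hp0 hp1
    rw [one_div_div, show (1 : ℝ) / (1 - z / n) = n / (n - z) by
      rw [one_sub_div (by linarith), one_div_div]] at h
    rw [entropy_mul hn]
    have ha : 0 ≤ logb 2 ((n : ℝ) / z) := logb_nonneg (by norm_num) (by
      rw [one_le_div (by linarith)]; linarith)
    have hd : 0 ≤ logb 2 ((n : ℝ) / ((n : ℝ) - z)) := logb_nonneg (by norm_num) (by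
      rw [one_le_div (by linarith)]; linarith)
    have hdl : logb 2 ((n : ℝ) / ((n : ℝ) - z)) ≤ logb 2 n := by
      refine logb_le_logb_of_le (by norm_num) (div_pos (by linarith) (by linarith)) ?_
      exact div_le_self (by linarith) (by linarith)
    set a := logb 2 ((n : ℝ) / z)
    set d := logb 2 ((n : ℝ) / ((n : ℝ) - z))
    have h1 : ((pK n : ℝ) * pb n - W) * d ≤ (n + pb n - W) * d :=
      mul_le_mul_of_nonneg_right (by linarith) hd
    have h2 : (pb n : ℝ) * d ≤ pb n * logb 2 n := mul_le_mul_of_nonneg_left hdl hb0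
    -- Each of the `z - W` missing ones exchanges a cost of `a + lg n`, for a one together with its
    -- label, for a cost `d ≤ lg n` of a zero, so the total does not grow.
    have h3 : 0 ≤ ((z : ℝ) - W) * (a + logb 2 n - d) :=
      mul_nonneg (by linarith) (by linarith)
    nlinarith
  -- If `z` equals the text length, the density would be `1`, which `bptr_le_logb` does not allow;
  -- `z / (z + 1)` takes its place at the cost of lower-order terms.
  · have hp0 : (0 : ℝ) < z / (z + 1) := by positivity
    have hp1 : (z : ℝ) / (z + 1) < 1 := by rw [div_lt_one (by linarith)]; linarith
    have h := bptr_le_logb X (pb z) (pK z) hp0 hp1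
    rw [one_div_div, show (1 : ℝ) / (1 - z / (z + 1)) = z + 1 by
      rw [one_sub_div (by linarith)]; simp] at h
    have hE := entropy_mul_nonneg hz le_rfl
    have hi : 0 ≤ (1 : ℝ) / z := by positivity
    have ha : logb 2 (((z : ℝ) + 1) / z) ≤ 2 * (1 / z) := by
      rw [add_div, div_self (by linarith)]
      exact logb_one_add_le hi
    have hd : logb 2 ((z : ℝ) + 1) ≤ logb 2 z + 2 * (1 / z) := by
      rw [show (z : ℝ) + 1 = z * ((z + 1) / z) by field_simp, logb_mul (by linarith) (by positivity)]
      linarith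
    have hd0 : 0 ≤ logb 2 ((z : ℝ) + 1) := logb_nonneg (by norm_num) (by linarith)
    have h1 : ((pK z : ℝ) * pb z - W) * logb 2 ((z : ℝ) + 1) ≤
        (z + pb z - W) * logb 2 ((z : ℝ) + 1) := mul_le_mul_of_nonneg_right (by linarith) hd0
    have h2 : (z + pb z - W) * logb 2 ((z : ℝ) + 1) ≤
        (z + pb z - W) * (logb 2 z + 2 * (1 / z)) := mul_le_mul_of_nonneg_left hd (by linarith)
    have h3 : W * logb 2 (((z : ℝ) + 1) / z) ≤ W * (2 * (1 / z)) :=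
      mul_le_mul_of_nonneg_left ha hW0
    have h4 : (z + pb z - W) * (logb 2 z + 2 * (1 / z)) + W * (2 * (1 / z)) =
        (z + pb z - W) * logb 2 z + 2 + 2 * (pb z * (1 / z)) := by
      field_simp; ring
    have h5 : (pb z : ℝ) * (1 / z) ≤ pb z := by
      rw [mul_one_div]
      exact div_le_self hb0 hz'
    nlinarith

theorem length_facs {σ : ℕ} {T : List (Fin σ)} (m : ℕ) : (facs T m).length = (facPos T m).length := by
  simp [facs]

theorem one_le_length_facPos {σ : ℕ} {T : List (Fin σ)} (hn : 1 ≤ T.length) :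
    1 ≤ (facPos T T.length).length := by
  have : 1 ∈ facPos T T.length := mem_facPos.2 ⟨⟨le_rfl, hn⟩, rfl⟩
  exact List.length_pos_of_mem this

/-- The number of bits of working memory of the program. -/
noncomputable def bits {σ : ℕ} (T : List (Fin σ)) : ℕ :=
  max (aSTR T.length + ((refs T (facPos T T.length)).length / pg T.length + 1) * pB T.length)
    (aLAB T + (numWit T / pg T.length + 1) * pB T.length)

variable {σ : ℕ} {T : List (Fin σ)}

theorem bits_lt (hT : IsText T) : bits T < 2 ^ (16 * pL T.length) := by
  have hW := numWit_le_length_refs hT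
  have hR := (length_refs_le_facPos (T := T) (facPos T T.length)).trans (length_facPos_le _)
  refine max_lt ?_ ?_
  · have := space_lt hT.pos (c := 0) (Nat.zero_le _) hR
    rwa [add_zero] at this
  · exact space_lt hT.pos (bptr_le _) (hW.trans hR)

/-- The second phase dominates: its labels and the compressed bit vector are estimated together,
while the list of ranks alone stays below `z lg n` up to the error term, and the entropy is
non-negative. -/
theorem bits_le (hT : IsText T) : (bits T : ℝ) ≤
    (1 + entropy T.length (facs T T.length).length) * T.length +
      (facs T T.length).length * logb 2 T.length + 700000 * ((T.length : ℝ) / pg T.length) := by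
  have hn := hT.pos
  have hW := numWit_le_length_refs hT
  have hR := length_refs_le_facPos (T := T) (facPos T T.length)
  have hz := one_le_length_facPos hn
  have hzn := length_facPos_le (T := T) T.length
  rw [length_facs]
  set n := T.length
  set z := (facPos T n).length
  have hg : (0 : ℝ) < pg n := by exact_mod_cast pg_pos hn
  have hl0 : 0 ≤ logb 2 (n : ℝ) := logb_nonneg (by norm_num) (by exact_mod_cast hn)
  have hE := entropy_mul_nonneg hz hzn
  have hq : 0 ≤ (n : ℝ) / pg n := by positivity
  have h1 : (aSTR n : ℝ) ≤ n + 500000 * (n / pg n) := by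
    have h := pg_mul_aSTR_le hn
    have h' : (pg n : ℝ) * aSTR n ≤ pg n * n + 500000 * n := by exact_mod_cast h
    have e : (pg n : ℝ) * (n + 500000 * (n / pg n)) = pg n * n + 500000 * n := by
      field_simp
    exact le_of_mul_le_mul_left (h'.trans_eq e.symm) hg
  have h2 := packed_le hn (hR.trans hzn)
  have h3 := packed_le hn (hW.trans (hR.trans hzn))
  have h4 : (numWit T : ℝ) * logb 2 n ≤ z * logb 2 n :=
    mul_le_mul_of_nonneg_right (by exact_mod_cast hW.trans hR) hl0
  have h5 : ((refs T (facPos T n)).length : ℝ) * logb 2 n ≤ z * logb 2 n :=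
    mul_le_mul_of_nonneg_right (by exact_mod_cast hR) hl0
  have h6 := bptr_add_le (markBit T) hz hzn (hW.trans hR)
  change _ + (numWit T : ℝ) * _ ≤ _ at h6
  rw [bits, Nat.cast_max]
  refine max_le ?_ ?_
  · rw [Nat.cast_add]
    linarith
  · rw [Nat.cast_add, aLAB, Nat.cast_add]
    linarith

/-- The bit length of the text length is at most `Nat.log 2 T.length + 1`, so the factor `16` yields
words that hold every address below `bits T`. -/
theorem env_bits (hT : IsText T) {w : ℕ} (hw : 16 * (Nat.log 2 T.length + 1) ≤ w) :
    Env T w (bits T) := by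
  have h1 : pL T.length ≤ Nat.log 2 T.length + 1 :=
    Nat.size_le.2 (Nat.lt_pow_succ_log_self (by norm_num) _)
  have h2 : 16 * pL T.length ≤ w := (Nat.mul_le_mul_left _ h1).trans hw
  exact ⟨hT, h2, (bits_lt hT).trans_le (Nat.pow_le_pow_right (by norm_num) h2),
    (Nat.le_add_right _ _).trans (le_max_left _ _)⟩

end SpaceBound

end LZ

/-! ### The theorem -/

theorem mainTheorem2 :
    ∃ (P : List LZ.Instr) (κ C : ℕ) (r : ℕ → ℝ),
      (r =o[atTop] fun n : ℕ => (n : ℝ)) ∧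
      ∀ (σ : ℕ) (T : List (Fin σ)), LZ.IsText T →
        ∃ F : List (List (Fin σ)),
          LZ.IsLZ77 T F ∧
          (∀ u : List (Fin σ), u ∈ (LZ.passOne T).marked ↔
            ∃ (x : ℕ) (hx : x < F.length),
              F[x] ∈ LZ.substringsBefore T (LZ.factorPos F x) ∧
              LZ.IsWitness T (LZ.factorPos F x) u) ∧
          (∀ u ∈ (LZ.passOne T).marked,
            IsLeast {i : ℕ | 1 ≤ i ∧ i ≤ T.length ∧ u <+: LZ.suffix T i}
              ((LZ.passTwo T (LZ.passOne T).marked).array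
                (LZ.witnessId T (LZ.passOne T).marked u))) ∧
          LZ.IsCoding T F (LZ.twoPass T) ∧
          ∀ w : ℕ, κ * (Nat.log 2 T.length + 1) ≤ w →
            ∃ t : ℕ, t ≤ C * T.length ∧
              P.length ≤ (LZ.run P T w t).pc ∧
              (LZ.run P T w t).out = LZ.twoPass T ∧
              ((LZ.run P T w t).space : ℝ) ≤
                (1 + LZ.entropy T.length F.length) * T.length +
                  F.length * Real.logb 2 T.length + r T.length := by
  refine ⟨LZ.program.code 0, 16, 5000, fun n => 700000 * ((n : ℝ) / LZ.pg n),
    LZ.isLittleO_div_pg _, fun σ T hT => ⟨LZ.facs T T.length, LZ.isLZ77_facs hT,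
      LZ.marked_iff_witness hT, fun u hu => LZ.isLeast_array hT hu, LZ.isCoding_twoPass hT,
      fun w hw => ?_⟩⟩
  have E := LZ.env_bits hT hw
  obtain ⟨s, hs, ho, ht⟩ := LZ.wp_program E (le_max_left _ _) (le_max_right _ _)
  obtain ⟨t, h1, h2, h3, h4⟩ := hs.run (by have := E.sixteen_le; omega)
  exact ⟨t, h1.trans ht, h2, h3.trans ho,
    (Nat.cast_le.2 h4).trans (LZ.bits_le hT)⟩
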